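/- All vector spaces are over $\mathbb{C}$, and $|x|\in\mathbb{Z}/2$ is the parity of a homogeneous $x$. **The Sergeev superalgebra.** For $k\ge 1$, $\operatorname{Ser}_k$ is the unital associative superalgebra with odd generators $c_1,\dots,c_k$, even generators $s_1,\dots,s_{k-1}$ and relations $c_i^2=1$; $c_ic_j=-c_jc_i$ for $i\ne j$; $s_j^2=1$; $s_is_j=s_js_i$ for $|i-j|>1$; $s_js_{j+1}s_j=s_{j+1}s_js_{j+1}$; $c_is_j=s_jc_i$ for $i\ne j,j+1$; $s_jc_j=c_{j+1}s_j$ and $s_jc_{j+1}=c_js_j$. **Webs.** $\mathfrak{q}\text{-}\mathbf{Web}_\uparrow$ is the $\mathbb{C}$-linear strict monoidal supercategory (super-interchange law $(f\otimes g)\circ(h\otimes k)=(-1)^{|g||h|}(f\circ h)\otimes(g\circ k)$) whose objects are the words in $\uparrow_k$, $k>0$ (with $\uparrow_0$ the unit object, i.e. edges labelled $0$ are omitted), with generating morphisms the odd dots $d_k:\uparrow_k\to\uparrow_k$, the even merges $m_{k,l}:\uparrow_k\uparrow_l\to\uparrow_{k+l}$ and the even splits $s_{k,l}:\uparrow_{k+l}\to\uparrow_k\uparrow_l$.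 Merges and splits with a label $0$ are identities, and $d_0=0$. Write $E^0,E^1:\uparrow_k\uparrow_l\to\uparrow_{k+1}\uparrow_{l-1}$ for the ladders $(m_{k,1}\otimes 1)(1\otimes r\otimes 1)(1\otimes s_{1,l-1})$ and $F^0,F^1:\uparrow_k\uparrow_l\to\uparrow_{k-1}\uparrow_{l+1}$ for the ladders $(1\otimes m_{1,l})(1\otimes r\otimes 1)(s_{k-1,1}\otimes 1)$, where $r=1$ for the superscript $0$ and $r=d_1$ for the superscript $1$; on a word of three letters, a subscript $i\in\{1,2\}$ means that the ladder is applied to the letters $i,i+1$. A composite through a negative label is zero. The defining relations, for all labels $\geq 0$ for which they make sense, are: - associativity: $m_{h+k,l}(m_{h,k}\otimes 1)=m_{h,k+l}(1\otimes m_{k,l})$ and $(s_{h,k}\otimes 1)s_{h+k,l}=(1\otimes s_{k,l})s_{h,k+l}$; - digon removal: $m_{k,l}s_{k,l}=\binom{k+l}{l}$; dot collision: $d_k^2=k$; - dots past merges and splits: $d_{k+l}m_{k,l}=m_{k,l}(d_k\otimes 1+1\otimes d_l)$ and $s_{k,l}d_{k+l}=(d_k\otimes 1+1\otimes d_l)s_{k,l}$;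 - dumbbell: with $D=s_{1,1}m_{1,1}$, $D=(d_1\otimes d_1)D(d_1\otimes d_1)+2$; - square switch on $\uparrow_k\uparrow_l$: $E^0F^0=F^0E^0+(k-l)$; with dots: $E^1F^0-F^0E^1=E^0F^1-F^1E^0=d_k\otimes 1-1\otimes d_l$; - double rungs on $\uparrow_h\uparrow_k\uparrow_l$: $E_1^0E_2^0-E_2^0E_1^0=E_1^1E_2^1+E_2^1E_1^1$, $\;E_1^0E_2^1-E_2^1E_1^0=E_1^1E_2^0-E_2^0E_1^1$, $\;F_2^0F_1^0-F_1^0F_2^0=F_2^1F_1^1+F_1^1F_2^1$, $\;F_1^0F_2^1-F_2^1F_1^0=F_1^1F_2^0-F_2^0F_1^1$. The crossing is $s_{1,1}m_{1,1}-1:\uparrow_1\uparrow_1\to\uparrow_1\uparrow_1$. **Supermodules.** For $n\ge1$ let $V=V_n$ be the superspace with even basis $v_1,\dots,v_n$ and odd basis $v_{\bar1},\dots,v_{\bar n}$, and let $c$ be the odd map with $c(v_i)=\sqrt{-1}\,v_{\bar i}$, $c(v_{\bar i})=-\sqrt{-1}\,v_i$. Let $\mathfrak{q}(n)$ be the Lie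 superalgebra of all $x\in\mathfrak{gl}(V)$ whose supercommutator with $c$ is zero. Let $S^d(V)$ be the degree $d$ component of the symmetric superalgebra of $V$. Homomorphisms $f$ of $\mathfrak{q}(n)$-supermodules of both parities are allowed: $f(x.m)=(-1)^{|f||x|}x.f(m)$. There is a functor of monoidal supercategories $\Psi_n$ from $\mathfrak{q}\text{-}\mathbf{Web}_\uparrow$ to $\mathfrak{q}(n)$-supermodules with $\uparrow_{a_1}\cdots\uparrow_{a_r}\mapsto S^{a_1}(V)\otimes\cdots\otimes S^{a_r}(V)$ that sends dots, merges and splits to $$v_1\cdots v_k\mapsto\sum_{t=1}^k(-1)^{|v_1|+\dots+|v_{t-1}|}v_1\cdots c(v_t)\cdots v_k,\qquad v_1\cdots v_k\otimes w_1\cdots w_l\mapsto v_1\cdots v_kw_1\cdots w_l,$$ $$v_1\cdots v_{k+l}\mapsto\sum_{I,J}(-1)^{\varepsilon_{I,J}}v_{i_1}\cdots v_{i_k}\otimes v_{j_1}\cdots v_{j_l},$$ for homogeneous $v_i,w_j$, where the sum is over all $I=\{i_1<\dots<i_k\}$, $J=\{j_1<\dots<j_l\}$ with $I\sqcup J=\{1,\dots,k+l\}$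 and $\varepsilon_{I,J}=\sum_{i\in I,\,j\in J,\,j<i}|v_i||v_j|$. Sergeev's map is the superalgebra homomorphism $\psi:\operatorname{Ser}_k\to\operatorname{End}_{\mathfrak{q}(n)}(V^{\otimes k})$ with, for homogeneous $v_i$, $$\psi(s_j)(v_1\otimes\dots\otimes v_k)=(-1)^{|v_j||v_{j+1}|}v_1\otimes\dots\otimes v_{j+1}\otimes v_j\otimes\dots\otimes v_k,$$ $$\psi(c_i)(v_1\otimes\dots\otimes v_k)=(-1)^{|v_1|+\dots+|v_{i-1}|}v_1\otimes\dots\otimes c(v_i)\otimes\dots\otimes v_k.$$ **Proposition.** For every $k\ge1$ there is an isomorphism of superalgebras $\xi_k:\operatorname{Ser}_k\to\operatorname{End}_{\mathfrak{q}\text{-}\mathbf{Web}_\uparrow}(\uparrow_1^k)$ that sends $c_i$ to the dot on the $i$-th strand and $s_j$ to the crossing of the strands $j$ and $j+1$. Moreover, for every $n\ge1$, $\Psi_n$ and $\psi$ as above exist and $\Psi_n\circ\xi_k=\psi$, where $\Psi_n(\uparrow_1^k)=S^1(V)^{\otimes k}$ is identified with $V^{\otimes k}$. -/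

import Mathlib

open scoped TensorProduct

noncomputable section

namespace TypeQ

/-- The sign `(-1)^p`. -/
def sgn (p : ZMod 2) : ℂ := if p = 0 then 1 else -1

@[simp] theorem sgn_zero : sgn 0 = 1 := if_pos rfl

@[simp] theorem sgn_one : sgn 1 = -1 := if_neg one_ne_zero

theorem eq_zero_or_one (ε : ZMod 2) : ε = 0 ∨ ε = 1 := by revert ε; decide

theorem sgn_add (a b : ZMod 2) : sgn (a + b) = sgn b * sgn a := by
  have h : (1 + 1 : ZMod 2) = 0 := rfl
  rcases eq_zero_or_one a with rfl | rfl <;> rcases eq_zero_or_one b with rfl | rfl <;> simp [h]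

/-! ### The Sergeev superalgebra -/

/-- Free generators: `inl i` is the odd generator `c_i` (`i < k`), and `inr j` is the even
generator `s_j` (`j < k - 1`), which stands for the transposition of `j` and `j + 1`. -/
abbrev SerGen (k : ℕ) : Type := Fin k ⊕ Fin (k - 1)

/-- The generator `c_i` in the free algebra. -/
def genC {k : ℕ} (i : Fin k) : FreeAlgebra ℂ (SerGen k) := FreeAlgebra.ι ℂ (Sum.inl i)

/-- The generator `s_j` in the free algebra. -/
def genS {k : ℕ} (j : Fin (k - 1)) : FreeAlgebra ℂ (SerGen k) := FreeAlgebra.ι ℂ (Sum.inr j)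

/-- The defining relations of the Sergeev superalgebra. -/
inductive SerRel (k : ℕ) : FreeAlgebra ℂ (SerGen k) → FreeAlgebra ℂ (SerGen k) → Prop
  | c_sq (i : Fin k) : SerRel k (genC i * genC i) 1
  | c_anti (i j : Fin k) (h : i ≠ j) : SerRel k (genC i * genC j) (-(genC j * genC i))
  | s_sq (i : Fin (k - 1)) : SerRel k (genS i * genS i) 1
  | s_comm (i j : Fin (k - 1)) (h : i.val ≠ j.val + 1) (h' : j.val ≠ i.val + 1) :
      SerRel k (genS i * genS j) (genS j * genS i)
  | s_braid (i j : Fin (k - 1)) (h : j.val = i.val + 1) :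
      SerRel k (genS i * genS j * genS i) (genS j * genS i * genS j)
  | cs_comm (i : Fin k) (j : Fin (k - 1)) (h : i.val ≠ j.val) (h' : i.val ≠ j.val + 1) :
      SerRel k (genC i * genS j) (genS j * genC i)
  | sc_left (j : Fin (k - 1)) (a b : Fin k) (ha : a.val = j.val) (hb : b.val = j.val + 1) :
      SerRel k (genS j * genC a) (genC b * genS j)
  | sc_right (j : Fin (k - 1)) (a b : Fin k) (ha : a.val = j.val) (hb : b.val = j.val + 1) :
      SerRel k (genS j * genC b) (genC a * genS j)

/-- The Sergeev superalgebra `Ser_k`. -/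
abbrev Ser (k : ℕ) : Type := RingQuot (SerRel k)

namespace Ser

/-- The odd generator `c_i` of `Ser_k`. -/
def c {k : ℕ} (i : Fin k) : Ser k := RingQuot.mkAlgHom ℂ (SerRel k) (genC i)

/-- The even generator `s_j` of `Ser_k`. -/
def s {k : ℕ} (j : Fin (k - 1)) : Ser k := RingQuot.mkAlgHom ℂ (SerRel k) (genS j)

/-- The product in `Ser_k` of a word in the generators. -/
def word {k : ℕ} (w : List (SerGen k)) : Ser k := (w.map (Sum.elim c s)).prod

/-- The homogeneous component of `Ser_k` of parity `ε`: the span of the words in which the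
number of odd letters has parity `ε`. -/
def gr (k : ℕ) (ε : ZMod 2) : Submodule ℂ (Ser k) :=
  Submodule.span ℂ {x | ∃ w : List (SerGen k),
    ((w.countP Sum.isLeft : ℕ) : ZMod 2) = ε ∧ x = word w}

end Ser

/-! ### Upward webs of type Q

Objects are words in the letters `↑_m`, `m > 0`; an edge labelled by zero is omitted, that is,
`↑_0` is the unit object (the empty word). Juxtaposition of words is the tensor product. -/

/-- Objects of the web category. -/
abbrev Word : Type := List ℕ+

/-- The object `↑_k` for `k ≥ 0`, with `↑_0` the empty word. -/
def strand : ℕ → Word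
  | 0 => []
  | k + 1 => [k.succPNat]

/-- The object `↑_1^k`. -/
abbrev ones (k : ℕ) : Word := List.replicate k 1

/-- Formal linear combinations of formal diagrams `a → b`, built from dots, merges and splits by
vertical composition (`comp g f` is `g ∘ f`, with `f` at the bottom) and horizontal juxtaposition
(`tensor`). The identity `id h` allows equal words to be written differently. -/
inductive Pre : Word → Word → Type
  | id {a b : Word} (h : a = b) : Pre a b
  | comp {a b c : Word} (g : Pre b c) (f : Pre a b) : Pre a c
  | tensor {a b c d : Word} (f : Pre a b) (g : Pre c d) : Pre (a ++ c) (b ++ d)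
  | dot (k : ℕ+) : Pre [k] [k]
  | merge (k l : ℕ+) : Pre [k, l] [k + l]
  | split (k l : ℕ+) : Pre [k + l] [k, l]
  | zero {a b : Word} : Pre a b
  | add {a b : Word} (f g : Pre a b) : Pre a b
  | smul {a b : Word} (z : ℂ) (f : Pre a b) : Pre a b

namespace Pre

infixr:80 " ⊚ " => TypeQ.Pre.comp
infixr:85 " ⊠ " => TypeQ.Pre.tensor
infixl:65 " ⊹ " => TypeQ.Pre.add
infixr:73 " ⊡ " => TypeQ.Pre.smul

/-- Parity: dots are odd, merges and splits are even. -/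
inductive HasParity : ∀ {a b : Word}, Pre a b → ZMod 2 → Prop
  | id {a b : Word} (h : a = b) : HasParity (.id h) 0
  | comp {a b c : Word} {g : Pre b c} {f : Pre a b} {p q : ZMod 2} :
      HasParity g p → HasParity f q → HasParity (g ⊚ f) (p + q)
  | tensor {a b c d : Word} {f : Pre a b} {g : Pre c d} {p q : ZMod 2} :
      HasParity f p → HasParity g q → HasParity (f ⊠ g) (p + q)
  | dot (k : ℕ+) : HasParity (.dot k) 1
  | merge (k l : ℕ+) : HasParity (.merge k l) 0
  | split (k l : ℕ+) : HasParity (.split k l) 0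
  | zero {a b : Word} (p : ZMod 2) : HasParity (.zero : Pre a b) p
  | add {a b : Word} {f g : Pre a b} {p : ZMod 2} :
      HasParity f p → HasParity g p → HasParity (f ⊹ g) p
  | smul {a b : Word} {f : Pre a b} {p : ZMod 2} (z : ℂ) :
      HasParity f p → HasParity (z ⊡ f) p

/-- The identity of a word. -/
abbrev one (a : Word) : Pre a a := .id rfl

/-- The identity of `↑_k`. -/
abbrev I (k : ℕ) : Pre (strand k) (strand k) := one (strand k)

/-- The regrouping `(ab)c = a(bc)`. -/
abbrev asc (a b c : Word) : Pre ((a ++ b) ++ c) (a ++ (b ++ c)) := .id (List.append_assoc a b c)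

/-- The regrouping `a(bc) = (ab)c`. -/
abbrev asc' (a b c : Word) : Pre (a ++ (b ++ c)) ((a ++ b) ++ c) :=
  .id (List.append_assoc a b c).symm

/-- The dot on `↑_k` for `k ≥ 0`; it is zero for `k = 0`. -/
def dotN : (k : ℕ) → Pre (strand k) (strand k)
  | 0 => .zero
  | k + 1 => .dot k.succPNat

/-- The merge `↑_k ↑_l → ↑_m`, `m = k + l`, for `k, l ≥ 0`; an edge labelled by zero is
omitted. -/
def mergeN : (k l m : ℕ) → k + l = m → Pre (strand k ++ strand l) (strand m)
  | 0, l, m, h => .id (by subst h; simp [strand])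
  | k + 1, 0, m, h => .id (by subst h; simp [strand])
  | k + 1, l + 1, m, h => .comp (.id (by subst h; rfl)) (.merge k.succPNat l.succPNat)

/-- The split `↑_m → ↑_k ↑_l`, `m = k + l`, for `k, l ≥ 0`; an edge labelled by zero is
omitted. -/
def splitN : (k l m : ℕ) → k + l = m → Pre (strand m) (strand k ++ strand l)
  | 0, l, m, h => .id (by subst h; simp [strand])
  | k + 1, 0, m, h => .id (by subst h; simp [strand])
  | k + 1, l + 1, m, h => .comp (.split k.succPNat l.succPNat) (.id (by subst h; rfl))

/-- A rung labelled `1`, carrying a dot if `d = true`. -/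
def rung : Bool → Pre (strand 1) (strand 1)
  | true => dotN 1
  | false => I 1

/-- The ladder `↑_k ↑_{l+1} → ↑_{k+1} ↑_l` with one leftward rung labelled `1`. -/
def rungL (d : Bool) (k l : ℕ) :
    Pre (strand k ++ strand (l + 1)) (strand (k + 1) ++ strand l) :=
  (mergeN k 1 (k + 1) rfl ⊠ I l) ⊚ asc' _ _ _ ⊚ (I k ⊠ (rung d ⊠ I l)) ⊚
    (I k ⊠ splitN 1 l (l + 1) (Nat.add_comm 1 l))

/-- The ladder `↑_{k+1} ↑_l → ↑_k ↑_{l+1}` with one rightward rung labelled `1`. -/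
def rungR (d : Bool) (k l : ℕ) :
    Pre (strand (k + 1) ++ strand l) (strand k ++ strand (l + 1)) :=
  (I k ⊠ mergeN 1 l (l + 1) (Nat.add_comm 1 l)) ⊚ (I k ⊠ (rung d ⊠ I l)) ⊚ asc _ _ _ ⊚
    (splitN k 1 (k + 1) rfl ⊠ I l)

/-- On `↑_k ↑_l`: a rightward rung, followed (above) by a leftward rung. It is zero if an edge
would be labelled by a negative number. -/
def ladLR (d d' : Bool) : (k l : ℕ) → Pre (strand k ++ strand l) (strand k ++ strand l)
  | 0, _ => .zero
  | k + 1, l => rungL d k l ⊚ rungR d' k l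

/-- On `↑_k ↑_l`: a leftward rung, followed (above) by a rightward rung. -/
def ladRL (d d' : Bool) : (k l : ℕ) → Pre (strand k ++ strand l) (strand k ++ strand l)
  | _, 0 => .zero
  | k, l + 1 => rungR d k l ⊚ rungL d' k l

/-- A leftward rung between the first two of three strands. -/
def rungL₁ (d : Bool) (h k l : ℕ) :
    Pre (strand h ++ (strand (k + 1) ++ strand l)) (strand (h + 1) ++ (strand k ++ strand l)) :=
  asc _ _ _ ⊚ (rungL d h k ⊠ I l) ⊚ asc' _ _ _

/-- A leftward rung between the last two of three strands. -/
def rungL₂ (d : Bool) (h k l : ℕ) :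
    Pre (strand h ++ (strand k ++ strand (l + 1))) (strand h ++ (strand (k + 1) ++ strand l)) :=
  I h ⊠ rungL d k l

/-- A rightward rung between the first two of three strands. -/
def rungR₁ (d : Bool) (h k l : ℕ) :
    Pre (strand (h + 1) ++ (strand k ++ strand l)) (strand h ++ (strand (k + 1) ++ strand l)) :=
  asc _ _ _ ⊚ (rungR d h k ⊠ I l) ⊚ asc' _ _ _

/-- A rightward rung between the last two of three strands. -/
def rungR₂ (d : Bool) (h k l : ℕ) :
    Pre (strand h ++ (strand (k + 1) ++ strand l)) (strand h ++ (strand k ++ strand (l + 1))) :=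
  I h ⊠ rungR d k l

/-- Leftward rungs: first between the last two strands, then (above) between the first two. -/
def ladL₁₂ (d d' : Bool) (h k l : ℕ) :
    Pre (strand h ++ (strand k ++ strand (l + 1))) (strand (h + 1) ++ (strand k ++ strand l)) :=
  rungL₁ d h k l ⊚ rungL₂ d' h k l

/-- Leftward rungs: first between the first two strands, then (above) between the last two. -/
def ladL₂₁ (d d' : Bool) : (h k l : ℕ) →
    Pre (strand h ++ (strand k ++ strand (l + 1))) (strand (h + 1) ++ (strand k ++ strand l))
  | _, 0, _ => .zero
  | h, k + 1, l => rungL₂ d (h + 1) k l ⊚ rungL₁ d' h k (l + 1)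

/-- Rightward rungs: first between the first two strands, then (above) between the last two. -/
def ladR₂₁ (d d' : Bool) (h k l : ℕ) :
    Pre (strand (h + 1) ++ (strand k ++ strand l)) (strand h ++ (strand k ++ strand (l + 1))) :=
  rungR₂ d h k l ⊚ rungR₁ d' h k l

/-- Rightward rungs: first between the last two strands, then (above) between the first two. -/
def ladR₁₂ (d d' : Bool) : (h k l : ℕ) →
    Pre (strand (h + 1) ++ (strand k ++ strand l)) (strand h ++ (strand k ++ strand (l + 1)))
  | _, 0, _ => .zero
  | h, k + 1, l => rungR₁ d h k (l + 1) ⊚ rungR₂ d' (h + 1) k l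

/-- The dumbbell on `↑_1 ↑_1`: a merge followed by a split. -/
def dumbbell : Pre (strand 1 ++ strand 1) (strand 1 ++ strand 1) :=
  splitN 1 1 2 rfl ⊚ mergeN 1 1 2 rfl

/-- The congruence defining the web category: the axioms of a `ℂ`-linear strict monoidal
supercategory together with the defining relations of webs of type Q. -/
inductive Rel : ∀ {a b : Word}, Pre a b → Pre a b → Prop
  -- equivalence relation
  | refl {a b : Word} (f : Pre a b) : Rel f f
  | symm {a b : Word} {f g : Pre a b} : Rel f g → Rel g f
  | trans {a b : Word} {f g h : Pre a b} : Rel f g → Rel g h → Rel f h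
  -- compatibility with the operations
  | add_congr {a b : Word} {f f' g g' : Pre a b} :
      Rel f f' → Rel g g' → Rel (f ⊹ g) (f' ⊹ g')
  | smul_congr {a b : Word} (z : ℂ) {f f' : Pre a b} : Rel f f' → Rel (z ⊡ f) (z ⊡ f')
  | comp_congr {a b c : Word} {g g' : Pre b c} {f f' : Pre a b} :
      Rel g g' → Rel f f' → Rel (g ⊚ f) (g' ⊚ f')
  | tensor_congr {a b c d : Word} {f f' : Pre a b} {g g' : Pre c d} :
      Rel f f' → Rel g g' → Rel (f ⊠ g) (f' ⊠ g')
  -- morphism spaces are complex vector spaces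
  | add_comm {a b : Word} (f g : Pre a b) : Rel (f ⊹ g) (g ⊹ f)
  | add_assoc {a b : Word} (f g h : Pre a b) : Rel (f ⊹ g ⊹ h) (f ⊹ (g ⊹ h))
  | zero_add {a b : Word} (f : Pre a b) : Rel (.zero ⊹ f) f
  | zero_smul {a b : Word} (f : Pre a b) : Rel ((0 : ℂ) ⊡ f) .zero
  | one_smul {a b : Word} (f : Pre a b) : Rel ((1 : ℂ) ⊡ f) f
  | mul_smul {a b : Word} (z w : ℂ) (f : Pre a b) : Rel ((z * w) ⊡ f) (z ⊡ w ⊡ f)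
  | smul_add {a b : Word} (z : ℂ) (f g : Pre a b) : Rel (z ⊡ (f ⊹ g)) (z ⊡ f ⊹ z ⊡ g)
  | add_smul {a b : Word} (z w : ℂ) (f : Pre a b) : Rel ((z + w) ⊡ f) (z ⊡ f ⊹ w ⊡ f)
  -- composition and tensor product are bilinear
  | add_comp {a b c : Word} (g g' : Pre b c) (f : Pre a b) :
      Rel ((g ⊹ g') ⊚ f) (g ⊚ f ⊹ g' ⊚ f)
  | comp_add {a b c : Word} (g : Pre b c) (f f' : Pre a b) :
      Rel (g ⊚ (f ⊹ f')) (g ⊚ f ⊹ g ⊚ f')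
  | smul_comp {a b c : Word} (z : ℂ) (g : Pre b c) (f : Pre a b) :
      Rel ((z ⊡ g) ⊚ f) (z ⊡ (g ⊚ f))
  | comp_smul {a b c : Word} (z : ℂ) (g : Pre b c) (f : Pre a b) :
      Rel (g ⊚ (z ⊡ f)) (z ⊡ (g ⊚ f))
  | add_tensor {a b c d : Word} (f f' : Pre a b) (g : Pre c d) :
      Rel ((f ⊹ f') ⊠ g) (f ⊠ g ⊹ f' ⊠ g)
  | tensor_add {a b c d : Word} (f : Pre a b) (g g' : Pre c d) :
      Rel (f ⊠ (g ⊹ g')) (f ⊠ g ⊹ f ⊠ g')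
  | smul_tensor {a b c d : Word} (z : ℂ) (f : Pre a b) (g : Pre c d) :
      Rel ((z ⊡ f) ⊠ g) (z ⊡ (f ⊠ g))
  | tensor_smul {a b c d : Word} (z : ℂ) (f : Pre a b) (g : Pre c d) :
      Rel (f ⊠ (z ⊡ g)) (z ⊡ (f ⊠ g))
  -- category axioms
  | one_comp {a b : Word} (f : Pre a b) : Rel (one b ⊚ f) f
  | comp_one {a b : Word} (f : Pre a b) : Rel (f ⊚ one a) f
  | comp_assoc {a b c d : Word} (h : Pre c d) (g : Pre b c) (f : Pre a b) :
      Rel ((h ⊚ g) ⊚ f) (h ⊚ (g ⊚ f))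
  -- strict monoidal supercategory axioms
  | tensor_one (a b : Word) : Rel (one a ⊠ one b) (one (a ++ b))
  | super_interchange {a b c a' b' c' : Word} (f : Pre b c) (g : Pre b' c') (h : Pre a b)
      (k : Pre a' b') {p q : ZMod 2} (hg : HasParity g p) (hh : HasParity h q) :
      Rel ((f ⊠ g) ⊚ (h ⊠ k)) (sgn (p * q) ⊡ ((f ⊚ h) ⊠ (g ⊚ k)))
  | tensor_assoc {a a' b b' c c' : Word} (f : Pre a a') (g : Pre b b') (h : Pre c c') :
      Rel (asc a' b' c' ⊚ ((f ⊠ g) ⊠ h)) ((f ⊠ (g ⊠ h)) ⊚ asc a b c)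
  | unit_tensor {a b : Word} (f : Pre a b) : Rel (one [] ⊠ f) f
  | tensor_unit {a b : Word} (f : Pre a b) :
      Rel (.id (List.append_nil b) ⊚ (f ⊠ one [])) (f ⊚ .id (List.append_nil a))
  -- associativity of merges and of splits
  | merge_assoc (h k l : ℕ) :
      Rel (mergeN (h + k) l (h + k + l) rfl ⊚ (mergeN h k (h + k) rfl ⊠ I l))
        (mergeN h (k + l) (h + k + l) (Nat.add_assoc h k l).symm ⊚
          (I h ⊠ mergeN k l (k + l) rfl) ⊚ asc _ _ _)
  | split_assoc (h k l : ℕ) :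
      Rel ((splitN h k (h + k) rfl ⊠ I l) ⊚ splitN (h + k) l (h + k + l) rfl)
        (asc' _ _ _ ⊚ (I h ⊠ splitN k l (k + l) rfl) ⊚
          splitN h (k + l) (h + k + l) (Nat.add_assoc h k l).symm)
  -- digon removal
  | digon (k l : ℕ) :
      Rel (mergeN k l (k + l) rfl ⊚ splitN k l (k + l) rfl)
        ((((k + l).choose l : ℕ) : ℂ) ⊡ I (k + l))
  -- dot collision
  | dot_collision (k : ℕ) : Rel (dotN k ⊚ dotN k) ((k : ℂ) ⊡ I k)
  -- dots past merges and splits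
  | dot_merge (k l : ℕ) :
      Rel (dotN (k + l) ⊚ mergeN k l (k + l) rfl)
        (mergeN k l (k + l) rfl ⊚ (dotN k ⊠ I l) ⊹ mergeN k l (k + l) rfl ⊚ (I k ⊠ dotN l))
  | dot_split (k l : ℕ) :
      Rel (splitN k l (k + l) rfl ⊚ dotN (k + l))
        ((dotN k ⊠ I l) ⊚ splitN k l (k + l) rfl ⊹ (I k ⊠ dotN l) ⊚ splitN k l (k + l) rfl)
  -- dumbbell relation
  | dumbbell :
      Rel dumbbell
        ((dotN 1 ⊠ dotN 1) ⊚ dumbbell ⊚ (dotN 1 ⊠ dotN 1) ⊹ (2 : ℂ) ⊡ one (strand 1 ++ strand 1))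
  -- square switch, without and with dots
  | square_switch (k l : ℕ) :
      Rel (ladLR false false k l)
        (ladRL false false k l ⊹ ((k : ℂ) - (l : ℂ)) ⊡ one (strand k ++ strand l))
  | square_switch_dot (k l : ℕ) :
      Rel (ladLR true false k l ⊹ (-1 : ℂ) ⊡ ladRL false true k l)
        ((dotN k ⊠ I l) ⊹ (-1 : ℂ) ⊡ (I k ⊠ dotN l))
  | square_switch_dot' (k l : ℕ) :
      Rel (ladLR false true k l ⊹ (-1 : ℂ) ⊡ ladRL true false k l)
        ((dotN k ⊠ I l) ⊹ (-1 : ℂ) ⊡ (I k ⊠ dotN l))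
  -- double rungs, and the same with the rungs reversed
  | double_rungs₁ (h k l : ℕ) :
      Rel (ladL₁₂ false false h k l ⊹ (-1 : ℂ) ⊡ ladL₂₁ false false h k l)
        (ladL₁₂ true true h k l ⊹ ladL₂₁ true true h k l)
  | double_rungs₂ (h k l : ℕ) :
      Rel (ladL₁₂ false true h k l ⊹ (-1 : ℂ) ⊡ ladL₂₁ true false h k l)
        (ladL₁₂ true false h k l ⊹ (-1 : ℂ) ⊡ ladL₂₁ false true h k l)
  | double_rungs₁_rev (h k l : ℕ) :
      Rel (ladR₂₁ false false h k l ⊹ (-1 : ℂ) ⊡ ladR₁₂ false false h k l)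
        (ladR₂₁ true true h k l ⊹ ladR₁₂ true true h k l)
  | double_rungs₂_rev (h k l : ℕ) :
      Rel (ladR₁₂ false true h k l ⊹ (-1 : ℂ) ⊡ ladR₂₁ true false h k l)
        (ladR₁₂ true false h k l ⊹ (-1 : ℂ) ⊡ ladR₂₁ false true h k l)

end Pre

/-- Morphisms `a → b` of the web category. -/
def WebHom (a b : Word) : Type := Quot (Pre.Rel (a := a) (b := b))

namespace WebHom

variable {a b c d : Word}

/-- The class of a formal diagram. -/
def mk (f : Pre a b) : WebHom a b := Quot.mk _ f

theorem sound {f g : Pre a b} (h : Pre.Rel f g) : mk f = mk g := Quot.sound h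

theorem ind {P : WebHom a b → Prop} (h : ∀ f, P (mk f)) : ∀ f, P f := Quot.ind h

/-- Composition `g ∘ f`. -/
def comp (g : WebHom b c) (f : WebHom a b) : WebHom a c :=
  Quot.map₂ Pre.comp (fun _ _ _ h => .comp_congr (.refl _) h)
    (fun _ _ _ h => .comp_congr h (.refl _)) g f

/-- Tensor product `f ⊗ g`. -/
def tensor (f : WebHom a b) (g : WebHom c d) : WebHom (a ++ c) (b ++ d) :=
  Quot.map₂ Pre.tensor (fun _ _ _ h => .tensor_congr (.refl _) h)
    (fun _ _ _ h => .tensor_congr h (.refl _)) f g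

/-- The identity morphism. -/
def one (a : Word) : WebHom a a := mk (.one a)

instance : Zero (WebHom a b) := ⟨mk .zero⟩

instance : Add (WebHom a b) :=
  ⟨Quot.map₂ Pre.add (fun _ _ _ h => .add_congr (.refl _) h)
    (fun _ _ _ h => .add_congr h (.refl _))⟩

instance : SMul ℂ (WebHom a b) := ⟨fun z => Quot.map (Pre.smul z) (fun _ _ h => .smul_congr z h)⟩

instance : Neg (WebHom a b) := ⟨fun f => (-1 : ℂ) • f⟩

theorem mk_zero : (mk .zero : WebHom a b) = 0 := rfl

theorem mk_add (f g : Pre a b) : mk (.add f g) = mk f + mk g := rfl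

theorem mk_smul (z : ℂ) (f : Pre a b) : mk (.smul z f) = z • mk f := rfl

theorem mk_comp (g : Pre b c) (f : Pre a b) : mk (.comp g f) = comp (mk g) (mk f) := rfl

theorem mk_tensor (f : Pre a b) (g : Pre c d) : mk (.tensor f g) = tensor (mk f) (mk g) := rfl

protected theorem add_comm (f g : WebHom a b) : f + g = g + f := by
  induction f using ind with | h f => induction g using ind with | h g => exact sound (.add_comm f g)

protected theorem add_assoc (f g h : WebHom a b) : f + g + h = f + (g + h) := by
  induction f using ind with | h f =>
  induction g using ind with | h g =>
  induction h using ind with | h h => exact sound (.add_assoc f g h)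

protected theorem zero_add (f : WebHom a b) : 0 + f = f := by
  induction f using ind with | h f => exact sound (.zero_add f)

protected theorem zero_smul (f : WebHom a b) : (0 : ℂ) • f = 0 := by
  induction f using ind with | h f => exact sound (.zero_smul f)

protected theorem one_smul (f : WebHom a b) : (1 : ℂ) • f = f := by
  induction f using ind with | h f => exact sound (.one_smul f)

protected theorem add_smul (z w : ℂ) (f : WebHom a b) : (z + w) • f = z • f + w • f := by
  induction f using ind with | h f => exact sound (.add_smul z w f)

protected theorem mul_smul (z w : ℂ) (f : WebHom a b) : (z * w) • f = z • w • f := by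
  induction f using ind with | h f => exact sound (.mul_smul z w f)

protected theorem smul_add (z : ℂ) (f g : WebHom a b) : z • (f + g) = z • f + z • g := by
  induction f using ind with | h f =>
  induction g using ind with | h g => exact sound (.smul_add z f g)

instance : AddCommGroup (WebHom a b) where
  add_assoc := WebHom.add_assoc
  zero_add := WebHom.zero_add
  add_zero f := by rw [WebHom.add_comm]; exact WebHom.zero_add f
  add_comm := WebHom.add_comm
  nsmul := nsmulRec
  zsmul := zsmulRec
  neg_add_cancel f := by
    change (-1 : ℂ) • f + f = 0
    conv_lhs => rw [← WebHom.one_smul f]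
    rw [← WebHom.mul_smul, ← WebHom.add_smul]
    convert WebHom.zero_smul f using 2
    norm_num

instance : Module ℂ (WebHom a b) where
  one_smul := WebHom.one_smul
  mul_smul := WebHom.mul_smul
  zero_smul := WebHom.zero_smul
  add_smul := WebHom.add_smul
  smul_add := WebHom.smul_add
  smul_zero z := by
    rw [← WebHom.zero_smul (0 : WebHom a b), ← WebHom.mul_smul, mul_zero]

theorem comp_assoc (h : WebHom c d) (g : WebHom b c) (f : WebHom a b) :
    comp (comp h g) f = comp h (comp g f) := by
  induction f using ind with | h f =>
  induction g using ind with | h g =>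
  induction h using ind with | h h => exact sound (.comp_assoc h g f)

theorem one_comp (f : WebHom a b) : comp (one b) f = f := by
  induction f using ind with | h f => exact sound (.one_comp f)

theorem comp_one (f : WebHom a b) : comp f (one a) = f := by
  induction f using ind with | h f => exact sound (.comp_one f)

theorem add_comp (g g' : WebHom b c) (f : WebHom a b) :
    comp (g + g') f = comp g f + comp g' f := by
  induction f using ind with | h f =>
  induction g using ind with | h g =>
  induction g' using ind with | h g' => exact sound (.add_comp g g' f)

theorem comp_add (g : WebHom b c) (f f' : WebHom a b) :
    comp g (f + f') = comp g f + comp g f' := by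
  induction f using ind with | h f =>
  induction g using ind with | h g =>
  induction f' using ind with | h f' => exact sound (.comp_add g f f')

theorem smul_comp (z : ℂ) (g : WebHom b c) (f : WebHom a b) :
    comp (z • g) f = z • comp g f := by
  induction f using ind with | h f =>
  induction g using ind with | h g => exact sound (.smul_comp z g f)

theorem comp_smul (z : ℂ) (g : WebHom b c) (f : WebHom a b) :
    comp g (z • f) = z • comp g f := by
  induction f using ind with | h f =>
  induction g using ind with | h g => exact sound (.comp_smul z g f)

/-- `End(↑_a)` is a ring under composition. -/
instance : Ring (WebHom a a) where
  mul := comp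
  one := one a
  mul_assoc := comp_assoc
  one_mul := one_comp
  mul_one := comp_one
  left_distrib := comp_add
  right_distrib := add_comp
  zero_mul f := by
    have h := smul_comp 0 (0 : WebHom a a) f
    rwa [zero_smul, zero_smul] at h
  mul_zero f := by
    have h := comp_smul 0 f (0 : WebHom a a)
    rwa [zero_smul, zero_smul] at h
  neg_add_cancel := neg_add_cancel
  zsmul := zsmulRec

instance : Algebra ℂ (WebHom a a) := Algebra.ofModule smul_comp (fun z g f => comp_smul z g f)

/-- The homogeneous morphisms of parity `ε`. -/
def gr (a b : Word) (ε : ZMod 2) : Submodule ℂ (WebHom a b) where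
  carrier := {f | ∃ p : Pre a b, p.HasParity ε ∧ mk p = f}
  zero_mem' := ⟨.zero, .zero ε, rfl⟩
  add_mem' := by
    rintro _ _ ⟨p, hp, rfl⟩ ⟨q, hq, rfl⟩
    exact ⟨.add p q, .add hp hq, rfl⟩
  smul_mem' := by
    rintro z _ ⟨p, hp, rfl⟩
    exact ⟨.smul z p, .smul z hp, rfl⟩

/-- The dot on `↑_k`. -/
def dot (k : ℕ+) : WebHom [k] [k] := mk (.dot k)

/-- The merge `↑_k ↑_l → ↑_{k+l}`. -/
def merge (k l : ℕ+) : WebHom [k, l] [k + l] := mk (.merge k l)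

/-- The split `↑_{k+l} → ↑_k ↑_l`. -/
def split (k l : ℕ+) : WebHom [k + l] [k, l] := mk (.split k l)

/-- The upward crossing of two `1`-strands. -/
def cross : WebHom [1, 1] [1, 1] := comp (split 1 1) (merge 1 1) - one [1, 1]

/-- The endomorphism `c_i` of `↑_1^k` (counting from `i = 0`): a dot on strand `i`. The value
outside the range `i < k` is irrelevant. -/
def dotAt : (k i : ℕ) → WebHom (ones k) (ones k)
  | 0, _ => 0
  | k + 1, 0 => tensor (dot 1) (one (ones k))
  | k + 1, i + 1 => tensor (one [1]) (dotAt k i)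

/-- The endomorphism `s_j` of `↑_1^k` (counting from `j = 0`): the crossing of the strands `j`
and `j + 1`. The value outside the range `j + 1 < k` is irrelevant. -/
def crossAt : (k j : ℕ) → WebHom (ones k) (ones k)
  | 0, _ => 0
  | 1, _ => 0
  | k + 2, 0 => tensor cross (one (ones k))
  | k + 1, j + 1 => tensor (one [1]) (crossAt k j)

end WebHom

/-! ### Superspaces -/

/-- A complex superspace. The `ℤ/2`-grading is recorded by its parity operator
`v ↦ (-1)^|v| v`, a linear involution whose eigenspaces are the homogeneous components. -/
class SuperSpace (V : Type) [AddCommGroup V] [Module ℂ V] where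
  par : V →ₗ[ℂ] V
  par_par : ∀ v, par (par v) = v

section Super

set_option linter.unusedSectionVars false

variable {V W V' W' : Type}
  [AddCommGroup V] [Module ℂ V] [SuperSpace V]
  [AddCommGroup W] [Module ℂ W] [SuperSpace W]
  [AddCommGroup V'] [Module ℂ V'] [SuperSpace V']
  [AddCommGroup W'] [Module ℂ W'] [SuperSpace W']

/-- The parity operator `v ↦ (-1)^|v| v`. -/
abbrev par : V →ₗ[ℂ] V := SuperSpace.par

@[simp] theorem par_par (v : V) : par (par v) = v := SuperSpace.par_par v

/-- `v` is homogeneous of parity `ε`. -/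
def IsHomog (ε : ZMod 2) (v : V) : Prop := par v = sgn ε • v

/-- Every vector is the sum of an even and an odd vector. -/
theorem exists_homog (v : V) : ∃ v₀ v₁ : V, IsHomog 0 v₀ ∧ IsHomog 1 v₁ ∧ v = v₀ + v₁ := by
  refine ⟨(1 / 2 : ℂ) • (v + par v), (1 / 2 : ℂ) • (v - par v), ?_, ?_, ?_⟩
  · simp [IsHomog, add_comm]
  · simp [IsHomog, ← smul_neg]
  · module

/-- The linear map `f` has parity `ε`. -/
def HasPar (ε : ZMod 2) (f : V →ₗ[ℂ] W) : Prop := ∀ v, par (f v) = sgn ε • f (par v)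

/-- A linear map has parity `ε` exactly if it maps vectors of parity `δ` to vectors of parity
`δ + ε`. -/
theorem hasPar_iff (ε : ZMod 2) (f : V →ₗ[ℂ] W) :
    HasPar ε f ↔ ∀ δ v, IsHomog δ v → IsHomog (δ + ε) (f v) := by
  constructor
  · intro h δ v hv
    unfold IsHomog at *
    rw [h v, hv, map_smul, sgn_add, mul_smul]
  · intro h v
    obtain ⟨v₀, v₁, h₀, h₁, rfl⟩ := exists_homog v
    have e₀ := h 0 v₀ h₀
    have e₁ := h 1 v₁ h₁
    unfold IsHomog at *
    simp only [map_add, e₀, e₁, h₀, h₁, map_smul, sgn_add, smul_add, mul_smul]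

/-- The even part of a linear map. -/
def evenPart (f : V →ₗ[ℂ] W) : V →ₗ[ℂ] W := (1 / 2 : ℂ) • (f + par ∘ₗ f ∘ₗ par)

/-- The odd part of a linear map. -/
def oddPart (f : V →ₗ[ℂ] W) : V →ₗ[ℂ] W := (1 / 2 : ℂ) • (f - par ∘ₗ f ∘ₗ par)

theorem evenPart_add_oddPart (f : V →ₗ[ℂ] W) : evenPart f + oddPart f = f := by
  unfold evenPart oddPart; module

theorem hasPar_evenPart (f : V →ₗ[ℂ] W) : HasPar 0 (evenPart f) := by
  intro v; simp [evenPart, add_comm]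

theorem hasPar_oddPart (f : V →ₗ[ℂ] W) : HasPar 1 (oddPart f) := by
  intro v; simp [oddPart, ← smul_neg]

theorem evenPart_of_even {f : V →ₗ[ℂ] W} (h : HasPar 0 f) : evenPart f = f := by
  ext v; simp [evenPart, h (par v)]; module

theorem oddPart_of_even {f : V →ₗ[ℂ] W} (h : HasPar 0 f) : oddPart f = 0 := by
  ext v; simp [oddPart, h (par v)]

theorem evenPart_of_odd {f : V →ₗ[ℂ] W} (h : HasPar 1 f) : evenPart f = 0 := by
  ext v; simp [evenPart, h (par v)]

theorem oddPart_of_odd {f : V →ₗ[ℂ] W} (h : HasPar 1 f) : oddPart f = f := by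
  ext v; simp [oddPart, h (par v)]; module

theorem evenPart_add (f g : V →ₗ[ℂ] W) : evenPart (f + g) = evenPart f + evenPart g := by
  ext v; simp [evenPart]; module

theorem oddPart_add (f g : V →ₗ[ℂ] W) : oddPart (f + g) = oddPart f + oddPart g := by
  ext v; simp [oddPart]; module

theorem evenPart_smul (z : ℂ) (f : V →ₗ[ℂ] W) : evenPart (z • f) = z • evenPart f := by
  ext v; simp [evenPart]; module

theorem oddPart_smul (z : ℂ) (f : V →ₗ[ℂ] W) : oddPart (z • f) = z • oddPart f := by
  ext v; simp [oddPart]; module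

instance : SuperSpace (V ⊗[ℂ] W) where
  par := TensorProduct.map par par
  par_par t := by
    induction t using TensorProduct.induction_on with
    | zero => simp
    | tmul v w => simp
    | add x y hx hy => simp only [map_add, hx, hy]

@[simp] theorem par_tmul (v : V) (w : W) : par (v ⊗ₜ[ℂ] w) = par v ⊗ₜ[ℂ] par w := rfl

/-- The tensor product of linear maps of superspaces,
`(f ⊗ g)(v ⊗ w) = (-1)^(|g||v|) f v ⊗ g w` for homogeneous `g` and `v`. -/
def superTensor (f : V →ₗ[ℂ] V') (g : W →ₗ[ℂ] W') : V ⊗[ℂ] W →ₗ[ℂ] V' ⊗[ℂ] W' :=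
  TensorProduct.map f (evenPart g) + TensorProduct.map (f ∘ₗ par) (oddPart g)

theorem superTensor_of_even (f : V →ₗ[ℂ] V') {g : W →ₗ[ℂ] W'} (hg : HasPar 0 g) :
    superTensor f g = TensorProduct.map f g := by
  simp [superTensor, evenPart_of_even hg, oddPart_of_even hg]

theorem superTensor_of_odd (f : V →ₗ[ℂ] V') {g : W →ₗ[ℂ] W'} (hg : HasPar 1 g) :
    superTensor f g = TensorProduct.map (f ∘ₗ par) g := by
  simp [superTensor, evenPart_of_odd hg, oddPart_of_odd hg]

theorem superTensor_homog (f : V →ₗ[ℂ] V') (g : W →ₗ[ℂ] W') (ε δ : ZMod 2) (hg : HasPar ε g)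
    (v : V) (hv : IsHomog δ v) (w : W) :
    superTensor f g (v ⊗ₜ[ℂ] w) = sgn (ε * δ) • (f v ⊗ₜ[ℂ] g w) := by
  unfold IsHomog at hv
  rcases eq_zero_or_one ε with rfl | rfl
  · simp [superTensor_of_even f hg]
  · simp [superTensor_of_odd f hg, hv, TensorProduct.smul_tmul']

theorem hasPar_id : HasPar 0 (LinearMap.id : V →ₗ[ℂ] V) := by intro v; simp

theorem superTensor_id (f : V →ₗ[ℂ] V') :
    superTensor f (LinearMap.id : W →ₗ[ℂ] W) = TensorProduct.map f LinearMap.id :=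
  superTensor_of_even f hasPar_id

theorem superTensor_add (f : V →ₗ[ℂ] V') (g g' : W →ₗ[ℂ] W') :
    superTensor f (g + g') = superTensor f g + superTensor f g' := by
  simp only [superTensor, evenPart_add, oddPart_add, TensorProduct.map_add_right]; abel

theorem superTensor_smul (z : ℂ) (f : V →ₗ[ℂ] V') (g : W →ₗ[ℂ] W') :
    superTensor f (z • g) = z • superTensor f g := by
  simp only [superTensor, evenPart_smul, oddPart_smul, TensorProduct.map_smul_right, smul_add]

/-- The graded flip `v ⊗ w ↦ (-1)^(|v||w|) w ⊗ v`. -/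
def flip (V W : Type) [AddCommGroup V] [Module ℂ V] [SuperSpace V]
    [AddCommGroup W] [Module ℂ W] [SuperSpace W] : V ⊗[ℂ] W →ₗ[ℂ] W ⊗[ℂ] V :=
  (TensorProduct.comm ℂ V W).toLinearMap ∘ₗ
    (TensorProduct.map LinearMap.id ((1 / 2 : ℂ) • (LinearMap.id + par)) +
      TensorProduct.map par ((1 / 2 : ℂ) • (LinearMap.id - par)))

theorem flip_tmul (v : V) (w : W) :
    flip V W (v ⊗ₜ w) = (1 / 2 : ℂ) • (w ⊗ₜ v + par w ⊗ₜ v + w ⊗ₜ par v - par w ⊗ₜ par v) := by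
  simp only [flip, LinearMap.comp_apply, LinearMap.add_apply, TensorProduct.map_tmul,
    LinearMap.id_apply, LinearMap.smul_apply, LinearMap.sub_apply, TensorProduct.tmul_smul,
    TensorProduct.tmul_add, TensorProduct.tmul_sub, map_add, map_sub, map_smul,
    LinearEquiv.coe_coe, TensorProduct.comm_tmul]
  module

theorem flip_homog (ε δ : ZMod 2) (v : V) (w : W) (hv : IsHomog ε v) (hw : IsHomog δ w) :
    flip V W (v ⊗ₜ w) = sgn (ε * δ) • (w ⊗ₜ[ℂ] v) := by
  unfold IsHomog at hv hw
  rw [flip_tmul, hv, hw]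
  rcases eq_zero_or_one ε with rfl | rfl <;> rcases eq_zero_or_one δ with rfl | rfl <;>
    simp [TensorProduct.neg_tmul, TensorProduct.tmul_neg] <;> module

/-- The operator `m ⊗ m' ↦ x m ⊗ m' + (-1)^(|x||m|) m ⊗ x' m'` on a tensor product, for operators
`x`, `x'` of the same parity `|x|`. -/
def tensorAct (x : V →ₗ[ℂ] V) (x' : W →ₗ[ℂ] W) : V ⊗[ℂ] W →ₗ[ℂ] V ⊗[ℂ] W :=
  TensorProduct.map x LinearMap.id + superTensor LinearMap.id x'

theorem evenPart_apply (f : V →ₗ[ℂ] W) (v : V) :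
    evenPart f v = (1 / 2 : ℂ) • (f v + par (f (par v))) := rfl

theorem oddPart_apply (f : V →ₗ[ℂ] W) (v : V) :
    oddPart f v = (1 / 2 : ℂ) • (f v - par (f (par v))) := rfl

theorem tensorAct_tmul (x : V →ₗ[ℂ] V) (y : W →ₗ[ℂ] W) (v : V) (w : W) :
    tensorAct x y (v ⊗ₜ w) = x v ⊗ₜ w + v ⊗ₜ[ℂ] evenPart y w + par v ⊗ₜ[ℂ] oddPart y w := by
  simp [tensorAct, superTensor, add_assoc]

theorem flip_tensorAct (x : V →ₗ[ℂ] V) (y : W →ₗ[ℂ] W) (t : V ⊗[ℂ] W) :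
    tensorAct y x (flip V W t) = flip V W (tensorAct x y t) := by
  induction t using TensorProduct.induction_on with
  | zero => simp
  | add s t hs ht => simp only [map_add, hs, ht]
  | tmul v w =>
    simp only [map_smul, map_add, map_sub, tensorAct_tmul, flip_tmul, evenPart_apply,
      oddPart_apply, par_par, TensorProduct.tmul_smul, TensorProduct.tmul_add,
      TensorProduct.tmul_sub]
    module

theorem assoc_tensorAct (x : V →ₗ[ℂ] V) (y : W →ₗ[ℂ] W) (z : V' →ₗ[ℂ] V')
    (t : (V ⊗[ℂ] W) ⊗[ℂ] V') :
    tensorAct x (tensorAct y z) (TensorProduct.assoc ℂ V W V' t) =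
      TensorProduct.assoc ℂ V W V' (tensorAct (tensorAct x y) z t) := by
  induction t using TensorProduct.induction_on with
  | zero => simp
  | add s t hs ht => simp only [map_add, hs, ht]
  | tmul s w =>
    induction s using TensorProduct.induction_on with
    | zero => simp
    | add s t hs ht => simp only [TensorProduct.add_tmul, map_add, hs, ht]
    | tmul u v =>
      simp only [TensorProduct.assoc_tmul, tensorAct_tmul, evenPart_apply,
        oddPart_apply, par_tmul, map_add, TensorProduct.add_tmul, TensorProduct.tmul_add,
        TensorProduct.tmul_smul, ← TensorProduct.smul_tmul', TensorProduct.tmul_sub, map_smul,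
        map_sub, TensorProduct.sub_tmul, par_par]
      module

theorem hasPar_comp {ε δ : ZMod 2} {x y : V →ₗ[ℂ] V} (hx : HasPar ε x) (hy : HasPar δ y) :
    HasPar (ε + δ) (x ∘ₗ y) := by
  intro v
  rw [LinearMap.comp_apply, hx (y v), hy v, map_smul, sgn_add, smul_smul, mul_comm]
  rfl

theorem hasPar_bracket {ε δ : ZMod 2} {x y : V →ₗ[ℂ] V} (hx : HasPar ε x) (hy : HasPar δ y) :
    HasPar (ε + δ) (x ∘ₗ y - sgn (ε * δ) • (y ∘ₗ x)) := by
  intro v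
  have h₁ := hasPar_comp hx hy v
  have h₂ := hasPar_comp hy hx v
  rw [add_comm δ ε] at h₂
  simp only [LinearMap.sub_apply, LinearMap.smul_apply, map_sub, map_smul, h₁, h₂]
  module

theorem tensor_par {ε : ZMod 2} {x : V →ₗ[ℂ] V} {x' : W →ₗ[ℂ] W} (hx : HasPar ε x)
    (hx' : HasPar ε x') :
    HasPar ε (tensorAct x x') := by
  unfold tensorAct
  intro t
  induction t using TensorProduct.induction_on with
  | zero => simp
  | add s t hs ht => simp only [map_add, hs, ht, smul_add]
  | tmul v w =>
    rcases eq_zero_or_one ε with rfl | rfl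
    · simp [superTensor_of_even _ hx', hx v, hx' w]
    · simp [superTensor_of_odd _ hx', hx v, hx' w, TensorProduct.neg_tmul,
        TensorProduct.tmul_neg, add_comm]

theorem tensor_bracket (ε δ : ZMod 2) {x y z : V →ₗ[ℂ] V} {x' y' z' : W →ₗ[ℂ] W}
    (hx : HasPar ε x) (hx' : HasPar ε x') (hy : HasPar δ y) (hy' : HasPar δ y')
    (hz : z = x ∘ₗ y - sgn (ε * δ) • (y ∘ₗ x))
    (hz' : z' = x' ∘ₗ y' - sgn (ε * δ) • (y' ∘ₗ x')) :
    tensorAct z z' = tensorAct x x' ∘ₗ tensorAct y y' -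
      sgn (ε * δ) • (tensorAct y y' ∘ₗ tensorAct x x') := by
  unfold tensorAct
  have h₂ : HasPar (ε + δ) z' := hz' ▸ hasPar_bracket hx' hy'
  have h11 : (1 + 1 : ZMod 2) = 0 := rfl
  refine TensorProduct.ext' fun v w => ?_
  rcases eq_zero_or_one ε with rfl | rfl <;> rcases eq_zero_or_one δ with rfl | rfl
  · rw [add_zero] at h₂
    rw [superTensor_of_even _ h₂]
    simp [superTensor_of_even _ hx', superTensor_of_even _ hy', hz, hz',
      TensorProduct.sub_tmul, TensorProduct.tmul_sub]
    abel
  · rw [zero_add] at h₂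
    rw [superTensor_of_odd _ h₂]
    simp [superTensor_of_even _ hx', superTensor_of_odd _ hy', hz, hz',
      TensorProduct.sub_tmul, TensorProduct.tmul_sub, hx v]
    abel
  · rw [add_zero] at h₂
    rw [superTensor_of_odd _ h₂]
    simp [superTensor_of_odd _ hx', superTensor_of_even _ hy', hz, hz',
      TensorProduct.sub_tmul, TensorProduct.tmul_sub, hy v]
    abel
  · rw [h11] at h₂
    rw [superTensor_of_even _ h₂]
    simp [superTensor_of_odd _ hx', superTensor_of_odd _ hy', hz, hz',
      TensorProduct.add_tmul, TensorProduct.tmul_add, hx v, hy v, TensorProduct.neg_tmul]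
    abel

end Super

/-! ### The Lie superalgebra `q(n)` and its supermodules -/

/-- The superspace `V = V_n` with even basis `v_i` (`Sum.inl i`) and odd basis `v_ī`
(`Sum.inr i`). -/
abbrev VN (n : ℕ) : Type := Fin n ⊕ Fin n → ℂ

instance (n : ℕ) : SuperSpace (VN n) where
  par :=
    { toFun := fun v => Sum.elim (fun i => v (Sum.inl i)) (fun i => -v (Sum.inr i))
      map_add' := fun v w => by ext (i | i) <;> simp; ring
      map_smul' := fun z v => by ext (i | i) <;> simp }
  par_par v := by ext (i | i) <;> simp

/-- The odd involution `c` of `V_n`: `c(v_i) = √-1 v_ī` and `c(v_ī) = -√-1 v_i`. -/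
def cV (n : ℕ) : VN n →ₗ[ℂ] VN n where
  toFun v := Sum.elim (fun i => -(Complex.I * v (Sum.inr i))) (fun i => Complex.I * v (Sum.inl i))
  map_add' v w := by ext (i | i) <;> simp <;> ring
  map_smul' z v := by ext (i | i) <;> simp <;> ring

/-- The superspace `q(n)` of all `x ∈ gl(V_n)` whose supercommutator with `c` vanishes: the even
part of `x` commutes and the odd part of `x` anticommutes with `c`. -/
def qLie (n : ℕ) : Submodule ℂ (VN n →ₗ[ℂ] VN n) where
  carrier := {x | evenPart x ∘ₗ cV n = cV n ∘ₗ evenPart x ∧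
    oddPart x ∘ₗ cV n = -(cV n ∘ₗ oddPart x)}
  zero_mem' := by simp [evenPart, oddPart]
  add_mem' := by
    rintro x y ⟨hx, hx'⟩ ⟨hy, hy'⟩
    refine ⟨?_, ?_⟩
    · rw [evenPart_add, LinearMap.add_comp, LinearMap.comp_add, hx, hy]
    · rw [oddPart_add, LinearMap.add_comp, LinearMap.comp_add, hx', hy']; abel
  smul_mem' := by
    rintro z x ⟨hx, hx'⟩
    refine ⟨?_, ?_⟩
    · rw [evenPart_smul, LinearMap.smul_comp, LinearMap.comp_smul, hx]
    · rw [oddPart_smul, LinearMap.smul_comp, LinearMap.comp_smul, hx', smul_neg]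

/-- A supermodule for the Lie superalgebra `q(n)`: a superspace with an action of `q(n)` that
respects the gradings and satisfies `[x,y].m = x.(y.m) - (-1)^(|x||y|) y.(x.m)`, where
`[x,y] = xy - (-1)^(|x||y|) yx` is the supercommutator of `gl(V_n)`. -/
structure QMod (n : ℕ) where
  carrier : Type
  [group : AddCommGroup carrier]
  [module : Module ℂ carrier]
  [super : SuperSpace carrier]
  act : qLie n →ₗ[ℂ] (carrier →ₗ[ℂ] carrier)
  act_par : ∀ (ε : ZMod 2) (x : qLie n), HasPar ε x.1 → HasPar ε (act x)
  act_bracket : ∀ (ε δ : ZMod 2) (x y z : qLie n), HasPar ε x.1 → HasPar δ y.1 →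
    z.1 = x.1 ∘ₗ y.1 - sgn (ε * δ) • (y.1 ∘ₗ x.1) →
    act z = act x ∘ₗ act y - sgn (ε * δ) • (act y ∘ₗ act x)

namespace QMod

attribute [instance] QMod.group QMod.module QMod.super

instance (n : ℕ) : CoeSort (QMod n) Type := ⟨QMod.carrier⟩

variable {n : ℕ}

/-- The trivial supermodule `ℂ`, concentrated in even parity. -/
@[reducible] def trivial (n : ℕ) : QMod n where
  carrier := ℂ
  super := { par := LinearMap.id, par_par := fun _ => rfl }
  act := 0
  act_par := fun ε x _ v => by simp
  act_bracket := fun ε δ x y z _ _ _ => by simp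

/-- The natural supermodule `V_n`. -/
@[reducible] def natural (n : ℕ) : QMod n where
  carrier := VN n
  act := (qLie n).subtype
  act_par := fun _ _ h => h
  act_bracket := fun _ _ _ _ _ _ _ h => h

/-- The tensor product of supermodules, with action
`x.(m ⊗ m') = x.m ⊗ m' + (-1)^(|x||m|) m ⊗ x.m'`. -/
@[reducible] def tensor (M N : QMod n) : QMod n where
  carrier := M ⊗[ℂ] N
  act :=
    { toFun := fun x => tensorAct (M.act x) (N.act x)
      map_add' := fun x y => by
        unfold tensorAct
        rw [map_add, map_add, superTensor_add, TensorProduct.map_add_left]; abel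
      map_smul' := fun z x => by
        unfold tensorAct
        rw [map_smul, map_smul, superTensor_smul, TensorProduct.map_smul_left]; simp }
  act_par := fun ε x hx => tensor_par (M.act_par ε x hx) (N.act_par ε x hx)
  act_bracket := by
    intro ε δ x y z hx hy hz
    exact tensor_bracket ε δ (M.act_par ε x hx) (N.act_par ε x hx) (M.act_par δ y hy)
      (N.act_par δ y hy) (M.act_bracket ε δ x y z hx hy hz) (N.act_bracket ε δ x y z hx hy hz)

/-- `f` is an even homomorphism from `M` to `N`. -/
structure EvenHom (M N : QMod n) (f : M →ₗ[ℂ] N) : Prop where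
  par : ∀ v, TypeQ.par (f v) = f (TypeQ.par v)
  act : ∀ x v, N.act x (f v) = f (M.act x v)

/-- The quotient of a supermodule by a subspace that is stable under parity and action. -/
@[reducible] def quotient (M : QMod n) (R : Submodule ℂ M) (hp : ∀ v ∈ R, TypeQ.par v ∈ R)
    (ha : ∀ x, ∀ v ∈ R, M.act x v ∈ R) : QMod n where
  carrier := M ⧸ R
  super :=
    { par := R.mapQ R TypeQ.par hp
      par_par := fun v => by
        induction v using Submodule.Quotient.induction_on with | H v => simp }
  act :=
    { toFun := fun x => R.mapQ R (M.act x) (ha x)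
      map_add' := fun x y => by ext v; simp
      map_smul' := fun z x => by ext v; simp }
  act_par := by
    intro ε x hx v
    induction v using Submodule.Quotient.induction_on with | H v =>
    exact congrArg R.mkQ (M.act_par ε x hx v)
  act_bracket := by
    intro ε δ x y z hx hy hz
    refine LinearMap.ext fun v => ?_
    induction v using Submodule.Quotient.induction_on with | H v =>
    exact congrArg R.mkQ (LinearMap.congr_fun (M.act_bracket ε δ x y z hx hy hz) v)

/-- The linear maps `f : M → N` of parity `ε` with `f(x.m) = (-1)^(|f||x|) x.f(m)`. -/
def homGr (M N : QMod n) (ε : ZMod 2) : Submodule ℂ (M →ₗ[ℂ] N) where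
  carrier := {f | HasPar ε f ∧ ∀ (δ : ZMod 2) (x : qLie n), HasPar δ x.1 → ∀ m,
    f (M.act x m) = sgn (ε * δ) • N.act x (f m)}
  zero_mem' := ⟨fun v => by simp, fun δ x _ m => by simp⟩
  add_mem' := by
    rintro f g ⟨hf, hf'⟩ ⟨hg, hg'⟩
    refine ⟨fun v => ?_, fun δ x hx m => ?_⟩
    · simp [hf v, hg v]
    · simp [hf' δ x hx m, hg' δ x hx m]
  smul_mem' := by
    rintro z f ⟨hf, hf'⟩
    refine ⟨fun v => ?_, fun δ x hx m => ?_⟩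
    · simp [hf v, smul_comm z]
    · simp [hf' δ x hx m, smul_comm z]

theorem EvenHom.comp {L M N : QMod n} {g : M →ₗ[ℂ] N} {f : L →ₗ[ℂ] M} (hg : EvenHom M N g)
    (hf : EvenHom L M f) : EvenHom L N (g ∘ₗ f) :=
  ⟨fun v => by simp [hg.par, hf.par], fun x v => by simp [hg.act, hf.act]⟩

theorem EvenHom.id (M : QMod n) : EvenHom M M LinearMap.id := ⟨fun _ => rfl, fun _ _ => rfl⟩

theorem EvenHom.lTensor (L : QMod n) {M N : QMod n} {f : M →ₗ[ℂ] N} (hf : EvenHom M N f) :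
    EvenHom (tensor L M) (tensor L N) (TensorProduct.map LinearMap.id f) := by
  refine ⟨fun t => ?_, fun x t => ?_⟩
  · induction t using TensorProduct.induction_on with
    | zero => simp
    | add s t hs ht => simp only [map_add, hs, ht]
    | tmul v w => simp [hf.par]
  · induction t using TensorProduct.induction_on with
    | zero => simp
    | add s t hs ht => simp only [map_add, hs, ht]
    | tmul v w =>
      change tensorAct (L.act x) (N.act x) (v ⊗ₜ f w) =
        TensorProduct.map LinearMap.id f (tensorAct (L.act x) (M.act x) (v ⊗ₜ w))
      simp only [tensorAct_tmul, TensorProduct.map_tmul, LinearMap.id_apply, evenPart_apply,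
        oddPart_apply, hf.par, hf.act, map_smul, map_add, map_sub]

theorem EvenHom.rTensor (L : QMod n) {M N : QMod n} {f : M →ₗ[ℂ] N} (hf : EvenHom M N f) :
    EvenHom (tensor M L) (tensor N L) (TensorProduct.map f LinearMap.id) := by
  refine ⟨fun t => ?_, fun x t => ?_⟩
  · induction t using TensorProduct.induction_on with
    | zero => simp
    | add s t hs ht => simp only [map_add, hs, ht]
    | tmul v w => simp [hf.par]
  · induction t using TensorProduct.induction_on with
    | zero => simp
    | add s t hs ht => simp only [map_add, hs, ht]
    | tmul v w =>
      change tensorAct (N.act x) (L.act x) (f v ⊗ₜ w) =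
        TensorProduct.map f LinearMap.id (tensorAct (M.act x) (L.act x) (v ⊗ₜ w))
      simp only [tensorAct_tmul, TensorProduct.map_tmul, LinearMap.id_apply, hf.par, hf.act,
        map_add]

theorem evenHom_flip (M N : QMod n) : EvenHom (tensor M N) (tensor N M) (flip M N) := by
  refine ⟨fun t => ?_, fun x t => ?_⟩
  · induction t using TensorProduct.induction_on with
    | zero => simp
    | add s t hs ht => simp only [map_add, hs, ht]
    | tmul v w =>
      rw [par_tmul, flip_tmul, flip_tmul]
      simp only [map_smul, map_add, map_sub, par_tmul, TypeQ.par_par]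
  · exact flip_tensorAct (M.act x) (N.act x) t

theorem evenHom_assoc (L M N : QMod n) : EvenHom (tensor (tensor L M) N) (tensor L (tensor M N))
    (TensorProduct.assoc ℂ L M N).toLinearMap := by
  refine ⟨fun t => ?_, fun x t => ?_⟩
  · induction t using TensorProduct.induction_on with
    | zero => simp
    | add s t hs ht => simp only [map_add, hs, ht]
    | tmul s w =>
      induction s using TensorProduct.induction_on with
      | zero => simp
      | add s t hs ht => simp only [TensorProduct.add_tmul, map_add, hs, ht]
      | tmul u v => rfl
  · exact assoc_tensorAct (L.act x) (M.act x) (N.act x) t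

theorem EvenHom.symm {M N : QMod n} {e : M ≃ₗ[ℂ] N} (h : EvenHom M N e.toLinearMap) :
    EvenHom N M e.symm.toLinearMap := by
  refine ⟨fun v => ?_, fun x v => ?_⟩
  · apply e.injective
    simpa using (h.par (e.symm v)).symm
  · apply e.injective
    simpa using (h.act x (e.symm v)).symm

/-- The graded flip of the first two factors of `M ⊗ (M ⊗ N)`. -/
def swap₁₂ (M N : QMod n) : M ⊗[ℂ] (M ⊗[ℂ] N) →ₗ[ℂ] M ⊗[ℂ] (M ⊗[ℂ] N) :=
  (TensorProduct.assoc ℂ M M N).toLinearMap ∘ₗ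
    TensorProduct.map (flip M M) LinearMap.id ∘ₗ (TensorProduct.assoc ℂ M M N).symm.toLinearMap

theorem evenHom_swap₁₂ (M N : QMod n) :
    EvenHom (tensor M (tensor M N)) (tensor M (tensor M N)) (swap₁₂ M N) :=
  (evenHom_assoc M M N).comp (((evenHom_flip M M).rTensor N).comp (evenHom_assoc M M N).symm)

end QMod

/-- The tensor power `V^{⊗d}`, as `V ⊗ (V ⊗ (⋯ ⊗ ℂ))`. -/
@[reducible] def T (n : ℕ) : ℕ → QMod n
  | 0 => QMod.trivial n
  | d + 1 => QMod.tensor (QMod.natural n) (T n d)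

/-- The pure tensor `v_1 ⊗ ⋯ ⊗ v_d`. -/
def pureT (n : ℕ) : (d : ℕ) → (Fin d → VN n) → T n d
  | 0, _ => (1 : ℂ)
  | d + 1, v => v 0 ⊗ₜ[ℂ] pureT n d (Fin.tail v)

/-- The graded flip of the factors `i` and `i + 1` of `V^{⊗d}` (counting from `i = 0`); the
identity if `i + 1 ≥ d`. -/
def sw (n : ℕ) : (d i : ℕ) → (T n d →ₗ[ℂ] T n d)
  | 0, _ => LinearMap.id
  | 1, _ => LinearMap.id
  | d + 2, 0 => QMod.swap₁₂ (QMod.natural n) (T n d)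
  | d + 2, i + 1 => TensorProduct.map LinearMap.id (sw n (d + 1) i)

theorem evenHom_sw (n : ℕ) : ∀ d i, QMod.EvenHom (T n d) (T n d) (sw n d i)
  | 0, _ => QMod.EvenHom.id _
  | 1, _ => QMod.EvenHom.id _
  | d + 2, 0 => QMod.evenHom_swap₁₂ (QMod.natural n) (T n d)
  | d + 2, i + 1 => (evenHom_sw n (d + 1) i).lTensor (QMod.natural n)

/-- The subspace of `V^{⊗d}` spanned by all `t - τ t` with `τ` a graded flip of two adjacent
factors. -/
def symRel (n d : ℕ) : Submodule ℂ (T n d) := ⨆ i, LinearMap.range (LinearMap.id - sw n d i)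

theorem symRel_stable {n d : ℕ} (f : T n d →ₗ[ℂ] T n d)
    (hf : ∀ i v, f (sw n d i v) = sw n d i (f v)) : ∀ v ∈ symRel n d, f v ∈ symRel n d := by
  suffices h : symRel n d ≤ (symRel n d).comap f from h
  refine iSup_le fun i => ?_
  rintro _ ⟨v, rfl⟩
  refine Submodule.mem_iSup_of_mem i ⟨f v, ?_⟩
  simp [hf]

/-- The supermodule `S^d(V)`, the component of degree `d` of the symmetric superalgebra: the
quotient of `V^{⊗d}` by the supercommutators of adjacent factors. -/
@[reducible] def Sym (n d : ℕ) : QMod n :=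
  (T n d).quotient (symRel n d) (symRel_stable _ fun i v => (evenHom_sw n d i).par v)
    fun x => symRel_stable _ fun i v => (evenHom_sw n d i).act x v

/-- The product `v_1 ⋯ v_d` in `S^d(V)`. -/
def sprod {n d : ℕ} (v : Fin d → VN n) : Sym n d := (symRel n d).mkQ (pureT n d v)

/-- The supermodule `S^{a_1}(V) ⊗ ⋯ ⊗ S^{a_r}(V)` for a word `a`, as
`S^{a_1}(V) ⊗ (S^{a_2}(V) ⊗ (⋯ ⊗ ℂ))`. -/
@[reducible] def sword (n : ℕ) : Word → QMod n
  | [] => QMod.trivial n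
  | m :: a => QMod.tensor (Sym n m) (sword n a)

/-- The canonical identification of the tensor product of the supermodules of two words with the
supermodule of their juxtaposition. -/
def mu (n : ℕ) : (a b : Word) → (sword n a ⊗[ℂ] sword n b) ≃ₗ[ℂ] sword n (a ++ b)
  | [], b => TensorProduct.lid ℂ (sword n b)
  | m :: a, b => (TensorProduct.assoc ℂ (Sym n m) (sword n a) (sword n b)).trans
      (TensorProduct.congr (LinearEquiv.refl ℂ (Sym n m)) (mu n a b))

theorem symRel_one (n : ℕ) : symRel n 1 = ⊥ := by
  refine le_antisymm (iSup_le fun i => ?_) bot_le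
  rintro _ ⟨v, rfl⟩
  simp [sw]

/-- The canonical identification `V = S^1(V)`. -/
def symOne (n : ℕ) : VN n ≃ₗ[ℂ] Sym n 1 :=
  (TensorProduct.rid ℂ (VN n)).symm.trans (Submodule.quotEquivOfEqBot _ (symRel_one n)).symm

/-- The canonical identification of `V^{⊗k}` with the supermodule of the word `↑_1^k`. -/
def tensorPower (n : ℕ) : (k : ℕ) → (T n k ≃ₗ[ℂ] sword n (ones k))
  | 0 => LinearEquiv.refl ℂ ℂ
  | k + 1 => TensorProduct.congr (symOne n) (tensorPower n k)

/-! ### The functor from webs to `q(n)`-supermodules and the action of the Sergeev superalgebra -/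

/-- The product of the `v_i`, `i ∈ I`, in increasing order of `i`. -/
def subprod {n N d : ℕ} (v : Fin N → VN n) (I : Finset (Fin N)) (h : I.card = d) : Sym n d :=
  sprod (fun i => v (I.orderEmbOfFin h i))

/-- The sum of `p_i p_j` over all `i ∈ I`, `j ∉ I` with `j < i`: the parity of the rearrangement
of `v_1 ⋯ v_N` that moves the factors `v_i`, `i ∈ I`, to the left. -/
def shufflePar {N : ℕ} (p : Fin N → ZMod 2) (I : Finset (Fin N)) : ZMod 2 :=
  ∑ i ∈ I, ∑ j ∈ Iᶜ with j < i, p i * p j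

theorem card_compl_of_add {k l : ℕ} {I : Finset (Fin (k + l))} (h : I.card = k) :
    Iᶜ.card = l := by
  rw [Finset.card_compl, Fintype.card_fin, h, Nat.add_sub_cancel_left]

/-- A functor `Ψ` of monoidal supercategories from webs to `q(n)`-supermodules that sends a word
`a` to `S^{a_1}(V) ⊗ ⋯ ⊗ S^{a_r}(V)` and dots, merges and splits to the maps
`v_1 ⋯ v_k ↦ ∑_t (-1)^(|v_1| + ⋯ + |v_{t-1}|) v_1 ⋯ c(v_t) ⋯ v_k`,
`v_1 ⋯ v_k ⊗ w_1 ⋯ w_l ↦ v_1 ⋯ v_k w_1 ⋯ w_l` and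
`v_1 ⋯ v_{k+l} ↦ ∑_{I,J} (-1)^(ε(I,J)) v_I ⊗ v_J` (for homogeneous `v_i` and `w_j`). -/
structure WebFunctor (n : ℕ) where
  map : ∀ {a b : Word}, WebHom a b →ₗ[ℂ] (sword n a →ₗ[ℂ] sword n b)
  map_one : ∀ a, map (WebHom.one a) = LinearMap.id
  map_comp : ∀ {a b c : Word} (g : WebHom b c) (f : WebHom a b),
    map (g.comp f) = map g ∘ₗ map f
  map_gr : ∀ {a b : Word} (ε : ZMod 2), ∀ f ∈ WebHom.gr a b ε,
    map f ∈ QMod.homGr (sword n a) (sword n b) ε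
  map_tensor : ∀ {a b c d : Word} (f : WebHom a b) (g : WebHom c d),
    map (f.tensor g) ∘ₗ (mu n a c).toLinearMap =
      (mu n b d).toLinearMap ∘ₗ superTensor (map f) (map g)
  map_dot : ∀ (k : ℕ+) (p : Fin k → ZMod 2) (v : Fin k → VN n), (∀ i, IsHomog (p i) (v i)) →
    map (WebHom.dot k) (sprod v ⊗ₜ[ℂ] (1 : ℂ)) =
      ∑ t : Fin k, sgn (∑ i with i < t, p i) •
        (sprod (Function.update v t (cV n (v t))) ⊗ₜ[ℂ] (1 : ℂ))
  map_merge : ∀ (k l : ℕ+) (v : Fin k → VN n) (w : Fin l → VN n),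
    map (WebHom.merge k l) (sprod v ⊗ₜ[ℂ] (sprod w ⊗ₜ[ℂ] (1 : ℂ))) =
      (sprod (d := ((k + l : ℕ+) : ℕ)) (Fin.append v w) ⊗ₜ[ℂ] (1 : ℂ))
  map_split : ∀ (k l : ℕ+) (p : Fin ((k : ℕ) + l) → ZMod 2) (v : Fin ((k : ℕ) + l) → VN n),
    (∀ i, IsHomog (p i) (v i)) →
    map (WebHom.split k l) (sprod (d := ((k + l : ℕ+) : ℕ)) v ⊗ₜ[ℂ] (1 : ℂ)) =
      ∑ I : {I : Finset (Fin ((k : ℕ) + l)) // I.card = k}, sgn (shufflePar p I.1) •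
        (subprod v I.1 I.2 ⊗ₜ[ℂ] (subprod v I.1ᶜ (card_compl_of_add I.2) ⊗ₜ[ℂ] (1 : ℂ)))

/-- A homomorphism `ψ` of superalgebras from `Ser_k` to `End_{q(n)}(V^{⊗k})` with
`ψ(s_j)(v_1 ⊗ ⋯ ⊗ v_k) = (-1)^(|v_j||v_{j+1}|) v_1 ⊗ ⋯ ⊗ v_{j+1} ⊗ v_j ⊗ ⋯ ⊗ v_k` and
`ψ(c_i)(v_1 ⊗ ⋯ ⊗ v_k) = (-1)^(|v_1| + ⋯ + |v_{i-1}|) v_1 ⊗ ⋯ ⊗ c(v_i) ⊗ ⋯ ⊗ v_k`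
for homogeneous `v_1, …, v_k`. -/
structure SergeevAction (n k : ℕ) where
  map : Ser k →ₐ[ℂ] Module.End ℂ (T n k)
  map_gr : ∀ (ε : ZMod 2), ∀ x ∈ Ser.gr k ε, map x ∈ QMod.homGr (T n k) (T n k) ε
  map_s : ∀ (j : Fin (k - 1)) (a b : Fin k), a.val = j.val → b.val = j.val + 1 →
    ∀ (p : Fin k → ZMod 2) (v : Fin k → VN n), (∀ i, IsHomog (p i) (v i)) →
    map (Ser.s j) (pureT n k v) = sgn (p a * p b) • pureT n k (v ∘ Equiv.swap a b)
  map_c : ∀ (i : Fin k) (p : Fin k → ZMod 2) (v : Fin k → VN n), (∀ i, IsHomog (p i) (v i)) →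
    map (Ser.c i) (pureT n k v) =
      sgn (∑ j with j < i, p j) • pureT n k (Function.update v i (cV n (v i)))

end TypeQ

end

/-! The homomorphism `serWeb` is built from the presentation of `Ser k`. Write $D$ for the dumbbell
on two thin strands, so that the crossing is $D-1$. Digon removal gives $D^2=2D$, hence the crossing
is an involution. For the braid relation, the web $\uparrow_1^3\to\uparrow_3\to\uparrow_1^3$ is
resolved in two ways: the square switches with labels $(2,1)$ and $(1,2)$ turn the two groupings
into $D_1D_2D_1-D_1$ and $D_2D_1D_2-D_2$, and associativity says that they agree (`bell_braid`). The
dotted square switch with labels $(1,1)$ moves a dot through a crossing (`cross_dot_right`).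

Surjectivity. Let $E_k$ be the complete merge $\uparrow_1^k\to\uparrow_k$ followed by the complete
split. The square switch gives a recursion that expresses $E_{l+2}$ by $E_{l+1}$, $E_l$ and $D$, so
$E_k$ is a polynomial in dots and crossings (`fullSplit_comp_fullMerge_mem`). The complete split
followed by the complete merge is $k!$, which is invertible. Therefore every nonzero generating web,
preceded by complete merges, equals complete merges preceded by a polynomial in dots and crossings.
This property passes to composites, tensor products and linear combinations (`fromDotCross`), and
for endomorphisms of $\uparrow_1^k$ it says that the web itself is such a polynomial, because the
complete merges are then identities.

Existence of $\Psi_n$. A diagram of total label $N$ is lifted to an operator on $V^{\otimes N}$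
along the projections to products of symmetric powers (`Lift`). Merges lift to the identity, splits
to normalized symmetrizers, dots to sums of the $c_i$, and ladders to sums of transpositions,
possibly with a $c_i$ in front. Since the projections are surjective, each web relation follows from
an identity between operators of graded permutations and Clifford generators, modulo the projection
to the target (`Lift.mapPre_eq`, `mapPre_rel`).

Injectivity. Moving Clifford generators to the left and using normal forms for permutations gives
$\dim\operatorname{Ser}_k\le 2^kk!$ (`Ser.finrank_le`). For $n=k$ the orbit of
$v_1\otimes\cdots\otimes v_k$ contains the $2^kk!$ basis tensors in which each letter occurs once
with an arbitrary parity, so $\psi$ is injective (`sergeevHom_injective`). As $\psi$ is $\Psi_k$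
composed with `serWeb` (`webAction_comp_serWeb`), `serWeb` is injective too.

Parity. Even and odd webs are images of diagrams of the given parity, so it is not clear from the
definition that they meet only in zero. On $\uparrow_1^k$ this follows from the faithful action on
$V_k^{\otimes k}$, and it shows that `serWeb` also reflects parity (`serWeb_mem_gr`). Finally, the
prescribed formulas determine $\Psi_n$ and $\psi$ uniquely (`WebFunctor.map_eq`,
`SergeevAction.map_eq`), so it is enough to compare the two that were constructed. -/

noncomputable section
namespace TypeQ

/-! ### Pure tensors, bases and homogeneous vectors -/

/-- The letters indexing the standard basis of `V_n`. -/
abbrev Letter (n : ℕ) : Type := Fin n ⊕ Fin n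

/-- The parity of a standard basis vector of `V_n`. -/
def letterPar {n : ℕ} : Letter n → ZMod 2 := Sum.elim (fun _ => 0) (fun _ => 1)

/-- The standard basis of `V_n`. -/
def letterVec {n : ℕ} (x : Letter n) : VN n := Pi.basisFun ℂ (Letter n) x

theorem sgn_mul_self (a : ZMod 2) : sgn a * sgn a = 1 := by
  rcases eq_zero_or_one a with rfl | rfl <;> simp

theorem sgn_ne_zero (a : ZMod 2) : sgn a ≠ 0 := by
  rcases eq_zero_or_one a with rfl | rfl <;> simp

theorem add_self_two (a : ZMod 2) : a + a = 0 := CharTwo.add_self_eq_zero a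

theorem isHomog_zero_vec {V : Type} [AddCommGroup V] [Module ℂ V] [SuperSpace V] (p : ZMod 2) :
    IsHomog p (0 : V) := by
  simp [IsHomog]

@[simp] theorem par_inl {n : ℕ} (v : VN n) (i : Fin n) :
    (par v : VN n) (Sum.inl i) = v (Sum.inl i) := rfl

@[simp] theorem par_inr {n : ℕ} (v : VN n) (i : Fin n) :
    (par v : VN n) (Sum.inr i) = -v (Sum.inr i) := rfl

theorem isHomog_letterVec {n : ℕ} (x : Letter n) : IsHomog (letterPar x) (letterVec x) := by
  unfold IsHomog
  rcases x with i | i <;> ext (j | j) <;>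
    simp [letterPar, letterVec, Pi.single_apply]
  split_ifs <;> simp

/-- The projection onto the homogeneous component of parity `p`. -/
def homogProj {V : Type} [AddCommGroup V] [Module ℂ V] [SuperSpace V] (p : ZMod 2) : V →ₗ[ℂ] V :=
  (1 / 2 : ℂ) • (LinearMap.id + sgn p • par)

section
variable {V : Type} [AddCommGroup V] [Module ℂ V] [SuperSpace V]

theorem homogProj_of_homog {p : ZMod 2} {v : V} (h : IsHomog p v) : homogProj p v = v := by
  unfold IsHomog at h
  simp only [homogProj, LinearMap.smul_apply, LinearMap.add_apply, LinearMap.id_apply, h,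
    smul_smul, sgn_mul_self]
  module

theorem homogProj_of_ne {p q : ZMod 2} (hpq : p ≠ q) {v : V} (h : IsHomog q v) :
    homogProj p v = 0 := by
  unfold IsHomog at h
  simp only [homogProj, LinearMap.smul_apply, LinearMap.add_apply, LinearMap.id_apply, h,
    smul_smul, ← sgn_add]
  have : q + p = 1 := by clear h; revert p q; decide
  rw [this]; simp

end

/-- Two multilinear maps that agree on basis vectors of prescribed parities agree on all vectors
of these parities. -/
theorem homog_multilinear_ext {n N : ℕ} {M : Type} [AddCommGroup M] [Module ℂ M]
    (f g : MultilinearMap ℂ (fun _ : Fin N => VN n) M) (p : Fin N → ZMod 2)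
    (h : ∀ x : Fin N → Letter n, (∀ i, letterPar (x i) = p i) →
      f (fun i => letterVec (x i)) = g (fun i => letterVec (x i)))
    (v : Fin N → VN n) (hv : ∀ i, IsHomog (p i) (v i)) : f v = g v := by
  -- Projecting each argument to its prescribed parity gives multilinear maps that can be compared
  -- on all tuples of basis vectors.
  have key : f.compLinearMap (fun i => homogProj (p i)) =
      g.compLinearMap (fun i => homogProj (p i)) := by
    refine Module.Basis.ext_multilinear (fun _ => Pi.basisFun ℂ (Letter n)) fun x => ?_
    simp only [MultilinearMap.compLinearMap_apply]
    by_cases hx : ∀ i, letterPar (x i) = p i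
    · have e : (fun i => homogProj (p i) (Pi.basisFun ℂ (Letter n) (x i))) =
          fun i => letterVec (x i) := by
        funext i
        exact homogProj_of_homog (hx i ▸ isHomog_letterVec (x i))
      rw [e]
      exact h x hx
    -- A basis vector of the wrong parity is killed by its projection, so both sides vanish.
    · push Not at hx
      obtain ⟨i, hi⟩ := hx
      have e : homogProj (p i) (Pi.basisFun ℂ (Letter n) (x i)) = 0 :=
        homogProj_of_ne (Ne.symm hi) (isHomog_letterVec (x i))
      rw [f.map_coord_zero i e, g.map_coord_zero i e]
  have e : (fun i => homogProj (p i) (v i)) = v := funext fun i => homogProj_of_homog (hv i)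
  have := congrArg (fun F => F v) key
  simpa only [MultilinearMap.compLinearMap_apply, e] using this

/-- The pure tensor as a multilinear map. -/
def pureTM (n N : ℕ) : MultilinearMap ℂ (fun _ : Fin N => VN n) (T n N) where
  toFun := pureT n N
  map_update_add' := by
    intro inst v i x y
    -- The field quantifies over all decidability instances; the lemmas on `Fin.tail` need the
    -- standard one.
    rw [Subsingleton.elim inst (instDecidableEqFin N)]
    clear inst
    induction N with
    | zero => exact i.elim0
    | succ N ih =>
      cases i using Fin.cases with
      | zero => simp only [pureT, Fin.tail_update_zero, Function.update_self, TensorProduct.add_tmul]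
      | succ i =>
        simp only [pureT, Fin.tail_update_succ, Function.update_of_ne (Fin.succ_ne_zero i).symm, ih,
          TensorProduct.tmul_add]
  map_update_smul' := by
    intro inst v i z x
    rw [Subsingleton.elim inst (instDecidableEqFin N)]
    clear inst
    induction N with
    | zero => exact i.elim0
    | succ N ih =>
      cases i using Fin.cases with
      | zero => simp only [pureT, Fin.tail_update_zero, Function.update_self,
          TensorProduct.smul_tmul']
      | succ i =>
        simp only [pureT, Fin.tail_update_succ, Function.update_of_ne (Fin.succ_ne_zero i).symm, ih,
          TensorProduct.tmul_smul]

/-- The standard basis of `V^{⊗N}`. -/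
def basisT (n : ℕ) : (N : ℕ) → Module.Basis (Fin N → Letter n) ℂ (T n N)
  | 0 => Module.Basis.singleton (Fin 0 → Letter n) ℂ
  | N + 1 => ((Pi.basisFun ℂ (Letter n)).tensorProduct (basisT n N)).reindex
      (Fin.consEquiv fun _ => Letter n)

theorem basisT_apply (n : ℕ) : ∀ (N : ℕ) (x : Fin N → Letter n),
    basisT n N x = pureT n N fun i => letterVec (x i)
  | 0, x => by simp [basisT, pureT]
  | N + 1, x => by
    rw [basisT, Module.Basis.reindex_apply, Module.Basis.tensorProduct_apply, basisT_apply n N]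
    rfl

/-- The pure tensor `v_0 ⊗ ⋯ ⊗ v_{N-1}` for a sequence of vectors `v`. -/
def pureSeq (n N : ℕ) (v : ℕ → VN n) : T n N := pureT n N fun i => v i

/-- Sequences indexed by `ℕ` allow factors to be shifted, cut and permuted without casts between
`Fin` types; the entries from `N` on are ignored. -/
theorem pureSeq_succ {n N : ℕ} (v : ℕ → VN n) :
    pureSeq n (N + 1) v = v 0 ⊗ₜ[ℂ] pureSeq n N fun i => v (i + 1) := rfl

theorem pureSeq_congr {n N : ℕ} {v w : ℕ → VN n} (h : ∀ i < N, v i = w i) :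
    pureSeq n N v = pureSeq n N w :=
  congrArg (pureT n N) (funext fun i => h i i.2)

/-- Extension of a finite family by a default value. -/
def extSeq {N : ℕ} {α : Type} (d : α) (w : Fin N → α) (i : ℕ) : α :=
  if h : i < N then w ⟨i, h⟩ else d

@[simp] theorem extSeq_coe {N : ℕ} {α : Type} (d : α) (w : Fin N → α) (i : Fin N) :
    extSeq d w i = w i := by simp [extSeq]

theorem pureSeq_ext {n N : ℕ} (w : Fin N → VN n) : pureSeq n N (extSeq 0 w) = pureT n N w := by
  simp [pureSeq]

theorem isHomog_ext {n N : ℕ} {p : Fin N → ZMod 2} {w : Fin N → VN n}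
    (h : ∀ i, IsHomog (p i) (w i)) (i : ℕ) : IsHomog (extSeq 0 p i) (extSeq 0 w i) := by
  unfold extSeq
  split_ifs
  · exact h _
  -- The default vector is zero, which is homogeneous of every parity.
  · exact isHomog_zero_vec _

/-- Linear maps on `V^{⊗N}` that agree on homogeneous pure tensors are equal. -/
theorem T_hom_ext {n N : ℕ} {M : Type} [AddCommGroup M] [Module ℂ M] {F G : T n N →ₗ[ℂ] M}
    (h : ∀ (p : ℕ → ZMod 2) (v : ℕ → VN n), (∀ i, IsHomog (p i) (v i)) →
      F (pureSeq n N v) = G (pureSeq n N v)) : F = G := by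
  refine (basisT n N).ext fun x => ?_
  rw [basisT_apply, ← pureSeq_ext]
  exact h _ _ (isHomog_ext fun i => isHomog_letterVec (x i))

/-- Linear maps on `V^{⊗N}` that agree on pure tensors are equal. -/
theorem T_pure_ext {n N : ℕ} {M : Type} [AddCommGroup M] [Module ℂ M] {F G : T n N →ₗ[ℂ] M}
    (h : ∀ v : ℕ → VN n, F (pureSeq n N v) = G (pureSeq n N v)) : F = G :=
  T_hom_ext fun _ v _ => h v

theorem isHomog_tmul {V W : Type} [AddCommGroup V] [Module ℂ V] [SuperSpace V] [AddCommGroup W]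
    [Module ℂ W] [SuperSpace W] {p q : ZMod 2} {v : V} {w : W} (hv : IsHomog p v)
    (hw : IsHomog q w) : IsHomog (p + q) (v ⊗ₜ[ℂ] w) := by
  unfold IsHomog at *
  rw [par_tmul, hv, hw, TensorProduct.smul_tmul_smul, sgn_add, mul_comm]

theorem isHomog_pureSeq {n : ℕ} : ∀ {N : ℕ} {p : ℕ → ZMod 2} {v : ℕ → VN n},
    (∀ i, IsHomog (p i) (v i)) → IsHomog (∑ i ∈ Finset.range N, p i) (pureSeq n N v)
  | 0, p, v, _ => by
    rw [Finset.sum_range_zero]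
    exact (one_smul ℂ (1 : ℂ)).symm.trans (by rw [sgn_zero]; rfl)
  | N + 1, p, v, h => by
    rw [Finset.sum_range_succ', pureSeq_succ, add_comm _ (p 0)]
    exact isHomog_tmul (h 0) (isHomog_pureSeq fun i => h (i + 1))

end TypeQ
end

noncomputable section
namespace TypeQ

/-! ### Homomorphisms of supermodules and the operators of the Sergeev superalgebra -/

section
variable {V W V' W' : Type}
  [AddCommGroup V] [Module ℂ V] [SuperSpace V]
  [AddCommGroup W] [Module ℂ W] [SuperSpace W]
  [AddCommGroup V'] [Module ℂ V'] [SuperSpace V']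
  [AddCommGroup W'] [Module ℂ W'] [SuperSpace W']

/-- Linear maps that agree on homogeneous vectors are equal. -/
theorem homog_ext {M : Type} [AddCommGroup M] [Module ℂ M] {F G : V →ₗ[ℂ] M}
    (h : ∀ p v, IsHomog p v → F v = G v) : F = G := by
  ext v
  obtain ⟨v₀, v₁, h₀, h₁, rfl⟩ := exists_homog v
  rw [map_add, map_add, h 0 v₀ h₀, h 1 v₁ h₁]

/-- Linear maps that agree on tensors of homogeneous vectors are equal. -/
theorem tensor_homog_ext {M : Type} [AddCommGroup M] [Module ℂ M] {F G : V ⊗[ℂ] W →ₗ[ℂ] M}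
    (h : ∀ p q v w, IsHomog p v → IsHomog q w → F (v ⊗ₜ w) = G (v ⊗ₜ w)) : F = G := by
  refine TensorProduct.ext (homog_ext fun p v hv => homog_ext fun q w hw => ?_)
  exact h p q v w hv hw

theorem tensorAct_homog {γ a : ZMod 2} {x : V →ₗ[ℂ] V} {y : W →ₗ[ℂ] W} (hy : HasPar γ y) {v : V}
    (hv : IsHomog a v) (w : W) :
    tensorAct x y (v ⊗ₜ w) = x v ⊗ₜ w + sgn (γ * a) • (v ⊗ₜ[ℂ] y w) := by
  rw [tensorAct, LinearMap.add_apply, superTensor_homog _ _ γ a hy v hv]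
  rfl

theorem IsHomog.map {p q : ZMod 2} {f : V →ₗ[ℂ] W} (hf : HasPar p f) {v : V} (hv : IsHomog q v) :
    IsHomog (q + p) (f v) := (hasPar_iff p f).1 hf q v hv

theorem IsHomog.smul {p : ZMod 2} {v : V} (hv : IsHomog p v) (z : ℂ) : IsHomog p (z • v) := by
  unfold IsHomog at *
  rw [map_smul, hv, smul_comm]

theorem hasPar_of_homog {ε : ZMod 2} {f : V ⊗[ℂ] W →ₗ[ℂ] V'}
    (h : ∀ p q v w, IsHomog p v → IsHomog q w → IsHomog (p + q + ε) (f (v ⊗ₜ w))) :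
    HasPar ε f := by
  have e : par ∘ₗ f = sgn ε • (f ∘ₗ par) := by
    refine tensor_homog_ext fun p q v w hv hw => ?_
    have h1 := h p q v w hv hw
    have h2 := isHomog_tmul hv hw
    unfold IsHomog at h1 h2
    rw [LinearMap.comp_apply, LinearMap.smul_apply, LinearMap.comp_apply, h1, h2, map_smul,
      smul_smul, sgn_add]
  exact fun v => LinearMap.congr_fun e v

theorem hasPar_superTensor {ε δ : ZMod 2} {f : V →ₗ[ℂ] V'} {g : W →ₗ[ℂ] W'} (hf : HasPar ε f)
    (hg : HasPar δ g) : HasPar (ε + δ) (superTensor f g) := by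
  refine hasPar_of_homog fun p q v w hv hw => ?_
  rw [superTensor_homog _ _ δ p hg v hv]
  have := (isHomog_tmul (hv.map hf) (hw.map hg)).smul (sgn (δ * p))
  rwa [show p + q + (ε + δ) = p + ε + (q + δ) by ring]

/-- Both sides are evaluated on homogeneous tensors. Moving `x` past `f` and `g`, and `g` past the
first factor, produces Koszul signs that agree modulo 2. -/
theorem superTensor_act {ε δ γ : ZMod 2} {f : V →ₗ[ℂ] V'} {g : W →ₗ[ℂ] W'} (hg : HasPar δ g)
    {x : V →ₗ[ℂ] V} {y : W →ₗ[ℂ] W} {x' : V' →ₗ[ℂ] V'} {y' : W' →ₗ[ℂ] W'}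
    (hx : HasPar γ x) (hy : HasPar γ y) (hy' : HasPar γ y') (hf : HasPar ε f)
    (hfx : ∀ v, f (x v) = sgn (ε * γ) • x' (f v)) (hgy : ∀ w, g (y w) = sgn (δ * γ) • y' (g w))
    (t : V ⊗[ℂ] W) :
    superTensor f g (tensorAct x y t) = sgn ((ε + δ) * γ) • tensorAct x' y' (superTensor f g t) := by
  have e : superTensor f g ∘ₗ tensorAct x y =
      sgn ((ε + δ) * γ) • (tensorAct x' y' ∘ₗ superTensor f g) := by
    refine tensor_homog_ext fun p q v w hv hw => ?_
    simp only [LinearMap.comp_apply, LinearMap.smul_apply]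
    rw [tensorAct_homog hy hv, map_add, map_smul, superTensor_homog _ _ δ _ hg _ (hv.map hx),
      superTensor_homog _ _ δ p hg _ hv, superTensor_homog _ _ δ p hg _ hv, map_smul,
      tensorAct_homog hy' (hv.map hf), hfx, hgy]
    simp only [smul_add, smul_smul, TensorProduct.tmul_smul, ← TensorProduct.smul_tmul', ← sgn_add]
    -- The two sign exponents of the second summand differ by even multiples only.
    have h2 : ∀ a : ZMod 2, a * 2 = 0 := by decide
    congr 1
    · congr 2; ring
    · congr 2; ring_nf; simp only [h2, add_zero]
  exact LinearMap.congr_fun e t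

end

namespace QMod

variable {n : ℕ}

theorem EvenHom.mem_homGr {M N : QMod n} {f : M →ₗ[ℂ] N} (h : EvenHom M N f) :
    f ∈ homGr M N 0 :=
  ⟨fun v => by simp [h.par], fun δ x _ m => by simp [h.act]⟩

theorem homGr_comp {L M N : QMod n} {ε δ : ZMod 2} {g : M →ₗ[ℂ] N} {f : L →ₗ[ℂ] M}
    (hg : g ∈ homGr M N ε) (hf : f ∈ homGr L M δ) : g ∘ₗ f ∈ homGr L N (ε + δ) := by
  refine ⟨fun v => ?_, fun γ x hx m => ?_⟩
  · rw [LinearMap.comp_apply, hg.1, hf.1, map_smul, smul_smul, sgn_add, mul_comm]; rfl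
  · rw [LinearMap.comp_apply, hf.2 γ x hx, map_smul, hg.2 γ x hx, smul_smul, add_mul, sgn_add]; rfl

theorem homGr_superTensor {M M' N N' : QMod n} {ε δ : ZMod 2} {f : M →ₗ[ℂ] M'} {g : N →ₗ[ℂ] N'}
    (hf : f ∈ homGr M M' ε) (hg : g ∈ homGr N N' δ) :
    superTensor f g ∈ homGr (tensor M N) (tensor M' N') (ε + δ) :=
  ⟨hasPar_superTensor hf.1 hg.1, fun γ x hx m =>
    superTensor_act hg.1 (M.act_par γ x hx) (N.act_par γ x hx) (N'.act_par γ x hx) hf.1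
      (hf.2 γ x hx) (hg.2 γ x hx) m⟩

theorem homGr_id (M : QMod n) : LinearMap.id ∈ homGr M M 0 := (EvenHom.id M).mem_homGr

end QMod

theorem cV_cV {n : ℕ} (v : VN n) : cV n (cV n v) = v := by
  ext (i | i) <;> simp [cV, ← mul_assoc]

theorem hasPar_cV (n : ℕ) : HasPar 1 (cV n) := by
  intro v
  ext (i | i) <;> simp [cV]

/-- `q(n)` is the supercentralizer of `c`; read from the other side, this says that `c` commutes
with the action up to the sign of an odd homomorphism. For `x` of pure parity only one of the two
conditions in `qLie` has content. -/
theorem cV_mem_homGr (n : ℕ) : cV n ∈ QMod.homGr (QMod.natural n) (QMod.natural n) 1 := by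
  refine ⟨hasPar_cV n, fun δ x hx m => ?_⟩
  have h := x.2
  rcases eq_zero_or_one δ with rfl | rfl
  · have := LinearMap.congr_fun h.1 m
    rw [evenPart_of_even hx] at this
    simpa using this.symm
  · have := LinearMap.congr_fun h.2 m
    rw [oddPart_of_odd hx] at this
    simp only [LinearMap.comp_apply, LinearMap.neg_apply] at this
    rw [mul_one, sgn_one]
    change cV n (x.1 m) = (-1 : ℂ) • x.1 (cV n m)
    rw [this]; simp

/-- The operator `1 ⊗ ⋯ ⊗ c ⊗ ⋯ ⊗ 1` on `V^{⊗N}`, with `c` in position `i`. -/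
def clif (n : ℕ) : (N i : ℕ) → (T n N →ₗ[ℂ] T n N)
  | 0, _ => 0
  | N + 1, 0 => superTensor (cV n) (LinearMap.id : T n N →ₗ[ℂ] T n N)
  | N + 1, i + 1 => superTensor (LinearMap.id : VN n →ₗ[ℂ] VN n) (clif n N i)

theorem clif_mem_homGr (n : ℕ) : ∀ N i, clif n N i ∈ QMod.homGr (T n N) (T n N) 1
  | 0, _ => Submodule.zero_mem _
  | N + 1, 0 => by
    have := QMod.homGr_superTensor (cV_mem_homGr n) (QMod.homGr_id (T n N))
    rwa [add_zero] at this
  | N + 1, i + 1 => by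
    have := QMod.homGr_superTensor (QMod.homGr_id (QMod.natural n)) (clif_mem_homGr n N i)
    rwa [zero_add] at this

theorem sum_lt_range (p : ℕ → ZMod 2) (i : ℕ) :
    ∑ j ∈ Finset.range (i + 1), p j = p 0 + ∑ j ∈ Finset.range i, p (j + 1) := by
  rw [Finset.sum_range_succ', add_comm]

theorem clif_pureSeq {n : ℕ} : ∀ {N i : ℕ} {p : ℕ → ZMod 2} {v : ℕ → VN n}, i < N →
    (∀ i, IsHomog (p i) (v i)) →
    clif n N i (pureSeq n N v) =
      sgn (∑ j ∈ Finset.range i, p j) • pureSeq n N (Function.update v i (cV n (v i)))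
  | 0, i, p, v, hi, h => absurd hi (Nat.not_lt_zero i)
  | N + 1, 0, p, v, hi, h => by
    rw [pureSeq_succ, clif, superTensor_id]
    simp [pureSeq_succ]
  | N + 1, i + 1, p, v, hi, h => by
    rw [pureSeq_succ, clif, superTensor_homog _ _ 1 (p 0) (clif_mem_homGr n N i).1 _ (h 0),
      clif_pureSeq (Nat.lt_of_succ_lt_succ hi) (fun i => h (i + 1)), TensorProduct.tmul_smul,
      smul_smul, one_mul, mul_comm, ← sgn_add, sum_lt_range, pureSeq_succ]
    congr 3
    funext j
    simp [Function.update_apply]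

theorem sw_pureSeq {n : ℕ} : ∀ {N i : ℕ} {p : ℕ → ZMod 2} {v : ℕ → VN n}, i + 1 < N →
    (∀ i, IsHomog (p i) (v i)) →
    sw n N i (pureSeq n N v) = sgn (p i * p (i + 1)) • pureSeq n N (v ∘ Equiv.swap i (i + 1))
  | 0, i, p, v, hi, h => absurd hi (Nat.not_lt_zero _)
  | 1, i, p, v, hi, h => absurd hi (by omega)
  | N + 2, 0, p, v, hi, h => by
    change (TensorProduct.assoc ℂ _ _ _) (TensorProduct.map (flip (VN n) (VN n)) LinearMap.id
      ((v 0 ⊗ₜ[ℂ] v 1) ⊗ₜ pureSeq n N fun i => v (i + 2))) = _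
    rw [TensorProduct.map_tmul, flip_homog _ _ _ _ (h 0) (h 1), ← TensorProduct.smul_tmul', map_smul]
    rfl
  | N + 2, i + 1, p, v, hi, h => by
    rw [pureSeq_succ, sw, TensorProduct.map_tmul, sw_pureSeq (Nat.lt_of_succ_lt_succ hi)
      (fun i => h (i + 1)), TensorProduct.tmul_smul, pureSeq_succ (v := v ∘ _)]
    have e0 : (v ∘ Equiv.swap (i + 1) (i + 1 + 1)) 0 = v 0 := by
      simp [Equiv.swap_apply_def]
    have e1 : (fun j => (v ∘ Equiv.swap (i + 1) (i + 1 + 1)) (j + 1)) =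
        (fun j => v (j + 1)) ∘ Equiv.swap i (i + 1) := by
      funext j
      simp only [Function.comp_apply, Equiv.swap_apply_def]
      split_ifs <;> simp_all
    rw [e0, e1]
    rfl

end TypeQ
end

noncomputable section
namespace TypeQ

/-! ### The graded action of permutations on tensor powers -/

/-- The permutations of `ℕ` that move only elements of `s`. -/
def permsOn (s : Finset ℕ) : Subgroup (Equiv.Perm ℕ) where
  carrier := {σ | ∀ x, x ∉ s → σ x = x}
  one_mem' := fun _ _ => rfl
  mul_mem' := fun {σ τ} hσ hτ x hx => by
    rw [Equiv.Perm.mul_apply, hτ x hx, hσ x hx]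
  inv_mem' := fun {σ} hσ x hx => by
    rw [Equiv.Perm.inv_eq_iff_eq, hσ x hx]

theorem permsOn_mem {s : Finset ℕ} {σ : Equiv.Perm ℕ} (hσ : σ ∈ permsOn s) {x : ℕ} :
    σ x ∈ s ↔ x ∈ s := by
  constructor
  · intro h
    by_contra hx
    rw [hσ x hx] at h
    exact hx h
  · intro h
    by_contra hx
    have := hσ _ hx
    rw [σ.injective this] at hx
    exact hx h

theorem permsOn_mono {s t : Finset ℕ} (h : s ⊆ t) : permsOn s ≤ permsOn t :=
  fun _ hσ x hx => hσ x fun hs => hx (h hs)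

theorem swap_mem_permsOn {s : Finset ℕ} {i j : ℕ} (hi : i ∈ s) (hj : j ∈ s) :
    Equiv.swap i j ∈ permsOn s := by
  intro x hx
  exact Equiv.swap_apply_of_ne_of_ne (fun h => hx (h ▸ hi)) (fun h => hx (h ▸ hj))

theorem mem_permsOfFinset {s : Finset ℕ} {σ : Equiv.Perm ℕ} :
    σ ∈ permsOfFinset s ↔ σ ∈ permsOn s := by
  rw [mem_perms_of_finset_iff]
  exact ⟨fun h x hx => by_contra fun hh => hx (h hh), fun h x hx => by_contra fun hh => hx (h x hh)⟩

/-- Adjacent transpositions generate. With this principle, statements about `permT` that are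
multiplicative in the permutation need to be checked for graded flips of neighbours only. -/
theorem permsOn_Ico_induction {P : Equiv.Perm ℕ → Prop} {a N : ℕ} (h1 : P 1)
    (hmul : ∀ σ ∈ permsOn (Finset.Ico a N), ∀ τ ∈ permsOn (Finset.Ico a N),
      P σ → P τ → P (σ * τ))
    (hswap : ∀ i, a ≤ i → i + 1 < N → P (Equiv.swap i (i + 1))) :
    ∀ σ ∈ permsOn (Finset.Ico a N), P σ := by
  have hsw : ∀ d i, a ≤ i → i + d < N → P (Equiv.swap i (i + d)) := by
    intro d
    induction d with
    | zero => intro i _ _; rw [add_zero, Equiv.swap_self]; exact h1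
    | succ d ih =>
      intro i ha hi
      rcases Nat.eq_zero_or_pos d with rfl | hd
      · exact hswap i ha hi
      -- A transposition of distant points is conjugate, by an adjacent one, to a transposition of
      -- points one step closer.
      have e : Equiv.swap i (i + (d + 1)) = Equiv.swap (i + d) (i + d + 1) * Equiv.swap i (i + d) *
          Equiv.swap (i + d) (i + d + 1) := by
        rw [Equiv.swap_comm (i + d) (i + d + 1), Equiv.swap_comm i (i + d), ← add_assoc,
          Equiv.swap_comm (i + d + 1), Equiv.swap_comm (i + d) i]
        have := Equiv.swap_mul_swap_mul_swap (x := i) (y := i + d) (z := i + d + 1) (by omega)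
          (by omega)
        rw [Equiv.swap_comm i (i + d + 1)]
        exact this.symm
      have m1 : Equiv.swap (i + d) (i + d + 1) ∈ permsOn (Finset.Ico a N) :=
        swap_mem_permsOn (by simp; omega) (by simp; omega)
      have m2 : Equiv.swap i (i + d) ∈ permsOn (Finset.Ico a N) :=
        swap_mem_permsOn (by simp; omega) (by simp; omega)
      rw [e]
      exact hmul _ (mul_mem m1 m2) _ m1 (hmul _ m1 _ m2 (hswap _ (by omega) hi)
        (ih i ha (by omega))) (hswap _ (by omega) hi)
  have key : ∀ M ≤ N, ∀ σ ∈ permsOn (Finset.Ico a M), P σ := by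
    intro M
    induction M with
    | zero =>
      intro _ σ hσ
      have : σ = 1 := Equiv.ext fun x => hσ x (by simp)
      rw [this]; exact h1
    | succ M ih =>
      intro hM σ hσ
      rcases lt_or_ge M a with hMa | hMa
      · have : σ = 1 := Equiv.ext fun x => hσ x (by simp; omega)
        rw [this]; exact h1
      have hlt : a ≤ σ M ∧ σ M ≤ M := by
        have := (permsOn_mem hσ (x := M)).2 (by simp; omega)
        simpa [Nat.lt_succ_iff] using this
      have m1 : Equiv.swap (σ M) M ∈ permsOn (Finset.Ico a (M + 1)) :=
        swap_mem_permsOn (by simp; omega) (by simp; omega)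
      -- After this multiplication the last point `M` is fixed, so the interval gets shorter.
      have m2 : Equiv.swap (σ M) M * σ ∈ permsOn (Finset.Ico a M) := by
        intro x hx
        rcases eq_or_ne x M with rfl | hxM
        · simp
        · exact mul_mem m1 hσ x (by simp at hx ⊢; omega)
      have e : σ = Equiv.swap (σ M) M * (Equiv.swap (σ M) M * σ) := by
        rw [← mul_assoc, Equiv.swap_mul_self, one_mul]
      rw [e]
      refine hmul _ (permsOn_mono (Finset.Ico_subset_Ico_right hM) m1) _
        (permsOn_mono (Finset.Ico_subset_Ico_right (by omega)) m2) ?_ (ih (by omega) _ m2)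
      have := hsw (M - σ M) (σ M) hlt.1 (by omega)
      rwa [Nat.add_sub_cancel' hlt.2] at this
  exact key N le_rfl

theorem permsOn_range_induction {P : Equiv.Perm ℕ → Prop} {N : ℕ} (h1 : P 1)
    (hmul : ∀ σ ∈ permsOn (Finset.range N), ∀ τ ∈ permsOn (Finset.range N),
      P σ → P τ → P (σ * τ))
    (hswap : ∀ i, i + 1 < N → P (Equiv.swap i (i + 1))) :
    ∀ σ ∈ permsOn (Finset.range N), P σ := by
  rw [Finset.range_eq_Ico] at hmul ⊢
  exact permsOn_Ico_induction h1 hmul fun i _ hi => hswap i hi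

/-- The sum of `p_i p_j` over the inversions `i < j` of `σ`. -/
def invPar (N : ℕ) (σ : Equiv.Perm ℕ) (p : ℕ → ZMod 2) : ZMod 2 :=
  ∑ x ∈ Finset.range N ×ˢ Finset.range N, if x.1 < x.2 ∧ σ x.2 < σ x.1 then p x.1 * p x.2 else 0

theorem invPar_congr {N : ℕ} {σ : Equiv.Perm ℕ} {p q : ℕ → ZMod 2} (h : ∀ i < N, p i = q i) :
    invPar N σ p = invPar N σ q := by
  refine Finset.sum_congr rfl fun x hx => ?_
  simp only [Finset.mem_product, Finset.mem_range] at hx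
  rw [h _ hx.1, h _ hx.2]

theorem invPar_one (N : ℕ) (p : ℕ → ZMod 2) : invPar N 1 p = 0 := by
  refine Finset.sum_eq_zero fun x _ => if_neg ?_
  rintro ⟨h, h'⟩
  exact lt_asymm h h'

theorem sum_symm_eq_zero (s : Finset ℕ) (f : ℕ × ℕ → ZMod 2) (hf : ∀ x, f x.swap = f x)
    (h0 : ∀ i, f (i, i) = 0) : ∑ x ∈ s ×ˢ s, f x = 0 := by
  refine Finset.sum_involution (fun x _ => x.swap) (fun x _ => ?_) (fun x _ hx h => ?_)
    (fun x hx => ?_) (fun x _ => Prod.swap_swap x)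
  · rw [hf]; exact add_self_two _
  · apply hx
    have : x = (x.1, x.1) := by
      ext
      · rfl
      · exact (congrArg Prod.fst h)
    rw [this]; exact h0 _
  · simp only [Finset.mem_product, Prod.fst_swap, Prod.snd_swap] at hx ⊢
    exact hx.symm

/-- The cocycle identity that makes the graded action multiplicative. After reindexing the last sum
by `τ`, the difference of the summands is a symmetric function of the pair, and such sums vanish
over `ZMod 2` because `(i, j)` and `(j, i)` cancel. -/
theorem invPar_mul {N : ℕ} {σ τ : Equiv.Perm ℕ} (hτ : τ ∈ permsOn (Finset.range N))
    (p : ℕ → ZMod 2) :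
    invPar N (σ * τ) p = invPar N τ p + invPar N σ (p ∘ ⇑τ⁻¹) := by
  have h2 : invPar N σ (p ∘ ⇑τ⁻¹) = ∑ x ∈ Finset.range N ×ˢ Finset.range N,
      if τ x.1 < τ x.2 ∧ σ (τ x.2) < σ (τ x.1) then p x.1 * p x.2 else 0 := by
    symm
    refine Finset.sum_equiv (Equiv.prodCongr τ τ) (fun x => ?_) (fun x _ => ?_)
    · simp only [Finset.mem_product, Equiv.prodCongr_apply, Prod.map_fst, Prod.map_snd,
        permsOn_mem hτ]
    · simp
  rw [← sub_eq_zero, h2, invPar, invPar, ← Finset.sum_add_distrib, ← Finset.sum_sub_distrib]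
  refine sum_symm_eq_zero _ _ (fun x => ?_) (fun i => by simp)
  obtain ⟨i, j⟩ := x
  rcases eq_or_ne i j with rfl | hij
  · rfl
  -- Each of the three orderings of the pair, by the identity, `τ` and `σ * τ`, is reversed when the
  -- two points are exchanged; a case check over the eight possibilities remains.
  have h1 : ∀ ρ : Equiv.Perm ℕ, ρ i < ρ j ↔ ¬ ρ j < ρ i := fun ρ => by
    have := ρ.injective.ne hij
    omega
  have a0 := h1 1
  have a1 := h1 τ
  have a2 := h1 (σ * τ)
  simp only [Equiv.Perm.one_apply, Equiv.Perm.mul_apply] at a0 a1 a2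
  simp only [Prod.swap, Equiv.Perm.mul_apply, a0, a1, a2]
  rw [mul_comm (p j) (p i)]
  generalize p i * p j = z
  have h11 : ∀ z : ZMod 2, -z = z := by decide
  by_cases b0 : j < i <;> by_cases b1 : τ j < τ i <;> by_cases b2 : σ (τ j) < σ (τ i) <;>
    simp [b0, b1, b2, h11]

theorem invPar_swap {N i : ℕ} (hi : i + 1 < N) (p : ℕ → ZMod 2) :
    invPar N (Equiv.swap i (i + 1)) p = p i * p (i + 1) := by
  rw [invPar, Finset.sum_eq_single (i, i + 1)]
  · simp
  · rintro ⟨a, b⟩ _ hab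
    refine if_neg ?_
    rintro ⟨h1, h2⟩
    apply hab
    simp only [Equiv.swap_apply_def] at h1 h2
    ext <;> simp only <;> split_ifs at h2 <;> omega
  · intro h
    simp at h
    omega

/-- The graded action of a permutation on `V^{⊗N}`. -/
def permT (n N : ℕ) (σ : Equiv.Perm ℕ) : T n N →ₗ[ℂ] T n N :=
  (basisT n N).constr ℂ fun x => sgn (invPar N σ (extSeq 0 fun i => letterPar (x i))) •
    pureSeq n N (extSeq 0 (fun i => letterVec (x i)) ∘ ⇑σ⁻¹)

theorem lt_of_permsOn {N : ℕ} {σ : Equiv.Perm ℕ} (hσ : σ ∈ permsOn (Finset.range N)) {i : ℕ}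
    (hi : i < N) : σ i < N := by
  simpa using (permsOn_mem hσ).2 (by simpa using hi)

/-- `permT` is defined on basis tensors because its sign depends on parities. For fixed parities the
sign is a constant, both sides are multilinear, and the comparison on basis tensors extends to all
homogeneous vectors. -/
theorem permT_pureSeq {n N : ℕ} {σ : Equiv.Perm ℕ} (hσ : σ ∈ permsOn (Finset.range N))
    {p : ℕ → ZMod 2} {v : ℕ → VN n} (hv : ∀ i, IsHomog (p i) (v i)) :
    permT n N σ (pureSeq n N v) = sgn (invPar N σ p) • pureSeq n N (v ∘ ⇑σ⁻¹) := by
  -- The restriction of `σ` to `Fin N`, needed to permute the arguments of a multilinear map.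
  let τ : Equiv.Perm (Fin N) :=
    { toFun := fun i => ⟨σ i, lt_of_permsOn hσ i.2⟩
      invFun := fun i => ⟨σ⁻¹ i, lt_of_permsOn (inv_mem hσ) i.2⟩
      left_inv := fun i => by simp
      right_inv := fun i => by simp }
  have key := homog_multilinear_ext ((permT n N σ).compMultilinearMap (pureTM n N))
    (sgn (invPar N σ p) • (pureTM n N).domDomCongr τ.symm) (fun i => p i) (fun x hx => ?_)
    (fun i => v i) (fun i => hv i)
  · exact key
  · change permT n N σ (pureT n N fun i => letterVec (x i)) =
      sgn (invPar N σ p) • pureT n N fun i => letterVec (x (τ.symm i))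
    rw [← basisT_apply, permT, Module.Basis.constr_basis]
    congr 2
    · exact invPar_congr fun i hi => by simpa [extSeq, hi] using hx ⟨i, hi⟩
    · refine congrArg (pureT n N) (funext fun i => ?_)
      have : σ⁻¹ i < N := lt_of_permsOn (inv_mem hσ) i.2
      simp only [Function.comp_apply, extSeq, this, dif_pos]
      rfl

theorem permT_one (n N : ℕ) : permT n N 1 = LinearMap.id :=
  T_hom_ext fun p v hv => by
    rw [permT_pureSeq (one_mem _) hv, invPar_one, sgn_zero, one_smul]; rfl

/-- The positions compose, and the signs compose by the cocycle identity `invPar_mul`. -/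
theorem permT_mul {n N : ℕ} {σ τ : Equiv.Perm ℕ} (hσ : σ ∈ permsOn (Finset.range N))
    (hτ : τ ∈ permsOn (Finset.range N)) :
    permT n N (σ * τ) = permT n N σ ∘ₗ permT n N τ :=
  T_hom_ext fun p v hv => by
    rw [LinearMap.comp_apply, permT_pureSeq (mul_mem hσ hτ) hv, permT_pureSeq hτ hv, map_smul,
      permT_pureSeq (p := p ∘ ⇑τ⁻¹) (v := v ∘ ⇑τ⁻¹) hσ (fun i => hv _), invPar_mul hτ, smul_smul, sgn_add, mul_comm,
      mul_inv_rev]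
    rfl

theorem permT_swap {n N i : ℕ} (hi : i + 1 < N) :
    permT n N (Equiv.swap i (i + 1)) = sw n N i :=
  T_hom_ext fun p v hv => by
    rw [permT_pureSeq (swap_mem_permsOn (by simp; omega) (by simpa using hi)) hv,
      sw_pureSeq hi hv, invPar_swap hi, Equiv.swap_inv]

theorem evenHom_permT {n N : ℕ} {σ : Equiv.Perm ℕ} (hσ : σ ∈ permsOn (Finset.range N)) :
    QMod.EvenHom (T n N) (T n N) (permT n N σ) := by
  revert σ hσ
  refine @permsOn_range_induction _ _ ?_ ?_ ?_
  · rw [permT_one]; exact QMod.EvenHom.id _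
  · intro σ hσ τ hτ h h'
    rw [permT_mul hσ hτ]
    exact h.comp h'
  · intro i hi
    rw [permT_swap hi]
    exact evenHom_sw n N i

/-! ### Clifford relations -/

theorem isHomog_update {n : ℕ} {p : ℕ → ZMod 2} {v : ℕ → VN n} (hv : ∀ i, IsHomog (p i) (v i))
    (i j : ℕ) : IsHomog (Function.update p i (p i + 1) j) (Function.update v i (cV n (v i)) j) := by
  rcases eq_or_ne j i with rfl | h
  · simpa using (hv j).map (hasPar_cV n)
  · simpa [Function.update_of_ne h] using hv j

theorem sum_update_range (p : ℕ → ZMod 2) (i j : ℕ) :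
    ∑ x ∈ Finset.range j, Function.update p i (p i + 1) x =
      ∑ x ∈ Finset.range j, p x + if i < j then 1 else 0 := by
  have h : ∀ x, Function.update p i (p i + 1) x = p x + if x = i then 1 else 0 := by
    intro x
    rcases eq_or_ne x i with rfl | h
    · simp
    · simp [h]
  simp only [h, Finset.sum_add_distrib, Finset.sum_ite_eq', Finset.mem_range]

theorem clif_sq {n N i : ℕ} (hi : i < N) : clif n N i ∘ₗ clif n N i = LinearMap.id :=
  T_hom_ext fun p v hv => by
    rw [LinearMap.comp_apply, clif_pureSeq hi hv, map_smul, clif_pureSeq hi (isHomog_update hv _),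
      smul_smul, sum_update_range, if_neg (lt_irrefl i), add_zero, sgn_mul_self, one_smul]
    simp [cV_cV]

/-- For `i < j`, applying `c_i` first changes the parity of a factor that `c_j` has to pass, whereas
`c_j` does not affect the sign of `c_i`. This produces exactly one extra sign. -/
theorem clif_anti {n N i j : ℕ} (hij : i ≠ j) (hi : i < N) (hj : j < N) :
    clif n N i ∘ₗ clif n N j = -(clif n N j ∘ₗ clif n N i) := by
  wlog h : i < j generalizing i j
  · rw [this hij.symm hj hi (by omega), neg_neg]
  refine T_hom_ext fun p v hv => ?_
  rw [LinearMap.neg_apply, LinearMap.comp_apply, LinearMap.comp_apply, clif_pureSeq hi hv,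
    clif_pureSeq hj hv, map_smul, map_smul, clif_pureSeq hi (isHomog_update hv _),
    clif_pureSeq hj (isHomog_update hv _), sum_update_range, sum_update_range, if_neg (by omega),
    if_pos h, Function.update_of_ne hij, Function.update_of_ne hij.symm,
    Function.update_comm hij, add_zero, sgn_add, sgn_one, smul_smul, smul_smul, ← neg_smul]
  congr 1
  ring

/-- The claim is multiplicative in `σ`, so a flip of `a` and `a + 1` suffices. There `c_i` changes
the sign of the flip when `i` is one of the two positions, and its own sign changes because it then
passes one factor more or less. -/
theorem permT_clif {n N : ℕ} {σ : Equiv.Perm ℕ} (hσ : σ ∈ permsOn (Finset.range N)) {i : ℕ}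
    (hi : i < N) : permT n N σ ∘ₗ clif n N i = clif n N (σ i) ∘ₗ permT n N σ := by
  revert σ i
  suffices h : ∀ σ ∈ permsOn (Finset.range N), ∀ i < N,
      permT n N σ ∘ₗ clif n N i = clif n N (σ i) ∘ₗ permT n N σ from fun {σ} hσ {i} hi => h σ hσ i hi
  refine permsOn_range_induction ?_ ?_ ?_
  · intro i _
    rw [permT_one]; rfl
  · intro σ hσ τ hτ h h' i hi
    rw [permT_mul hσ hτ, LinearMap.comp_assoc, h' i hi, ← LinearMap.comp_assoc,
      h _ (lt_of_permsOn hτ hi), LinearMap.comp_assoc]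
    rfl
  · intro a ha i hi
    have hsw : Equiv.swap a (a + 1) ∈ permsOn (Finset.range N) :=
      swap_mem_permsOn (by simp; omega) (by simpa using ha)
    refine T_hom_ext fun p v hv => ?_
    rw [LinearMap.comp_apply, LinearMap.comp_apply, clif_pureSeq hi hv, map_smul,
      permT_pureSeq hsw (isHomog_update hv _), permT_pureSeq hsw hv, map_smul,
      clif_pureSeq (p := p ∘ ⇑(Equiv.swap a (a + 1))⁻¹)
        (v := v ∘ ⇑(Equiv.swap a (a + 1))⁻¹) (lt_of_permsOn hsw hi) (fun i => hv _),
      invPar_swap ha, invPar_swap ha, smul_smul, smul_smul, ← sgn_add, ← sgn_add, Equiv.swap_inv]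
    have e : Function.update v i (cV n (v i)) ∘ ⇑(Equiv.swap a (a + 1)) =
        Function.update (v ∘ ⇑(Equiv.swap a (a + 1))) (Equiv.swap a (a + 1) i)
          (cV n ((v ∘ ⇑(Equiv.swap a (a + 1))) (Equiv.swap a (a + 1) i))) := by
      funext j
      simp only [Function.comp_apply, Function.update_apply, Equiv.swap_apply_self,
        Equiv.swap_apply_eq_iff]
    rw [e]
    congr 2
    -- Comparison of the total sign exponents modulo 2 for `i = a + 1` and, in `h4`, for `i = a`.
    have h3 : ∀ x a b : ZMod 2, a * (b + 1) + (x + a) = x + a * b := by decide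
    have h4 : ∀ x a b : ZMod 2, (a + 1) * b + x = (x + b) + a * b := by decide
    rcases eq_or_ne i a with rfl | h
    · rw [Equiv.swap_apply_left, Function.update_self, Function.update_of_ne (by omega),
        Finset.sum_range_succ, h4]
      congr 2
      · refine Finset.sum_congr rfl fun x hx => ?_
        simp only [Finset.mem_range] at hx
        rw [Function.comp_apply, Equiv.swap_apply_of_ne_of_ne (by omega) (by omega)]
      · simp
    rcases eq_or_ne i (a + 1) with rfl | h'
    · rw [Equiv.swap_apply_right, Function.update_self, Function.update_of_ne (by omega),
        Finset.sum_range_succ, h3]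
      congr 1
      refine Finset.sum_congr rfl fun x hx => ?_
      simp only [Finset.mem_range] at hx
      rw [Function.comp_apply, Equiv.swap_apply_of_ne_of_ne (by omega) (by omega)]
    · rw [Equiv.swap_apply_of_ne_of_ne h h', Function.update_of_ne (Ne.symm h),
        Function.update_of_ne (Ne.symm h'), add_comm]
      congr 1
      refine Finset.sum_equiv (Equiv.swap a (a + 1)) (fun x => ?_) (fun x _ => ?_)
      · simp only [Finset.mem_range, Equiv.swap_apply_def]
        split_ifs <;> omega
      · simp

end TypeQ
end

noncomputable section
namespace TypeQ

/-! ### Cutting tensor powers -/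

/-- Tensor powers with equal exponents are identified. -/
def castT (n : ℕ) {N M : ℕ} (h : N = M) : T n N ≃ₗ[ℂ] T n M := h ▸ LinearEquiv.refl ℂ (T n N)

theorem castT_pureSeq {n N M : ℕ} (h : N = M) (v : ℕ → VN n) :
    castT n h (pureSeq n N v) = pureSeq n M v := by subst h; rfl

/-- The identification `V^{⊗N} = V^{⊗M} ⊗ V^{⊗r}` for `N = M + r`. -/
def tcut (n : ℕ) : (M r N : ℕ) → M + r = N → (T n N ≃ₗ[ℂ] T n M ⊗[ℂ] T n r)
  | 0, r, N, h => (castT n (h.symm.trans (Nat.zero_add r))).trans (TensorProduct.lid ℂ (T n r)).symm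
  | M + 1, r, 0, h => absurd h (by omega)
  | M + 1, r, N + 1, h =>
    (TensorProduct.congr (LinearEquiv.refl ℂ (VN n)) (tcut n M r N (by omega))).trans
      (TensorProduct.assoc ℂ (VN n) (T n M) (T n r)).symm

theorem tcut_pureSeq {n : ℕ} : ∀ {M r N : ℕ} (h : M + r = N) (v : ℕ → VN n),
    tcut n M r N h (pureSeq n N v) = pureSeq n M v ⊗ₜ[ℂ] pureSeq n r fun i => v (M + i)
  | 0, r, N, h, v => by
    rw [tcut, LinearEquiv.trans_apply, castT_pureSeq, TensorProduct.lid_symm_apply]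
    simp only [Nat.zero_add]
    rfl
  | M + 1, r, 0, h, v => absurd h (by omega)
  | M + 1, r, N + 1, h, v => by
    rw [tcut, LinearEquiv.trans_apply, pureSeq_succ, TensorProduct.congr_tmul, tcut_pureSeq]
    have e : (fun i => v (M + i + 1)) = fun i => v (M + 1 + i) := by
      funext i; congr 1; omega
    rw [e]
    rfl

theorem evenHom_castT (n : ℕ) {N M : ℕ} (h : N = M) :
    QMod.EvenHom (T n N) (T n M) (castT n h).toLinearMap := by
  subst h; exact QMod.EvenHom.id _

theorem QMod.evenHom_lid {n : ℕ} (M : QMod n) :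
    QMod.EvenHom (QMod.tensor (QMod.trivial n) M) M (TensorProduct.lid ℂ M).toLinearMap := by
  let _ := (QMod.trivial n).super
  have h1 : ∀ z : ℂ, par z = z := fun _ => rfl
  constructor
  · intro t
    induction t using TensorProduct.induction_on with
    | zero => simp
    | add s t hs ht => simp only [map_add, hs, ht]
    | tmul z w =>
      change par (z • w) = z • par w
      rw [map_smul]
  · intro x t
    induction t using TensorProduct.induction_on with
    | zero => simp
    | add s t hs ht => simp only [map_add, hs, ht]
    | tmul z w =>
      change M.act x (z • w) = TensorProduct.lid ℂ M (tensorAct 0 (M.act x) (z ⊗ₜ w))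
      rw [tensorAct_tmul, h1 z, add_assoc, ← TensorProduct.tmul_add, ← LinearMap.add_apply,
        evenPart_add_oddPart]
      simp

theorem evenHom_tcut (n : ℕ) : ∀ (M r N : ℕ) (h : M + r = N),
    QMod.EvenHom (T n N) (QMod.tensor (T n M) (T n r)) (tcut n M r N h).toLinearMap
  | 0, r, N, h => (QMod.evenHom_lid (T n r)).symm.comp (evenHom_castT n _)
  | M + 1, r, 0, h => absurd h (by omega)
  | M + 1, r, N + 1, h => (QMod.evenHom_assoc (QMod.natural n) (T n M) (T n r)).symm.comp
      ((evenHom_tcut n M r N (by omega)).lTensor (QMod.natural n))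

theorem swap_permsOn_range {i N : ℕ} (hi : i + 1 < N) :
    Equiv.swap i (i + 1) ∈ permsOn (Finset.range N) :=
  swap_mem_permsOn (by simp; omega) (by simpa using hi)

theorem tcut_permT_left {n M r N : ℕ} (h : M + r = N) {σ : Equiv.Perm ℕ}
    (hσ : σ ∈ permsOn (Finset.range M)) :
    (tcut n M r N h).toLinearMap ∘ₗ permT n N σ =
      TensorProduct.map (permT n M σ) LinearMap.id ∘ₗ (tcut n M r N h).toLinearMap := by
  have hMN : permsOn (Finset.range M) ≤ permsOn (Finset.range N) := permsOn_mono (by simp; omega)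
  revert σ hσ
  refine @permsOn_range_induction _ _ ?_ ?_ ?_
  · rw [permT_one, permT_one, TensorProduct.map_id]; rfl
  · intro σ hσ τ hτ h1 h2
    rw [permT_mul (hMN hσ) (hMN hτ), ← LinearMap.comp_assoc, h1, LinearMap.comp_assoc, h2,
      ← LinearMap.comp_assoc, ← TensorProduct.map_comp, permT_mul hσ hτ]
    rfl
  · intro i hi
    refine T_hom_ext fun p v hv => ?_
    simp only [LinearMap.comp_apply, LinearEquiv.coe_coe]
    rw [permT_swap hi, permT_swap (by omega), sw_pureSeq (by omega) hv, map_smul, tcut_pureSeq,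
      tcut_pureSeq, TensorProduct.map_tmul, sw_pureSeq hi hv, TensorProduct.smul_tmul',
      LinearMap.id_apply]
    congr 1
    exact pureSeq_congr fun j _ => by
      simp only [Function.comp_apply]
      rw [Equiv.swap_apply_of_ne_of_ne (by omega) (by omega)]

/-- The permutation `τ` is `σ` shifted by `M`. Its values are part of the conclusion, so that it can
be built by induction over products and still be identified afterwards. -/
theorem tcut_permT_right {n M r N : ℕ} (h : M + r = N) {σ : Equiv.Perm ℕ}
    (hσ : σ ∈ permsOn (Finset.range r)) :
    ∃ τ ∈ permsOn (Finset.range N), (∀ i < M, τ i = i) ∧ (∀ i, τ (M + i) = M + σ i) ∧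
    (tcut n M r N h).toLinearMap ∘ₗ permT n N τ =
      TensorProduct.map LinearMap.id (permT n r σ) ∘ₗ (tcut n M r N h).toLinearMap := by
  revert σ hσ
  refine @permsOn_range_induction _ _ ?_ ?_ ?_
  · refine ⟨1, one_mem _, fun _ _ => rfl, fun _ => rfl, ?_⟩
    rw [permT_one, permT_one, TensorProduct.map_id]; rfl
  · rintro σ hσ σ' hσ' ⟨τ, hτ, hτ1, hτ2, hτ3⟩ ⟨τ', hτ', hτ1', hτ2', hτ3'⟩
    refine ⟨τ * τ', mul_mem hτ hτ', fun i hi => ?_, fun i => ?_, ?_⟩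
    · rw [Equiv.Perm.mul_apply, hτ1' i hi, hτ1 i hi]
    · rw [Equiv.Perm.mul_apply, hτ2', hτ2]; rfl
    rw [permT_mul hτ hτ', ← LinearMap.comp_assoc, hτ3, LinearMap.comp_assoc, hτ3',
      ← LinearMap.comp_assoc, ← TensorProduct.map_comp, permT_mul hσ hσ']
    rfl
  · intro i hi
    refine ⟨Equiv.swap (M + i) (M + i + 1), swap_permsOn_range (by omega), fun j hj => ?_,
      fun j => ?_, ?_⟩
    · rw [Equiv.swap_apply_of_ne_of_ne (by omega) (by omega)]
    · simp only [Equiv.swap_apply_def]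
      split_ifs <;> omega
    refine T_hom_ext fun p v hv => ?_
    simp only [LinearMap.comp_apply, LinearEquiv.coe_coe]
    rw [permT_swap hi, permT_swap (by omega), sw_pureSeq (by omega) hv, map_smul, tcut_pureSeq,
      tcut_pureSeq, TensorProduct.map_tmul, sw_pureSeq hi (fun i => hv (M + i)),
      TensorProduct.tmul_smul, LinearMap.id_apply]
    congr 2
    · exact pureSeq_congr fun j _ => by
        simp only [Function.comp_apply]
        rw [Equiv.swap_apply_of_ne_of_ne (by omega) (by omega)]
    · refine congrArg (pureSeq n r) (funext fun j => ?_)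
      simp only [Function.comp_apply, Equiv.swap_apply_def]
      congr 1
      split_ifs <;> omega

theorem tcut_permT_swap {n M r N : ℕ} (h : M + r = N) {i j : ℕ} (hi : i < r) (hj : j < r) :
    (tcut n M r N h).toLinearMap ∘ₗ permT n N (Equiv.swap (M + i) (M + j)) =
      TensorProduct.map LinearMap.id (permT n r (Equiv.swap i j)) ∘ₗ
        (tcut n M r N h).toLinearMap := by
  obtain ⟨τ, -, h1, h2, h3⟩ := tcut_permT_right (n := n) h (σ := Equiv.swap i j)
    (swap_mem_permsOn (by simpa using hi) (by simpa using hj))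
  have : τ = Equiv.swap (M + i) (M + j) := by
    ext x
    rcases lt_or_ge x M with hx | hx
    · rw [h1 x hx, Equiv.swap_apply_of_ne_of_ne (by omega) (by omega)]
    · obtain ⟨y, rfl⟩ := Nat.exists_eq_add_of_le hx
      rw [h2]
      simp only [Equiv.swap_apply_def]
      split_ifs <;> omega
  rw [← this, h3]

theorem tcut_clif_left {n M r N : ℕ} (h : M + r = N) {i : ℕ} (hi : i < M) :
    (tcut n M r N h).toLinearMap ∘ₗ clif n N i =
      superTensor (clif n M i) LinearMap.id ∘ₗ (tcut n M r N h).toLinearMap := by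
  refine T_hom_ext fun p v hv => ?_
  simp only [LinearMap.comp_apply, LinearEquiv.coe_coe]
  rw [clif_pureSeq (by omega) hv, map_smul, tcut_pureSeq, tcut_pureSeq, superTensor_id,
    TensorProduct.map_tmul, clif_pureSeq hi hv, TensorProduct.smul_tmul', LinearMap.id_apply]
  congr 1
  exact pureSeq_congr fun j _ => Function.update_of_ne (by omega) _ _

/-- The sign that `c_{M+i}` picks up from the first `M` factors is the Koszul sign contained in
`superTensor`. -/
theorem tcut_clif_right {n M r N : ℕ} (h : M + r = N) {i : ℕ} (hi : i < r) :
    (tcut n M r N h).toLinearMap ∘ₗ clif n N (M + i) =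
      superTensor LinearMap.id (clif n r i) ∘ₗ (tcut n M r N h).toLinearMap := by
  refine T_hom_ext fun p v hv => ?_
  simp only [LinearMap.comp_apply, LinearEquiv.coe_coe]
  rw [clif_pureSeq (by omega) hv, map_smul, tcut_pureSeq, tcut_pureSeq,
    superTensor_homog _ _ 1 _ (clif_mem_homGr n r i).1 _ (isHomog_pureSeq hv),
    clif_pureSeq hi (fun i => hv (M + i)), TensorProduct.tmul_smul, LinearMap.id_apply, smul_smul,
    ← sgn_add, one_mul, Finset.sum_range_add, add_comm]
  congr 2
  · exact pureSeq_congr fun j _ => Function.update_of_ne (by omega) _ _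
  · refine congrArg (pureSeq n r) (funext fun j => ?_)
    simp [Function.update_apply]

/-! ### Symmetric powers -/

section
variable {A B M : Type} [AddCommGroup A] [Module ℂ A] [AddCommGroup B] [Module ℂ B]
  [AddCommGroup M] [Module ℂ M]

/-- The factorization of a linear map through a surjection. -/
def descend (P : A →ₗ[ℂ] B) (hP : Function.Surjective P) (f : A →ₗ[ℂ] M)
    (h : LinearMap.ker P ≤ LinearMap.ker f) : B →ₗ[ℂ] M :=
  (LinearMap.ker P).liftQ f h ∘ₗ (P.quotKerEquivOfSurjective hP).symm.toLinearMap

theorem descend_apply (P : A →ₗ[ℂ] B) (hP : Function.Surjective P) (f : A →ₗ[ℂ] M)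
    (h : LinearMap.ker P ≤ LinearMap.ker f) (a : A) : descend P hP f h (P a) = f a := by
  have e : (P.quotKerEquivOfSurjective hP).symm (P a) = (LinearMap.ker P).mkQ a := by
    rw [LinearEquiv.symm_apply_eq]; rfl
  rw [descend, LinearMap.comp_apply, LinearEquiv.coe_coe, e]
  rfl

end

/-- The projection from the tensor power to the symmetric power. -/
def symProj (n N : ℕ) : T n N →ₗ[ℂ] Sym n N := (symRel n N).mkQ

theorem symProj_surjective (n N : ℕ) : Function.Surjective (symProj n N) :=
  Submodule.mkQ_surjective _

theorem symProj_pureSeq {n N : ℕ} (v : ℕ → VN n) :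
    symProj n N (pureSeq n N v) = sprod fun i : Fin N => v i := rfl

theorem evenHom_symProj (n N : ℕ) : QMod.EvenHom (T n N) (Sym n N) (symProj n N) :=
  ⟨fun _ => rfl, fun _ _ => rfl⟩

theorem sw_of_le {n : ℕ} : ∀ {N i : ℕ}, N ≤ i + 1 → sw n N i = LinearMap.id
  | 0, _, _ => rfl
  | 1, _, _ => rfl
  | N + 2, 0, h => absurd h (by omega)
  | N + 2, i + 1, h => by rw [sw, sw_of_le (by omega), TensorProduct.map_id]

theorem symRel_le_ker {n N : ℕ} {M : Type} [AddCommGroup M] [Module ℂ M] {f : T n N →ₗ[ℂ] M}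
    (h : ∀ i, i + 1 < N → f ∘ₗ permT n N (Equiv.swap i (i + 1)) = f) :
    symRel n N ≤ LinearMap.ker f := by
  refine iSup_le fun i => ?_
  rintro _ ⟨v, rfl⟩
  rw [LinearMap.mem_ker, LinearMap.sub_apply, map_sub, LinearMap.id_apply]
  rcases lt_or_ge (i + 1) N with hi | hi
  · rw [← permT_swap hi, ← LinearMap.comp_apply, h i hi, sub_self]
  -- Flips out of range are identities and contribute nothing to `symRel`.
  · rw [sw_of_le hi, LinearMap.id_apply, sub_self]

theorem symProj_permT {n N : ℕ} {σ : Equiv.Perm ℕ} (hσ : σ ∈ permsOn (Finset.range N)) :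
    symProj n N ∘ₗ permT n N σ = symProj n N := by
  revert σ hσ
  refine @permsOn_range_induction _ _ ?_ ?_ ?_
  · rw [permT_one]; rfl
  · intro σ hσ τ hτ h1 h2
    rw [permT_mul hσ hτ, ← LinearMap.comp_assoc, h1, h2]
  · intro i hi
    rw [permT_swap hi]
    refine LinearMap.ext fun v => ?_
    refine (Submodule.Quotient.eq _).2 ?_
    rw [← neg_sub]
    exact neg_mem (Submodule.mem_iSup_of_mem i ⟨v, rfl⟩)

/-- The projection `V^{⊗N} → S^k(V) ⊗ S^l(V)`, `N = k + l`. -/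
def symProj₂ (n k l N : ℕ) (h : k + l = N) : T n N →ₗ[ℂ] Sym n k ⊗[ℂ] Sym n l :=
  TensorProduct.map (symProj n k) (symProj n l) ∘ₗ (tcut n k l N h).toLinearMap

theorem symProj₂_surjective (n k l N : ℕ) (h : k + l = N) :
    Function.Surjective (symProj₂ n k l N h) :=
  (TensorProduct.map_surjective (symProj_surjective n k) (symProj_surjective n l)).comp
    (tcut n k l N h).surjective

/-- The kernel of a tensor product of two surjections is the sum of the contributions of the two
kernels. Each of them comes from flips inside one block, and under the cut these are permutations of
all `N` factors, under which `f` is invariant. -/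
theorem ker_symProj₂_le {n k l N : ℕ} (h : k + l = N) {M : Type} [AddCommGroup M] [Module ℂ M]
    {f : T n N →ₗ[ℂ] M} (h1 : ∀ σ ∈ permsOn (Finset.range N), f ∘ₗ permT n N σ = f) :
    LinearMap.ker (symProj₂ n k l N h) ≤ LinearMap.ker f := by
  have e : LinearMap.ker (TensorProduct.map (symProj n k) (symProj n l)) ≤
      LinearMap.ker (f ∘ₗ (tcut n k l N h).symm.toLinearMap) := by
    unfold symProj
    rw [TensorProduct.map_ker (f := (symRel n k).subtype) (f' := (symRel n l).subtype)
      (LinearMap.exact_subtype_mkQ _) (symProj_surjective n k)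
      (LinearMap.exact_subtype_mkQ _) (symProj_surjective n l)]
    rw [sup_le_iff]
    have hpre : permsOn (Finset.range k) ≤ permsOn (Finset.range N) :=
      permsOn_mono (by simp; omega)
    constructor
    · rintro _ ⟨t, rfl⟩
      rw [LinearMap.mem_ker]
      induction t using TensorProduct.induction_on with
      | zero => simp
      | add s t hs ht => rw [map_add, map_add, hs, ht, add_zero]
      | tmul t s =>
        have := symRel_le_ker (f := f ∘ₗ (tcut n k l N h).symm.toLinearMap ∘ₗ
          TensorProduct.mk ℂ _ _ t) (fun i hi => ?_) s.2
        · exact this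
        · obtain ⟨τ, hτ, -, -, hτ'⟩ := tcut_permT_right (n := n) h (swap_permsOn_range hi)
          refine LinearMap.ext fun s => ?_
          have h2 := LinearMap.congr_fun hτ' ((tcut n k l N h).symm (t ⊗ₜ s))
          simp only [LinearMap.comp_apply, LinearEquiv.coe_coe, LinearEquiv.apply_symm_apply,
            TensorProduct.map_tmul, LinearMap.id_apply] at h2
          simp only [LinearMap.comp_apply, LinearEquiv.coe_coe, TensorProduct.mk_apply]
          rw [← h2, LinearEquiv.symm_apply_apply, ← LinearMap.comp_apply, h1 τ hτ]
    · rintro _ ⟨t, rfl⟩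
      rw [LinearMap.mem_ker]
      induction t using TensorProduct.induction_on with
      | zero => simp
      | add s t hs ht => rw [map_add, map_add, hs, ht, add_zero]
      | tmul s t =>
        have := symRel_le_ker (f := f ∘ₗ (tcut n k l N h).symm.toLinearMap ∘ₗ
          (TensorProduct.mk ℂ _ _).flip t) (fun i hi => ?_) s.2
        · exact this
        · have hτ := swap_permsOn_range hi
          refine LinearMap.ext fun s => ?_
          have h2 := LinearMap.congr_fun (tcut_permT_left (n := n) h hτ)
            ((tcut n k l N h).symm (s ⊗ₜ t))
          simp only [LinearMap.comp_apply, LinearEquiv.coe_coe, LinearEquiv.apply_symm_apply,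
            TensorProduct.map_tmul, LinearMap.id_apply] at h2
          simp only [LinearMap.comp_apply, LinearEquiv.coe_coe, LinearMap.flip_apply,
            TensorProduct.mk_apply]
          rw [← h2, LinearEquiv.symm_apply_apply, ← LinearMap.comp_apply, h1 _ (hpre hτ)]
  intro t ht
  have := e (x := tcut n k l N h t) ht
  simpa using this

end TypeQ
end

noncomputable section
namespace TypeQ

/-! ### Merges, splits and dots on symmetric powers -/

theorem linearMap_comp_sum {ι A B C : Type} [AddCommGroup A] [Module ℂ A] [AddCommGroup B]
    [Module ℂ B] [AddCommGroup C] [Module ℂ C] (g : B →ₗ[ℂ] C) (s : Finset ι) (f : ι → A →ₗ[ℂ] B) :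
    g ∘ₗ ∑ i ∈ s, f i = ∑ i ∈ s, g ∘ₗ f i := by
  ext v; simp

theorem linearMap_sum_comp {ι A B C : Type} [AddCommGroup A] [Module ℂ A] [AddCommGroup B]
    [Module ℂ B] [AddCommGroup C] [Module ℂ C] (s : Finset ι) (g : ι → B →ₗ[ℂ] C) (f : A →ₗ[ℂ] B) :
    (∑ i ∈ s, g i) ∘ₗ f = ∑ i ∈ s, g i ∘ₗ f := by
  ext v; simp

/-- The sum of the actions of all permutations on `V^{⊗N}`. -/
def symT (n N : ℕ) : T n N →ₗ[ℂ] T n N := ∑ σ ∈ permsOfFinset (Finset.range N), permT n N σ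

theorem permT_symT {n N : ℕ} {τ : Equiv.Perm ℕ} (hτ : τ ∈ permsOn (Finset.range N)) :
    permT n N τ ∘ₗ symT n N = symT n N := by
  rw [symT, linearMap_comp_sum]
  refine Finset.sum_bij (fun σ _ => τ * σ) (fun σ hσ => ?_) (fun _ _ _ _ h => mul_left_cancel h)
    (fun σ hσ => ?_) (fun σ hσ => ?_)
  · rw [mem_permsOfFinset] at *
    exact mul_mem hτ hσ
  · rw [mem_permsOfFinset] at hσ
    exact ⟨τ⁻¹ * σ, mem_permsOfFinset.2 (mul_mem (inv_mem hτ) hσ), mul_inv_cancel_left _ _⟩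
  · rw [mem_permsOfFinset] at hσ
    rw [permT_mul hτ hσ]

theorem symT_permT {n N : ℕ} {τ : Equiv.Perm ℕ} (hτ : τ ∈ permsOn (Finset.range N)) :
    symT n N ∘ₗ permT n N τ = symT n N := by
  rw [symT, linearMap_sum_comp]
  refine Finset.sum_bij (fun σ _ => σ * τ) (fun σ hσ => ?_) (fun _ _ _ _ h => mul_right_cancel h)
    (fun σ hσ => ?_) (fun σ hσ => ?_)
  · rw [mem_permsOfFinset] at *
    exact mul_mem hσ hτ
  · rw [mem_permsOfFinset] at hσ
    exact ⟨σ * τ⁻¹, mem_permsOfFinset.2 (mul_mem hσ (inv_mem hτ)), inv_mul_cancel_right _ _⟩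
  · rw [mem_permsOfFinset] at hσ
    rw [permT_mul hσ hτ]

theorem comp_symT {n N : ℕ} {M : Type} [AddCommGroup M] [Module ℂ M] {f : T n N →ₗ[ℂ] M}
    (h : ∀ σ ∈ permsOn (Finset.range N), f ∘ₗ permT n N σ = f) :
    f ∘ₗ symT n N = (N.factorial : ℂ) • f := by
  rw [symT, linearMap_comp_sum, Finset.sum_congr rfl fun σ hσ => h σ (mem_permsOfFinset.1 hσ),
    Finset.sum_const, card_perms_of_finset, Finset.card_range, Nat.cast_smul_eq_nsmul]

theorem QMod.EvenHom.sum {n : ℕ} {M N : QMod n} {ι : Type} {s : Finset ι} {f : ι → M →ₗ[ℂ] N}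
    (h : ∀ i ∈ s, QMod.EvenHom M N (f i)) : QMod.EvenHom M N (∑ i ∈ s, f i) := by
  constructor
  · intro v
    simp only [LinearMap.sum_apply, map_sum]
    exact Finset.sum_congr rfl fun i hi => (h i hi).par v
  · intro x v
    simp only [LinearMap.sum_apply, map_sum]
    exact Finset.sum_congr rfl fun i hi => (h i hi).act x v

theorem QMod.EvenHom.smul {n : ℕ} {M N : QMod n} {f : M →ₗ[ℂ] N} (h : QMod.EvenHom M N f)
    (z : ℂ) : QMod.EvenHom M N (z • f) :=
  ⟨fun v => by simp [h.par], fun x v => by simp [h.act]⟩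

theorem QMod.homGr_of_comp {n : ℕ} {L M N : QMod n} {ε : ZMod 2} {P : L →ₗ[ℂ] M} {g : M →ₗ[ℂ] N}
    (hP : QMod.EvenHom L M P) (hs : Function.Surjective P) (h : g ∘ₗ P ∈ QMod.homGr L N ε) :
    g ∈ QMod.homGr M N ε := by
  refine ⟨fun v => ?_, fun δ x hx v => ?_⟩
  · obtain ⟨t, rfl⟩ := hs v
    rw [hP.par]; exact h.1 t
  · obtain ⟨t, rfl⟩ := hs v
    rw [hP.act]; exact h.2 δ x hx t

theorem evenHom_symT (n N : ℕ) : QMod.EvenHom (T n N) (T n N) (symT n N) :=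
  QMod.EvenHom.sum fun _ hσ => evenHom_permT (mem_permsOfFinset.1 hσ)

theorem QMod.EvenHom.map {n : ℕ} {M M' N N' : QMod n} {f : M →ₗ[ℂ] M'} {g : N →ₗ[ℂ] N'}
    (hf : QMod.EvenHom M M' f) (hg : QMod.EvenHom N N' g) :
    QMod.EvenHom (QMod.tensor M N) (QMod.tensor M' N') (TensorProduct.map f g) := by
  have : TensorProduct.map f g =
      TensorProduct.map f LinearMap.id ∘ₗ TensorProduct.map LinearMap.id g := by
    rw [← TensorProduct.map_comp]; rfl
  rw [this]
  exact (hf.rTensor N').comp (hg.lTensor M)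

theorem evenHom_symProj₂ (n k l N : ℕ) (h : k + l = N) :
    QMod.EvenHom (T n N) (QMod.tensor (Sym n k) (Sym n l)) (symProj₂ n k l N h) :=
  ((evenHom_symProj n k).map (evenHom_symProj n l)).comp (evenHom_tcut n k l N h)

/-- The multiplication `S^k(V) ⊗ S^l(V) → S^N(V)`, `N = k + l`. -/
def symMul (n k l N : ℕ) (h : k + l = N) : Sym n k ⊗[ℂ] Sym n l →ₗ[ℂ] Sym n N :=
  descend (symProj₂ n k l N h) (symProj₂_surjective n k l N h) (symProj n N)
    (ker_symProj₂_le h fun _ hσ => symProj_permT hσ)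

theorem symMul_comp {n k l N : ℕ} (h : k + l = N) :
    symMul n k l N h ∘ₗ symProj₂ n k l N h = symProj n N :=
  LinearMap.ext fun t => descend_apply (symProj₂ n k l N h) (symProj₂_surjective n k l N h)
    (symProj n N) (ker_symProj₂_le h fun _ hσ => symProj_permT hσ) t

theorem symMul_mem_homGr {n k l N : ℕ} (h : k + l = N) :
    symMul n k l N h ∈ QMod.homGr (QMod.tensor (Sym n k) (Sym n l)) (Sym n N) 0 := by
  refine QMod.homGr_of_comp (evenHom_symProj₂ n k l N h) (symProj₂_surjective n k l N h) ?_
  rw [symMul_comp]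
  exact (evenHom_symProj n N).mem_homGr

/-- The comultiplication `S^N(V) → S^k(V) ⊗ S^l(V)`, `N = k + l`. -/
def symSplit (n k l N : ℕ) (h : k + l = N) : Sym n N →ₗ[ℂ] Sym n k ⊗[ℂ] Sym n l :=
  -- The $N!$ permutations fall into classes of $k!\,l!$ elements with equal image in $S^k(V)\otimes
  -- S^l(V)$, one class for each subset `I` in the shuffle formula; the scalar makes each class
  -- count once.
  (symRel n N).liftQ (((k.factorial * l.factorial : ℕ) : ℂ)⁻¹ • (symProj₂ n k l N h ∘ₗ symT n N))
    (symRel_le_ker fun i hi => by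
      rw [LinearMap.smul_comp, LinearMap.comp_assoc, symT_permT (swap_permsOn_range hi)])

theorem symSplit_comp {n k l N : ℕ} (h : k + l = N) :
    symSplit n k l N h ∘ₗ symProj n N =
      ((k.factorial * l.factorial : ℕ) : ℂ)⁻¹ • (symProj₂ n k l N h ∘ₗ symT n N) := rfl

theorem symSplit_mem_homGr {n k l N : ℕ} (h : k + l = N) :
    symSplit n k l N h ∈ QMod.homGr (Sym n N) (QMod.tensor (Sym n k) (Sym n l)) 0 := by
  refine QMod.homGr_of_comp (evenHom_symProj n N) (symProj_surjective n N) ?_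
  rw [symSplit_comp]
  exact (((evenHom_symProj₂ n k l N h).comp (evenHom_symT n N)).smul _).mem_homGr

/-- The sum of the operators `c_i`, `i ∈ s`. -/
def clifSum (n N : ℕ) (s : Finset ℕ) : T n N →ₗ[ℂ] T n N := ∑ i ∈ s, clif n N i

theorem permT_clifSum {n N : ℕ} {σ : Equiv.Perm ℕ} (hσ : σ ∈ permsOn (Finset.range N)) :
    permT n N σ ∘ₗ clifSum n N (Finset.range N) = clifSum n N (Finset.range N) ∘ₗ permT n N σ := by
  rw [clifSum, linearMap_comp_sum, linearMap_sum_comp]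
  refine Finset.sum_equiv σ (fun x => (permsOn_mem hσ).symm) fun i hi => ?_
  rw [permT_clif hσ (by simpa using hi)]

theorem clifSum_mem_homGr (n N : ℕ) (s : Finset ℕ) :
    clifSum n N s ∈ QMod.homGr (T n N) (T n N) 1 :=
  Submodule.sum_mem _ fun i _ => clif_mem_homGr n N i

/-- The odd derivation of the symmetric superalgebra that extends `c`, in degree `N`. -/
def symDot (n N : ℕ) : Sym n N →ₗ[ℂ] Sym n N :=
  (symRel n N).liftQ (symProj n N ∘ₗ clifSum n N (Finset.range N)) (symRel_le_ker fun i hi => by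
    rw [LinearMap.comp_assoc, ← permT_clifSum (swap_permsOn_range hi), ← LinearMap.comp_assoc,
      symProj_permT (swap_permsOn_range hi)])

theorem symDot_comp (n N : ℕ) :
    symDot n N ∘ₗ symProj n N = symProj n N ∘ₗ clifSum n N (Finset.range N) := rfl

theorem symDot_mem_homGr (n N : ℕ) : symDot n N ∈ QMod.homGr (Sym n N) (Sym n N) 1 := by
  refine QMod.homGr_of_comp (evenHom_symProj n N) (symProj_surjective n N) ?_
  rw [symDot_comp]
  have := QMod.homGr_comp (evenHom_symProj n N).mem_homGr
    (clifSum_mem_homGr n N (Finset.range N))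
  rwa [zero_add] at this

theorem sprod_eq {n N : ℕ} (v : Fin N → VN n) : sprod v = symProj n N (pureSeq n N (extSeq 0 v)) := by
  rw [pureSeq_ext]; rfl

theorem sum_extSeq {N : ℕ} (p : Fin N → ZMod 2) (t : Fin N) :
    ∑ j ∈ Finset.range t, extSeq 0 p j = ∑ i : Fin N with i < t, p i := by
  symm
  refine Finset.sum_bij (fun i _ => (i : ℕ)) (fun i hi => ?_) (fun _ _ _ _ h => Fin.ext h)
    (fun j hj => ?_) (fun i _ => (extSeq_coe _ _ _).symm)
  · simpa using hi
  · simp only [Finset.mem_range] at hj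
    exact ⟨⟨j, hj.trans t.2⟩, Finset.mem_filter.2 ⟨Finset.mem_univ _, hj⟩, rfl⟩

theorem clif_pureT {n N : ℕ} (i : Fin N) (p : Fin N → ZMod 2) (v : Fin N → VN n)
    (hv : ∀ i, IsHomog (p i) (v i)) :
    clif n N i (pureT n N v) =
      sgn (∑ j with j < i, p j) • pureT n N (Function.update v i (cV n (v i))) := by
  rw [← pureSeq_ext, clif_pureSeq i.2 (isHomog_ext hv), sum_extSeq, ← pureSeq_ext]
  congr 1
  refine pureSeq_congr fun j hj => ?_
  lift j to Fin N using hj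
  simp only [extSeq_coe]
  rcases eq_or_ne j i with rfl | h
  · simp
  · rw [Function.update_of_ne h, Function.update_of_ne (Fin.val_ne_of_ne h), extSeq_coe]

theorem symDot_sprod {n N : ℕ} (p : Fin N → ZMod 2) (v : Fin N → VN n)
    (hv : ∀ i, IsHomog (p i) (v i)) :
    symDot n N (sprod v) = ∑ t : Fin N, sgn (∑ i with i < t, p i) •
      sprod (Function.update v t (cV n (v t))) := by
  change symProj n N (clifSum n N (Finset.range N) (pureT n N v)) = _
  rw [clifSum, LinearMap.sum_apply, map_sum, Finset.sum_range]
  refine Finset.sum_congr rfl fun t _ => ?_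
  rw [clif_pureT t p v hv, map_smul]
  rfl

theorem symMul_sprod {n k l : ℕ} (v : Fin k → VN n) (w : Fin l → VN n) :
    symMul n k l (k + l) rfl (sprod v ⊗ₜ sprod w) = sprod (Fin.append v w) := by
  have h := LinearMap.congr_fun (symMul_comp (n := n) (rfl : k + l = k + l))
    (pureSeq n (k + l) (extSeq 0 (Fin.append v w)))
  rw [LinearMap.comp_apply, symProj₂, LinearMap.comp_apply, LinearEquiv.coe_coe, tcut_pureSeq,
    TensorProduct.map_tmul, symProj_pureSeq, symProj_pureSeq, ← sprod_eq] at h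
  rw [← h]
  congr 3
  · funext i
    exact ((extSeq_coe 0 (Fin.append v w) (Fin.castAdd l i)).trans (Fin.append_left v w i)).symm
  · funext i
    exact ((extSeq_coe 0 (Fin.append v w) (Fin.natAdd k i)).trans (Fin.append_right v w i)).symm

end TypeQ
end

noncomputable section
namespace TypeQ

/-! ### The shuffle formula for splits -/

theorem symProj₂_permT_left {n k l N : ℕ} (h : k + l = N) {σ : Equiv.Perm ℕ}
    (hσ : σ ∈ permsOn (Finset.range k)) :
    symProj₂ n k l N h ∘ₗ permT n N σ = symProj₂ n k l N h := by
  rw [symProj₂, LinearMap.comp_assoc, tcut_permT_left h hσ, ← LinearMap.comp_assoc,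
    ← TensorProduct.map_comp, symProj_permT hσ]
  rfl

theorem symProj₂_permT_right {n k l N : ℕ} (h : k + l = N) {σ : Equiv.Perm ℕ}
    (hσ : σ ∈ permsOn (Finset.Ico k N)) :
    symProj₂ n k l N h ∘ₗ permT n N σ = symProj₂ n k l N h := by
  have hle : permsOn (Finset.Ico k N) ≤ permsOn (Finset.range N) :=
    permsOn_mono fun x hx => by simp at hx ⊢; omega
  revert σ hσ
  refine @permsOn_Ico_induction _ _ _ ?_ ?_ ?_
  · rw [permT_one]; rfl
  · intro σ hσ τ hτ h1 h2
    rw [permT_mul (hle hσ) (hle hτ), ← LinearMap.comp_assoc, h1, h2]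
  · intro i hi hiN
    obtain ⟨j, rfl⟩ := Nat.exists_eq_add_of_le hi
    rw [add_assoc, symProj₂, LinearMap.comp_assoc, tcut_permT_swap h (by omega) (by omega),
      ← LinearMap.comp_assoc, ← TensorProduct.map_comp,
      symProj_permT (swap_permsOn_range (by omega))]
    rfl

/-- Such a permutation is a product of one that moves only the first `k` places and one that moves
only the others, and each symmetric power absorbs its own. -/
theorem symProj₂_permT_block {n k l N : ℕ} (h : k + l = N) {σ : Equiv.Perm ℕ}
    (hσ : σ ∈ permsOn (Finset.range N)) (hk : ∀ x, x < k ↔ σ x < k) :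
    symProj₂ n k l N h ∘ₗ permT n N σ = symProj₂ n k l N h := by
  let σ₁ : Equiv.Perm ℕ := Equiv.Perm.ofSubtype
    (Equiv.Perm.subtypePerm (p := (· < k)) σ fun x => (hk x).symm)
  have h1 : σ₁ ∈ permsOn (Finset.range k) := fun x hx =>
    Equiv.Perm.ofSubtype_apply_of_not_mem _ (by simpa using hx)
  have h1' : ∀ x < k, σ₁ x = σ x := fun x hx => by
    exact Equiv.Perm.ofSubtype_apply_of_mem (p := (· < k)) _ hx
  have h1r : σ₁ ∈ permsOn (Finset.range N) := permsOn_mono (by simp; omega) h1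
  have h2 : σ₁⁻¹ * σ ∈ permsOn (Finset.Ico k N) := by
    intro x hx
    rw [Equiv.Perm.mul_apply, Equiv.Perm.inv_eq_iff_eq]
    rcases lt_or_ge x k with hxk | hxk
    · rw [h1' x hxk]
    · rw [h1 x (by simpa using hxk), hσ x (by simp at hx ⊢; omega)]
  have h2r : σ₁⁻¹ * σ ∈ permsOn (Finset.range N) := mul_mem (inv_mem h1r) hσ
  have e : σ = σ₁ * (σ₁⁻¹ * σ) := (mul_inv_cancel_left _ _).symm
  rw [e, permT_mul h1r h2r, ← LinearMap.comp_assoc, symProj₂_permT_left h h1,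
    symProj₂_permT_right h h2]

section Shuffle
variable {k l : ℕ}

/-- The permutation that moves the elements of `I` to the first places and preserves the order
of the elements of `I` and of its complement. -/
def shuffle (I : Finset (Fin (k + l))) (hI : I.card = k) : Equiv.Perm ℕ :=
  Equiv.Perm.extendDomain
    ((finSumEquivOfFinset hI (card_compl_of_add hI)).symm.trans finSumFinEquiv)
    (Fin.equivSubtype (n := k + l))

theorem shuffle_coe (I : Finset (Fin (k + l))) (hI : I.card = k) (x : Fin (k + l)) :
    shuffle I hI x =
      (finSumFinEquiv ((finSumEquivOfFinset hI (card_compl_of_add hI)).symm x) : Fin (k + l)) :=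
  Equiv.Perm.extendDomain_apply_image
    ((finSumEquivOfFinset hI (card_compl_of_add hI)).symm.trans finSumFinEquiv) Fin.equivSubtype x

theorem shuffle_emb (I : Finset (Fin (k + l))) (hI : I.card = k) (a : Fin k) :
    shuffle I hI (I.orderEmbOfFin hI a) = a := by
  rw [shuffle_coe, ← finSumEquivOfFinset_inl hI (card_compl_of_add hI), Equiv.symm_apply_apply]
  simp

theorem shuffle_emb_compl (I : Finset (Fin (k + l))) (hI : I.card = k) (b : Fin l) :
    shuffle I hI (Iᶜ.orderEmbOfFin (card_compl_of_add hI) b) = k + b := by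
  rw [shuffle_coe, ← finSumEquivOfFinset_inr hI (card_compl_of_add hI), Equiv.symm_apply_apply]
  simp

theorem shuffle_mem (I : Finset (Fin (k + l))) (hI : I.card = k) :
    shuffle I hI ∈ permsOn (Finset.range (k + l)) := fun x hx =>
  Equiv.Perm.extendDomain_apply_not_subtype _ (Fin.equivSubtype (n := k + l)) (by simpa using hx)

theorem exists_emb {I : Finset (Fin (k + l))} (hI : I.card = k) {x : Fin (k + l)} (hx : x ∈ I) :
    ∃ a, I.orderEmbOfFin hI a = x := by
  have : x ∈ Set.range (I.orderEmbOfFin hI) := by rw [Finset.range_orderEmbOfFin]; exact hx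
  exact this

theorem exists_emb_compl {I : Finset (Fin (k + l))} (hI : I.card = k) {x : Fin (k + l)}
    (hx : x ∉ I) : ∃ b, Iᶜ.orderEmbOfFin (card_compl_of_add hI) b = x := by
  have : x ∈ Set.range (Iᶜ.orderEmbOfFin (card_compl_of_add hI)) := by
    rw [Finset.range_orderEmbOfFin]; simpa using hx
  exact this

theorem shuffle_lt_iff (I : Finset (Fin (k + l))) (hI : I.card = k) (x : Fin (k + l)) :
    shuffle I hI x < k ↔ x ∈ I := by
  by_cases hx : x ∈ I
  · obtain ⟨a, rfl⟩ := exists_emb hI hx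
    simp [shuffle_emb]
  · obtain ⟨b, rfl⟩ := exists_emb_compl hI hx
    rw [shuffle_emb_compl]
    simp only [hx, iff_false]; omega

/-- A shuffle keeps the order inside `I` and inside its complement and places `I` first. So its
inversions are the pairs counted by `shufflePar`, whence `invPar_shuffle`. -/
theorem shuffle_inv_iff (I : Finset (Fin (k + l))) (hI : I.card = k) {x y : Fin (k + l)}
    (hxy : x < y) : shuffle I hI y < shuffle I hI x ↔ y ∈ I ∧ x ∉ I := by
  by_cases hx : x ∈ I <;> by_cases hy : y ∈ I
  · simp only [hx, hy, not_true, and_false, iff_false, not_lt]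
    obtain ⟨a, rfl⟩ := exists_emb hI hx
    obtain ⟨b, rfl⟩ := exists_emb hI hy
    rw [shuffle_emb, shuffle_emb]
    exact ((I.orderEmbOfFin hI).lt_iff_lt.1 hxy).le
  · simp only [hx, hy, false_and, iff_false, not_lt]
    have h1 := (shuffle_lt_iff I hI x).2 hx
    have h2 := (shuffle_lt_iff I hI y).not.2 hy
    omega
  · simp only [hx, hy, not_false_eq_true, and_self, iff_true]
    have h1 := (shuffle_lt_iff I hI y).2 hy
    have h2 := (shuffle_lt_iff I hI x).not.2 hx
    omega
  · simp only [hy, false_and, iff_false, not_lt]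
    obtain ⟨a, rfl⟩ := exists_emb_compl hI hx
    obtain ⟨b, rfl⟩ := exists_emb_compl hI hy
    rw [shuffle_emb_compl, shuffle_emb_compl]
    exact Nat.add_le_add_left ((Iᶜ.orderEmbOfFin (card_compl_of_add hI)).lt_iff_lt.1 hxy).le k

theorem invPar_shuffle (I : Finset (Fin (k + l))) (hI : I.card = k) (p : Fin (k + l) → ZMod 2) :
    invPar (k + l) (shuffle I hI) (extSeq 0 p) = shufflePar p I := by
  rw [invPar, Finset.sum_product_right, shufflePar, Finset.sum_range, ← Finset.sum_filter_add_sum_filter_not Finset.univ (· ∈ I)]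
  rw [Finset.filter_mem_eq_inter, Finset.univ_inter]
  -- The larger element of an inversion lies in `I`, so the terms with `y` outside `I` vanish.
  have h0 : ∀ y ∈ Finset.univ.filter (fun y : Fin (k + l) => ¬ y ∈ I),
      ∑ x ∈ Finset.range (k + l), (if x < (y : ℕ) ∧ shuffle I hI y < shuffle I hI x then
        extSeq 0 p x * extSeq 0 p y else 0) = 0 := by
    intro y hy
    rw [Finset.sum_range]
    refine Finset.sum_eq_zero fun x _ => if_neg ?_
    rintro ⟨h1, h2⟩
    rw [shuffle_inv_iff I hI h1] at h2
    simp at hy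
    exact hy h2.1
  rw [Finset.sum_eq_zero h0, add_zero]
  refine Finset.sum_congr rfl fun y hy => ?_
  rw [Finset.sum_range, Finset.sum_filter, ← Finset.sum_filter_add_sum_filter_not Finset.univ (· ∈ Iᶜ),
    Finset.filter_mem_eq_inter, Finset.univ_inter]
  rw [Finset.sum_eq_zero (s := Finset.univ.filter _), add_zero]
  · refine Finset.sum_congr rfl fun x hx => ?_
    by_cases hxy : x < y
    · rw [if_pos hxy, if_pos, extSeq_coe, extSeq_coe, mul_comm]
      exact ⟨hxy, (shuffle_inv_iff I hI hxy).2 ⟨hy, by simpa using hx⟩⟩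
    · rw [if_neg hxy, if_neg]
      exact fun h => hxy h.1
  · intro x hx
    refine if_neg ?_
    rintro ⟨h1, h2⟩
    rw [shuffle_inv_iff I hI h1] at h2
    simp at hx
    exact h2.2 hx

/-- The elements that a permutation moves to the first `k` places. -/
def firstSet (k l : ℕ) (σ : Equiv.Perm ℕ) : Finset (Fin (k + l)) :=
  Finset.univ.filter fun x => σ x < k

theorem mem_firstSet {σ : Equiv.Perm ℕ} {x : Fin (k + l)} : x ∈ firstSet k l σ ↔ σ x < k := by
  simp [firstSet]

theorem firstSet_shuffle (I : Finset (Fin (k + l))) (hI : I.card = k) :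
    firstSet k l (shuffle I hI) = I := by
  ext x; rw [mem_firstSet, shuffle_lt_iff]

/-- If `σ` and `τ` bring the same set to the first `k` places, then `σ * τ⁻¹` preserves these
places. The extra factor `ρ` serves two uses: a shuffle when fibres are compared, and `1` when the
block part is split off. -/
theorem firstSet_mul {σ τ ρ : Equiv.Perm ℕ} (hσ : σ ∈ permsOn (Finset.range (k + l)))
    (hτ : τ ∈ permsOn (Finset.range (k + l))) (h : firstSet k l σ = firstSet k l τ) (x : ℕ) :
    (σ * τ⁻¹ * ρ) x < k ↔ ρ x < k := by
  have key : ∀ y, σ y < k ↔ τ y < k := by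
    intro y
    rcases lt_or_ge y (k + l) with hy | hy
    · have := Finset.ext_iff.1 h ⟨y, hy⟩
      rwa [mem_firstSet, mem_firstSet] at this
    · rw [hσ y (by simpa using hy), hτ y (by simpa using hy)]
  rw [Equiv.Perm.mul_apply, Equiv.Perm.mul_apply, key]
  simp

theorem card_firstSet {σ : Equiv.Perm ℕ} (hσ : σ ∈ permsOn (Finset.range (k + l))) :
    (firstSet k l σ).card = k := by
  refine (Finset.card_bij (s := firstSet k l σ) (t := Finset.range k) (fun x _ => σ x) (fun x hx => by simpa using mem_firstSet.1 hx)
    (fun x _ y _ h => Fin.ext (σ.injective h)) fun b hb => ?_).trans (Finset.card_range k)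
  simp only [Finset.mem_range] at hb
  have := lt_of_permsOn (inv_mem hσ) (i := b) (by omega)
  exact ⟨⟨σ⁻¹ b, this⟩, mem_firstSet.2 (by simpa using hb), by simp⟩

/-- Right multiplication by `(shuffle J)⁻¹ * shuffle I` injects the fibre over `J` into the fibre
over `I`, so all fibres have the same size. There are $\binom{k+l}{k}$ of them, and together they
contain $(k+l)!$ permutations. -/
theorem card_fibre (I : Finset (Fin (k + l))) (hI : I.card = k) :
    ((permsOfFinset (Finset.range (k + l))).filter fun σ => firstSet k l σ = I).card =
      k.factorial * l.factorial := by
  have hconst : ∀ J ∈ Finset.powersetCard k (Finset.univ : Finset (Fin (k + l))),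
      ((permsOfFinset (Finset.range (k + l))).filter fun σ => firstSet k l σ = J).card =
      ((permsOfFinset (Finset.range (k + l))).filter fun σ => firstSet k l σ = I).card := by
    have hle : ∀ I J : Finset (Fin (k + l)), I.card = k → J.card = k →
        ((permsOfFinset (Finset.range (k + l))).filter fun σ => firstSet k l σ = J).card ≤
        ((permsOfFinset (Finset.range (k + l))).filter fun σ => firstSet k l σ = I).card := by
      intro I J hI hJ
      refine Finset.card_le_card_of_injOn (fun σ => σ * (shuffle J hJ)⁻¹ * shuffle I hI)
        (fun σ hσ => ?_) (fun _ _ _ _ h => mul_right_cancel (mul_right_cancel h))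
      simp only [Finset.coe_filter, Set.mem_ofPred_eq, mem_permsOfFinset] at hσ ⊢
      refine ⟨mul_mem (mul_mem hσ.1 (inv_mem (shuffle_mem J hJ))) (shuffle_mem I hI), ?_⟩
      ext x
      rw [mem_firstSet, firstSet_mul hσ.1 (shuffle_mem J hJ) (by rw [hσ.2, firstSet_shuffle]),
        shuffle_lt_iff]
    intro J hJ
    have hJ' := (Finset.mem_powersetCard.1 hJ).2
    exact le_antisymm (hle I J hI hJ') (hle J I hJ' hI)
  have hsum := Finset.card_eq_sum_card_fiberwise (f := firstSet k l)
    (s := permsOfFinset (Finset.range (k + l)))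
    (t := Finset.powersetCard k (Finset.univ : Finset (Fin (k + l)))) (fun σ hσ => by
      have := card_firstSet (mem_permsOfFinset.1 hσ)
      simpa using this)
  rw [Finset.sum_congr rfl hconst, Finset.sum_const, Finset.card_powersetCard, Finset.card_univ,
    Fintype.card_fin, card_perms_of_finset, Finset.card_range, smul_eq_mul,
    ← Nat.add_choose_mul_factorial_mul_factorial, mul_assoc,
    Nat.choose_symm_add] at hsum
  exact (Nat.eq_of_mul_eq_mul_left (Nat.choose_pos (Nat.le_add_left l k)) hsum).symm

/-- Up to a block permutation, which the projection absorbs, `σ` is the shuffle of `I`, whose graded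
sign is `shufflePar`. -/
theorem symProj₂_shuffle {n : ℕ} (p : Fin (k + l) → ZMod 2) (v : Fin (k + l) → VN n)
    (hv : ∀ i, IsHomog (p i) (v i)) (I : Finset (Fin (k + l))) (hI : I.card = k)
    {σ : Equiv.Perm ℕ} (hσ : σ ∈ permsOn (Finset.range (k + l))) (h : firstSet k l σ = I) :
    symProj₂ n k l (k + l) rfl (permT n (k + l) σ (pureT n (k + l) v)) =
      sgn (shufflePar p I) • (subprod v I hI ⊗ₜ[ℂ] subprod v Iᶜ (card_compl_of_add hI)) := by
  have hρ := shuffle_mem I hI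
  -- The factor `1` is the `ρ` of `firstSet_mul`.
  have e : σ = σ * (shuffle I hI)⁻¹ * 1 * shuffle I hI := by group
  have hm : σ * (shuffle I hI)⁻¹ * 1 ∈ permsOn (Finset.range (k + l)) :=
    mul_mem (mul_mem hσ (inv_mem hρ)) (one_mem _)
  rw [e, permT_mul hm hρ, LinearMap.comp_apply, ← LinearMap.comp_apply, symProj₂_permT_block rfl hm
    (fun x => (firstSet_mul (ρ := 1) hσ hρ (by rw [h, firstSet_shuffle]) x).symm), ← pureSeq_ext,
    permT_pureSeq hρ (isHomog_ext hv), map_smul, invPar_shuffle, symProj₂, LinearMap.comp_apply,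
    LinearEquiv.coe_coe, tcut_pureSeq, TensorProduct.map_tmul, symProj_pureSeq, symProj_pureSeq]
  congr 3
  · funext a
    rw [Function.comp_apply, ← shuffle_emb I hI a, Equiv.Perm.inv_def, Equiv.symm_apply_apply, extSeq_coe]
  · funext b
    rw [Function.comp_apply, ← shuffle_emb_compl I hI b, Equiv.Perm.inv_def, Equiv.symm_apply_apply, extSeq_coe]

/-- The symmetrizer is grouped by `firstSet`. All terms of a fibre agree, and their number cancels
the normalization of `symSplit`. -/
theorem symSplit_sprod {n : ℕ} (p : Fin (k + l) → ZMod 2) (v : Fin (k + l) → VN n)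
    (hv : ∀ i, IsHomog (p i) (v i)) :
    symSplit n k l (k + l) rfl (sprod v) =
      ∑ I : {I : Finset (Fin (k + l)) // I.card = k}, sgn (shufflePar p I.1) •
        (subprod v I.1 I.2 ⊗ₜ[ℂ] subprod v I.1ᶜ (card_compl_of_add I.2)) := by
  change ((k.factorial * l.factorial : ℕ) : ℂ)⁻¹ •
    symProj₂ n k l (k + l) rfl (symT n (k + l) (pureT n (k + l) v)) = _
  have hne : ((k.factorial * l.factorial : ℕ) : ℂ) ≠ 0 :=
    Nat.cast_ne_zero.2 (mul_ne_zero k.factorial_ne_zero l.factorial_ne_zero)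
  rw [inv_smul_eq_iff₀ hne, symT, LinearMap.sum_apply, map_sum, Finset.smul_sum,
    ← Finset.sum_fiberwise_of_maps_to (g := firstSet k l)
      (t := Finset.powersetCard k (Finset.univ : Finset (Fin (k + l)))) (fun σ hσ => by
        have := card_firstSet (mem_permsOfFinset.1 hσ)
        simpa using this)]
  symm
  refine Finset.sum_bij (fun I _ => I.1) (fun I _ => by simpa using I.2)
    (fun _ _ _ _ h => Subtype.ext h)
    (fun J hJ => ⟨⟨J, (Finset.mem_powersetCard.1 hJ).2⟩, Finset.mem_univ _, rfl⟩) fun I _ => ?_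
  rw [Finset.sum_congr rfl fun σ hσ => symProj₂_shuffle p v hv I.1 I.2
    (mem_permsOfFinset.1 (Finset.mem_filter.1 hσ).1) (Finset.mem_filter.1 hσ).2, Finset.sum_const,
    card_fibre I.1 I.2, Nat.cast_smul_eq_nsmul]

end Shuffle
end TypeQ
end

noncomputable section
namespace TypeQ

/-! ### The super tensor product of linear maps -/

section
set_option linter.unusedSectionVars false
variable {V W V' W' V'' W'' : Type}
  [AddCommGroup V] [Module ℂ V] [SuperSpace V]
  [AddCommGroup W] [Module ℂ W] [SuperSpace W]
  [AddCommGroup V'] [Module ℂ V'] [SuperSpace V']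
  [AddCommGroup W'] [Module ℂ W'] [SuperSpace W']
  [AddCommGroup V''] [Module ℂ V''] [SuperSpace V'']
  [AddCommGroup W''] [Module ℂ W''] [SuperSpace W'']

theorem superTensor_even_tmul (f : V →ₗ[ℂ] V') (g : W →ₗ[ℂ] W') {v : V} (hv : IsHomog 0 v) (w : W) :
    superTensor f g (v ⊗ₜ w) = f v ⊗ₜ g w := by
  unfold IsHomog at hv
  rw [sgn_zero, one_smul] at hv
  simp only [superTensor, LinearMap.add_apply, TensorProduct.map_tmul, LinearMap.comp_apply, hv]
  rw [← TensorProduct.tmul_add, ← LinearMap.add_apply, evenPart_add_oddPart]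

/-- On an odd first vector the Koszul sign amounts to conjugating `g` by the parity operator. This
form needs no homogeneity of `g`, which later computations rely on. -/
theorem superTensor_odd_tmul (f : V →ₗ[ℂ] V') (g : W →ₗ[ℂ] W') {v : V} (hv : IsHomog 1 v) (w : W) :
    superTensor f g (v ⊗ₜ w) = f v ⊗ₜ par (g (par w)) := by
  unfold IsHomog at hv
  rw [sgn_one, neg_one_smul] at hv
  simp only [superTensor, LinearMap.add_apply, TensorProduct.map_tmul, LinearMap.comp_apply, hv,
    map_neg, TensorProduct.neg_tmul, ← TensorProduct.tmul_neg]
  rw [← TensorProduct.tmul_add, evenPart_apply, oddPart_apply]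
  congr 1
  module

theorem add_superTensor (f f' : V →ₗ[ℂ] V') (g : W →ₗ[ℂ] W') :
    superTensor (f + f') g = superTensor f g + superTensor f' g := by
  simp only [superTensor, LinearMap.add_comp, TensorProduct.map_add_left]; abel

theorem smul_superTensor (z : ℂ) (f : V →ₗ[ℂ] V') (g : W →ₗ[ℂ] W') :
    superTensor (z • f) g = z • superTensor f g := by
  simp only [superTensor, LinearMap.smul_comp, TensorProduct.map_smul_left, smul_add]

/-- The super interchange law for linear maps; only the two maps that pass each other, `g` and `h`,
have to be homogeneous. -/
theorem superTensor_comp {p q : ZMod 2} (f : V' →ₗ[ℂ] V'') {g : W' →ₗ[ℂ] W''} {h : V →ₗ[ℂ] V'}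
    (k : W →ₗ[ℂ] W') (hg : HasPar p g) (hh : HasPar q h) :
    superTensor f g ∘ₗ superTensor h k = sgn (p * q) • superTensor (f ∘ₗ h) (g ∘ₗ k) := by
  have h11 : (1 + 1 : ZMod 2) = 0 := rfl
  refine tensor_homog_ext fun a b v w hv _ => ?_
  have hhv := hv.map hh
  simp only [LinearMap.comp_apply, LinearMap.smul_apply]
  have e : ∀ y, par (g (par y)) = sgn p • g y := fun y => by rw [hg, par_par]
  rcases eq_zero_or_one a with rfl | rfl <;> rcases eq_zero_or_one q with rfl | rfl
  · rw [add_zero] at hhv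
    rw [superTensor_even_tmul _ _ hv, superTensor_even_tmul _ _ hhv, superTensor_even_tmul _ _ hv,
      mul_zero, sgn_zero, one_smul]; rfl
  · rw [zero_add] at hhv
    rw [superTensor_even_tmul _ _ hv, superTensor_odd_tmul _ _ hhv, superTensor_even_tmul _ _ hv,
      mul_one, e, TensorProduct.tmul_smul]; rfl
  · rw [add_zero] at hhv
    rw [superTensor_odd_tmul _ _ hv, superTensor_odd_tmul _ _ hhv, superTensor_odd_tmul _ _ hv,
      mul_zero, sgn_zero, one_smul, par_par]; rfl
  · rw [h11] at hhv
    rw [superTensor_odd_tmul _ _ hv, superTensor_even_tmul _ _ hhv, superTensor_odd_tmul _ _ hv,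
      mul_one]
    simp only [LinearMap.comp_apply]
    rw [hg, TensorProduct.tmul_smul, smul_smul, sgn_mul_self, one_smul]

theorem superTensor_comp_left_even (f : V' →ₗ[ℂ] V'') {g : W' →ₗ[ℂ] W''} (h : V →ₗ[ℂ] V')
    (k : W →ₗ[ℂ] W') (hg : HasPar 0 g) :
    superTensor f g ∘ₗ superTensor h k = superTensor (f ∘ₗ h) (g ∘ₗ k) := by
  have h1 := superTensor_comp f (h := evenPart h) k hg (hasPar_evenPart h)
  have h2 := superTensor_comp f (h := oddPart h) k hg (hasPar_oddPart h)
  rw [zero_mul, sgn_zero, one_smul] at h1 h2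
  rw [← evenPart_add_oddPart h, add_superTensor, LinearMap.comp_add, h1, h2, LinearMap.comp_add,
    add_superTensor]

theorem superTensor_comp_right_even (f : V' →ₗ[ℂ] V'') (g : W' →ₗ[ℂ] W'') {h : V →ₗ[ℂ] V'}
    (k : W →ₗ[ℂ] W') (hh : HasPar 0 h) :
    superTensor f g ∘ₗ superTensor h k = superTensor (f ∘ₗ h) (g ∘ₗ k) := by
  have h1 := superTensor_comp f (g := evenPart g) k (hasPar_evenPart g) hh
  have h2 := superTensor_comp f (g := oddPart g) k (hasPar_oddPart g) hh
  rw [mul_zero, sgn_zero, one_smul] at h1 h2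
  rw [← evenPart_add_oddPart g, superTensor_add, LinearMap.add_comp, h1, h2, LinearMap.add_comp,
    superTensor_add]

/-- Only the first two vectors determine signs, so these are taken homogeneous and the third stays
arbitrary. If both are odd, the two conjugations of `h` by the parity operator cancel, which matches
the evenness of `v ⊗ w`. -/
theorem superTensor_assoc (f : V →ₗ[ℂ] V') (g : W →ₗ[ℂ] W') (h : V'' →ₗ[ℂ] W'') :
    (TensorProduct.assoc ℂ V' W' W'').toLinearMap ∘ₗ superTensor (superTensor f g) h =
      superTensor f (superTensor g h) ∘ₗ (TensorProduct.assoc ℂ V W V'').toLinearMap := by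
  have h11 : (1 + 1 : ZMod 2) = 0 := rfl
  refine TensorProduct.ext' fun t x => ?_
  suffices key : ((TensorProduct.assoc ℂ V' W' W'').toLinearMap ∘ₗ
      superTensor (superTensor f g) h) ∘ₗ (TensorProduct.mk ℂ (V ⊗[ℂ] W) V'').flip x =
      (superTensor f (superTensor g h) ∘ₗ (TensorProduct.assoc ℂ V W V'').toLinearMap) ∘ₗ
        (TensorProduct.mk ℂ (V ⊗[ℂ] W) V'').flip x from LinearMap.congr_fun key t
  refine tensor_homog_ext fun a b v w hv hw => ?_
  have hvw := isHomog_tmul hv hw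
  simp only [LinearMap.flip_apply, TensorProduct.mk_apply, LinearMap.comp_apply,
    LinearEquiv.coe_coe, TensorProduct.assoc_tmul]
  have hw1 : ∀ w : W, IsHomog 0 w → par w = w := fun w hw => by simpa [IsHomog] using hw
  have hw2 : ∀ w : W, IsHomog 1 w → par w = -w := fun w hw => by simpa [IsHomog] using hw
  rcases eq_zero_or_one a with rfl | rfl <;> rcases eq_zero_or_one b with rfl | rfl
  · rw [add_zero] at hvw
    rw [superTensor_even_tmul _ _ hvw, superTensor_even_tmul _ _ hv, superTensor_even_tmul _ _ hv,
      superTensor_even_tmul _ _ hw]; rfl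
  · rw [zero_add] at hvw
    rw [superTensor_odd_tmul _ _ hvw, superTensor_even_tmul _ _ hv, superTensor_even_tmul _ _ hv,
      superTensor_odd_tmul _ _ hw]; rfl
  · rw [add_zero] at hvw
    rw [superTensor_odd_tmul _ _ hvw, superTensor_odd_tmul _ _ hv, superTensor_odd_tmul _ _ hv,
      par_tmul, hw1 w hw, superTensor_even_tmul _ _ hw]; rfl
  · rw [h11] at hvw
    rw [superTensor_even_tmul _ _ hvw, superTensor_odd_tmul _ _ hv, superTensor_odd_tmul _ _ hv,
      par_tmul, hw2 w hw, TensorProduct.neg_tmul, map_neg (superTensor g h),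
      superTensor_odd_tmul _ _ hw]
    simp [TensorProduct.neg_tmul]

end

/-! ### Tensor products of symmetric powers along words -/

/-- Equal words have the same supermodule. -/
def castW (n : ℕ) {a b : Word} (h : a = b) : sword n a ≃ₗ[ℂ] sword n b :=
  h ▸ LinearEquiv.refl ℂ (sword n a)

theorem castW_cons {n : ℕ} (m : ℕ+) {a b : Word} (h : a = b) (h' : m :: a = m :: b) (s : Sym n m)
    (x : sword n a) : castW n h' (s ⊗ₜ x : Sym n m ⊗[ℂ] sword n a) = s ⊗ₜ[ℂ] castW n h x := by
  subst h; rfl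

theorem evenHom_castW (n : ℕ) {a b : Word} (h : a = b) :
    QMod.EvenHom (sword n a) (sword n b) (castW n h).toLinearMap := by
  subst h; exact QMod.EvenHom.id _

theorem evenHom_mu (n : ℕ) : ∀ a b : Word,
    QMod.EvenHom (QMod.tensor (sword n a) (sword n b)) (sword n (a ++ b)) (mu n a b).toLinearMap
  | [], b => QMod.evenHom_lid (sword n b)
  | m :: a, b => ((evenHom_mu n a b).lTensor (Sym n m)).comp
      (QMod.evenHom_assoc (Sym n m) (sword n a) (sword n b))

theorem mu_cons {n : ℕ} (m : ℕ+) (a b : Word) (s : Sym n m) (x : sword n a) (y : sword n b) :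
    mu n (m :: a) b ((s ⊗ₜ x) ⊗ₜ y) = s ⊗ₜ[ℂ] mu n a b (x ⊗ₜ y) := rfl

theorem mu_assoc_tmul {n : ℕ} : ∀ (a b c : Word) (x : sword n a) (y : sword n b) (z : sword n c),
    castW n (List.append_assoc a b c) (mu n (a ++ b) c (mu n a b (x ⊗ₜ y) ⊗ₜ z)) =
      mu n a (b ++ c) (x ⊗ₜ mu n b c (y ⊗ₜ z))
  | [], b, c, x, y, z => by
    change mu n b c ((TensorProduct.lid ℂ (sword n b) (x ⊗ₜ y)) ⊗ₜ z) =
      TensorProduct.lid ℂ (sword n (b ++ c)) (x ⊗ₜ mu n b c (y ⊗ₜ z))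
    rw [TensorProduct.lid_tmul, TensorProduct.lid_tmul, ← TensorProduct.smul_tmul', map_smul]
  | m :: a, b, c, x, y, z => by
    induction x using TensorProduct.induction_on with
    | zero => simp
    | add x x' hx hx' => simp only [TensorProduct.add_tmul, map_add, hx, hx']
    | tmul s x =>
      rw [mu_cons, mu_cons]
      change castW n _ (mu n (m :: (a ++ b)) c ((s ⊗ₜ mu n a b (x ⊗ₜ y)) ⊗ₜ z)) = _
      rw [mu_cons]
      refine (castW_cons m (List.append_assoc a b c) _ s _).trans ?_
      rw [mu_assoc_tmul a b c]

theorem mu_nil_tmul {n : ℕ} : ∀ (a : Word) (x : sword n a) (z : ℂ),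
    castW n (List.append_nil a) (mu n a [] (x ⊗ₜ z)) = z • x
  | [], x, z => by
    change x • z = z • x
    exact mul_comm (x : ℂ) z
  | m :: a, x, z => by
    induction x using TensorProduct.induction_on with
    | zero => simp
    | add x x' hx hx' => rw [TensorProduct.add_tmul, map_add, map_add, hx, hx', smul_add]
    | tmul s x =>
      rw [mu_cons]
      refine (castW_cons m (List.append_nil a) _ s _).trans ?_
      rw [mu_nil_tmul a, TensorProduct.tmul_smul]

/-! ### The functor on formal diagrams -/

/-- The tensor product of maps between the supermodules of words. -/
def wordTensor {n : ℕ} {a b c d : Word} (f : sword n a →ₗ[ℂ] sword n b)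
    (g : sword n c →ₗ[ℂ] sword n d) : sword n (a ++ c) →ₗ[ℂ] sword n (b ++ d) :=
  (mu n b d).toLinearMap ∘ₗ superTensor f g ∘ₗ (mu n a c).symm.toLinearMap

/-- The map of supermodules defined by a formal diagram. -/
def mapPre (n : ℕ) : {a b : Word} → Pre a b → (sword n a →ₗ[ℂ] sword n b)
  | _, _, .id h => (castW n h).toLinearMap
  | _, _, .comp g f => mapPre n g ∘ₗ mapPre n f
  | _, _, .tensor f g => wordTensor (mapPre n f) (mapPre n g)
  | _, _, .dot k => TensorProduct.map (symDot n k) LinearMap.id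
  | _, _, .merge k l => TensorProduct.map (symMul n k l (k + l : ℕ+) rfl) LinearMap.id ∘ₗ
      (TensorProduct.assoc ℂ (Sym n k) (Sym n l) ℂ).symm.toLinearMap
  | _, _, .split k l => (TensorProduct.assoc ℂ (Sym n k) (Sym n l) ℂ).toLinearMap ∘ₗ
      TensorProduct.map (symSplit n k l (k + l : ℕ+) rfl) LinearMap.id
  | _, _, .zero => 0
  | _, _, .add f g => mapPre n f + mapPre n g
  | _, _, .smul z f => z • mapPre n f

theorem wordTensor_mem_homGr {n : ℕ} {a b c d : Word} {f : sword n a →ₗ[ℂ] sword n b}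
    {g : sword n c →ₗ[ℂ] sword n d} {ε δ : ZMod 2} (hf : f ∈ QMod.homGr (sword n a) (sword n b) ε)
    (hg : g ∈ QMod.homGr (sword n c) (sword n d) δ) :
    wordTensor f g ∈ QMod.homGr (sword n (a ++ c)) (sword n (b ++ d)) (ε + δ) := by
  have := QMod.homGr_comp (evenHom_mu n b d).mem_homGr
    (QMod.homGr_comp (QMod.homGr_superTensor hf hg) (evenHom_mu n a c).symm.mem_homGr)
  rwa [add_zero, zero_add] at this

theorem QMod.homGr_map_id {n : ℕ} {M M' : QMod n} (N : QMod n) {ε : ZMod 2} {f : M →ₗ[ℂ] M'}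
    (hf : f ∈ QMod.homGr M M' ε) :
    TensorProduct.map f LinearMap.id ∈ QMod.homGr (QMod.tensor M N) (QMod.tensor M' N) ε := by
  have := QMod.homGr_superTensor hf (QMod.homGr_id N)
  rwa [superTensor_id, add_zero] at this

theorem mapPre_mem_homGr (n : ℕ) {a b : Word} {f : Pre a b} {ε : ZMod 2} (h : f.HasParity ε) :
    mapPre n f ∈ QMod.homGr (sword n a) (sword n b) ε := by
  induction h with
  | id h => exact (evenHom_castW n h).mem_homGr
  | comp _ _ h1 h2 => exact QMod.homGr_comp h1 h2
  | tensor _ _ h1 h2 => exact wordTensor_mem_homGr h1 h2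
  | dot k => exact QMod.homGr_map_id (QMod.trivial n) (symDot_mem_homGr n k)
  | merge k l =>
    have := QMod.homGr_comp (QMod.homGr_map_id (QMod.trivial n) (symMul_mem_homGr (n := n) (k := k)
      (l := l) (N := (k + l : ℕ+)) rfl))
      (QMod.evenHom_assoc (Sym n k) (Sym n l) (QMod.trivial n)).symm.mem_homGr
    rw [add_zero] at this
    exact this
  | split k l =>
    have := QMod.homGr_comp (QMod.evenHom_assoc (Sym n k) (Sym n l) (QMod.trivial n)).mem_homGr
      (QMod.homGr_map_id (QMod.trivial n) (symSplit_mem_homGr (n := n) (k := k)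
      (l := l) (N := (k + l : ℕ+)) rfl))
    rw [add_zero] at this
    exact this
  | zero => exact Submodule.zero_mem _
  | add _ _ h1 h2 => exact Submodule.add_mem _ h1 h2
  | smul z _ h => exact Submodule.smul_mem _ z h

section
variable {n : ℕ} {a b c d a' b' c' : Word}

theorem wordTensor_id (a b : Word) :
    wordTensor (LinearMap.id : sword n a →ₗ[ℂ] sword n a) (LinearMap.id : sword n b →ₗ[ℂ] _) =
      LinearMap.id := by
  rw [wordTensor, superTensor_id, TensorProduct.map_id]
  ext x; simp

theorem wordTensor_comp {p q : ZMod 2} (f : sword n b →ₗ[ℂ] sword n c)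
    {g : sword n b' →ₗ[ℂ] sword n c'} {h : sword n a →ₗ[ℂ] sword n b}
    (k : sword n a' →ₗ[ℂ] sword n b') (hg : HasPar p g) (hh : HasPar q h) :
    wordTensor f g ∘ₗ wordTensor h k = sgn (p * q) • wordTensor (f ∘ₗ h) (g ∘ₗ k) := by
  rw [wordTensor, wordTensor, wordTensor, ← LinearMap.comp_smul, ← LinearMap.smul_comp,
    ← superTensor_comp f k hg hh]
  ext x; simp

/-- Precomposing with the surjection `mu ∘ (mu ⊗ id)` reduces the claim to `superTensor_assoc`. The
coherence `hmu` relates the two ways of concatenating three words, and `mu` is even, so it moves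
through `superTensor` without signs. -/
theorem wordTensor_assoc (f : sword n a →ₗ[ℂ] sword n a') (g : sword n b →ₗ[ℂ] sword n b')
    (h : sword n c →ₗ[ℂ] sword n c') :
    (castW n (List.append_assoc a' b' c')).toLinearMap ∘ₗ wordTensor (wordTensor f g) h =
      wordTensor f (wordTensor g h) ∘ₗ (castW n (List.append_assoc a b c)).toLinearMap := by
  have hmu : ∀ a b c : Word, (castW n (List.append_assoc a b c)).toLinearMap ∘ₗ
      (mu n (a ++ b) c).toLinearMap ∘ₗ TensorProduct.map (mu n a b).toLinearMap LinearMap.id =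
      (mu n a (b ++ c)).toLinearMap ∘ₗ TensorProduct.map LinearMap.id (mu n b c).toLinearMap ∘ₗ
        (TensorProduct.assoc ℂ _ _ _).toLinearMap := fun a b c =>
    TensorProduct.ext_threefold fun x y z => mu_assoc_tmul a b c x y z
  have h1 : superTensor (wordTensor f g) h ∘ₗ
      TensorProduct.map (mu n a b).toLinearMap LinearMap.id =
      TensorProduct.map (mu n a' b').toLinearMap LinearMap.id ∘ₗ
        superTensor (superTensor f g) h := by
    rw [← superTensor_id, ← superTensor_id, superTensor_comp_right_even _ _ _ fun v =>
      by simpa using (evenHom_mu n a b).par v, superTensor_comp_left_even _ _ _ hasPar_id]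
    congr 1
    ext x; simp [wordTensor]
  have h2 : superTensor f (wordTensor g h) ∘ₗ
      TensorProduct.map LinearMap.id (mu n b c).toLinearMap =
      TensorProduct.map LinearMap.id (mu n b' c').toLinearMap ∘ₗ
        superTensor f (superTensor g h) := by
    have e1 : HasPar 0 (mu n b c).toLinearMap := fun v => by
      simpa using (evenHom_mu n b c).par v
    have e2 : HasPar 0 (mu n b' c').toLinearMap := fun v => by
      simpa using (evenHom_mu n b' c').par v
    rw [← superTensor_of_even _ e1, ← superTensor_of_even _ e2,
      superTensor_comp_right_even _ _ _ hasPar_id, superTensor_comp_left_even _ _ _ e2]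
    congr 1
    ext x; simp [wordTensor]
  have hs : Function.Surjective ((mu n (a ++ b) c).toLinearMap ∘ₗ
      TensorProduct.map (mu n a b).toLinearMap LinearMap.id) :=
    (mu n (a ++ b) c).surjective.comp
      (TensorProduct.map_surjective (mu n a b).surjective Function.surjective_id)
  rw [← LinearMap.cancel_right hs]
  have l1 : wordTensor (wordTensor f g) h ∘ₗ (mu n (a ++ b) c).toLinearMap =
      (mu n (a' ++ b') c').toLinearMap ∘ₗ superTensor (wordTensor f g) h := by
    ext x; simp [wordTensor]
  have l2 : wordTensor f (wordTensor g h) ∘ₗ (mu n a (b ++ c)).toLinearMap =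
      (mu n a' (b' ++ c')).toLinearMap ∘ₗ superTensor f (wordTensor g h) := by
    ext x; simp [wordTensor]
  calc _ = ((castW n (List.append_assoc a' b' c')).toLinearMap ∘ₗ (mu n (a' ++ b') c').toLinearMap ∘ₗ
        TensorProduct.map (mu n a' b').toLinearMap LinearMap.id) ∘ₗ
          superTensor (superTensor f g) h := by
        rw [LinearMap.comp_assoc, ← LinearMap.comp_assoc _ _ (wordTensor _ _), l1,
          LinearMap.comp_assoc, h1]
        simp only [LinearMap.comp_assoc]
    _ = (mu n a' (b' ++ c')).toLinearMap ∘ₗ (TensorProduct.map LinearMap.id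
          (mu n b' c').toLinearMap ∘ₗ superTensor f (superTensor g h)) ∘ₗ
          (TensorProduct.assoc ℂ _ _ _).toLinearMap := by
        rw [hmu]
        simp only [LinearMap.comp_assoc]
        rw [superTensor_assoc]
    _ = _ := by
        rw [← h2, LinearMap.comp_assoc _ _ (wordTensor f (wordTensor g h)), hmu a b c,
          ← LinearMap.comp_assoc _ _ (wordTensor f (wordTensor g h)), l2]
        rfl

theorem wordTensor_unit_left (f : sword n a →ₗ[ℂ] sword n b) :
    wordTensor (LinearMap.id : sword n [] →ₗ[ℂ] sword n []) f = f := by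
  refine LinearMap.ext fun x => ?_
  let _ := (QMod.trivial n).super
  have h : IsHomog 0 (1 : ℂ) := by
    unfold IsHomog; rw [sgn_zero, one_smul]; rfl
  have e := superTensor_even_tmul (LinearMap.id : ℂ →ₗ[ℂ] ℂ) f h x
  change TensorProduct.lid ℂ (sword n b) (superTensor (LinearMap.id : ℂ →ₗ[ℂ] ℂ) f
    ((TensorProduct.lid ℂ (sword n a)).symm x)) = f x
  rw [TensorProduct.lid_symm_apply, e, LinearMap.id_apply, TensorProduct.lid_tmul, one_smul]

theorem wordTensor_unit_right (f : sword n a →ₗ[ℂ] sword n b) :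
    (castW n (List.append_nil b)).toLinearMap ∘ₗ
      wordTensor f (LinearMap.id : sword n [] →ₗ[ℂ] sword n []) =
      f ∘ₗ (castW n (List.append_nil a)).toLinearMap := by
  rw [← LinearMap.cancel_right (mu n a []).surjective]
  refine TensorProduct.ext' fun x z => ?_
  simp only [LinearMap.comp_apply, LinearEquiv.coe_coe, wordTensor, LinearEquiv.symm_apply_apply,
    superTensor_id, TensorProduct.map_tmul, LinearMap.id_apply]
  rw [mu_nil_tmul, mu_nil_tmul, map_smul]

end
end TypeQ
end

noncomputable section
namespace TypeQ

/-! ### Lifting webs to tensor powers -/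

/-- The sum of the labels of a word. -/
def wsum : Word → ℕ
  | [] => 0
  | m :: a => m + wsum a

theorem wsum_append : ∀ a b : Word, wsum (a ++ b) = wsum a + wsum b
  | [], b => (Nat.zero_add _).symm
  | m :: a, b => by rw [List.cons_append, wsum, wsum, wsum_append a b, Nat.add_assoc]

theorem wsum_strand : ∀ k : ℕ, wsum (strand k) = k
  | 0 => rfl
  | _ + 1 => rfl

/-- The projection `V^{⊗N} → S^{a_1}(V) ⊗ ⋯ ⊗ S^{a_r}(V)`. -/
def wordProj (n : ℕ) : (a : Word) → (N : ℕ) → wsum a = N → (T n N →ₗ[ℂ] sword n a)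
  | [], _, h => (castT n h.symm).toLinearMap
  | m :: a, N, h => TensorProduct.map (symProj n m) (wordProj n a (wsum a) rfl) ∘ₗ
      (tcut n m (wsum a) N h).toLinearMap

theorem wordProj_surjective (n : ℕ) : ∀ (a : Word) (N : ℕ) (h : wsum a = N),
    Function.Surjective (wordProj n a N h)
  | [], _, h => (castT n h.symm).surjective
  | m :: a, N, h => (TensorProduct.map_surjective (symProj_surjective n m)
      (wordProj_surjective n a _ rfl)).comp (tcut n m (wsum a) N h).surjective

theorem evenHom_wordProj (n : ℕ) : ∀ (a : Word) (N : ℕ) (h : wsum a = N),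
    QMod.EvenHom (T n N) (sword n a) (wordProj n a N h)
  | [], _, h => evenHom_castT n h.symm
  | m :: a, N, h => ((evenHom_symProj n m).map (evenHom_wordProj n a _ rfl)).comp
      (evenHom_tcut n m (wsum a) N h)

theorem wordProj_nil_pureSeq {n N : ℕ} (h : 0 = N) (v : ℕ → VN n) :
    wordProj n [] N h (pureSeq n N v) = (1 : ℂ) := castT_pureSeq h.symm v

theorem wordProj_cons_pureSeq {n N L : ℕ} (m : ℕ+) (a : Word) (h : wsum (m :: a) = N)
    (ha : wsum a = L) (v : ℕ → VN n) :
    wordProj n (m :: a) N h (pureSeq n N v) =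
      symProj n m (pureSeq n m v) ⊗ₜ[ℂ] wordProj n a L ha (pureSeq n L fun i => v (m + i)) := by
  subst ha
  exact (congrArg (TensorProduct.map (symProj n m) (wordProj n a (wsum a) rfl))
    (tcut_pureSeq (M := m) (r := wsum a) h v)).trans (TensorProduct.map_tmul _ _ _ _)

theorem wordProj_append_pureSeq {n : ℕ} : ∀ {M L N : ℕ} (a c : Word) (ha : wsum a = M)
    (hc : wsum c = L) (h : wsum (a ++ c) = N) (v : ℕ → VN n),
    wordProj n (a ++ c) N h (pureSeq n N v) = mu n a c (wordProj n a M ha (pureSeq n M v) ⊗ₜ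
      wordProj n c L hc (pureSeq n L fun i => v (M + i)))
  | M, L, N, [], c, ha, hc, h, v => by
    have hM : M = 0 := ha.symm
    subst hM
    have hL : L = N := hc.symm.trans h
    subst hL
    refine Eq.trans ?_ (congrArg (fun z : ℂ => TensorProduct.lid ℂ (sword n c)
      (z ⊗ₜ[ℂ] wordProj n c L hc (pureSeq n L fun i => v (0 + i))))
      (wordProj_nil_pureSeq ha v)).symm
    simp only [TensorProduct.lid_tmul, one_smul, Nat.zero_add]
    rfl
  | M, L, N, m :: a, c, ha, hc, h, v => by
    rw [wordProj_cons_pureSeq m a ha rfl, mu_cons]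
    refine (wordProj_cons_pureSeq m (a ++ c) h (wsum_append a c) v).trans ?_
    rw [wordProj_append_pureSeq a c rfl hc]
    congr 4
    have : M = m + wsum a := ha.symm
    subst this
    simp only [Nat.add_assoc]

theorem wordProj_append {n M L N : ℕ} (a c : Word) (ha : wsum a = M) (hc : wsum c = L)
    (hN : M + L = N) (h : wsum (a ++ c) = N) :
    wordProj n (a ++ c) N h = (mu n a c).toLinearMap ∘ₗ
      TensorProduct.map (wordProj n a M ha) (wordProj n c L hc) ∘ₗ
      (tcut n M L N hN).toLinearMap :=
  T_pure_ext fun v => by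
    simp only [LinearMap.comp_apply, LinearEquiv.coe_coe]
    rw [tcut_pureSeq, TensorProduct.map_tmul, wordProj_append_pureSeq a c ha hc]

theorem wordProj_castW {n N : ℕ} {a b : Word} (h : a = b) (ha : wsum a = N) (hb : wsum b = N) :
    (castW n h).toLinearMap ∘ₗ wordProj n a N ha = wordProj n b N hb := by
  subst h; rfl

/-- The map defined by the diagram `f` is induced by the operator `A` on the tensor power. -/
structure Lift (n N : ℕ) {a b : Word} (f : Pre a b) (A : T n N →ₗ[ℂ] T n N) : Prop where
  src : wsum a = N
  tgt : wsum b = N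
  comm : mapPre n f ∘ₗ wordProj n a N src = wordProj n b N tgt ∘ₗ A

section
variable {n M L N : ℕ} {a b c d : Word}

theorem lift_id (h : a = b) (ha : wsum a = N) : Lift n N (.id h) LinearMap.id :=
  ⟨ha, h ▸ ha, wordProj_castW h ha _⟩

theorem Lift.comp {g : Pre b c} {f : Pre a b} {A B : T n N →ₗ[ℂ] T n N} (hg : Lift n N g B)
    (hf : Lift n N f A) : Lift n N (g ⊚ f) (B ∘ₗ A) :=
  ⟨hf.src, hg.tgt, by
    rw [mapPre, LinearMap.comp_assoc, hf.comm, ← LinearMap.comp_assoc, hg.comm,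
      LinearMap.comp_assoc]⟩

/-- A lift matters only modulo the kernel of the projection of its target. This freedom turns
symmetrizers into short sums of transpositions. -/
theorem Lift.congr {f : Pre a b} {A A' : T n N →ₗ[ℂ] T n N} (hf : Lift n N f A)
    (h : ∀ hb, wordProj n b N hb ∘ₗ A = wordProj n b N hb ∘ₗ A') : Lift n N f A' :=
  ⟨hf.src, hf.tgt, by rw [hf.comm, h]⟩

/-- The projections are even and compatible with cutting, so the operator `C` only has to correspond
to `A ⊗ B` under the cut. -/
theorem Lift.tensor {f : Pre a b} {g : Pre c d} {A : T n M →ₗ[ℂ] T n M} {B : T n L →ₗ[ℂ] T n L}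
    {C : T n N →ₗ[ℂ] T n N} (hf : Lift n M f A) (hg : Lift n L g B) (hN : M + L = N)
    (hC : (tcut n M L N hN).toLinearMap ∘ₗ C =
      superTensor A B ∘ₗ (tcut n M L N hN).toLinearMap) : Lift n N (f ⊠ g) C := by
  have h1 : wsum (a ++ c) = N := by rw [wsum_append, hf.src, hg.src, hN]
  have h2 : wsum (b ++ d) = N := by rw [wsum_append, hf.tgt, hg.tgt, hN]
  refine ⟨h1, h2, ?_⟩
  have ev : ∀ (a : Word) (N : ℕ) (h : wsum a = N), HasPar 0 (wordProj n a N h) := fun a N h v => by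
    simpa using (evenHom_wordProj n a N h).par v
  rw [wordProj_append a c hf.src hg.src hN, wordProj_append b d hf.tgt hg.tgt hN, mapPre,
    LinearMap.comp_assoc, LinearMap.comp_assoc, hC, ← superTensor_of_even _ (ev _ _ _),
    ← superTensor_of_even _ (ev _ _ _), ← LinearMap.comp_assoc _ _ (superTensor _ _),
    superTensor_comp_left_even _ _ _ (ev _ _ _), ← hf.comm, ← hg.comm,
    ← superTensor_comp_right_even _ _ _ (ev _ _ _), wordTensor]
  ext x; simp

theorem Lift.add {f g : Pre a b} {A B : T n N →ₗ[ℂ] T n N} (hf : Lift n N f A)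
    (hg : Lift n N g B) : Lift n N (f ⊹ g) (A + B) :=
  ⟨hf.src, hf.tgt, by rw [mapPre, LinearMap.add_comp, hf.comm, hg.comm, LinearMap.comp_add]⟩

theorem Lift.smul {f : Pre a b} {A : T n N →ₗ[ℂ] T n N} (z : ℂ) (hf : Lift n N f A) :
    Lift n N (z ⊡ f) (z • A) :=
  ⟨hf.src, hf.tgt, by rw [mapPre, LinearMap.smul_comp, hf.comm, LinearMap.comp_smul]⟩

theorem lift_zero (ha : wsum a = N) (hb : wsum b = N) : Lift n N (.zero : Pre a b) 0 :=
  ⟨ha, hb, by rw [mapPre, LinearMap.zero_comp, LinearMap.comp_zero]⟩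

/-- The projection of the source is surjective, so an equality of maps between products of symmetric
powers becomes an identity between operators on `V^{⊗N}`, modulo the projection of the target. The
web relations specific to type Q are verified in this way. -/
theorem Lift.mapPre_eq {f g : Pre a b} {A B : T n N →ₗ[ℂ] T n N} (hf : Lift n N f A)
    (hg : Lift n N g B) (h : ∀ hb, wordProj n b N hb ∘ₗ A = wordProj n b N hb ∘ₗ B) :
    mapPre n f = mapPre n g := by
  rw [← LinearMap.cancel_right (wordProj_surjective n a N hf.src), hf.comm, hg.comm, h]

theorem Lift.mapPre_eq' {f g : Pre a b} {A : T n N →ₗ[ℂ] T n N} (hf : Lift n N f A)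
    (hg : Lift n N g A) : mapPre n f = mapPre n g := hf.mapPre_eq hg fun _ => rfl

/-! ### Invariance of the projections under permutations -/

theorem wordProj_append_permT_left {σ : Equiv.Perm ℕ} (hσ : σ ∈ permsOn (Finset.range M))
    (ha : wsum a = M) (h : wordProj n a M ha ∘ₗ permT n M σ = wordProj n a M ha)
    (hN : wsum (a ++ c) = N) :
    wordProj n (a ++ c) N hN ∘ₗ permT n N σ = wordProj n (a ++ c) N hN := by
  rw [wordProj_append a c ha rfl (by rw [← hN, wsum_append, ha]), LinearMap.comp_assoc,
    LinearMap.comp_assoc, tcut_permT_left _ hσ, ← LinearMap.comp_assoc (tcut _ _ _ _ _).toLinearMap,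
    ← TensorProduct.map_comp, h, LinearMap.comp_id]

theorem wordProj_append_permT_right (ha : wsum a = M) (hc : wsum c = L)
    (h : ∀ σ ∈ permsOn (Finset.range L), wordProj n c L hc ∘ₗ permT n L σ = wordProj n c L hc)
    (hN : wsum (a ++ c) = N) {σ : Equiv.Perm ℕ} (hσ : σ ∈ permsOn (Finset.Ico M N)) :
    wordProj n (a ++ c) N hN ∘ₗ permT n N σ = wordProj n (a ++ c) N hN := by
  have hle : permsOn (Finset.Ico M N) ≤ permsOn (Finset.range N) :=
    permsOn_mono fun x hx => by simp at hx ⊢; omega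
  have hML : M + L = N := by rw [← hN, wsum_append, ha, hc]
  revert σ hσ
  refine @permsOn_Ico_induction _ _ _ ?_ ?_ ?_
  · rw [permT_one]; rfl
  · intro σ hσ τ hτ h1 h2
    rw [permT_mul (hle hσ) (hle hτ), ← LinearMap.comp_assoc, h1, h2]
  · intro i hi hiN
    obtain ⟨j, rfl⟩ := Nat.exists_eq_add_of_le hi
    rw [add_assoc, wordProj_append a c ha hc hML, LinearMap.comp_assoc, LinearMap.comp_assoc,
      tcut_permT_swap hML (by omega) (by omega),
      ← LinearMap.comp_assoc (tcut _ _ _ _ _).toLinearMap, ← TensorProduct.map_comp,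
      h _ (swap_permsOn_range (by omega)), LinearMap.comp_id]

theorem wordProj_strand_permT : ∀ {k : ℕ} (hk : wsum (strand k) = k) {σ : Equiv.Perm ℕ},
    σ ∈ permsOn (Finset.range k) →
    wordProj n (strand k) k hk ∘ₗ permT n k σ = wordProj n (strand k) k hk
  | 0, hk, σ, hσ => by
    have : σ = 1 := Equiv.ext fun x => hσ x (by simp)
    rw [this, permT_one]; rfl
  | k + 1, hk, σ, hσ => by
    change (TensorProduct.map (symProj n (k + 1)) (wordProj n [] 0 rfl) ∘ₗ
      (tcut n (k + 1) 0 (k + 1) rfl).toLinearMap) ∘ₗ permT n (k + 1) σ =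
      TensorProduct.map (symProj n (k + 1)) (wordProj n [] 0 rfl) ∘ₗ
      (tcut n (k + 1) 0 (k + 1) rfl).toLinearMap
    rw [LinearMap.comp_assoc, tcut_permT_left _ hσ, ← LinearMap.comp_assoc,
      ← TensorProduct.map_comp, symProj_permT hσ, LinearMap.comp_id]

theorem wordProj_strands_permT_left {k l : ℕ} (h : wsum (strand k ++ strand l) = N)
    {σ : Equiv.Perm ℕ} (hσ : σ ∈ permsOn (Finset.range k)) :
    wordProj n (strand k ++ strand l) N h ∘ₗ permT n N σ =
      wordProj n (strand k ++ strand l) N h :=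
  wordProj_append_permT_left hσ (wsum_strand k) (wordProj_strand_permT _ hσ) h

theorem wordProj_strands_permT_right {k l : ℕ} (h : wsum (strand k ++ strand l) = N)
    {σ : Equiv.Perm ℕ} (hσ : σ ∈ permsOn (Finset.Ico k N)) :
    wordProj n (strand k ++ strand l) N h ∘ₗ permT n N σ =
      wordProj n (strand k ++ strand l) N h :=
  wordProj_append_permT_right (wsum_strand k) (wsum_strand l)
    (fun _ hσ => wordProj_strand_permT _ hσ) h hσ

/-! ### Lifts of the generators -/

theorem map_sum_left {ι A B C D : Type} [AddCommGroup A] [Module ℂ A] [AddCommGroup B]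
    [Module ℂ B] [AddCommGroup C] [Module ℂ C] [AddCommGroup D] [Module ℂ D] (s : Finset ι)
    (f : ι → A →ₗ[ℂ] B) (g : C →ₗ[ℂ] D) :
    TensorProduct.map (∑ i ∈ s, f i) g = ∑ i ∈ s, TensorProduct.map (f i) g := by
  ext x y
  simp [TensorProduct.sum_tmul]

theorem superTensor_tensorPower_id {k l : ℕ} (f : T n k →ₗ[ℂ] T n k) :
    superTensor f (LinearMap.id : T n l →ₗ[ℂ] T n l) = TensorProduct.map f LinearMap.id :=
  superTensor_id f

theorem lift_dotN : ∀ k : ℕ, Lift n k (Pre.dotN k) (clifSum n k (Finset.range k))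
  | 0 => by
    have := lift_zero (n := n) (N := 0) (a := strand 0) (b := strand 0) rfl rfl
    rwa [show (0 : T n 0 →ₗ[ℂ] T n 0) = clifSum n 0 (Finset.range 0) from rfl] at this
  | k + 1 => by
    refine ⟨rfl, rfl, ?_⟩
    change TensorProduct.map (symDot n (k + 1)) LinearMap.id ∘ₗ
      (TensorProduct.map (symProj n (k + 1)) (wordProj n [] 0 rfl) ∘ₗ
      (tcut n (k + 1) 0 (k + 1) rfl).toLinearMap) =
      (TensorProduct.map (symProj n (k + 1)) (wordProj n [] 0 rfl) ∘ₗ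
      (tcut n (k + 1) 0 (k + 1) rfl).toLinearMap) ∘ₗ clifSum n (k + 1) (Finset.range (k + 1))
    have e : (tcut n (k + 1) 0 (k + 1) rfl).toLinearMap ∘ₗ
        clifSum n (k + 1) (Finset.range (k + 1)) =
        TensorProduct.map (clifSum n (k + 1) (Finset.range (k + 1))) LinearMap.id ∘ₗ
          (tcut n (k + 1) 0 (k + 1) rfl).toLinearMap := by
      rw [clifSum, linearMap_comp_sum, map_sum_left, linearMap_sum_comp]
      refine Finset.sum_congr rfl fun i hi => ?_
      refine (tcut_clif_left (M := k + 1) (r := 0) rfl (by simpa using hi)).trans ?_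
      rw [superTensor_tensorPower_id]
    rw [LinearMap.comp_assoc, e, ← LinearMap.comp_assoc, ← LinearMap.comp_assoc,
      ← TensorProduct.map_comp, ← TensorProduct.map_comp, symDot_comp, LinearMap.comp_id,
      LinearMap.id_comp]

end
end TypeQ
end

noncomputable section
namespace TypeQ
variable {n M L N : ℕ} {a b c d : Word}

/-! ### Lifts of merges and splits -/

theorem wordProj_pair_pureSeq (k l : ℕ+) (v : ℕ → VN n) :
    wordProj n [k, l] ((k : ℕ) + l) rfl (pureSeq n ((k : ℕ) + l) v) =
      symProj n k (pureSeq n k v) ⊗ₜ[ℂ]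
        (symProj n l (pureSeq n l fun i => v (k + i)) ⊗ₜ[ℂ] (1 : ℂ)) := by
  refine (wordProj_cons_pureSeq k [l] rfl rfl v).trans ?_
  refine congrArg (fun z => symProj n k (pureSeq n k v) ⊗ₜ[ℂ] z) ?_
  refine (wordProj_cons_pureSeq l [] rfl rfl _).trans ?_
  exact congrArg (fun z : ℂ => symProj n l (pureSeq n l fun i => v (k + i)) ⊗ₜ[ℂ] z)
    (wordProj_nil_pureSeq rfl _)

theorem wordProj_single_pureSeq (k : ℕ+) (v : ℕ → VN n) :
    wordProj n [k] k rfl (pureSeq n k v) = symProj n k (pureSeq n k v) ⊗ₜ[ℂ] (1 : ℂ) := by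
  refine (wordProj_cons_pureSeq k [] rfl rfl v).trans ?_
  exact congrArg (fun z : ℂ => symProj n k (pureSeq n k v) ⊗ₜ[ℂ] z) (wordProj_nil_pureSeq rfl _)

theorem wordProj_pair (k l : ℕ+) :
    wordProj n [k, l] ((k : ℕ) + l) rfl = (TensorProduct.assoc ℂ (Sym n k) (Sym n l) ℂ) ∘ₗ
      (TensorProduct.rid ℂ (Sym n k ⊗[ℂ] Sym n l)).symm.toLinearMap ∘ₗ
      symProj₂ n k l ((k : ℕ) + l) rfl := by
  refine T_pure_ext fun v => ?_
  rw [wordProj_pair_pureSeq, symProj₂]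
  simp only [LinearMap.comp_apply, LinearEquiv.coe_coe]
  rw [tcut_pureSeq, TensorProduct.map_tmul]
  simp

theorem wordProj_single (k : ℕ+) :
    wordProj n [k] k rfl = (TensorProduct.rid ℂ (Sym n k)).symm.toLinearMap ∘ₗ symProj n k := by
  refine T_pure_ext fun v => ?_
  rw [wordProj_single_pureSeq]
  simp

/-- Multiplying the classes of two tensors gives the class of their concatenation, so nothing
happens on the tensor power. -/
theorem lift_merge (k l : ℕ+) : Lift n ((k : ℕ) + l) (.merge k l) LinearMap.id := by
  refine ⟨rfl, rfl, ?_⟩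
  rw [wordProj_pair]
  refine Eq.trans ?_ (wordProj_single (n := n) (k + l)).symm
  rw [mapPre]
  refine T_pure_ext fun v => ?_
  simp only [LinearMap.comp_apply, LinearEquiv.coe_coe, TensorProduct.rid_symm_apply,
    LinearEquiv.symm_apply_apply, TensorProduct.map_tmul, LinearMap.id_apply]
  exact congrArg (fun z => z ⊗ₜ[ℂ] (1 : ℂ)) (LinearMap.congr_fun (symMul_comp (n := n)
    (rfl : (k : ℕ) + l = k + l)) _)

theorem lift_split (k l : ℕ+) : Lift n ((k : ℕ) + l) (.split k l)
    ((((k : ℕ).factorial * (l : ℕ).factorial : ℕ) : ℂ)⁻¹ • symT n ((k : ℕ) + l)) := by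
  refine ⟨rfl, rfl, ?_⟩
  rw [wordProj_pair]
  refine (congrArg (fun z => mapPre n (.split k l) ∘ₗ z) (wordProj_single (n := n) (k + l))).trans ?_
  rw [mapPre]
  refine LinearMap.ext fun v => ?_
  simp only [LinearMap.comp_apply, LinearEquiv.coe_coe, TensorProduct.rid_symm_apply,
    TensorProduct.map_tmul, LinearMap.id_apply]
  refine congrArg (fun z => (TensorProduct.assoc ℂ (Sym n k) (Sym n l) ℂ) (z ⊗ₜ[ℂ] (1 : ℂ))) ?_
  refine (LinearMap.congr_fun (symSplit_comp (n := n) (rfl : (k : ℕ) + l = k + l)) v).trans ?_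
  exact (map_smul (symProj₂ n k l ((k : ℕ) + l) rfl) _ (symT n ((k : ℕ) + l) v)).symm

theorem lift_mergeN : ∀ (k l m : ℕ) (h : k + l = m), Lift n m (Pre.mergeN k l m h) LinearMap.id
  | 0, l, m, h => lift_id _ ((wsum_append _ _).trans (by rw [wsum_strand, wsum_strand, h]))
  | k + 1, 0, m, h => lift_id _ ((wsum_append _ _).trans (by rw [wsum_strand, wsum_strand, h]))
  | k + 1, l + 1, m, h => by
    subst h
    exact Lift.comp (B := LinearMap.id) (A := LinearMap.id) (lift_id _ rfl)
      (lift_merge k.succPNat l.succPNat)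

theorem wordProj_strand_append_zero_permT {k l m : ℕ} (h : k + l = m) (h0 : k = 0 ∨ l = 0)
    (hm : wsum (strand k ++ strand l) = m) {σ : Equiv.Perm ℕ}
    (hσ : σ ∈ permsOn (Finset.range m)) :
    wordProj n (strand k ++ strand l) m hm ∘ₗ permT n m σ =
      wordProj n (strand k ++ strand l) m hm := by
  rcases h0 with rfl | rfl
  · exact wordProj_strands_permT_right hm (by rwa [← Finset.range_eq_Ico])
  · exact wordProj_strands_permT_left hm (by rwa [show k = m from h])

/-- If a label is zero, the split is an identity. The same formula still works, because the target
is then a single symmetric power, on which the symmetrizer acts as $m!$. -/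
theorem lift_splitN : ∀ (k l m : ℕ) (h : k + l = m), Lift n m (Pre.splitN k l m h)
    (((k.factorial * l.factorial : ℕ) : ℂ)⁻¹ • symT n m)
  | 0, l, m, h => by
    obtain rfl : l = m := by omega
    refine (lift_id (N := l) _ (wsum_strand l)).congr fun hb => ?_
    rw [LinearMap.comp_smul, comp_symT fun σ hσ =>
      wordProj_strand_append_zero_permT h (Or.inl rfl) hb hσ, smul_smul, LinearMap.comp_id,
      Nat.factorial_zero, one_mul, inv_mul_cancel₀, one_smul]
    exact_mod_cast l.factorial_ne_zero
  | k + 1, 0, m, h => by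
    subst h
    refine (lift_id (N := k + 1) _ (wsum_strand _)).congr fun hb => ?_
    rw [LinearMap.comp_smul, comp_symT fun σ hσ =>
      wordProj_strand_append_zero_permT rfl (Or.inr rfl) hb hσ, smul_smul, LinearMap.comp_id,
      Nat.factorial_zero, mul_one, inv_mul_cancel₀, one_smul]
    exact_mod_cast (k + 1).factorial_ne_zero
  | k + 1, l + 1, m, h => by
    subst h
    exact Lift.comp (A := LinearMap.id) (lift_split k.succPNat l.succPNat) (lift_id _ rfl)

/-- Coset decomposition: `σ` is determined by `j = σ⁻¹ x` and by `σ * swap x j`, which fixes `x` and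
so permutes only `s`. -/
theorem permsOfFinset_insert_sum {X : Type} [AddCommMonoid X] {s : Finset ℕ} {x : ℕ} (hx : x ∉ s)
    (F : Equiv.Perm ℕ → X) :
    ∑ σ ∈ permsOfFinset (insert x s), F σ =
      ∑ j ∈ insert x s, ∑ τ ∈ permsOfFinset s, F (τ * Equiv.swap x j) := by
  rw [← Finset.sum_product']
  refine Finset.sum_bij' (fun σ _ => (σ⁻¹ x, σ * Equiv.swap x (σ⁻¹ x)))
    (fun p _ => p.2 * Equiv.swap x p.1) ?_ ?_ ?_ ?_ ?_
  · intro σ hσ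
    have hσ' := mem_permsOfFinset.1 hσ
    have h1 : σ⁻¹ x ∈ insert x s := (permsOn_mem (inv_mem hσ')).2 (Finset.mem_insert_self x s)
    rw [Finset.mem_product]
    refine ⟨h1, mem_permsOfFinset.2 fun y hy => ?_⟩
    have h2 : (σ * Equiv.swap x (σ⁻¹ x)) ∈ permsOn (insert x s) :=
      mul_mem hσ' (swap_mem_permsOn (Finset.mem_insert_self x s) h1)
    by_cases hyx : y = x
    · subst hyx; simp
    · exact h2 y (by simp [hyx, hy])
  · rintro ⟨j, τ⟩ h
    rw [Finset.mem_product] at h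
    exact mem_permsOfFinset.2 (mul_mem (permsOn_mono (Finset.subset_insert x s)
      (mem_permsOfFinset.1 h.2)) (swap_mem_permsOn (Finset.mem_insert_self x s) h.1))
  · intro σ _
    simp [mul_assoc]
  · rintro ⟨j, τ⟩ h
    rw [Finset.mem_product] at h
    have h2 : τ x = x := mem_permsOfFinset.1 h.2 x hx
    have h3 : (τ * Equiv.swap x j)⁻¹ x = j := by
      rw [Equiv.Perm.inv_eq_iff_eq]; simp [h2]
    simp only [h3, mul_assoc, Equiv.swap_mul_self, mul_one]
  · intro σ _
    simp [mul_assoc]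

/-- Symmetrizing over one more point, modulo the permutations of the other points. -/
theorem comp_symT_insert {X : Type} [AddCommGroup X] [Module ℂ X] {s : Finset ℕ} {x : ℕ}
    (hx : x ∉ s) (hs : insert x s = Finset.range N) {f : T n N →ₗ[ℂ] X}
    (h : ∀ σ ∈ permsOn s, f ∘ₗ permT n N σ = f) :
    f ∘ₗ symT n N = (s.card.factorial : ℂ) •
      f ∘ₗ ∑ j ∈ Finset.range N, permT n N (Equiv.swap x j) := by
  rw [symT, ← hs, permsOfFinset_insert_sum hx, linearMap_comp_sum, linearMap_comp_sum,
    Finset.smul_sum]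
  refine Finset.sum_congr rfl fun j hj => ?_
  rw [linearMap_comp_sum, ← card_perms_of_finset, Nat.cast_smul_eq_nsmul, ← Finset.sum_const]
  refine Finset.sum_congr rfl fun τ hτ => ?_
  have hτ' := mem_permsOfFinset.1 hτ
  rw [permT_mul (hs ▸ permsOn_mono (Finset.subset_insert x s) hτ')
    (hs ▸ swap_mem_permsOn (Finset.mem_insert_self x s) hj), ← LinearMap.comp_assoc, h τ hτ']

/-- The target absorbs the permutations of the last `l` places; their number `l!` cancels the
normalization, and only coset representatives, the transpositions with the place that is split off,
remain. -/
theorem lift_splitN_one (l m : ℕ) (h : 1 + l = m) : Lift n m (Pre.splitN 1 l m h)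
    (∑ j ∈ Finset.range m, permT n m (Equiv.swap 0 j)) := by
  refine (lift_splitN 1 l m h).congr fun hb => ?_
  have e : m - 1 = l := by omega
  rw [LinearMap.comp_smul, comp_symT_insert (s := Finset.Ico 1 m) (x := 0) (by simp)
    (by ext; simp; omega) fun σ hσ => wordProj_strands_permT_right hb hσ, smul_smul, Nat.card_Ico,
    e, Nat.factorial_one, one_mul, inv_mul_cancel₀, one_smul]
  exact_mod_cast l.factorial_ne_zero

theorem lift_splitN_last (k m : ℕ) (h : k + 1 = m) : Lift n m (Pre.splitN k 1 m h)
    (∑ j ∈ Finset.range m, permT n m (Equiv.swap k j)) := by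
  refine (lift_splitN k 1 m h).congr fun hb => ?_
  rw [LinearMap.comp_smul, comp_symT_insert (s := Finset.range k) (x := k) (by simp)
    (by ext; simp; omega) fun σ hσ => wordProj_strands_permT_left hb hσ, smul_smul,
    Finset.card_range, Nat.factorial_one, mul_one, inv_mul_cancel₀, one_smul]
  exact_mod_cast k.factorial_ne_zero

end TypeQ
end

noncomputable section
namespace TypeQ
variable {n M L N : ℕ} {a b c d : Word}

/-! ### Lifts of ladders -/

/-- The operator `c_i`, or the identity if `d = false`. -/
def clifOp (n N : ℕ) (d : Bool) (i : ℕ) : T n N →ₗ[ℂ] T n N :=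
  if d then clif n N i else LinearMap.id

/-- The sum of all transpositions of `q` with an element of `s`, followed by `c_q` if `d = true`. -/
def ladOp (n N : ℕ) (d : Bool) (q : ℕ) (s : Finset ℕ) : T n N →ₗ[ℂ] T n N :=
  clifOp n N d q ∘ₗ ∑ j ∈ s, permT n N (Equiv.swap q j)

theorem hasPar_sum_permT {q : ℕ} {s : Finset ℕ} (hq : q < N) (hs : s ⊆ Finset.range N) :
    HasPar 0 (∑ j ∈ s, permT n N (Equiv.swap q j)) :=
  (QMod.EvenHom.sum fun _ hj => evenHom_permT
    (swap_mem_permsOn (Finset.mem_range.2 hq) (hs hj))).mem_homGr.1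

theorem tcut_ladOp_left (h : M + L = N) (d : Bool) {q : ℕ} {s : Finset ℕ} (hq : q < M)
    (hs : s ⊆ Finset.range M) :
    (tcut n M L N h).toLinearMap ∘ₗ ladOp n N d q s =
      superTensor (ladOp n M d q s) LinearMap.id ∘ₗ (tcut n M L N h).toLinearMap := by
  have e : (tcut n M L N h).toLinearMap ∘ₗ ∑ j ∈ s, permT n N (Equiv.swap q j) =
      superTensor (∑ j ∈ s, permT n M (Equiv.swap q j)) LinearMap.id ∘ₗ
        (tcut n M L N h).toLinearMap := by
    rw [superTensor_id, map_sum_left, linearMap_comp_sum, linearMap_sum_comp]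
    exact Finset.sum_congr rfl fun j hj =>
      tcut_permT_left h (swap_mem_permsOn (Finset.mem_range.2 hq) (hs hj))
  cases d
  · exact e
  · change (tcut n M L N h).toLinearMap ∘ₗ (clif n N q ∘ₗ _) =
      superTensor (clif n M q ∘ₗ _) LinearMap.id ∘ₗ _
    rw [← LinearMap.comp_assoc, tcut_clif_left h hq, LinearMap.comp_assoc, e,
      ← LinearMap.comp_assoc, superTensor_comp_left_even _ _ _ hasPar_id, LinearMap.comp_id]

theorem tcut_ladOp_right (h : M + L = N) (d : Bool) {q u v : ℕ} (hq : q < L) (hv : v ≤ L) :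
    (tcut n M L N h).toLinearMap ∘ₗ ladOp n N d (M + q) (Finset.Ico (M + u) (M + v)) =
      superTensor LinearMap.id (ladOp n L d q (Finset.Ico u v)) ∘ₗ
        (tcut n M L N h).toLinearMap := by
  have hs : Finset.Ico u v ⊆ Finset.range L := fun x hx => by simp at hx ⊢; omega
  have e : (tcut n M L N h).toLinearMap ∘ₗ
      ∑ j ∈ Finset.Ico (M + u) (M + v), permT n N (Equiv.swap (M + q) j) =
      superTensor LinearMap.id (∑ j ∈ Finset.Ico u v, permT n L (Equiv.swap q j)) ∘ₗ
        (tcut n M L N h).toLinearMap := by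
    rw [superTensor_of_even _ (hasPar_sum_permT hq hs), linearMap_comp_sum,
      ← Finset.map_add_left_Ico, Finset.sum_map]
    refine LinearMap.ext fun t => ?_
    simp only [LinearMap.sum_apply, LinearMap.comp_apply]
    have hj : ∀ j ∈ Finset.Ico u v, (tcut n M L N h).toLinearMap
        (permT n N (Equiv.swap (M + q) (addLeftEmbedding M j)) t) =
        TensorProduct.map LinearMap.id (permT n L (Equiv.swap q j)) (tcut n M L N h t) :=
      fun j hj => LinearMap.congr_fun (tcut_permT_swap h hq (Finset.mem_range.1 (hs hj))) t
    rw [Finset.sum_congr rfl hj]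
    generalize (tcut n M L N h) t = x
    change _ = TensorProduct.map LinearMap.id _ x
    induction x using TensorProduct.induction_on with
    | zero => simp
    | add x y hx hy => simp only [map_add, Finset.sum_add_distrib, hx, hy]
    | tmul x y => simp [TensorProduct.tmul_sum]
  cases d
  · exact e
  · change (tcut n M L N h).toLinearMap ∘ₗ (clif n N (M + q) ∘ₗ _) =
      superTensor LinearMap.id (clif n L q ∘ₗ _) ∘ₗ _
    rw [← LinearMap.comp_assoc, tcut_clif_right h hq, LinearMap.comp_assoc, e,
      ← LinearMap.comp_assoc, superTensor_comp_right_even _ _ _ hasPar_id, LinearMap.comp_id]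

theorem superTensor_one_one : superTensor (LinearMap.id : T n M →ₗ[ℂ] T n M)
    (LinearMap.id : T n L →ₗ[ℂ] T n L) = LinearMap.id := by
  rw [superTensor_tensorPower_id, TensorProduct.map_id]

theorem Lift.tensor_one_id {f : Pre a b} (hf : Lift n M f LinearMap.id) (hc : wsum c = L)
    (hN : M + L = N) : Lift n N (f ⊠ Pre.one c) LinearMap.id :=
  hf.tensor (lift_id rfl hc) hN (by rw [superTensor_one_one]; rfl)

theorem Lift.one_tensor_id {f : Pre a b} (hf : Lift n L f LinearMap.id) (hc : wsum c = M)
    (hN : M + L = N) : Lift n N (Pre.one c ⊠ f) LinearMap.id :=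
  (lift_id rfl hc).tensor hf hN (by rw [superTensor_one_one]; rfl)

theorem Lift.tensor_one {f : Pre a b} {e : Bool} {q : ℕ} {s : Finset ℕ}
    (hf : Lift n M f (ladOp n M e q s)) (hq : q < M) (hs : s ⊆ Finset.range M) (hc : wsum c = L)
    (hN : M + L = N) : Lift n N (f ⊠ Pre.one c) (ladOp n N e q s) :=
  hf.tensor (lift_id rfl hc) hN (tcut_ladOp_left hN e hq hs)

theorem Lift.one_tensor {f : Pre a b} {e : Bool} {q u v : ℕ}
    (hf : Lift n L f (ladOp n L e q (Finset.Ico u v))) (hq : q < L) (hv : v ≤ L)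
    (hc : wsum c = M) (hN : M + L = N) :
    Lift n N (Pre.one c ⊠ f) (ladOp n N e (M + q) (Finset.Ico (M + u) (M + v))) :=
  (lift_id rfl hc).tensor hf hN (tcut_ladOp_right hN e hq hv)

/-- The only transposition is the trivial one. A bare rung is thus itself a ladder operator, and the
tensor product lemmas for ladder operators cover it. -/
theorem ladOp_single (d : Bool) (q : ℕ) : ladOp n N d q {q} = clifOp n N d q := by
  rw [ladOp, Finset.sum_singleton, Equiv.swap_self]
  exact (congrArg (fun z => clifOp n N d q ∘ₗ z) (permT_one n N)).trans (LinearMap.comp_id _)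

theorem lift_rung (d : Bool) : Lift n 1 (Pre.rung d) (ladOp n 1 d 0 (Finset.Ico 0 1)) := by
  rw [show Finset.Ico 0 1 = {0} from rfl, ladOp_single]
  cases d
  · exact lift_id rfl rfl
  · have := lift_dotN (n := n) 1
    rwa [clifSum, Finset.sum_range_one] at this

theorem ladOp_false (q : ℕ) (s : Finset ℕ) :
    ladOp n N false q s = ∑ j ∈ s, permT n N (Equiv.swap q j) := LinearMap.id_comp _

theorem ladOp_single_comp (d : Bool) (q : ℕ) (s : Finset ℕ) :
    ladOp n N d q {q} ∘ₗ ladOp n N false q s = ladOp n N d q s := by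
  rw [ladOp_single, ladOp_false]; rfl

theorem lift_rungs (d : Bool) {k l : ℕ} (h : k + (1 + l) = N) :
    Lift n N (Pre.I k ⊠ (Pre.rung d ⊠ Pre.I l)) (ladOp n N d k {k}) := by
  have h1 := (lift_rung (n := n) d).tensor_one (c := strand l) (N := 1 + l) zero_lt_one
    (by simp) (wsum_strand l) rfl
  have h2 := h1.one_tensor (c := strand k) (by omega) (by omega) (wsum_strand k) h
  rwa [add_zero, Nat.Ico_succ_singleton] at h2

/-- The factor that is split off is the first one of the right strand, in position `k`. The merge is
invisible on the tensor power, so only the transpositions of the split and a possible `c_k` remain.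
-/
theorem lift_rungL (d : Bool) (k l : ℕ) (h : k + (l + 1) = N) :
    Lift n N (Pre.rungL d k l) (ladOp n N d k (Finset.Ico k N)) := by
  have h1 := lift_splitN_one (n := n) l (l + 1) (Nat.add_comm 1 l)
  rw [← ladOp_false, Finset.range_eq_Ico] at h1
  have h2 := h1.one_tensor (c := strand k) (by omega) le_rfl (wsum_strand k) h
  have h3 := ((lift_rungs (n := n) d (by omega : k + (1 + l) = N)).comp h2)
  have h4 := (lift_id (n := n) (N := N)
    (List.append_assoc (strand k) (strand 1) (strand l)).symm h3.tgt).comp h3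
  have h5 := ((lift_mergeN (n := n) k 1 (k + 1) rfl).tensor_one_id (c := strand l) (wsum_strand l)
    (by omega : k + 1 + l = N)).comp h4
  rw [LinearMap.id_comp, LinearMap.id_comp, add_zero, ladOp_single_comp, h] at h5
  exact h5

/-- Here the factor that is split off is the last one of the left strand, again in position `k`. -/
theorem lift_rungR (d : Bool) (k l : ℕ) (h : (k + 1) + l = N) :
    Lift n N (Pre.rungR d k l) (ladOp n N d k (Finset.Ico 0 (k + 1))) := by
  have h1 := lift_splitN_last (n := n) k (k + 1) rfl
  rw [← ladOp_false, Finset.range_eq_Ico] at h1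
  have h2 := h1.tensor_one (c := strand l) (by omega) (by simp) (wsum_strand l) h
  have h3 := (lift_id (n := n) (N := N)
    (List.append_assoc (strand k) (strand 1) (strand l)) h2.tgt).comp h2
  have h4 := (lift_rungs (n := n) d (by omega : k + (1 + l) = N)).comp h3
  have h5 := ((lift_mergeN (n := n) 1 l (l + 1) (Nat.add_comm 1 l)).one_tensor_id (c := strand k)
    (wsum_strand k) (by omega : k + (l + 1) = N)).comp h4
  rw [LinearMap.id_comp, LinearMap.id_comp, ladOp_single_comp] at h5
  exact h5

theorem lift_rungL₁ (d : Bool) (h k l : ℕ) (hN : h + (k + 1) + l = N) :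
    Lift n N (Pre.rungL₁ d h k l) (ladOp n N d h (Finset.Ico h (h + (k + 1)))) := by
  have h1 := (lift_rungL (n := n) d h k rfl).tensor_one (c := strand l) (by omega)
    (fun x hx => by simp at hx ⊢; omega) (wsum_strand l) hN
  have h2 := h1.comp (lift_id (n := n) (N := N) (List.append_assoc (strand h) (strand (k + 1))
    (strand l)).symm (by simp only [wsum_append, wsum_strand]; omega))
  exact (lift_id (n := n) (N := N) (List.append_assoc _ _ _) h2.tgt).comp h2

theorem lift_rungR₁ (d : Bool) (h k l : ℕ) (hN : h + 1 + k + l = N) :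
    Lift n N (Pre.rungR₁ d h k l) (ladOp n N d h (Finset.Ico 0 (h + 1))) := by
  have h1 := (lift_rungR (n := n) d h k rfl).tensor_one (c := strand l) (by omega)
    (fun x hx => by simp at hx ⊢; omega) (wsum_strand l) hN
  have h2 := h1.comp (lift_id (n := n) (N := N) (List.append_assoc (strand (h + 1)) (strand k)
    (strand l)).symm (by simp only [wsum_append, wsum_strand]; omega))
  exact (lift_id (n := n) (N := N) (List.append_assoc _ _ _) h2.tgt).comp h2

theorem lift_rungL₂ (d : Bool) (h k l : ℕ) (hN : h + (k + (l + 1)) = N) :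
    Lift n N (Pre.rungL₂ d h k l) (ladOp n N d (h + k) (Finset.Ico (h + k) N)) := by
  have h1 := (lift_rungL (n := n) d k l rfl).one_tensor (c := strand h) (by omega) le_rfl
    (wsum_strand h) hN
  rwa [hN] at h1

theorem lift_rungR₂ (d : Bool) (h k l : ℕ) (hN : h + (k + 1 + l) = N) :
    Lift n N (Pre.rungR₂ d h k l) (ladOp n N d (h + k) (Finset.Ico h (h + k + 1))) := by
  have h1 := (lift_rungR (n := n) d k l rfl).one_tensor (c := strand h) (by omega) (by omega)
    (wsum_strand h) hN
  rwa [add_zero, ← add_assoc] at h1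

end TypeQ
end

noncomputable section
namespace TypeQ
variable {n M L N : ℕ} {a b c d : Word}

/-! ### Products of ladder operators -/

section
variable (n N)

/-- The operator `c_i`, or the identity, in the endomorphism algebra of `V^{⊗N}`. -/
abbrev opC (d : Bool) (i : ℕ) : Module.End ℂ (T n N) := clifOp n N d i

/-- The operator of a permutation in the endomorphism algebra of `V^{⊗N}`. -/
abbrev opR (σ : Equiv.Perm ℕ) : Module.End ℂ (T n N) := permT n N σ

/-- A ladder operator in the endomorphism algebra of `V^{⊗N}`. -/
abbrev opL (d : Bool) (q : ℕ) (s : Finset ℕ) : Module.End ℂ (T n N) := ladOp n N d q s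

end

theorem opR_one : opR n N 1 = 1 := permT_one n N

theorem opR_mul {σ τ : Equiv.Perm ℕ} (hσ : σ ∈ permsOn (Finset.range N))
    (hτ : τ ∈ permsOn (Finset.range N)) : opR n N σ * opR n N τ = opR n N (σ * τ) :=
  (permT_mul hσ hτ).symm

theorem opR_opC {σ : Equiv.Perm ℕ} (hσ : σ ∈ permsOn (Finset.range N)) (d : Bool) {i : ℕ}
    (hi : i < N) : opR n N σ * opC n N d i = opC n N d (σ i) * opR n N σ := by
  cases d
  · exact (mul_one (opR n N σ)).trans (one_mul (opR n N σ)).symm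
  · exact permT_clif hσ hi

theorem opL_eq (d : Bool) (q : ℕ) (s : Finset ℕ) :
    opL n N d q s = opC n N d q * ∑ j ∈ s, opR n N (Equiv.swap q j) := rfl

theorem opC_false (i : ℕ) : opC n N false i = 1 := rfl

theorem opC_sq (d : Bool) {i : ℕ} (hi : i < N) : opC n N d i * opC n N d i = 1 := by
  cases d
  · exact one_mul (1 : Module.End ℂ (T n N))
  · exact clif_sq hi

theorem opC_anti {i j : ℕ} (hij : i ≠ j) (hi : i < N) (hj : j < N) :
    opC n N true i * opC n N true j = -(opC n N true j * opC n N true i) := clif_anti hij hi hj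

/-- The second Clifford operator is moved to the left through the transpositions, which changes its
index. -/
theorem opL_mul_opL (d d' : Bool) {p q : ℕ} {s t : Finset ℕ} (hp : p < N) (hq : q < N)
    (hs : s ⊆ Finset.range N) :
    opL n N d p s * opL n N d' q t = ∑ i ∈ s, ∑ j ∈ t, opC n N d p *
      opC n N d' (Equiv.swap p i q) * (opR n N (Equiv.swap p i) * opR n N (Equiv.swap q j)) := by
  rw [opL_eq, opL_eq, mul_assoc, Finset.sum_mul, Finset.mul_sum]
  refine Finset.sum_congr rfl fun i hi => ?_
  rw [← mul_assoc (opR n N _), opR_opC (swap_mem_permsOn (Finset.mem_range.2 hp) (hs hi)) _ hq,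
    mul_assoc, Finset.mul_sum, Finset.mul_sum, Finset.mul_sum]
  simp only [mul_assoc]

/-- The sum `∑ c_a c'_a + ∑ c_a c'_b (a b)` over `a ∈ A` and `b ∈ B`. -/
def squareOp (n N : ℕ) (d d' : Bool) (A B : Finset ℕ) : Module.End ℂ (T n N) :=
  ∑ a ∈ A, (opC n N d a * opC n N d' a +
    ∑ b ∈ B, opC n N d a * opC n N d' b * opR n N (Equiv.swap a b))

/-- The map `f` absorbs permutations of `A`. Multiplying the summand of `a ∈ A` on the left by `swap
q a` moves the pivot from `q` to `a`, so the result no longer refers to `q`: the index `i = q` gives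
the diagonal terms, and `i ∈ B` gives the transpositions of `a` and `i`. -/
theorem comp_opL_mul_opL {X : Type} [AddCommGroup X] [Module ℂ X] {A B : Finset ℕ} {q : ℕ}
    {f : T n N →ₗ[ℂ] X} (hA : A ⊆ Finset.range N) (hB : B ⊆ Finset.range N) (hqA : q ∈ A)
    (hAB : Disjoint A B) (hf : ∀ σ ∈ permsOn A, f ∘ₗ permT n N σ = f) (d d' : Bool) :
    f ∘ₗ (opL n N d q (insert q B) * opL n N d' q A) = f ∘ₗ squareOp n N d d' A B := by
  have hq : q < N := Finset.mem_range.1 (hA hqA)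
  have hqB : q ∉ B := Finset.disjoint_left.1 hAB hqA
  have hBq : insert q B ⊆ Finset.range N := Finset.insert_subset (hA hqA) hB
  rw [opL_mul_opL d d' hq hq hBq, Finset.sum_comm, squareOp, linearMap_comp_sum,
    linearMap_comp_sum]
  refine Finset.sum_congr rfl fun a ha => ?_
  have haN : a < N := Finset.mem_range.1 (hA ha)
  have hqa := swap_mem_permsOn (hA hqA) (hA ha)
  have key : ∀ i ∈ insert q B, f ∘ₗ (opC n N d q * opC n N d' (Equiv.swap q i q) *
      (opR n N (Equiv.swap q i) * opR n N (Equiv.swap q a))) =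
      f ∘ₗ (opC n N d a * opC n N d' (Equiv.swap q a i) * opR n N (Equiv.swap a
        (Equiv.swap q a i))) := fun i hi => by
    have hqi := swap_mem_permsOn (hA hqA) (hBq hi)
    have e : opR n N (Equiv.swap q a) * (opC n N d q * opC n N d' (Equiv.swap q i q) *
      (opR n N (Equiv.swap q i) * opR n N (Equiv.swap q a))) =
      opC n N d a * opC n N d' (Equiv.swap q a i) * opR n N (Equiv.swap a
        (Equiv.swap q a i)) := by
      rw [Equiv.swap_apply_left, ← mul_assoc, ← mul_assoc, ← mul_assoc, opR_opC hqa _ hq,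
        Equiv.swap_apply_left, mul_assoc (opC n N d a),
        opR_opC hqa _ (Finset.mem_range.1 (hBq hi)), mul_assoc, opR_mul hqi hqa, mul_assoc,
        mul_assoc, opR_mul hqa (mul_mem hqi hqa), ← mul_assoc (Equiv.swap q a), Equiv.mul_swap_eq_swap_mul _ q i,
        mul_assoc (Equiv.swap _ _), Equiv.swap_mul_self, mul_one, Equiv.swap_apply_left, mul_assoc]
    rw [← e, Module.End.mul_eq_comp (opR n N (Equiv.swap q a)), ← LinearMap.comp_assoc]
    exact congrArg (fun g => g ∘ₗ _) (hf _ (swap_mem_permsOn hqA ha)).symm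
  rw [linearMap_comp_sum, Finset.sum_congr rfl key, Finset.sum_insert hqB,
    Equiv.swap_apply_left, Equiv.swap_self, LinearMap.comp_add, linearMap_comp_sum]
  refine congrArg₂ _ ?_ (Finset.sum_congr rfl fun i hi => ?_)
  · exact congrArg (fun z => f ∘ₗ z) ((congrArg _ opR_one).trans (mul_one _))
  · rw [Equiv.swap_apply_of_ne_of_ne (fun h : i = q => hqB (h ▸ hi))
      fun h : i = a => Finset.disjoint_left.1 hAB ha (h ▸ hi)]

theorem range_subset {k : ℕ} (h : k ≤ N) : Finset.range k ⊆ Finset.range N :=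
  Finset.range_subset_range.2 h

theorem Ico_subset {k l : ℕ} (h : l ≤ N) : Finset.Ico k l ⊆ Finset.range N := fun x hx => by
  simp at hx ⊢; omega

/-- After both rungs the pivot `k` lies in the left strand of the target, whose symmetry removes it.
If the left label is zero, the sum over the empty set `A` matches the convention that the ladder is
zero. -/
theorem lift_ladLR (d d' : Bool) : ∀ (k l : ℕ) (_ : k + l = N), Lift n N (Pre.ladLR d d' k l)
    (squareOp n N d d' (Finset.range k) (Finset.Ico k N))
  | 0, l, h => lift_zero ((wsum_append _ _).trans (by rw [wsum_strand, wsum_strand, h]))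
      ((wsum_append _ _).trans (by rw [wsum_strand, wsum_strand, h]))
  | k + 1, l, h => by
    refine ((lift_rungL d k l (by omega)).comp (lift_rungR d' k l h)).congr fun hb => ?_
    rw [← comp_opL_mul_opL (q := k) (range_subset (by omega)) (Ico_subset le_rfl) (by simp)
      (Finset.disjoint_left.2 fun x hx => by simp at hx ⊢; omega)
      fun σ hσ => wordProj_strands_permT_left hb hσ, Finset.range_eq_Ico,
      Finset.insert_Ico_add_one_left_eq_Ico (by omega)]
    rfl

/-- Same argument with the pivot in the right strand; the empty set `Ico k k` corresponds to the
right label zero. -/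
theorem lift_ladRL (d d' : Bool) : ∀ (k l : ℕ) (_ : k + l = N), Lift n N (Pre.ladRL d d' k l)
    (squareOp n N d d' (Finset.Ico k N) (Finset.range k))
  | k, 0, h => by
    have := lift_zero (n := n) (N := N) (a := strand k ++ strand 0) (b := strand k ++ strand 0)
      ((wsum_append _ _).trans (by rw [wsum_strand, wsum_strand, h]))
      ((wsum_append _ _).trans (by rw [wsum_strand, wsum_strand, h]))
    rw [add_zero] at h
    rw [h, Finset.Ico_self]
    subst h
    cases k <;> exact this
  | k, l + 1, h => by
    have h1 : Lift n N (Pre.ladRL d d' k (l + 1))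
        (ladOp n N d k (Finset.Ico 0 (k + 1)) ∘ₗ ladOp n N d' k (Finset.Ico k N)) := by
      have := (lift_rungR (n := n) (N := N) d k l (by omega)).comp (lift_rungL d' k l h)
      cases k <;> exact this
    refine h1.congr fun hb => ?_
    rw [← comp_opL_mul_opL (q := k) (Ico_subset le_rfl) (range_subset (by omega))
      (by simp; omega) (Finset.disjoint_left.2 fun x hx => by simp at hx ⊢; omega)
      fun σ hσ => wordProj_strands_permT_right hb hσ, ← Finset.range_eq_Ico,
      Finset.range_add_one]
    rfl

/-- The two products of ladder operators with distinct pivots. -/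
theorem opL_insert_mul_opL {p q : ℕ} {A B : Finset ℕ} (hp : p < N) (hq : q < N)
    (hA : A ⊆ Finset.range N) (hB : B ⊆ Finset.range N) (hpA : A.Nonempty → p ∈ A) (hqB : q ∈ B)
    (hAB : Disjoint A B) :
    ∃ S U : Module.End ℂ (T n N), (p = q → S = 0) ∧
      (∀ d d', opL n N d p (insert q A) * opL n N d' q B =
        opC n N d p * opC n N d' q * S + opC n N d p * opC n N d' p * U) ∧
      ∀ d d', opL n N d q B * opL n N d' p A = opC n N d q * opC n N d' p * S := by
  have hqA : q ∉ A := Finset.disjoint_right.1 hAB hqB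
  have hpq : ∀ i ∈ A, q ≠ p := fun i hi h => hqA (h ▸ hpA ⟨i, hi⟩)
  -- `S` collects the products of transpositions in which the pivots do not interact; `U` collects
  -- the terms with `i = q`, where `swap p q` moves the second Clifford operator onto the first.
  refine ⟨∑ i ∈ A, ∑ j ∈ B, opR n N (Equiv.swap p i) * opR n N (Equiv.swap q j),
    ∑ j ∈ B, opR n N (Equiv.swap p q) * opR n N (Equiv.swap q j), ?_, fun d d' => ?_,
    fun d d' => ?_⟩
  · rintro rfl
    -- If the pivots coincide, `A` is empty: otherwise it would contain `p = q`, which lies in the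
    -- disjoint set `B`.
    exact Finset.sum_eq_zero fun i hi => absurd rfl (hpq i hi)
  · rw [opL_mul_opL d d' hp hq (Finset.insert_subset (Finset.mem_range.2 hq) hA),
      Finset.sum_insert hqA, add_comm, Equiv.swap_apply_right, Finset.mul_sum, Finset.mul_sum]
    refine congrArg₂ _ (Finset.sum_congr rfl fun i hi => ?_) rfl
    rw [Equiv.swap_apply_of_ne_of_ne (hpq i hi) fun h => hqA (h ▸ hi), Finset.mul_sum]
  · rw [opL_mul_opL d d' hq hp hB, Finset.sum_comm, Finset.mul_sum]
    refine Finset.sum_congr rfl fun i hi => ?_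
    rw [Finset.mul_sum]
    refine Finset.sum_congr rfl fun j hj => ?_
    -- In this order the transpositions within `B` fix `A`, in particular `p`, so the two families
    -- commute and no term like `U` appears.
    have h1 : ∀ x ∈ A, Equiv.swap q j x = x := fun x hx =>
      Equiv.swap_apply_of_ne_of_ne (fun h => hqA (h ▸ hx))
        fun h => Finset.disjoint_left.1 hAB hx (h ▸ hj)
    rw [h1 p (hpA ⟨i, hi⟩), opR_mul (swap_mem_permsOn (hB hqB) (hB hj))
      (swap_mem_permsOn (Finset.mem_range.2 hp) (hA hi)), Equiv.mul_swap_eq_swap_mul,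
      h1 p (hpA ⟨i, hi⟩), h1 i hi, opR_mul (swap_mem_permsOn (Finset.mem_range.2 hp) (hA hi))
      (swap_mem_permsOn (hB hqB) (hB hj))]

/-- The pattern of the double rung relations. -/
theorem double_rung_pattern {p q : ℕ} (hp : p < N) (hq : q < N) {S U : Module.End ℂ (T n N)}
    (hS : p = q → S = 0) {F G : Bool → Bool → Module.End ℂ (T n N)}
    (hF : ∀ d d', F d d' = opC n N d p * opC n N d' q * S + opC n N d p * opC n N d' p * U)
    (hG : ∀ d d', G d d' = opC n N d q * opC n N d' p * S) :
    F false false + (-1 : ℂ) • G false false = F true true + G true true ∧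
    F false true + (-1 : ℂ) • G true false = F true false + (-1 : ℂ) • G false true := by
  simp only [hF, hG, opC_false, one_mul, mul_one, neg_smul, one_smul]
  refine ⟨?_, by abel⟩
  -- The terms with `U` agree since `c_p` squares to one, and the terms with `S` agree since `c_p`
  -- and `c_q` anticommute. If `p = q` the latter fails, but then `S` vanishes.
  rw [opC_sq _ hp, one_mul]
  by_cases h : p = q
  · simp [hS h]
  · rw [opC_anti h hp hq, neg_mul]
    abel

/-- The pivots are `h` and `h + k`. They coincide exactly for `k = 0`, when the second composite
passes through a negative label and is zero, in accordance with `S = 0`. -/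
theorem lift_ladL (h k l : ℕ) (hN : h + (k + (l + 1)) = N) :
    ∃ F G : Bool → Bool → Module.End ℂ (T n N),
      (∀ d d', Lift n N (Pre.ladL₁₂ d d' h k l) (F d d')) ∧
      (∀ d d', Lift n N (Pre.ladL₂₁ d d' h k l) (G d d')) ∧
      F false false + (-1 : ℂ) • G false false = F true true + G true true ∧
      F false true + (-1 : ℂ) • G true false = F true false + (-1 : ℂ) • G false true := by
  obtain ⟨S, U, hS, hF, hG⟩ := opL_insert_mul_opL (n := n) (N := N) (p := h) (q := h + k)
    (A := Finset.Ico h (h + k)) (B := Finset.Ico (h + k) N) (by omega) (by omega)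
    (Ico_subset (by omega)) (Ico_subset le_rfl) (by rintro ⟨x, hx⟩; simp at hx ⊢; omega)
    (by simp; omega) (Finset.disjoint_left.2 fun x hx => by simp at hx ⊢; omega)
  refine ⟨_, _, fun d d' => ?_, fun d d' => ?_, double_rung_pattern (by omega) (by omega) hS hF hG⟩
  · have := (lift_rungL₁ (n := n) (N := N) d h k l (by omega)).comp (lift_rungL₂ d' h k l hN)
    rwa [← add_assoc, ← Finset.insert_Ico_right_eq_Ico_add_one (by omega)] at this
  · cases k with
    | zero =>
      have e : opL n N d (h + 0) (Finset.Ico (h + 0) N) * opL n N d' h (Finset.Ico h (h + 0)) = 0 := by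
        rw [hG, hS rfl, mul_zero]
      rw [e]
      refine lift_zero ?_ ?_ <;> simp only [wsum_append, wsum_strand] <;> omega
    | succ k =>
      have := (lift_rungL₂ (n := n) (N := N) d (h + 1) k l (by omega)).comp
        (lift_rungL₁ d' h k (l + 1) (by omega))
      rwa [show h + 1 + k = h + (k + 1) by omega] at this

/-- The mirror image of `lift_ladL`, with the two pivots exchanged; both cases share
`double_rung_pattern`. -/
theorem lift_ladR (h k l : ℕ) (hN : h + 1 + (k + l) = N) :
    ∃ F G : Bool → Bool → Module.End ℂ (T n N),
      (∀ d d', Lift n N (Pre.ladR₂₁ d d' h k l) (F d d')) ∧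
      (∀ d d', Lift n N (Pre.ladR₁₂ d d' h k l) (G d d')) ∧
      F false false + (-1 : ℂ) • G false false = F true true + G true true ∧
      F false true + (-1 : ℂ) • G true false = F true false + (-1 : ℂ) • G false true := by
  obtain ⟨S, U, hS, hF, hG⟩ := opL_insert_mul_opL (n := n) (N := N) (p := h + k) (q := h)
    (A := Finset.Ico (h + 1) (h + k + 1)) (B := Finset.Ico 0 (h + 1)) (by omega) (by omega)
    (Ico_subset (by omega)) (Ico_subset (by omega)) (by rintro ⟨x, hx⟩; simp at hx ⊢; omega)
    (by simp) (Finset.disjoint_left.2 fun x hx => by simp at hx ⊢; omega)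
  refine ⟨_, _, fun d d' => ?_, fun d d' => ?_, double_rung_pattern (by omega) (by omega) hS hF hG⟩
  · have := (lift_rungR₂ (n := n) (N := N) d h k l (by omega)).comp
      (lift_rungR₁ d' h k l (by omega))
    rwa [← Finset.insert_Ico_add_one_left_eq_Ico (by omega)] at this
  · cases k with
    | zero =>
      have e : opL n N d h (Finset.Ico 0 (h + 1)) *
          opL n N d' (h + 0) (Finset.Ico (h + 1) (h + 0 + 1)) = 0 := by
        rw [hG, hS rfl, mul_zero]
      rw [e]
      refine lift_zero ?_ ?_ <;> simp only [wsum_append, wsum_strand] <;> omega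
    | succ k =>
      have := (lift_rungR₁ (n := n) (N := N) d h k (l + 1) (by omega)).comp
        (lift_rungR₂ d' (h + 1) k l (by omega))
      rwa [show h + 1 + k = h + (k + 1) by omega] at this

end TypeQ
end

noncomputable section
namespace TypeQ
variable {n M L N : ℕ} {a b c d : Word}

/-! ### The defining relations hold for the induced maps -/

theorem superTensor_zero_right {V W V' W' : Type} [AddCommGroup V] [Module ℂ V] [SuperSpace V]
    [AddCommGroup W] [Module ℂ W] [SuperSpace W] [AddCommGroup V'] [Module ℂ V'] [SuperSpace V']
    [AddCommGroup W'] [Module ℂ W'] [SuperSpace W'] (f : V →ₗ[ℂ] V') :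
    superTensor f (0 : W →ₗ[ℂ] W') = 0 := by
  simpa using superTensor_smul 0 f (0 : W →ₗ[ℂ] W')

theorem superTensor_sum {V W V' W' ι : Type} [AddCommGroup V] [Module ℂ V] [SuperSpace V]
    [AddCommGroup W] [Module ℂ W] [SuperSpace W] [AddCommGroup V'] [Module ℂ V'] [SuperSpace V']
    [AddCommGroup W'] [Module ℂ W'] [SuperSpace W'] (f : V →ₗ[ℂ] V') (s : Finset ι)
    (g : ι → W →ₗ[ℂ] W') :
    superTensor f (∑ i ∈ s, g i) = ∑ i ∈ s, superTensor f (g i) := by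
  classical
  induction s using Finset.induction_on with
  | empty => simp [superTensor_zero_right]
  | insert i s hi ih => rw [Finset.sum_insert hi, Finset.sum_insert hi, superTensor_add, ih]

theorem tcut_clifSum_left {k l : ℕ} (h : k + l = N) :
    (tcut n k l N h).toLinearMap ∘ₗ clifSum n N (Finset.range k) =
      superTensor (clifSum n k (Finset.range k)) LinearMap.id ∘ₗ (tcut n k l N h).toLinearMap := by
  rw [superTensor_tensorPower_id, clifSum, clifSum, map_sum_left, linearMap_comp_sum,
    linearMap_sum_comp]
  refine Finset.sum_congr rfl fun i hi => ?_
  rw [tcut_clif_left h (Finset.mem_range.1 hi), superTensor_tensorPower_id]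

theorem tcut_clifSum_right {k l : ℕ} (h : k + l = N) :
    (tcut n k l N h).toLinearMap ∘ₗ clifSum n N (Finset.Ico k N) =
      superTensor LinearMap.id (clifSum n l (Finset.range l)) ∘ₗ (tcut n k l N h).toLinearMap := by
  subst h
  rw [clifSum, clifSum, superTensor_sum, linearMap_comp_sum, linearMap_sum_comp,
    Finset.sum_Ico_eq_sum_range, Nat.add_sub_cancel_left]
  exact Finset.sum_congr rfl fun i hi => tcut_clif_right rfl (Finset.mem_range.1 hi)

theorem lift_dotN_tensor_one {k l : ℕ} (h : k + l = N) :
    Lift n N (Pre.dotN k ⊠ Pre.I l) (clifSum n N (Finset.range k)) :=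
  (lift_dotN k).tensor (lift_id rfl (wsum_strand l)) h (tcut_clifSum_left h)

theorem lift_one_tensor_dotN {k l : ℕ} (h : k + l = N) :
    Lift n N (Pre.I k ⊠ Pre.dotN l) (clifSum n N (Finset.Ico k N)) :=
  (lift_id rfl (wsum_strand k)).tensor (lift_dotN l) h (tcut_clifSum_right h)

theorem lift_dotN_tensor_dotN {k l : ℕ} (h : k + l = N) :
    Lift n N (Pre.dotN k ⊠ Pre.dotN l)
      (clifSum n N (Finset.range k) ∘ₗ clifSum n N (Finset.Ico k N)) := by
  refine (lift_dotN k).tensor (lift_dotN l) h ?_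
  rw [← LinearMap.comp_assoc, tcut_clifSum_left, LinearMap.comp_assoc, tcut_clifSum_right,
    ← LinearMap.comp_assoc, superTensor_comp_left_even _ _ _ hasPar_id, LinearMap.comp_id,
    LinearMap.id_comp]

theorem permT_comp_symT_eq (z : ℂ) {s : Finset ℕ}
    (hs : s ⊆ Finset.range N) :
    (z • ∑ σ ∈ permsOfFinset s, permT n N σ) ∘ₗ symT n N =
      (z * (s.card.factorial : ℂ)) • symT n N := by
  rw [LinearMap.smul_comp, linearMap_sum_comp, mul_smul, ← card_perms_of_finset,
    Nat.cast_smul_eq_nsmul, ← Finset.sum_const]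
  refine congrArg _ (Finset.sum_congr rfl fun σ hσ => ?_)
  exact permT_symT (permsOn_mono hs (mem_permsOfFinset.1 hσ))

/-- In the associativity of splits this operator is applied after a total symmetrizer. That
symmetrizer absorbs all permutations, so only the number of terms and the normalization matter. -/
theorem lift_splitN_tensor_one {h k l : ℕ} (hN : h + k + l = N) :
    ∃ C, Lift n N (Pre.splitN h k (h + k) rfl ⊠ Pre.I l) C ∧
      C ∘ₗ symT n N = ((((h.factorial * k.factorial : ℕ) : ℂ)⁻¹) *
        ((h + k).factorial : ℂ)) • symT n N := by
  refine ⟨(((h.factorial * k.factorial : ℕ) : ℂ)⁻¹) •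
    ∑ σ ∈ permsOfFinset (Finset.range (h + k)), permT n N σ,
    (lift_splitN h k (h + k) rfl).tensor (lift_id rfl (wsum_strand l)) hN ?_, ?_⟩
  · rw [superTensor_tensorPower_id, symT, TensorProduct.map_smul_left, LinearMap.comp_smul,
      LinearMap.smul_comp, map_sum_left, linearMap_comp_sum, linearMap_sum_comp]
    exact congrArg _ (Finset.sum_congr rfl fun σ hσ => tcut_permT_left hN (mem_permsOfFinset.1 hσ))
  · rw [permT_comp_symT_eq _ (range_subset (by omega)), Finset.card_range]

theorem lift_one_tensor_splitN {h k l : ℕ} (hN : h + (k + l) = N) :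
    ∃ C, Lift n N (Pre.I h ⊠ Pre.splitN k l (k + l) rfl) C ∧
      C ∘ₗ symT n N = ((((k.factorial * l.factorial : ℕ) : ℂ)⁻¹) *
        ((k + l).factorial : ℂ)) • symT n N := by
  -- Stated for all `σ`, with a dummy value outside the relevant set, so that the shifted
  -- permutation can be chosen as a function.
  have H : ∀ σ : Equiv.Perm ℕ, ∃ τ ∈ permsOn (Finset.range N),
      σ ∈ permsOfFinset (Finset.range (k + l)) →
      (tcut n h (k + l) N hN).toLinearMap ∘ₗ permT n N τ =
      superTensor LinearMap.id (permT n (k + l) σ) ∘ₗ (tcut n h (k + l) N hN).toLinearMap := by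
    intro σ
    by_cases hσ : σ ∈ permsOfFinset (Finset.range (k + l))
    · have hσ' := mem_permsOfFinset.1 hσ
      obtain ⟨τ, hτ, -, -, e⟩ := tcut_permT_right (n := n) hN hσ'
      exact ⟨τ, hτ, fun _ => by
        rw [e, superTensor_of_even _ (evenHom_permT hσ').mem_homGr.1]⟩
    · exact ⟨1, one_mem _, fun h => absurd h hσ⟩
  choose τ hτ e using H
  refine ⟨(((k.factorial * l.factorial : ℕ) : ℂ)⁻¹) •
    ∑ σ ∈ permsOfFinset (Finset.range (k + l)), permT n N (τ σ),
    (lift_id rfl (wsum_strand h)).tensor (lift_splitN k l (k + l) rfl) hN ?_, ?_⟩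
  · rw [superTensor_smul, symT, superTensor_sum, LinearMap.comp_smul, LinearMap.smul_comp,
      linearMap_comp_sum, linearMap_sum_comp]
    exact congrArg _ (Finset.sum_congr rfl fun σ hσ => e σ hσ)
  · have hc : ((k + l).factorial : ℂ) = (permsOfFinset (Finset.range (k + l))).card := by
      rw [card_perms_of_finset, Finset.card_range]
    rw [LinearMap.smul_comp, linearMap_sum_comp, mul_smul, hc, Nat.cast_smul_eq_nsmul, ← Finset.sum_const]
    exact congrArg _ (Finset.sum_congr rfl fun σ _ => permT_symT (hτ σ))

theorem mapPre_merge_assoc (h k l : ℕ) :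
    mapPre n (Pre.mergeN (h + k) l (h + k + l) rfl ⊚ (Pre.mergeN h k (h + k) rfl ⊠ Pre.I l)) =
      mapPre n (Pre.mergeN h (k + l) (h + k + l) (Nat.add_assoc h k l).symm ⊚
          (Pre.I h ⊠ Pre.mergeN k l (k + l) rfl) ⊚ Pre.asc _ _ _) := by
  have h1 := (lift_mergeN (n := n) (h + k) l _ rfl).comp
    ((lift_mergeN (n := n) h k _ rfl).tensor_one_id (c := strand l) (wsum_strand l) rfl)
  have h2 := (lift_mergeN (n := n) h (k + l) (h + k + l) (Nat.add_assoc h k l).symm).comp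
    (((lift_mergeN (n := n) k l _ rfl).one_tensor_id (c := strand h) (wsum_strand h)
      (Nat.add_assoc h k l).symm).comp (lift_id (List.append_assoc _ _ _) h1.src))
  exact h1.mapPre_eq' h2

/-- Both sides are $1/(h!\,k!\,l!)$ times the total symmetrizer. -/
theorem mapPre_split_assoc (h k l : ℕ) :
    mapPre n ((Pre.splitN h k (h + k) rfl ⊠ Pre.I l) ⊚ Pre.splitN (h + k) l (h + k + l) rfl) =
      mapPre n (Pre.asc' _ _ _ ⊚ (Pre.I h ⊠ Pre.splitN k l (k + l) rfl) ⊚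
          Pre.splitN h (k + l) (h + k + l) (Nat.add_assoc h k l).symm) := by
  obtain ⟨C, hC, eC⟩ := lift_splitN_tensor_one (n := n) (h := h) (k := k) (l := l) rfl
  obtain ⟨D, hD, eD⟩ := lift_one_tensor_splitN (n := n) (h := h) (k := k) (l := l)
    (Nat.add_assoc h k l).symm
  have h1 := hC.comp (lift_splitN (n := n) (h + k) l (h + k + l) rfl)
  have h2 := hD.comp (lift_splitN (n := n) h (k + l) (h + k + l) (Nat.add_assoc h k l).symm)
  have h3 := (lift_id (List.append_assoc (strand h) (strand k) (strand l)).symm h2.tgt).comp h2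
  refine h1.mapPre_eq h3 fun hb => ?_
  simp only [LinearMap.id_comp, LinearMap.comp_smul, eC, eD, smul_smul]
  congr 1
  have f1 : ((h + k).factorial : ℂ) ≠ 0 := by exact_mod_cast (h + k).factorial_ne_zero
  have f2 : ((k + l).factorial : ℂ) ≠ 0 := by exact_mod_cast (k + l).factorial_ne_zero
  have f3 : (h.factorial : ℂ) ≠ 0 := by exact_mod_cast h.factorial_ne_zero
  have f4 : (k.factorial : ℂ) ≠ 0 := by exact_mod_cast k.factorial_ne_zero
  have f5 : (l.factorial : ℂ) ≠ 0 := by exact_mod_cast l.factorial_ne_zero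
  push_cast
  field_simp

/-- A symmetric power absorbs the symmetrizer as $(k+l)!$, and dividing by $k!\,l!$ leaves the
binomial coefficient. -/
theorem mapPre_digon (k l : ℕ) :
    mapPre n (Pre.mergeN k l (k + l) rfl ⊚ Pre.splitN k l (k + l) rfl) =
      mapPre n ((((k + l).choose l : ℕ) : ℂ) ⊡ Pre.I (k + l)) := by
  have h1 := (lift_mergeN (n := n) k l (k + l) rfl).comp (lift_splitN (n := n) k l (k + l) rfl)
  have h2 := (lift_id (n := n) (rfl : strand (k + l) = _) (wsum_strand _)).smul
    (((k + l).choose l : ℕ) : ℂ)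
  refine h1.mapPre_eq h2 fun hb => ?_
  rw [LinearMap.id_comp, LinearMap.comp_smul, LinearMap.comp_smul,
    comp_symT fun σ hσ => wordProj_strand_permT hb hσ, smul_smul, LinearMap.comp_id]
  congr 1
  have f4 : (k.factorial : ℂ) ≠ 0 := by exact_mod_cast k.factorial_ne_zero
  have f5 : (l.factorial : ℂ) ≠ 0 := by exact_mod_cast l.factorial_ne_zero
  rw [← Nat.add_choose_mul_factorial_mul_factorial k l]
  push_cast
  field_simp

/-- The cross terms cancel by anticommutation, and each square contributes one. -/
theorem clifSum_sq (N : ℕ) :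
    clifSum n N (Finset.range N) ∘ₗ clifSum n N (Finset.range N) = (N : ℂ) • LinearMap.id := by
  have key : ∀ s : Finset ℕ, s ⊆ Finset.range N →
      clifSum n N s ∘ₗ clifSum n N s = (s.card : ℂ) • LinearMap.id := by
    intro s
    induction s using Finset.induction_on with
    | empty => intro _; simp [clifSum]
    | insert i s hi ih =>
      intro hs
      have hiN : i < N := Finset.mem_range.1 (hs (Finset.mem_insert_self i s))
      have hc : clif n N i ∘ₗ clifSum n N s = -(clifSum n N s ∘ₗ clif n N i) := by
        rw [clifSum, linearMap_comp_sum, linearMap_sum_comp, ← Finset.sum_neg_distrib]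
        refine Finset.sum_congr rfl fun j hj => clif_anti (fun h => hi (h ▸ hj)) hiN ?_
        exact Finset.mem_range.1 (hs (Finset.mem_insert_of_mem hj))
      have e : clifSum n N (insert i s) = clif n N i + clifSum n N s := Finset.sum_insert hi
      rw [e, LinearMap.add_comp, LinearMap.comp_add, LinearMap.comp_add, clif_sq hiN, hc,
        ih ((Finset.subset_insert i s).trans hs), Finset.card_insert_of_notMem hi]
      push_cast
      module
  simpa using key _ subset_rfl

theorem mapPre_dot_collision (k : ℕ) :
    mapPre n (Pre.dotN k ⊚ Pre.dotN k) = mapPre n ((k : ℂ) ⊡ Pre.I k) :=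
  ((lift_dotN k).comp (lift_dotN k)).mapPre_eq
    ((lift_id (rfl : strand k = strand k) (wsum_strand k)).smul (k : ℂ))
    fun hb => by rw [clifSum_sq]

theorem clifSum_range_add_Ico {k l : ℕ} (h : k + l = N) :
    clifSum n N (Finset.range k) + clifSum n N (Finset.Ico k N) =
      clifSum n N (Finset.range N) := by
  rw [clifSum, clifSum, clifSum, Finset.sum_range_add_sum_Ico _ (by omega)]

theorem mapPre_dot_merge (k l : ℕ) :
    mapPre n (Pre.dotN (k + l) ⊚ Pre.mergeN k l (k + l) rfl) =
      mapPre n (Pre.mergeN k l (k + l) rfl ⊚ (Pre.dotN k ⊠ Pre.I l) ⊹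
        Pre.mergeN k l (k + l) rfl ⊚ (Pre.I k ⊠ Pre.dotN l)) := by
  have h0 := lift_mergeN (n := n) k l (k + l) rfl
  refine ((lift_dotN (k + l)).comp h0).mapPre_eq
    ((h0.comp (lift_dotN_tensor_one rfl)).add (h0.comp (lift_one_tensor_dotN rfl))) fun hb => ?_
  rw [LinearMap.id_comp, LinearMap.id_comp, clifSum_range_add_Ico rfl, LinearMap.comp_id]

theorem clifSum_comp_symT (N : ℕ) : symT n N ∘ₗ clifSum n N (Finset.range N) =
    clifSum n N (Finset.range N) ∘ₗ symT n N := by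
  rw [symT, linearMap_comp_sum, linearMap_sum_comp]
  exact Finset.sum_congr rfl fun σ hσ => permT_clifSum (mem_permsOfFinset.1 hσ)

theorem mapPre_dot_split (k l : ℕ) :
    mapPre n (Pre.splitN k l (k + l) rfl ⊚ Pre.dotN (k + l)) =
      mapPre n ((Pre.dotN k ⊠ Pre.I l) ⊚ Pre.splitN k l (k + l) rfl ⊹
        (Pre.I k ⊠ Pre.dotN l) ⊚ Pre.splitN k l (k + l) rfl) := by
  have h0 := lift_splitN (n := n) k l (k + l) rfl
  refine (h0.comp (lift_dotN (k + l))).mapPre_eq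
    (((lift_dotN_tensor_one rfl).comp h0).add ((lift_one_tensor_dotN rfl).comp h0)) fun hb => ?_
  rw [← LinearMap.add_comp, clifSum_range_add_Ico rfl, LinearMap.smul_comp, clifSum_comp_symT,
    LinearMap.comp_smul, LinearMap.comp_smul, LinearMap.comp_smul]

theorem lift_dumbbell : Lift n 2 Pre.dumbbell (1 + opR n 2 (Equiv.swap 0 1)) := by
  have h := (lift_splitN_one (n := n) 1 2 rfl).comp (lift_mergeN (n := n) 1 1 2 rfl)
  rw [LinearMap.comp_id, Finset.sum_range_succ, Finset.sum_range_one, Equiv.swap_self] at h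
  have e : permT n 2 (Equiv.refl ℕ) = LinearMap.id := permT_one n 2
  rw [e] at h
  exact h

/-- On the tensor square the dumbbell is `1 + r` with `r` the flip, and two dots are `x * y`. Since
`(x * y) * (x * y) = -1` and `(x * y) * r * (x * y) = r`, the right-hand side is `-1 + r + 2`. -/
theorem mapPre_dumbbell :
    mapPre n Pre.dumbbell = mapPre n ((Pre.dotN 1 ⊠ Pre.dotN 1) ⊚ Pre.dumbbell ⊚
      (Pre.dotN 1 ⊠ Pre.dotN 1) ⊹ (2 : ℂ) ⊡ Pre.one (strand 1 ++ strand 1)) := by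
  have h := lift_dotN_tensor_dotN (n := n) (N := 2) (k := 1) (l := 1) rfl
  rw [clifSum, clifSum, Finset.sum_range_one, Nat.Ico_succ_singleton, Finset.sum_singleton] at h
  refine lift_dumbbell.mapPre_eq ((h.comp (lift_dumbbell.comp h)).add
    ((lift_id (N := 2) rfl rfl).smul 2)) fun hb => congrArg _ ?_
  set x := opC n 2 true 0 with hx
  set y := opC n 2 true 1 with hy
  set r := opR n 2 (Equiv.swap 0 1) with hr
  have hs : Equiv.swap 0 1 ∈ permsOn (Finset.range 2) := swap_permsOn_range (by omega)
  have h1 : r * x = y * r := opR_opC hs true (by omega)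
  have h2 : r * y = x * r := opR_opC hs true (by omega)
  have hxx : x * x = 1 := opC_sq true (by omega)
  have hyy : y * y = 1 := opC_sq true (by omega)
  have hyx : y * x = -(x * y) := opC_anti (by omega) (by omega) (by omega)
  change 1 + r = x * y * ((1 + r) * (x * y)) + (2 : ℂ) • 1
  have e1 : x * y * (x * y) = -1 := by
    rw [mul_assoc, ← mul_assoc y, hyx, neg_mul, mul_neg, mul_assoc x y, hyy, mul_one, hxx]
  have e2 : x * y * (r * (x * y)) = r := by
    rw [← mul_assoc r, h1, mul_assoc y, h2, mul_assoc x, ← mul_assoc y y, hyy, one_mul,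
      ← mul_assoc, hxx, one_mul]
  rw [add_mul, one_mul, mul_add, e1, e2, two_smul]
  abel

/-- The hypothesis says that at most one rung is dotted, so the two Clifford factors commute
trivially. As a transposition is symmetric in its two points, the off-diagonal sums agree and only
diagonal terms survive; they give the right-hand sides of the three square switches. -/
theorem squareOp_swap (A B : Finset ℕ) (d d' : Bool) (h : (d && d') = false) :
    squareOp n N d d' A B - squareOp n N d' d B A =
      ∑ a ∈ A, opC n N d a * opC n N d' a - ∑ b ∈ B, opC n N d' b * opC n N d b := by
  rw [squareOp, squareOp, Finset.sum_add_distrib, Finset.sum_add_distrib]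
  have e : ∑ a ∈ A, ∑ b ∈ B, opC n N d a * opC n N d' b * opR n N (Equiv.swap a b) =
      ∑ b ∈ B, ∑ a ∈ A, opC n N d' b * opC n N d a * opR n N (Equiv.swap b a) := by
    rw [Finset.sum_comm]
    refine Finset.sum_congr rfl fun b _ => Finset.sum_congr rfl fun a _ => ?_
    rw [Equiv.swap_comm]
    cases d <;> cases d' <;> simp_all [opC_false]
  rw [e]
  abel

theorem wsum_strands {k l : ℕ} (h : k + l = N) : wsum (strand k ++ strand l) = N := by
  rw [wsum_append, wsum_strand, wsum_strand, h]

theorem mapPre_square_switch (k l : ℕ) :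
    mapPre n (Pre.ladLR false false k l) = mapPre n (Pre.ladRL false false k l ⊹
      ((k : ℂ) - (l : ℂ)) ⊡ Pre.one (strand k ++ strand l)) := by
  refine (lift_ladLR false false k l rfl).mapPre_eq ((lift_ladRL false false k l rfl).add
    ((lift_id rfl (wsum_strands rfl)).smul _)) fun hb => congrArg _ ?_
  have h := squareOp_swap (n := n) (N := k + l) (Finset.range k) (Finset.Ico k (k + l)) false false rfl
  rw [← sub_eq_iff_eq_add']
  refine h.trans ?_
  simp only [opC_false, mul_one, Finset.sum_const, Finset.card_range, Nat.card_Ico,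
    Nat.add_sub_cancel_left]
  rw [sub_smul, Nat.cast_smul_eq_nsmul, Nat.cast_smul_eq_nsmul]
  rfl

theorem mapPre_square_switch_dot (k l : ℕ) :
    mapPre n (Pre.ladLR true false k l ⊹ (-1 : ℂ) ⊡ Pre.ladRL false true k l) =
      mapPre n ((Pre.dotN k ⊠ Pre.I l) ⊹ (-1 : ℂ) ⊡ (Pre.I k ⊠ Pre.dotN l)) := by
  refine ((lift_ladLR true false k l rfl).add ((lift_ladRL false true k l rfl).smul _)).mapPre_eq
    ((lift_dotN_tensor_one rfl).add ((lift_one_tensor_dotN rfl).smul _)) fun hb => congrArg _ ?_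
  have h := squareOp_swap (n := n) (N := k + l) (Finset.range k) (Finset.Ico k (k + l)) true false rfl
  simp only [opC_false, mul_one, one_mul] at h
  rw [neg_smul, one_smul, neg_smul, one_smul, ← sub_eq_add_neg, ← sub_eq_add_neg]
  exact h

theorem mapPre_square_switch_dot' (k l : ℕ) :
    mapPre n (Pre.ladLR false true k l ⊹ (-1 : ℂ) ⊡ Pre.ladRL true false k l) =
      mapPre n ((Pre.dotN k ⊠ Pre.I l) ⊹ (-1 : ℂ) ⊡ (Pre.I k ⊠ Pre.dotN l)) := by
  refine ((lift_ladLR false true k l rfl).add ((lift_ladRL true false k l rfl).smul _)).mapPre_eq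
    ((lift_dotN_tensor_one rfl).add ((lift_one_tensor_dotN rfl).smul _)) fun hb => congrArg _ ?_
  have h := squareOp_swap (n := n) (N := k + l) (Finset.range k) (Finset.Ico k (k + l)) false true rfl
  simp only [opC_false, mul_one, one_mul] at h
  rw [neg_smul, one_smul, neg_smul, one_smul, ← sub_eq_add_neg, ← sub_eq_add_neg]
  exact h

/-- Related diagrams induce the same map. -/
theorem mapPre_rel {f g : Pre a b} (h : Pre.Rel f g) : mapPre n f = mapPre n g := by
  induction h with
  | refl f => rfl
  | symm _ ih => exact ih.symm
  | trans _ _ ih₁ ih₂ => exact ih₁.trans ih₂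
  | add_congr _ _ ih₁ ih₂ => simp only [mapPre, ih₁, ih₂]
  | smul_congr z _ ih => simp only [mapPre, ih]
  | comp_congr _ _ ih₁ ih₂ => simp only [mapPre, ih₁, ih₂]
  | tensor_congr _ _ ih₁ ih₂ => simp only [mapPre, ih₁, ih₂]
  | add_comm f g => exact add_comm _ _
  | add_assoc f g h => exact add_assoc _ _ _
  | zero_add f => exact zero_add _
  | zero_smul f => exact zero_smul _ _
  | one_smul f => exact one_smul _ _
  | mul_smul z w f => exact mul_smul _ _ _
  | smul_add z f g => exact smul_add _ _ _
  | add_smul z w f => exact add_smul _ _ _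
  | add_comp g g' f => exact LinearMap.add_comp _ _ _
  | comp_add g f f' => exact LinearMap.comp_add _ _ _
  | smul_comp z g f => exact LinearMap.smul_comp _ _ _
  | comp_smul z g f => exact LinearMap.comp_smul _ _ _
  | add_tensor f f' g =>
    simp only [mapPre, wordTensor, add_superTensor, LinearMap.add_comp, LinearMap.comp_add]
  | tensor_add f g g' =>
    simp only [mapPre, wordTensor, superTensor_add, LinearMap.add_comp, LinearMap.comp_add]
  | smul_tensor z f g =>
    simp only [mapPre, wordTensor, smul_superTensor, LinearMap.smul_comp, LinearMap.comp_smul]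
  | tensor_smul z f g =>
    simp only [mapPre, wordTensor, superTensor_smul, LinearMap.smul_comp, LinearMap.comp_smul]
  | one_comp f => exact LinearMap.id_comp _
  | comp_one f => exact LinearMap.comp_id _
  | comp_assoc h g f => exact LinearMap.comp_assoc _ _ _
  | tensor_one a b => exact wordTensor_id a b
  | super_interchange f g h k hg hh =>
    exact wordTensor_comp _ _ (mapPre_mem_homGr n hg).1 (mapPre_mem_homGr n hh).1
  | tensor_assoc f g h => exact wordTensor_assoc _ _ _
  | unit_tensor f => exact wordTensor_unit_left _
  | tensor_unit f => exact wordTensor_unit_right _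
  | merge_assoc h k l => exact mapPre_merge_assoc h k l
  | split_assoc h k l => exact mapPre_split_assoc h k l
  | digon k l => exact mapPre_digon k l
  | dot_collision k => exact mapPre_dot_collision k
  | dot_merge k l => exact mapPre_dot_merge k l
  | dot_split k l => exact mapPre_dot_split k l
  | dumbbell => exact mapPre_dumbbell
  | square_switch k l => exact mapPre_square_switch k l
  | square_switch_dot k l => exact mapPre_square_switch_dot k l
  | square_switch_dot' k l => exact mapPre_square_switch_dot' k l
  | double_rungs₁ h k l =>
    obtain ⟨F, G, hF, hG, e, -⟩ := lift_ladL (n := n) h k l rfl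
    exact ((hF _ _).add ((hG _ _).smul _)).mapPre_eq ((hF _ _).add (hG _ _))
      fun _ => congrArg _ e
  | double_rungs₂ h k l =>
    obtain ⟨F, G, hF, hG, -, e⟩ := lift_ladL (n := n) h k l rfl
    exact ((hF _ _).add ((hG _ _).smul _)).mapPre_eq ((hF _ _).add ((hG _ _).smul _))
      fun _ => congrArg _ e
  | double_rungs₁_rev h k l =>
    obtain ⟨F, G, hF, hG, e, -⟩ := lift_ladR (n := n) h k l rfl
    exact ((hF _ _).add ((hG _ _).smul _)).mapPre_eq ((hF _ _).add (hG _ _))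
      fun _ => congrArg _ e
  | double_rungs₂_rev h k l =>
    -- In this relation `F` and `G` stand in the opposite places, so the identity `e` has to be
    -- rearranged.
    obtain ⟨F, G, hF, hG, -, e⟩ := lift_ladR (n := n) h k l rfl
    refine ((hG _ _).add ((hF _ _).smul _)).mapPre_eq ((hG _ _).add ((hF _ _).smul _))
      fun _ => congrArg _ ?_
    rw [neg_smul, one_smul, neg_smul, one_smul, ← sub_eq_add_neg, ← sub_eq_add_neg,
      sub_eq_sub_iff_add_eq_add] at e ⊢
    rw [add_comm (G false true), e]
    exact add_comm _ _

end TypeQ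
end

noncomputable section
namespace TypeQ
variable {n : ℕ} {a b c d : Word}

/-! ### The functor `Ψ` and the action `ψ` -/

/-- The functor from webs to supermodules, on morphisms. -/
def webMap (n : ℕ) (a b : Word) : WebHom a b →ₗ[ℂ] (sword n a →ₗ[ℂ] sword n b) where
  toFun := Quot.lift (mapPre n) fun _ _ h => mapPre_rel h
  map_add' f g := by
    induction f using WebHom.ind with | h f =>
    induction g using WebHom.ind with | h g => rfl
  map_smul' z f := by
    induction f using WebHom.ind with | h f => rfl

theorem webMap_mk (f : Pre a b) : webMap n a b (WebHom.mk f) = mapPre n f := rfl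

/-- The functor from webs to `q(n)`-supermodules. -/
def webFunctor (n : ℕ) : WebFunctor n where
  map := webMap n _ _
  map_one a := rfl
  map_comp g f := by
    induction f using WebHom.ind with | h f =>
    induction g using WebHom.ind with | h g => rfl
  map_gr ε f := by
    rintro ⟨p, hp, rfl⟩
    exact mapPre_mem_homGr n hp
  map_tensor f g := by
    induction f using WebHom.ind with | h f =>
    induction g using WebHom.ind with | h g =>
    rw [← WebHom.mk_tensor, webMap_mk, mapPre, wordTensor]
    refine LinearMap.ext fun x => ?_
    simp only [LinearMap.comp_apply, LinearEquiv.coe_coe, LinearEquiv.symm_apply_apply]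
    rfl
  map_dot k p v hv := by
    change symDot n k (sprod v) ⊗ₜ[ℂ] (1 : ℂ) = _
    rw [symDot_sprod p v hv, TensorProduct.sum_tmul]
    exact Finset.sum_congr rfl fun t _ => TensorProduct.smul_tmul' _ _ _
  map_merge k l v w := by
    change symMul n k l ((k : ℕ) + l) rfl (sprod v ⊗ₜ sprod w) ⊗ₜ[ℂ] (1 : ℂ) = _
    rw [symMul_sprod]
    rfl
  map_split k l p v hv := by
    change (TensorProduct.assoc ℂ (Sym n k) (Sym n l) ℂ)
      (symSplit n k l ((k : ℕ) + l) rfl (sprod v) ⊗ₜ[ℂ] (1 : ℂ)) = _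
    rw [symSplit_sprod p v hv, TensorProduct.sum_tmul, map_sum]
    refine Finset.sum_congr rfl fun I _ => ?_
    rw [← TensorProduct.smul_tmul', map_smul, TensorProduct.assoc_tmul]

/-- The images of the generators of the Sergeev superalgebra. -/
def genOp (n k : ℕ) : SerGen k → Module.End ℂ (T n k) :=
  Sum.elim (fun i => opC n k true i) fun j => opR n k (Equiv.swap j (j + 1))

theorem swap_permsOn_of_pred {k : ℕ} (j : Fin (k - 1)) :
    Equiv.swap (j : ℕ) (j + 1) ∈ permsOn (Finset.range k) :=
  swap_permsOn_range (by omega)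

/-- Both sides are the transposition of `x` and `z`. -/
theorem swap_braid {x y z : ℕ} (hxy : x ≠ y) (hyz : y ≠ z) (hxz : x ≠ z) :
    Equiv.swap x y * Equiv.swap y z * Equiv.swap x y =
      Equiv.swap y z * Equiv.swap x y * Equiv.swap y z := by
  rw [Equiv.swap_mul_swap_mul_swap hxy hxz, Equiv.swap_comm x y, Equiv.swap_comm y z,
    Equiv.swap_mul_swap_mul_swap hyz.symm hxz.symm, Equiv.swap_comm]

theorem genOp_rel (n k : ℕ) {x y : FreeAlgebra ℂ (SerGen k)} (h : SerRel k x y) :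
    FreeAlgebra.lift ℂ (genOp n k) x = FreeAlgebra.lift ℂ (genOp n k) y := by
  have hc : ∀ i : Fin k, FreeAlgebra.lift ℂ (genOp n k) (genC i) = opC n k true i := fun i => by
    rw [genC, FreeAlgebra.lift_ι_apply]; rfl
  have hs : ∀ j : Fin (k - 1), FreeAlgebra.lift ℂ (genOp n k) (genS j) =
      opR n k (Equiv.swap j (j + 1)) := fun j => by
    rw [genS, FreeAlgebra.lift_ι_apply]; rfl
  induction h with
  | c_sq i => rw [map_mul, hc, map_one, opC_sq true i.2]
  | c_anti i j h =>
    rw [map_neg, map_mul, map_mul, hc, hc, opC_anti (fun e => h (Fin.ext e)) i.2 j.2]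
  | s_sq i =>
    rw [map_mul, hs, map_one, opR_mul (swap_permsOn_of_pred i) (swap_permsOn_of_pred i),
      Equiv.swap_mul_self, opR_one]
  | s_comm i j h h' =>
    rw [map_mul, map_mul, hs, hs, opR_mul (swap_permsOn_of_pred i) (swap_permsOn_of_pred j),
      opR_mul (swap_permsOn_of_pred j) (swap_permsOn_of_pred i)]
    by_cases e : i = j
    · rw [e]
    · have e' : (i : ℕ) ≠ j := fun h => e (Fin.ext h)
      rw [Equiv.mul_swap_eq_swap_mul, Equiv.swap_apply_of_ne_of_ne (by omega) (by omega),
        Equiv.swap_apply_of_ne_of_ne (by omega) (by omega)]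
  | s_braid i j h =>
    simp only [map_mul, hs]
    have hi := swap_permsOn_of_pred i
    have hj := swap_permsOn_of_pred j
    rw [opR_mul hi hj, opR_mul (mul_mem hi hj) hi, opR_mul hj hi, opR_mul (mul_mem hj hi) hj, h]
    congr 1
    exact swap_braid (by omega) (by omega) (by omega)
  | cs_comm i j h h' =>
    rw [map_mul, map_mul, hc, hs, opR_opC (swap_permsOn_of_pred j) true i.2,
      Equiv.swap_apply_of_ne_of_ne h h']
  | sc_left j x y hx hy =>
    rw [map_mul, map_mul, hs, hc, hc, opR_opC (swap_permsOn_of_pred j) true x.2, hx,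
      Equiv.swap_apply_left, hy]
  | sc_right j x y hx hy =>
    rw [map_mul, map_mul, hs, hc, hc, opR_opC (swap_permsOn_of_pred j) true y.2, hy,
      Equiv.swap_apply_right, hx]

/-- Sergeev's homomorphism. -/
def sergeevHom (n k : ℕ) : Ser k →ₐ[ℂ] Module.End ℂ (T n k) :=
  RingQuot.liftAlgHom ℂ ⟨FreeAlgebra.lift ℂ (genOp n k), fun _ _ h => genOp_rel n k h⟩

theorem sergeevHom_c {k : ℕ} (i : Fin k) : sergeevHom n k (Ser.c i) = opC n k true i := by
  rw [sergeevHom, Ser.c, RingQuot.liftAlgHom_mkAlgHom_apply, genC, FreeAlgebra.lift_ι_apply]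
  rfl

theorem sergeevHom_s {k : ℕ} (j : Fin (k - 1)) :
    sergeevHom n k (Ser.s j) = opR n k (Equiv.swap j (j + 1)) := by
  rw [sergeevHom, Ser.s, RingQuot.liftAlgHom_mkAlgHom_apply, genS, FreeAlgebra.lift_ι_apply]
  rfl

theorem sergeevHom_word_mem_homGr {k : ℕ} (w : List (SerGen k)) :
    sergeevHom n k (Ser.word w) ∈
      QMod.homGr (T n k) (T n k) ((w.countP Sum.isLeft : ℕ) : ZMod 2) := by
  induction w with
  | nil =>
    rw [Ser.word, List.map_nil, List.prod_nil, map_one]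
    exact QMod.homGr_id _
  | cons x w ih =>
    have e : Ser.word (x :: w) = Sum.elim Ser.c Ser.s x * Ser.word w := by
      rw [Ser.word, List.map_cons, List.prod_cons]; rfl
    rw [e, map_mul, List.countP_cons, Nat.cast_add, add_comm]
    refine QMod.homGr_comp ?_ ih
    rcases x with i | j
    · rw [Sum.elim_inl, sergeevHom_c]
      have := clif_mem_homGr n k i
      simpa [opC, clifOp] using this
    · rw [Sum.elim_inr, sergeevHom_s]
      simpa using (evenHom_permT (n := n) (swap_permsOn_of_pred j)).mem_homGr

/-- Sergeev's action on the tensor power. -/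
def sergeevAction (n k : ℕ) : SergeevAction n k where
  map := sergeevHom n k
  map_gr ε x hx := by
    rw [Ser.gr] at hx
    induction hx using Submodule.span_induction with
    | mem x hx =>
      obtain ⟨w, rfl, rfl⟩ := hx
      exact sergeevHom_word_mem_homGr w
    | zero => rw [map_zero]; exact Submodule.zero_mem _
    | add x y _ _ hx hy => rw [map_add]; exact Submodule.add_mem _ hx hy
    | smul z x _ hx => rw [map_smul]; exact Submodule.smul_mem _ z hx
  map_s j x y hx hy p v hv := by
    have hk : (j : ℕ) + 1 < k := by omega
    have ex : extSeq 0 p j = p x := by rw [← hx, extSeq_coe]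
    have ey : extSeq 0 p (j + 1) = p y := by rw [← hy, extSeq_coe]
    rw [sergeevHom_s, opR, permT_swap hk, ← pureSeq_ext, sw_pureSeq hk (isHomog_ext hv), ex, ey,
      ← pureSeq_ext]
    refine congrArg _ (pureSeq_congr fun i hi => ?_)
    obtain ⟨i, rfl⟩ : ∃ i' : Fin k, (i' : ℕ) = i := ⟨⟨i, hi⟩, rfl⟩
    have hxy : (y : ℕ) = x + 1 := by omega
    rw [extSeq_coe, Function.comp_apply, Function.comp_apply, ← hx, ← hxy]
    have : Equiv.swap (x : ℕ) y i = (Equiv.swap x y i : Fin k) := by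
      simp only [Equiv.swap_apply_def, Fin.ext_iff]
      split_ifs <;> rfl
    rw [this, extSeq_coe]
  map_c i p v hv := by
    rw [sergeevHom_c]
    exact clif_pureT i p v hv

end TypeQ
end

noncomputable section
namespace TypeQ
namespace WebHom
variable {a b c d a' b' c' d' : Word}

/-! ### Calculus in the web category -/

/-- The identity between two equal words. -/
def idc (h : a = b) : WebHom a b := mk (.id h)

theorem idc_rfl (h : a = a) : idc h = one a := rfl

theorem idc_comp_idc (h : a = b) (h' : b = c) : comp (idc h') (idc h) = idc (h.trans h') := by
  subst h h'; exact comp_one _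

theorem idc_comp_cancel (h : a = b) (h' : b = a) (f : WebHom c a) :
    comp (idc h') (comp (idc h) f) = f := by
  rw [← comp_assoc, idc_comp_idc]; exact one_comp f

theorem comp_idc_cancel (h : a = b) (h' : b = a) (f : WebHom a c) :
    comp (comp f (idc h')) (idc h) = f := by
  rw [comp_assoc, idc_comp_idc]; exact comp_one f

theorem zero_comp (f : WebHom a b) : comp (0 : WebHom b c) f = 0 := by
  simpa using smul_comp 0 (0 : WebHom b c) f

theorem comp_zero (f : WebHom b c) : comp f (0 : WebHom a b) = 0 := by
  simpa using comp_smul 0 f (0 : WebHom a b)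

theorem add_tensor (f f' : WebHom a b) (g : WebHom c d) :
    tensor (f + f') g = tensor f g + tensor f' g := by
  induction f using ind with | h f =>
  induction f' using ind with | h f' =>
  induction g using ind with | h g => exact sound (.add_tensor f f' g)

theorem tensor_add (f : WebHom a b) (g g' : WebHom c d) :
    tensor f (g + g') = tensor f g + tensor f g' := by
  induction f using ind with | h f =>
  induction g using ind with | h g =>
  induction g' using ind with | h g' => exact sound (.tensor_add f g g')

theorem smul_tensor (z : ℂ) (f : WebHom a b) (g : WebHom c d) :
    tensor (z • f) g = z • tensor f g := by
  induction f using ind with | h f =>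
  induction g using ind with | h g => exact sound (.smul_tensor z f g)

theorem tensor_smul (z : ℂ) (f : WebHom a b) (g : WebHom c d) :
    tensor f (z • g) = z • tensor f g := by
  induction f using ind with | h f =>
  induction g using ind with | h g => exact sound (.tensor_smul z f g)

theorem zero_tensor (g : WebHom c d) : tensor (0 : WebHom a b) g = 0 := by
  simpa using smul_tensor 0 (0 : WebHom a b) g

theorem tensor_zero (f : WebHom a b) : tensor f (0 : WebHom c d) = 0 := by
  simpa using tensor_smul 0 f (0 : WebHom c d)

theorem tensor_one_one (a b : Word) : tensor (one a) (one b) = one (a ++ b) :=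
  sound (.tensor_one a b)

theorem tensor_assoc (f : WebHom a a') (g : WebHom b b') (h : WebHom c c') :
    comp (idc (List.append_assoc a' b' c')) (tensor (tensor f g) h) =
      comp (tensor f (tensor g h)) (idc (List.append_assoc a b c)) := by
  induction f using ind with | h f =>
  induction g using ind with | h g =>
  induction h using ind with | h h => exact sound (.tensor_assoc f g h)

theorem unit_tensor (f : WebHom a b) : tensor (one []) f = f := by
  induction f using ind with | h f => exact sound (.unit_tensor f)

theorem tensor_unit (f : WebHom a b) :
    comp (idc (List.append_nil b)) (tensor f (one [])) = comp f (idc (List.append_nil a)) := by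
  induction f using ind with | h f => exact sound (.tensor_unit f)

theorem one_mem_gr (a : Word) : one a ∈ gr a a 0 := ⟨_, .id rfl, rfl⟩

theorem idc_mem_gr (h : a = b) : idc h ∈ gr a b 0 := ⟨_, .id h, rfl⟩

theorem comp_mem_gr {p q : ZMod 2} {g : WebHom b c} {f : WebHom a b} (hg : g ∈ gr b c p)
    (hf : f ∈ gr a b q) : comp g f ∈ gr a c (p + q) := by
  obtain ⟨g, hg, rfl⟩ := hg
  obtain ⟨f, hf, rfl⟩ := hf
  exact ⟨_, .comp hg hf, rfl⟩

theorem comp_mem_gr_zero {g : WebHom b c} {f : WebHom a b} (hg : g ∈ gr b c 0)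
    (hf : f ∈ gr a b 0) : comp g f ∈ gr a c 0 := comp_mem_gr hg hf

theorem tensor_mem_gr {p q : ZMod 2} {g : WebHom c d} {f : WebHom a b} (hf : f ∈ gr a b p)
    (hg : g ∈ gr c d q) : tensor f g ∈ gr (a ++ c) (b ++ d) (p + q) := by
  obtain ⟨g, hg, rfl⟩ := hg
  obtain ⟨f, hf, rfl⟩ := hf
  exact ⟨_, .tensor hf hg, rfl⟩

theorem tensor_mem_gr_zero {g : WebHom c d} {f : WebHom a b} (hf : f ∈ gr a b 0)
    (hg : g ∈ gr c d 0) : tensor f g ∈ gr (a ++ c) (b ++ d) 0 := tensor_mem_gr hf hg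

theorem dot_mem_gr (k : ℕ+) : dot k ∈ gr [k] [k] 1 := ⟨_, .dot k, rfl⟩

theorem merge_mem_gr (k l : ℕ+) : merge k l ∈ gr [k, l] [k + l] 0 := ⟨_, .merge k l, rfl⟩

theorem split_mem_gr (k l : ℕ+) : split k l ∈ gr [k + l] [k, l] 0 := ⟨_, .split k l, rfl⟩

/-- The interchange law is imposed only when two of the morphisms are homogeneous. The decomposition
extends it to the case where one of them is even and the other is arbitrary, and then there is no
sign. -/
theorem exists_parts (f : WebHom a b) : ∃ f₀ ∈ gr a b 0, ∃ f₁ ∈ gr a b 1, f = f₀ + f₁ := by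
  have two : (1 + 1 : ZMod 2) = 0 := rfl
  induction f using ind with | h f =>
  induction f with
  | id h => exact ⟨_, ⟨_, .id h, rfl⟩, 0, Submodule.zero_mem _, (add_zero _).symm⟩
  | comp g f ihg ihf =>
    obtain ⟨g₀, hg₀, g₁, hg₁, eg⟩ := ihg
    obtain ⟨f₀, hf₀, f₁, hf₁, ef⟩ := ihf
    refine ⟨comp g₀ f₀ + comp g₁ f₁, Submodule.add_mem _ (comp_mem_gr hg₀ hf₀)
      (two ▸ comp_mem_gr hg₁ hf₁), comp g₀ f₁ + comp g₁ f₀, Submodule.add_mem _ ?_ ?_, ?_⟩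
    · simpa using comp_mem_gr hg₀ hf₁
    · simpa using comp_mem_gr hg₁ hf₀
    · rw [mk_comp, eg, ef, add_comp, comp_add, comp_add]; abel
  | tensor f g ihf ihg =>
    obtain ⟨g₀, hg₀, g₁, hg₁, eg⟩ := ihg
    obtain ⟨f₀, hf₀, f₁, hf₁, ef⟩ := ihf
    refine ⟨tensor f₀ g₀ + tensor f₁ g₁, Submodule.add_mem _ (tensor_mem_gr hf₀ hg₀)
      (two ▸ tensor_mem_gr hf₁ hg₁), tensor f₁ g₀ + tensor f₀ g₁, Submodule.add_mem _ ?_ ?_, ?_⟩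
    · simpa using tensor_mem_gr hf₁ hg₀
    · simpa using tensor_mem_gr hf₀ hg₁
    · rw [mk_tensor, eg, ef, add_tensor, tensor_add, tensor_add]; abel
  | dot k => exact ⟨0, Submodule.zero_mem _, _, ⟨_, .dot k, rfl⟩, (zero_add _).symm⟩
  | merge k l => exact ⟨_, ⟨_, .merge k l, rfl⟩, 0, Submodule.zero_mem _, (add_zero _).symm⟩
  | split k l => exact ⟨_, ⟨_, .split k l, rfl⟩, 0, Submodule.zero_mem _, (add_zero _).symm⟩
  | zero => exact ⟨0, Submodule.zero_mem _, 0, Submodule.zero_mem _, (add_zero _).symm⟩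
  | add f g ihf ihg =>
    obtain ⟨g₀, hg₀, g₁, hg₁, eg⟩ := ihg
    obtain ⟨f₀, hf₀, f₁, hf₁, ef⟩ := ihf
    refine ⟨f₀ + g₀, Submodule.add_mem _ hf₀ hg₀, f₁ + g₁, Submodule.add_mem _ hf₁ hg₁, ?_⟩
    rw [mk_add, eg, ef]; abel
  | smul z f ihf =>
    obtain ⟨f₀, hf₀, f₁, hf₁, ef⟩ := ihf
    exact ⟨z • f₀, Submodule.smul_mem _ z hf₀, z • f₁, Submodule.smul_mem _ z hf₁, by
      rw [mk_smul, ef, smul_add]⟩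

theorem interchange {p q : ZMod 2} (f : WebHom b c) {g : WebHom b' c'} {h : WebHom a b}
    (k : WebHom a' b') (hg : g ∈ gr b' c' p) (hh : h ∈ gr a b q) :
    comp (tensor f g) (tensor h k) = sgn (p * q) • tensor (comp f h) (comp g k) := by
  obtain ⟨g, hg, rfl⟩ := hg
  obtain ⟨h, hh, rfl⟩ := hh
  induction f using ind with | h f =>
  induction k using ind with | h k => exact sound (.super_interchange f g h k hg hh)

theorem interchange_left (f : WebHom b c) {g : WebHom b' c'} (h : WebHom a b)
    (k : WebHom a' b') (hg : g ∈ gr b' c' 0) :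
    comp (tensor f g) (tensor h k) = tensor (comp f h) (comp g k) := by
  obtain ⟨h₀, hh₀, h₁, hh₁, rfl⟩ := exists_parts h
  rw [add_tensor, comp_add, interchange f k hg hh₀, interchange f k hg hh₁, comp_add, add_tensor]
  simp

theorem interchange_right (f : WebHom b c) (g : WebHom b' c') {h : WebHom a b}
    (k : WebHom a' b') (hh : h ∈ gr a b 0) :
    comp (tensor f g) (tensor h k) = tensor (comp f h) (comp g k) := by
  obtain ⟨g₀, hg₀, g₁, hg₁, rfl⟩ := exists_parts g
  rw [tensor_add, add_comp, interchange f k hg₀ hh, interchange f k hg₁ hh, add_comp, tensor_add]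
  simp

theorem one_tensor_comp (u : Word) (g : WebHom b c) (f : WebHom a b) :
    tensor (one u) (comp g f) = comp (tensor (one u) g) (tensor (one u) f) := by
  rw [interchange_right _ _ _ (one_mem_gr u), one_comp]

theorem comp_tensor_one (u : Word) (g : WebHom b c) (f : WebHom a b) :
    tensor (comp g f) (one u) = comp (tensor g (one u)) (tensor f (one u)) := by
  rw [interchange_left _ _ _ (one_mem_gr u), one_comp]

/-- Tensoring with an identity on the left. -/
def tensorLeft (u : Word) (a : Word) : WebHom a a →ₐ[ℂ] WebHom (u ++ a) (u ++ a) :=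
  AlgHom.ofLinearMap
    { toFun := fun f => tensor (one u) f
      map_add' := tensor_add (one u)
      map_smul' := fun z f => tensor_smul z (one u) f }
    (tensor_one_one u a) (one_tensor_comp u)

/-- Tensoring with an identity on the right. -/
def tensorRight (u : Word) (a : Word) : WebHom a a →ₐ[ℂ] WebHom (a ++ u) (a ++ u) :=
  AlgHom.ofLinearMap
    { toFun := fun f => tensor f (one u)
      map_add' := fun f g => add_tensor f g (one u)
      map_smul' := fun z f => smul_tensor z f (one u) }
    (tensor_one_one a u) (comp_tensor_one u)

theorem mul_eq_comp (f g : WebHom a a) : f * g = comp f g := rfl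

theorem one_eq (a : Word) : (1 : WebHom a a) = one a := rfl

/-- Reassociation if the first word is a single letter. -/
theorem tensor_assoc_letter {m l : ℕ+} (f : WebHom [m] [l]) (g : WebHom b b') (h : WebHom c c') :
    tensor (tensor f g) h = tensor f (tensor g h) :=
  (one_comp _).symm.trans ((tensor_assoc f g h).trans (comp_one _))

/-- Reassociation if the first word has two letters. -/
theorem tensor_assoc_two {m l m' l' : ℕ+} (f : WebHom [m, m'] [l, l']) (g : WebHom b b')
    (h : WebHom c c') : tensor (tensor f g) h = tensor f (tensor g h) :=
  (one_comp _).symm.trans ((tensor_assoc f g h).trans (comp_one _))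

/-! ### The relations of the Sergeev superalgebra -/

theorem dot_one_sq : comp (dot 1) (dot 1) = one [1] :=
  (sound (.dot_collision 1)).trans (by rw [mk_smul, Nat.cast_one, one_smul]; rfl)

/-- The dumbbell on two strands labelled `1`. -/
def bell : WebHom [1, 1] [1, 1] := comp (split 1 1) (merge 1 1)

theorem bell_mem_gr : bell ∈ gr [1, 1] [1, 1] 0 :=
  comp_mem_gr_zero (split_mem_gr 1 1) (merge_mem_gr 1 1)

theorem cross_eq : cross = bell - 1 := rfl

theorem cross_mem_gr : cross ∈ gr [1, 1] [1, 1] 0 :=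
  Submodule.sub_mem _ bell_mem_gr (one_mem_gr _)

theorem mk_splitN_one : mk (Pre.splitN 1 1 2 rfl) = split 1 1 :=
  comp_one (split 1 1)

theorem mk_mergeN_one : mk (Pre.mergeN 1 1 2 rfl) = merge 1 1 :=
  one_comp (merge 1 1)

theorem merge_comp_split : comp (merge 1 1) (split 1 1) = (2 : ℂ) • one [1 + 1] := by
  have h := sound (.digon 1 1)
  rw [mk_comp] at h
  exact (congrArg₂ comp mk_mergeN_one.symm mk_splitN_one.symm).trans (h.trans (by
    rw [mk_smul]; norm_num; rfl))

/-- The inner merge after a split is a digon, which contributes the factor 2. -/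
theorem bell_sq : bell * bell = (2 : ℂ) • bell := by
  rw [mul_eq_comp, bell, comp_assoc, ← comp_assoc (merge 1 1), merge_comp_split, smul_comp,
    comp_smul, one_comp]

theorem cross_sq : cross * cross = 1 := by
  rw [cross_eq, sub_mul, mul_sub, bell_sq, one_mul, mul_one, two_smul]
  abel

end WebHom
end TypeQ
end

/-! ### Tensor products of webs up to equality of words. -/

noncomputable section
namespace TypeQ
namespace WebHom
variable {a b c d a' b' c' d' a'' b'' w x y z : Word}

theorem idc_comp_idc_comp (h : a = b) (h' : b = c) (f : WebHom d a) :
    comp (idc h') (comp (idc h) f) = comp (idc (h.trans h')) f := by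
  rw [← comp_assoc, idc_comp_idc]

/-- The tensor product, with source and target rewritten along equalities of words. -/
def tn (hx : a ++ c = x) (hy : b ++ d = y) (f : WebHom a b) (g : WebHom c d) : WebHom x y :=
  comp (idc hy) (comp (tensor f g) (idc hx.symm))

theorem tn_rfl (f : WebHom a b) (g : WebHom c d) : tn rfl rfl f g = tensor f g :=
  (one_comp _).trans (comp_one _)

theorem tn_comp_even {f : WebHom b c} {g : WebHom b' c'} {h : WebHom a b} {k : WebHom a' b'}
    {hx : a ++ a' = x} {hy hy' : b ++ b' = y} {hz : c ++ c' = z}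
    (e : g ∈ gr b' c' 0 ∨ h ∈ gr a b 0) :
    comp (tn hy hz f g) (tn hx hy' h k) = tn hx hz (comp f h) (comp g k) := by
  subst hx hy hz
  rw [tn_rfl, tn_rfl, tn_rfl]
  rcases e with e | e
  · exact interchange_left _ _ _ e
  · exact interchange_right _ _ _ e

theorem tn_one_comp {u : Word} {g : WebHom b c} {f : WebHom a b} {hx : u ++ a = x}
    {hy hy' : u ++ b = y} {hz : u ++ c = z} :
    comp (tn hy hz (one u) g) (tn hx hy' (one u) f) = tn hx hz (one u) (comp g f) := by
  rw [tn_comp_even (Or.inr (one_mem_gr u)), one_comp]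

theorem tn_comp_one {u : Word} {g : WebHom b c} {f : WebHom a b} {hx : a ++ u = x}
    {hy hy' : b ++ u = y} {hz : c ++ u = z} :
    comp (tn hy hz g (one u)) (tn hx hy' f (one u)) = tn hx hz (comp g f) (one u) := by
  rw [tn_comp_even (Or.inl (one_mem_gr u)), one_comp]

/-- As source and target are variables with proofs, reassociation is an equation between morphisms
of the same type and can be used for rewriting without inserting `idc`. -/
theorem tn_assoc {f : WebHom a a'} {g : WebHom b b'} {h : WebHom c c'} {u v s t : Word}
    {h₁ : a ++ b = u} {h₂ : a' ++ b' = v} {h₃ : u ++ c = x} {h₄ : v ++ c' = y}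
    {k₁ : b ++ c = s} {k₂ : b' ++ c' = t} {k₃ : a ++ s = x} {k₄ : a' ++ t = y} :
    tn h₃ h₄ (tn h₁ h₂ f g) h = tn k₃ k₄ f (tn k₁ k₂ g h) := by
  subst h₁ h₂ h₃ h₄ k₁ k₂
  rw [tn_rfl, tn_rfl, tn_rfl, tn, ← comp_assoc]
  have e := tensor_assoc f g h
  have e' := congrArg (fun z => comp (idc (List.append_assoc a' b' c').symm) z) e
  simp only [idc_comp_cancel] at e'
  rw [e', comp_assoc]

theorem tn_idc {hx : a ++ c = x} {hy : b ++ d = y} (h : a = b) (h' : c = d) :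
    tn hx hy (idc h) (idc h') = idc (by rw [← hx, ← hy, h, h']) := by
  subst h h' hx hy
  rw [tn_rfl]
  exact tensor_one_one _ _

theorem tn_one_one {hx : a ++ c = x} {hy : a ++ c = y} :
    tn hx hy (one a) (one c) = idc (hx.symm.trans hy) := tn_idc rfl rfl

theorem tn_nil_left {u : Word} (h : u = []) {hx : u ++ a = x} {hy : u ++ b = y} {f : WebHom a b} :
    tn hx hy (one u) f = comp (idc (by rw [← hy, h]; rfl)) (comp f (idc (by rw [← hx, h]; rfl))) := by
  subst h hx hy
  rw [tn_rfl, unit_tensor]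
  exact ((one_comp _).trans (comp_one _)).symm

theorem tn_nil_right {u : Word} (h : u = []) {hx : a ++ u = x} {hy : b ++ u = y} {f : WebHom a b} :
    tn hx hy f (one u) = comp (idc (by rw [← hy, h, List.append_nil]))
      (comp f (idc (by rw [← hx, h, List.append_nil]))) := by
  subst h hx hy
  rw [tn_rfl]
  have e := congrArg (fun z => comp (idc (List.append_nil b).symm) z) (tensor_unit f)
  simp only [idc_comp_cancel] at e
  exact e

theorem tn_smul {hx : a ++ c = x} {hy : b ++ d = y} (z : ℂ) (f : WebHom a b) (g : WebHom c d) :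
    tn hx hy f (z • g) = z • tn hx hy f g := by
  subst hx hy; simp only [tn_rfl, tensor_smul]

theorem smul_tn {hx : a ++ c = x} {hy : b ++ d = y} (z : ℂ) (f : WebHom a b) (g : WebHom c d) :
    tn hx hy (z • f) g = z • tn hx hy f g := by
  subst hx hy; simp only [tn_rfl, smul_tensor]

theorem tn_mem_gr_zero {hx : a ++ c = x} {hy : b ++ d = y} {f : WebHom a b} {g : WebHom c d}
    (hf : f ∈ gr a b 0) (hg : g ∈ gr c d 0) : tn hx hy f g ∈ gr x y 0 := by
  subst hx hy; rw [tn_rfl]; exact tensor_mem_gr_zero hf hg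

/-! ### Ladders -/

/-- The merge with labels `≥ 0`. -/
def mrg (k l m : ℕ) (h : k + l = m) : WebHom (strand k ++ strand l) (strand m) :=
  mk (Pre.mergeN k l m h)

/-- The split with labels `≥ 0`. -/
def spl (k l m : ℕ) (h : k + l = m) : WebHom (strand m) (strand k ++ strand l) :=
  mk (Pre.splitN k l m h)

/-- The dot with label `≥ 0`. -/
def dt (k : ℕ) : WebHom (strand k) (strand k) := mk (Pre.dotN k)

/-- A rung labelled `1`. -/
def rng (d : Bool) : WebHom (strand 1) (strand 1) := mk (Pre.rung d)

theorem rng_false : rng false = one (strand 1) := rfl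

theorem rng_true : rng true = dt 1 := rfl

theorem strand_add_zero (k m : ℕ) (h : k + 0 = m) : strand k ++ strand 0 = strand m := by
  subst h; simp [strand]

theorem strand_zero_add (l m : ℕ) (h : 0 + l = m) : strand 0 ++ strand l = strand m := by
  subst h; simp [strand]

theorem mrg_zero_left (l m : ℕ) (h : 0 + l = m) : mrg 0 l m h = idc (strand_zero_add l m h) := rfl

theorem mrg_zero_right (k m : ℕ) (h : k + 0 = m) :
    mrg k 0 m h = idc (strand_add_zero k m h) := by
  cases k <;> rfl

theorem spl_zero_left (l m : ℕ) (h : 0 + l = m) :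
    spl 0 l m h = idc (strand_zero_add l m h).symm := rfl

theorem spl_zero_right (k m : ℕ) (h : k + 0 = m) :
    spl k 0 m h = idc (strand_add_zero k m h).symm := by
  cases k <;> rfl

theorem mk_rungL (d : Bool) (k l : ℕ) : mk (Pre.rungL d k l) =
    comp (tn (List.append_assoc _ _ _) rfl (mrg k 1 (k + 1) rfl) (one (strand l)))
      (comp (tn rfl rfl (one (strand k)) (tn rfl rfl (rng d) (one (strand l))))
        (tn rfl rfl (one (strand k)) (spl 1 l (l + 1) (Nat.add_comm 1 l)))) := by
  rw [tn_rfl, tn_rfl, tn_rfl, tn, idc_rfl, one_comp, comp_assoc]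
  rfl

theorem mk_rungR (d : Bool) (k l : ℕ) : mk (Pre.rungR d k l) =
    comp (tn rfl rfl (one (strand k)) (mrg 1 l (l + 1) (Nat.add_comm 1 l)))
      (comp (tn rfl rfl (one (strand k)) (tn rfl rfl (rng d) (one (strand l))))
        (tn rfl (List.append_assoc _ _ _) (spl k 1 (k + 1) rfl) (one (strand l)))) := by
  rw [tn_rfl, tn_rfl, tn_rfl, tn, idc_rfl, comp_one]
  rfl

theorem mk_rungL_zero (d : Bool) (l : ℕ) : mk (Pre.rungL d 0 l) =
    comp (tn rfl rfl (rng d) (one (strand l))) (comp (spl 1 l (l + 1) (Nat.add_comm 1 l))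
      (idc (strand_zero_add _ _ (Nat.zero_add _)))) := by
  rw [mk_rungL, mrg_zero_left, ← idc_rfl (rfl : strand l = strand l), tn_idc, idc_rfl,
    tn_nil_left (u := strand 0) rfl, tn_nil_left (u := strand 0) rfl]
  simp only [comp_assoc, idc_comp_idc_comp, idc_rfl, one_comp]

theorem mk_rungR_zero (d : Bool) (l : ℕ) : mk (Pre.rungR d 0 l) =
    comp (idc (strand_zero_add _ _ (Nat.zero_add _)).symm)
      (comp (mrg 1 l (l + 1) (Nat.add_comm 1 l)) (tn rfl rfl (rng d) (one (strand l)))) := by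
  rw [mk_rungR, spl_zero_left, ← idc_rfl (rfl : strand l = strand l), tn_idc, idc_rfl,
    tn_nil_left (u := strand 0) rfl, tn_nil_left (u := strand 0) rfl]
  simp only [comp_assoc, idc_comp_idc_comp, idc_comp_idc, idc_rfl, one_comp, comp_one]

theorem mk_rungL_right (d : Bool) (k : ℕ) : mk (Pre.rungL d k 0) =
    comp (idc (strand_add_zero _ _ rfl).symm)
      (comp (mrg k 1 (k + 1) rfl) (tn rfl rfl (one (strand k)) (rng d))) := by
  rw [mk_rungL, spl_zero_right, ← idc_rfl (rfl : strand k = strand k), tn_idc, idc_rfl,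
    ← tn_assoc (h₁ := rfl) (h₂ := rfl) (h₃ := List.append_assoc _ _ _)
      (h₄ := List.append_assoc _ _ _),
    tn_nil_right (u := strand 0) rfl, tn_nil_right (u := strand 0) rfl]
  simp only [comp_assoc, idc_comp_idc_comp, idc_comp_idc, idc_rfl, one_comp, comp_one]

theorem mk_rungR_right (d : Bool) (k : ℕ) : mk (Pre.rungR d k 0) =
    comp (tn rfl rfl (one (strand k)) (rng d)) (comp (spl k 1 (k + 1) rfl)
      (idc (strand_add_zero _ _ rfl))) := by
  rw [mk_rungR, mrg_zero_right, ← idc_rfl (rfl : strand k = strand k), tn_idc, idc_rfl,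
    ← tn_assoc (h₁ := rfl) (h₂ := rfl) (h₃ := List.append_assoc _ _ _)
      (h₄ := List.append_assoc _ _ _),
    tn_nil_right (u := strand 0) rfl, tn_nil_right (u := strand 0) rfl]
  simp only [comp_assoc, idc_comp_idc_comp, idc_rfl, one_comp]

/-- The dumbbell on two strands labelled `1`. -/
def bellN : WebHom (strand 1 ++ strand 1) (strand 1 ++ strand 1) :=
  comp (spl 1 1 (1 + 1) rfl) (mrg 1 1 (1 + 1) rfl)

/-- The dumbbell with labels `1` and `l + 1`. -/
theorem spl_mrg_one (l : ℕ) :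
    comp (spl 1 (l + 1) (l + 2) (Nat.add_comm 1 (l + 1)))
      (mrg 1 (l + 1) (l + 2) (Nat.add_comm 1 (l + 1))) =
    comp (tn rfl rfl (one (strand 1)) (mrg 1 l (l + 1) (Nat.add_comm 1 l)))
      (comp (tn (List.append_assoc _ _ _) (List.append_assoc _ _ _) bellN (one (strand l)))
        (tn rfl rfl (one (strand 1)) (spl 1 l (l + 1) (Nat.add_comm 1 l)))) -
      (l : ℂ) • one (strand 1 ++ strand (l + 1)) := by
  -- The square switch with labels `1` and `l + 1`. The ladder on the left passes through the left
  -- label zero, so it is just a merge followed by a split; the scalar is `1 - (l + 1) = -l`.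
  have h : comp (mk (Pre.rungL false 0 (l + 1))) (mk (Pre.rungR false 0 (l + 1))) =
      comp (mk (Pre.rungR false 1 l)) (mk (Pre.rungL false 1 l)) +
        (((1 : ℕ) : ℂ) - ((l + 1 : ℕ) : ℂ)) • one (strand 1 ++ strand (l + 1)) :=
    sound (.square_switch 1 (l + 1))
  rw [mk_rungL_zero, mk_rungR_zero, mk_rungR, mk_rungL] at h
  simp only [rng_false, tn_one_one, idc_rfl, one_comp, comp_one, comp_assoc,
    idc_comp_idc_comp] at h
  rw [h, bellN, ← tn_comp_one (hy := rfl) (hy' := rfl)]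
  simp only [comp_assoc]
  rw [show ((1 : ℕ) : ℂ) - ((l + 1 : ℕ) : ℂ) = -(l : ℂ) by push_cast; ring, neg_smul,
    ← sub_eq_add_neg]

/-- The dumbbell with labels `2` and `1`. -/
theorem spl_mrg_two :
    comp (spl 2 1 3 rfl) (mrg 2 1 3 rfl) =
      comp (tn (List.append_assoc _ _ _) rfl (mrg 1 1 2 rfl) (one (strand 1)))
        (comp (tn rfl rfl (one (strand 1)) bellN)
        (tn rfl (List.append_assoc _ _ _) (spl 1 1 2 rfl) (one (strand 1)))) -
          one (strand 2 ++ strand 1) := by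
  -- The square switch with labels `2` and `1`. Here the ladder on the right passes through the
  -- right label zero and becomes a merge followed by a split; the scalar is `2 - 1`.
  have h : comp (mk (Pre.rungL false 1 1)) (mk (Pre.rungR false 1 1)) =
      comp (mk (Pre.rungR false 2 0)) (mk (Pre.rungL false 2 0)) +
        (((2 : ℕ) : ℂ) - ((1 : ℕ) : ℂ)) • one (strand 2 ++ strand 1) :=
    sound (.square_switch 2 1)
  rw [mk_rungL, mk_rungR, mk_rungR_right, mk_rungL_right] at h
  simp only [rng_false, tn_one_one, idc_rfl, one_comp, comp_one, comp_assoc,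
    idc_comp_idc_comp] at h
  rw [eq_sub_iff_add_eq, bellN, ← tn_one_comp (hy := rfl) (hy' := rfl), comp_assoc]
  refine Eq.trans ?_ h.symm
  refine congrArg (comp (spl 2 1 3 rfl) (mrg 2 1 3 rfl) + ·) ?_
  norm_num

theorem mrg_assoc (h k l x y z : ℕ) (hx : h + k = x) (hy : k + l = y) (hz : x + l = z)
    (hz' : h + y = z) {w : Word} (h₁ : (strand h ++ strand k) ++ strand l = w)
    (h₂ : strand h ++ (strand k ++ strand l) = w) :
    comp (mrg x l z hz) (tn h₁ rfl (mrg h k x hx) (one (strand l))) =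
      comp (mrg h y z hz') (tn h₂ rfl (one (strand h)) (mrg k l y hy)) := by
  subst hx hy hz h₁
  have e : comp (mrg (h + k) l _ rfl) (tensor (mrg h k _ rfl) (one (strand l))) =
    comp (mrg h (k + l) _ hz') (comp (tensor (one (strand h)) (mrg k l _ rfl))
      (idc (List.append_assoc _ _ _))) := sound (.merge_assoc h k l)
  rw [tn_rfl, e, tn, idc_rfl, one_comp]

theorem spl_assoc (h k l x y z : ℕ) (hx : h + k = x) (hy : k + l = y) (hz : x + l = z)
    (hz' : h + y = z) {w : Word} (h₁ : (strand h ++ strand k) ++ strand l = w)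
    (h₂ : strand h ++ (strand k ++ strand l) = w) :
    comp (tn rfl h₁ (spl h k x hx) (one (strand l))) (spl x l z hz) =
      comp (tn rfl h₂ (one (strand h)) (spl k l y hy)) (spl h y z hz') := by
  subst hx hy hz h₁
  have e : comp (tensor (spl h k _ rfl) (one (strand l))) (spl (h + k) l _ rfl) =
    comp (idc (List.append_assoc _ _ _).symm) (comp (tensor (one (strand h)) (spl k l _ rfl))
      (spl h (k + l) _ hz')) := sound (.split_assoc h k l)
  rw [tn_rfl, e, tn, idc_rfl, comp_one, comp_assoc]

theorem mrg_comp_spl (k l m : ℕ) (h : k + l = m) :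
    comp (mrg k l m h) (spl k l m h) = ((m.choose l : ℕ) : ℂ) • one (strand m) := by
  subst h; exact sound (.digon k l)

theorem dt_comp_mrg (k l m : ℕ) (h : k + l = m) :
    comp (dt m) (mrg k l m h) = comp (mrg k l m h) (tn rfl rfl (dt k) (one (strand l))) +
      comp (mrg k l m h) (tn rfl rfl (one (strand k)) (dt l)) := by
  subst h
  rw [tn_rfl, tn_rfl]
  exact sound (.dot_merge k l)

/-- In the dotted square switch with labels `1` and `1` both ladders become dumbbells, with a dot on
the left strand above or on the right strand below. Moving the two undotted terms across turns the
dumbbell into the crossing. -/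
theorem cross_dot_right :
    comp cross (tn rfl rfl (one [1]) (dot 1)) = comp (tn rfl rfl (dot 1) (one [1])) cross := by
  have h : comp (mk (Pre.rungL true 0 1)) (mk (Pre.rungR false 0 1)) +
      (-1 : ℂ) • comp (mk (Pre.rungR false 1 0)) (mk (Pre.rungL true 1 0)) =
      tensor (dt 1) (one (strand 1)) + (-1 : ℂ) • tensor (one (strand 1)) (dt 1) :=
    sound (.square_switch_dot 1 1)
  rw [mk_rungL_zero, mk_rungR_zero, mk_rungR_right, mk_rungL_right] at h
  simp only [rng_false, rng_true, tn_one_one, idc_rfl, one_comp, comp_one, comp_assoc,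
    idc_comp_idc_comp] at h
  rw [← comp_assoc (spl 1 1 _ _)] at h
  change comp (tn rfl rfl (dt 1) (one (strand 1))) bellN + (-1 : ℂ) •
    comp bellN (tn rfl rfl (one (strand 1)) (dt 1)) = _ at h
  rw [← tn_rfl, ← tn_rfl, neg_smul, one_smul, neg_smul, one_smul, ← sub_eq_add_neg,
    ← sub_eq_add_neg, sub_eq_sub_iff_add_eq_add] at h
  have e : comp (bellN - one _) (tn rfl rfl (one (strand 1)) (dt 1)) =
      comp (tn rfl rfl (dt 1) (one (strand 1))) (bellN - one _) := by
    change (bellN - 1) * _ = _ * (bellN - 1)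
    rw [sub_mul, mul_sub, one_mul, mul_one, sub_eq_sub_iff_add_eq_add, add_comm _ (tn _ _ (dt 1) _)]
    exact h.symm
  have hb : bellN = bell := congrArg₂ comp mk_splitN_one mk_mergeN_one
  rw [hb] at e
  exact e

end WebHom
end TypeQ
end

noncomputable section
namespace TypeQ
namespace WebHom
variable {a b c d a' b' c' d' a'' b'' w x y z : Word}

/-! ### The homomorphism from the Sergeev superalgebra to the web category -/

theorem bellN_eq : bellN = bell := congrArg₂ comp mk_splitN_one mk_mergeN_one

theorem comp_sub (g : WebHom b c) (f f' : WebHom a b) :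
    comp g (f - f') = comp g f - comp g f' := by
  rw [eq_sub_iff_add_eq, ← comp_add, sub_add_cancel]

theorem sub_comp (g g' : WebHom b c) (f : WebHom a b) :
    comp (g - g') f = comp g f - comp g' f := by
  rw [eq_sub_iff_add_eq, ← add_comp, sub_add_cancel]

/-- Expanding with `u * u = 2 • u`, everything in the triple product is symmetric in the two
elements except `u * v * u - u`. -/
theorem braid_of_idempotents {A : Type*} [Ring A] [Algebra ℂ A] {x y : A}
    (hx : x * x = (2 : ℂ) • x) (hy : y * y = (2 : ℂ) • y) (h : x * y * x - x = y * x * y - y) :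
    (x - 1) * (y - 1) * (x - 1) = (y - 1) * (x - 1) * (y - 1) := by
  have e : ∀ u v : A, u * u = (2 : ℂ) • u →
      (u - 1) * (v - 1) * (u - 1) = (u * v * u - u) - u * v - v * u + u + v - 1 := by
    intro u v hu
    simp only [sub_mul, mul_sub, one_mul, mul_one, hu, two_smul]
    abel
  rw [e x y hx, e y x hy, h]
  abel

theorem cross_comp_eq (f g : WebHom [1, 1] [1, 1]) (h : cross * f = g * cross) :
    cross * g = f * cross :=
  calc cross * g = cross * (g * cross) * cross := by rw [mul_assoc, mul_assoc, cross_sq, mul_one]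
    _ = _ := by rw [← h, ← mul_assoc, cross_sq, one_mul]

theorem cross_dot_left :
    comp cross (tensor (dot 1) (one [1])) = comp (tensor (one [1]) (dot 1)) cross := by
  refine cross_comp_eq _ _ ?_
  have := cross_dot_right
  rwa [tn_rfl, tn_rfl] at this

/-- Both sides are the web that merges three thin strands into one of label 3 and splits it again.
`spl_mrg_two` resolves it when the first two strands are grouped, `spl_mrg_one 1` when the last two
are, and associativity of merges and splits identifies the groupings. -/
theorem bell_braid {w : Word} (h₁ : (strand 1 ++ strand 1) ++ strand 1 = w)
    (h₂ : strand 1 ++ (strand 1 ++ strand 1) = w) :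
    (tn h₁ h₁ bellN (one (strand 1))) * (tn h₂ h₂ (one (strand 1)) bellN) *
        (tn h₁ h₁ bellN (one (strand 1))) - tn h₁ h₁ bellN (one (strand 1)) =
      (tn h₂ h₂ (one (strand 1)) bellN) * (tn h₁ h₁ bellN (one (strand 1))) *
        (tn h₂ h₂ (one (strand 1)) bellN) - tn h₂ h₂ (one (strand 1)) bellN := by
  subst h₂
  have e₁ := spl_mrg_two
  have e₂ := spl_mrg_one 1
  have e₃ := congrArg (fun f => comp (tn rfl h₁ (spl 1 1 2 rfl) (one (strand 1)))
    (comp f (tn h₁ rfl (mrg 1 1 2 rfl) (one (strand 1))))) e₁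
  have e₄ := congrArg (fun f => comp (tn rfl rfl (one (strand 1)) (spl 1 1 2 rfl))
    (comp f (tn rfl rfl (one (strand 1)) (mrg 1 1 2 rfl)))) e₂
  have hD₁ : comp (tn rfl h₁ (spl 1 1 2 rfl) (one (strand 1)))
      (tn h₁ rfl (mrg 1 1 2 rfl) (one (strand 1))) = tn h₁ h₁ bellN (one (strand 1)) :=
    tn_comp_one
  have hD₂ : comp (tn rfl rfl (one (strand 1)) (spl 1 1 2 rfl))
      (tn rfl rfl (one (strand 1)) (mrg 1 1 2 rfl)) = tn rfl rfl (one (strand 1)) bellN :=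
    tn_one_comp
  -- The complete merge and the complete split of three strands, regrouped.
  have e : comp (tn rfl h₁ (spl 1 1 2 rfl) (one (strand 1))) (comp (comp (spl 2 1 3 rfl)
      (mrg 2 1 3 rfl)) (tn h₁ rfl (mrg 1 1 2 rfl) (one (strand 1)))) =
      comp (tn rfl rfl (one (strand 1)) (spl 1 1 2 rfl)) (comp (comp (spl 1 2 3 rfl)
      (mrg 1 2 3 rfl)) (tn rfl rfl (one (strand 1)) (mrg 1 1 2 rfl))) := by
    rw [comp_assoc, mrg_assoc 1 1 1 2 2 3 rfl rfl rfl rfl h₁ rfl, ← comp_assoc,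
      spl_assoc 1 1 1 2 2 3 rfl rfl rfl rfl h₁ rfl]
    simp only [comp_assoc]
  have e' := e₃.symm.trans (e.trans e₄)
  simp only [Nat.cast_one, one_smul, comp_sub, sub_comp, one_comp] at e'
  rw [hD₁, hD₂] at e'
  simp only [mul_eq_comp]
  refine Eq.trans ?_ (e'.trans ?_)
  · rw [← hD₁]
    simp only [comp_assoc]
  · rw [← hD₂]
    simp only [comp_assoc]

/-- Endomorphisms of two strands, acting on the first two of three strands. -/
def firstTwo : WebHom [1, 1] [1, 1] →ₐ[ℂ] WebHom [1, 1, 1] [1, 1, 1] := tensorRight [1] [1, 1]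

/-- Endomorphisms of two strands, acting on the last two of three strands. -/
def lastTwo : WebHom [1, 1] [1, 1] →ₐ[ℂ] WebHom [1, 1, 1] [1, 1, 1] := tensorLeft [1] [1, 1]

theorem cross_braid : firstTwo cross * lastTwo cross * firstTwo cross =
    lastTwo cross * firstTwo cross * lastTwo cross := by
  have h := bell_braid (w := [1, 1, 1]) rfl rfl
  have e₁ : tn (x := [1, 1, 1]) (y := [1, 1, 1]) rfl rfl bellN (one (strand 1)) = firstTwo bell :=
    (tn_rfl _ _).trans (congrArg (fun f => tensor f (one [1])) bellN_eq)
  have e₂ : tn (x := [1, 1, 1]) (y := [1, 1, 1]) rfl rfl (one (strand 1)) bellN = lastTwo bell :=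
    (tn_rfl _ _).trans (congrArg (fun f => tensor (one [1]) f) bellN_eq)
  rw [e₁, e₂] at h
  rw [cross_eq, map_sub, map_sub, map_one, map_one]
  refine braid_of_idempotents ?_ ?_ h
  · rw [← map_mul, bell_sq, map_smul]
  · rw [← map_mul, bell_sq, map_smul]

theorem dotAt_succ (k i : ℕ) : dotAt (k + 1) (i + 1) = tensorLeft [1] (ones k) (dotAt k i) := rfl

theorem crossAt_succ (k i : ℕ) :
    crossAt (k + 1) (i + 1) = tensorLeft [1] (ones k) (crossAt k i) := by
  cases k with
  | zero => exact (tensor_zero (one [1])).symm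
  | succ k => rfl

theorem dotAt_zero (k : ℕ) : dotAt (k + 1) 0 = tensorRight (ones k) [1] (dot 1) := rfl

theorem crossAt_zero (k : ℕ) : crossAt (k + 2) 0 = tensorRight (ones k) [1, 1] cross := rfl

/-- Adding a strand on the left of `↑_1^k`. -/
def consStrand (k : ℕ) : WebHom (ones k) (ones k) →ₐ[ℂ] WebHom (ones (k + 1)) (ones (k + 1)) :=
  tensorLeft [1] (ones k)

theorem dotAt_mem_gr : ∀ k i, dotAt k i ∈ gr (ones k) (ones k) 1
  | 0, _ => Submodule.zero_mem _
  | k + 1, 0 => tensor_mem_gr (dot_mem_gr 1) (one_mem_gr (ones k))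
  | k + 1, i + 1 => tensor_mem_gr (one_mem_gr [1]) (dotAt_mem_gr k i)

theorem crossAt_mem_gr : ∀ k i, crossAt k i ∈ gr (ones k) (ones k) 0
  | 0, _ => Submodule.zero_mem _
  | 1, 0 => Submodule.zero_mem _
  | k + 2, 0 => tensor_mem_gr_zero cross_mem_gr (one_mem_gr (ones k))
  | k + 1, i + 1 => by
    rw [crossAt_succ]; exact tensor_mem_gr_zero (one_mem_gr [1]) (crossAt_mem_gr k i)

theorem dotAt_sq : ∀ k i, i < k → dotAt k i * dotAt k i = 1
  | k + 1, 0, _ => by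
    rw [dotAt_zero]
    exact (map_mul (tensorRight (ones k) [1]) _ _).symm.trans
      ((congrArg _ dot_one_sq).trans (map_one (tensorRight (ones k) [1])))
  | k + 1, i + 1, h => by
    rw [dotAt_succ]
    exact (map_mul (consStrand k) _ _).symm.trans
      ((congrArg _ (dotAt_sq k i (Nat.lt_of_succ_lt_succ h))).trans (map_one (consStrand k)))

theorem tensor_one_comm_odd (f : WebHom a a) (g : WebHom b b) (hf : f ∈ gr a a 1)
    (hg : g ∈ gr b b 1) : comp (tensor f (one b)) (tensor (one a) g) =
      -comp (tensor (one a) g) (tensor f (one b)) := by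
  rw [interchange_left _ _ _ (one_mem_gr b), interchange _ _ hg hf, one_comp, one_comp, comp_one,
    comp_one]
  simp

theorem tensor_one_comm_left (f : WebHom a a) (g : WebHom b b) (hf : f ∈ gr a a 0) :
    comp (tensor f (one b)) (tensor (one a) g) = comp (tensor (one a) g) (tensor f (one b)) := by
  rw [interchange_left _ _ _ (one_mem_gr b), interchange_right _ _ _ hf, one_comp, one_comp,
    comp_one, comp_one]

theorem tensor_one_comm_right (f : WebHom a a) (g : WebHom b b) (hg : g ∈ gr b b 0) :
    comp (tensor f (one b)) (tensor (one a) g) = comp (tensor (one a) g) (tensor f (one b)) := by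
  rw [interchange_left _ _ _ (one_mem_gr b), interchange_left _ _ _ hg, one_comp, one_comp,
    comp_one, comp_one]

theorem dotAt_anti_of_lt : ∀ k i j, i < j → dotAt k i * dotAt k j = -(dotAt k j * dotAt k i)
  | 0, _, _, _ => by simp [dotAt]
  | k + 1, 0, j + 1, _ => tensor_one_comm_odd (dot 1) (dotAt k j) (dot_mem_gr 1) (dotAt_mem_gr k j)
  | k + 1, i + 1, j + 1, h => by
    rw [dotAt_succ, dotAt_succ]
    exact (map_mul (consStrand k) _ _).symm.trans ((congrArg _
      (dotAt_anti_of_lt k i j (Nat.lt_of_succ_lt_succ h))).trans ((map_neg (consStrand k) _).trans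
        (congrArg _ (map_mul (consStrand k) _ _))))

theorem dotAt_anti (k i j : ℕ) (h : i ≠ j) : dotAt k i * dotAt k j = -(dotAt k j * dotAt k i) := by
  rcases lt_or_gt_of_ne h with h | h
  · exact dotAt_anti_of_lt k i j h
  · rw [dotAt_anti_of_lt k j i h, neg_neg]

theorem crossAt_sq : ∀ k i, i + 1 < k → crossAt k i * crossAt k i = 1
  | k + 2, 0, _ => by
    rw [crossAt_zero]
    exact (map_mul (tensorRight (ones k) [1, 1]) _ _).symm.trans
      ((congrArg _ cross_sq).trans (map_one (tensorRight (ones k) [1, 1])))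
  | k + 1, i + 1, h => by
    rw [crossAt_succ]
    exact (map_mul (consStrand k) _ _).symm.trans
      ((congrArg _ (crossAt_sq k i (Nat.lt_of_succ_lt_succ h))).trans (map_one (consStrand k)))

theorem one_tensor_tensor (u v : ℕ+) (f : WebHom a b) :
    tensor (one [u]) (tensor (one [v]) f) = tensor (one [u, v]) f :=
  (tensor_assoc_letter (one [u]) (one [v]) f).symm.trans
    (congrArg (fun g => tensor g f) (tensor_one_one [u] [v]))

theorem crossAt_comm_of_lt : ∀ k i j, i + 1 < j →
    crossAt k i * crossAt k j = crossAt k j * crossAt k i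
  | 0, _, _, _ => rfl
  | 1, 0, j + 1, _ => by rw [crossAt]; exact (zero_mul _).trans (mul_zero _).symm
  | k + 2, 0, j + 2, _ => by
    have e : crossAt (k + 2) (j + 2) = tensor (one [1, 1]) (crossAt k j) := by
      rw [crossAt_succ, crossAt_succ]; exact one_tensor_tensor 1 1 _
    rw [e]
    exact tensor_one_comm_left cross (crossAt k j) cross_mem_gr
  | k + 1, i + 1, j + 1, h => by
    rw [crossAt_succ, crossAt_succ]
    exact (map_mul (consStrand k) _ _).symm.trans ((congrArg _
      (crossAt_comm_of_lt k i j (Nat.lt_of_succ_lt_succ h))).trans (map_mul (consStrand k) _ _))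

theorem crossAt_braid : ∀ k i, i + 2 < k →
    crossAt k i * crossAt k (i + 1) * crossAt k i =
      crossAt k (i + 1) * crossAt k i * crossAt k (i + 1)
  | k + 3, 0, _ => by
    let φ : WebHom [1, 1, 1] [1, 1, 1] →ₐ[ℂ] WebHom (ones (k + 3)) (ones (k + 3)) :=
      tensorRight (ones k) [1, 1, 1]
    have e₁ : crossAt (k + 3) 0 = φ (firstTwo cross) :=
      (congrArg (tensor cross) (tensor_one_one [1] (ones k)).symm).trans
        (tensor_assoc_two cross (one [1]) (one (ones k))).symm
    have e₂ : crossAt (k + 3) 1 = φ (lastTwo cross) :=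
      (tensor_assoc_letter (one [1]) cross (one (ones k))).symm
    rw [e₁, e₂, ← map_mul, ← map_mul, cross_braid, map_mul, map_mul]
  | k + 1, i + 1, h => by
    have e : ∀ i, crossAt (k + 1) (i + 1) = consStrand k (crossAt k i) := crossAt_succ k
    rw [e, e, ← map_mul, ← map_mul, crossAt_braid k i (Nat.lt_of_succ_lt_succ h), map_mul, map_mul]

theorem dotAt_crossAt_comm : ∀ k i j, i ≠ j → i ≠ j + 1 →
    dotAt k i * crossAt k j = crossAt k j * dotAt k i
  | 0, _, _, _, _ => rfl
  | k + 1, 0, j + 1, _, _ => by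
    rw [crossAt_succ]
    exact tensor_one_comm_right (dot 1) (crossAt k j) (crossAt_mem_gr k j)
  | 1, _, 0, _, _ => by rw [crossAt]; exact (mul_zero _).trans (zero_mul _).symm
  | k + 2, i + 2, 0, _, _ => by
    have e : dotAt (k + 2) (i + 2) = tensor (one [1, 1]) (dotAt k i) := one_tensor_tensor 1 1 _
    rw [e]
    exact (tensor_one_comm_left cross (dotAt k i) cross_mem_gr).symm
  | k + 1, i + 1, j + 1, h, h' => by
    have e : ∀ i, crossAt (k + 1) (i + 1) = consStrand k (crossAt k i) := crossAt_succ k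
    have e' : dotAt (k + 1) (i + 1) = consStrand k (dotAt k i) := rfl
    rw [e, e', ← map_mul, dotAt_crossAt_comm k i j (by omega) (by omega), map_mul]

theorem crossAt_dotAt : ∀ k j, j + 1 < k →
    crossAt k j * dotAt k j = dotAt k (j + 1) * crossAt k j
  | k + 2, 0, _ => by
    let φ : WebHom [1, 1] [1, 1] →ₐ[ℂ] WebHom (ones (k + 2)) (ones (k + 2)) :=
      tensorRight (ones k) [1, 1]
    have e₁ : dotAt (k + 2) 0 = φ (tensor (dot 1) (one [1])) :=
      (congrArg (tensor (dot 1)) (tensor_one_one [1] (ones k)).symm).trans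
        (tensor_assoc_letter (dot 1) (one [1]) (one (ones k))).symm
    have e₂ : dotAt (k + 2) 1 = φ (tensor (one [1]) (dot 1)) :=
      (tensor_assoc_letter (one [1]) (dot 1) (one (ones k))).symm
    have e₃ : crossAt (k + 2) 0 = φ cross := rfl
    rw [e₁, e₂, e₃, ← map_mul, ← map_mul]
    exact congrArg φ cross_dot_left
  | k + 1, i + 1, h => by
    have e : ∀ i, crossAt (k + 1) (i + 1) = consStrand k (crossAt k i) := crossAt_succ k
    have e' : ∀ i, dotAt (k + 1) (i + 1) = consStrand k (dotAt k i) := fun _ => rfl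
    rw [e, e', e', ← map_mul, crossAt_dotAt k i (Nat.lt_of_succ_lt_succ h), map_mul]

/-- This follows from `crossAt_dotAt` by conjugating with the crossing, which is an involution. -/
theorem crossAt_dotAt_succ (k j : ℕ) (h : j + 1 < k) :
    crossAt k j * dotAt k (j + 1) = dotAt k j * crossAt k j :=
  calc crossAt k j * dotAt k (j + 1)
      = crossAt k j * (dotAt k (j + 1) * crossAt k j) * crossAt k j := by
        rw [mul_assoc, mul_assoc, crossAt_sq k j h, mul_one]
    _ = _ := by rw [← crossAt_dotAt k j h, ← mul_assoc, crossAt_sq k j h, one_mul]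

end WebHom

/-- The images of the generators of `Ser_k` in the web category. -/
def webGen (k : ℕ) : SerGen k → WebHom (ones k) (ones k) :=
  Sum.elim (fun i => WebHom.dotAt k i) (fun j => WebHom.crossAt k j)

theorem webGen_rel (k : ℕ) {x y : FreeAlgebra ℂ (SerGen k)} (h : SerRel k x y) :
    FreeAlgebra.lift ℂ (webGen k) x = FreeAlgebra.lift ℂ (webGen k) y := by
  have hc : ∀ i : Fin k, FreeAlgebra.lift ℂ (webGen k) (genC i) = WebHom.dotAt k i :=
    fun i => FreeAlgebra.lift_ι_apply _ _
  have hs : ∀ i : Fin (k - 1), FreeAlgebra.lift ℂ (webGen k) (genS i) = WebHom.crossAt k i :=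
    fun i => FreeAlgebra.lift_ι_apply _ _
  cases h with
  | c_sq i => simp only [map_mul, hc, map_one, WebHom.dotAt_sq k i i.2]
  | c_anti i j h =>
    simp only [map_mul, map_neg, hc]
    exact WebHom.dotAt_anti k i j (Fin.val_ne_of_ne h)
  | s_sq i => simp only [map_mul, hs, map_one, WebHom.crossAt_sq k i (by omega)]
  | s_comm i j h h' =>
    simp only [map_mul, hs]
    rcases lt_trichotomy (i : ℕ) j with e | e | e
    · exact WebHom.crossAt_comm_of_lt k i j (by omega)
    · rw [e]
    · exact (WebHom.crossAt_comm_of_lt k j i (by omega)).symm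
  | s_braid i j h =>
    simp only [map_mul, hs, h]
    exact WebHom.crossAt_braid k i (by omega)
  | cs_comm i j h h' =>
    simp only [map_mul, hs, hc]
    exact WebHom.dotAt_crossAt_comm k i j h h'
  | sc_left j a b ha hb =>
    simp only [map_mul, hs, hc, ha, hb]
    exact WebHom.crossAt_dotAt k j (by omega)
  | sc_right j a b ha hb =>
    simp only [map_mul, hs, hc, ha, hb]
    exact WebHom.crossAt_dotAt_succ k j (by omega)

/-- The homomorphism from the Sergeev superalgebra to the web category. -/
def serWeb (k : ℕ) : Ser k →ₐ[ℂ] WebHom (ones k) (ones k) :=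
  RingQuot.liftAlgHom ℂ ⟨FreeAlgebra.lift ℂ (webGen k), fun _ _ h => webGen_rel k h⟩

theorem serWeb_c (k : ℕ) (i : Fin k) : serWeb k (Ser.c i) = WebHom.dotAt k i := by
  rw [serWeb, Ser.c, RingQuot.liftAlgHom_mkAlgHom_apply]
  exact FreeAlgebra.lift_ι_apply _ _

theorem serWeb_s (k : ℕ) (j : Fin (k - 1)) : serWeb k (Ser.s j) = WebHom.crossAt k j := by
  rw [serWeb, Ser.s, RingQuot.liftAlgHom_mkAlgHom_apply]
  exact FreeAlgebra.lift_ι_apply _ _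

/-- The image of a word is a composite of dots and crossings with as many dots as the word has odd
letters. -/
theorem serWeb_gr (k : ℕ) (ε : ZMod 2) (x : Ser k) (hx : x ∈ Ser.gr k ε) :
    serWeb k x ∈ WebHom.gr (ones k) (ones k) ε := by
  refine (Submodule.span_le (p := (WebHom.gr (ones k) (ones k) ε).comap
    (serWeb k).toLinearMap)).2 ?_ hx
  rintro _ ⟨w, hw, rfl⟩
  subst hw
  change serWeb k (Ser.word w) ∈ WebHom.gr _ _ _
  clear hx
  induction w with
  | nil =>
    rw [Ser.word, List.map_nil, List.prod_nil, map_one]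
    exact WebHom.one_mem_gr _
  | cons g w ih =>
    have e : Ser.word (g :: w) = Sum.elim Ser.c Ser.s g * Ser.word w := rfl
    rw [e, map_mul, List.countP_cons, Nat.cast_add, add_comm]
    refine WebHom.comp_mem_gr ?_ ih
    rcases g with i | j
    · simpa [serWeb_c] using WebHom.dotAt_mem_gr k i
    · simpa [serWeb_s] using WebHom.crossAt_mem_gr k j

end TypeQ
end

noncomputable section
namespace TypeQ
namespace WebHom
variable {a b c d a' b' c' d' a'' b'' w x y z : Word}

/-! ### Dots and crossings span the endomorphisms of `↑_1^k` -/

/-- Dots and crossings on strands labelled `1`. -/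
inductive Elementary : ∀ a : Word, WebHom a a → Prop
  | dot (v : Word) : Elementary (1 :: v) (tensor (dot 1) (one v))
  | cross (v : Word) : Elementary (1 :: 1 :: v) (tensor cross (one v))
  | cons (m : ℕ+) {a : Word} {f : WebHom a a} :
      Elementary a f → Elementary (m :: a) (tensor (one [m]) f)

/-- The algebra generated by dots and crossings on strands labelled `1`. -/
def dotCross (a : Word) : Subalgebra ℂ (WebHom a a) := Algebra.adjoin ℂ {f | Elementary a f}

theorem Elementary.tensor_one {f : WebHom a a} (h : Elementary a f) (u : Word) :
    Elementary (a ++ u) (tensor f (one u)) := by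
  induction h with
  | dot v =>
    rw [tensor_assoc_letter (WebHom.dot 1) (one v) (one u), tensor_one_one]
    exact .dot (v ++ u)
  | cross v =>
    rw [tensor_assoc_two WebHom.cross (one v) (one u), tensor_one_one]
    exact .cross (v ++ u)
  | cons m h ih =>
    rw [tensor_assoc_letter (one [m])]
    exact .cons m ih

theorem Elementary.one_tensor {f : WebHom a a} (h : Elementary a f) :
    ∀ u : Word, Elementary (u ++ a) (tensor (one u) f)
  | [] => by rw [unit_tensor]; exact h
  | m :: u => by
    have e : tensor (one (m :: u)) f = tensor (one [m]) (tensor (one u) f) :=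
      (congrArg (fun g => tensor g f) (tensor_one_one [m] u)).symm.trans
        (tensor_assoc_letter (one [m]) (one u) f)
    rw [e]
    exact .cons m (h.one_tensor u)

theorem tensor_one_mem_dotCross {f : WebHom a a} (h : f ∈ dotCross a) (u : Word) :
    tensor f (one u) ∈ dotCross (a ++ u) :=
  Algebra.adjoin_le (S := (dotCross (a ++ u)).comap (tensorRight u a))
    (fun _ hg => Algebra.subset_adjoin (hg.tensor_one u)) h

theorem one_tensor_mem_dotCross {f : WebHom a a} (h : f ∈ dotCross a) (u : Word) :
    tensor (one u) f ∈ dotCross (u ++ a) :=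
  Algebra.adjoin_le (S := (dotCross (u ++ a)).comap (tensorLeft u a))
    (fun _ hg => Algebra.subset_adjoin (hg.one_tensor u)) h

/-- The product is a composite of `f ⊗ 1` and `1 ⊗ g`, and tensoring with identities preserves the
generated algebras. -/
theorem tn_mem_dotCross {f : WebHom a a} {g : WebHom b b} (hf : f ∈ dotCross a)
    (hg : g ∈ dotCross b) {hx hx' : a ++ b = x} : tn hx hx' f g ∈ dotCross x := by
  subst hx
  have e : tensor f g = comp (tensor f (one b)) (tensor (one a) g) := by
    rw [interchange_left _ _ _ (one_mem_gr b), comp_one, one_comp]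
  rw [tn_rfl, e]
  exact mul_mem (tensor_one_mem_dotCross hf b) (one_tensor_mem_dotCross hg a)

theorem idc_conj_mem_dotCross {f : WebHom a a} (hf : f ∈ dotCross a) (h : b = a) (h' : a = b) :
    comp (idc h') (comp f (idc h)) ∈ dotCross b := by
  subst h
  rw [idc_rfl, one_comp, comp_one]
  exact hf

theorem idc_mem_dotCross (h : a = a) : idc h ∈ dotCross a := one_mem (dotCross a)

theorem dot_mem_dotCross : dot 1 ∈ dotCross [1] := by
  have e : tensor (dot 1) (one []) = dot 1 :=
    (one_comp _).symm.trans ((tensor_unit (dot 1)).trans (comp_one _))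
  rw [← e]
  exact Algebra.subset_adjoin (.dot [])

theorem bellN_mem_dotCross : bellN ∈ dotCross (strand 1 ++ strand 1) := by
  have e : tensor cross (one []) = cross :=
    (one_comp _).symm.trans ((tensor_unit cross).trans (comp_one _))
  have h : cross ∈ dotCross [1, 1] := by
    rw [← e]
    exact Algebra.subset_adjoin (.cross [])
  rw [bellN_eq, show bell = cross + 1 by rw [cross_eq, sub_add_cancel]]
  exact add_mem h (one_mem _)

theorem dotCross_ones_le (k : ℕ) : dotCross (ones k) ≤ (serWeb k).range := by
  refine Algebra.adjoin_le fun f hf => ?_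
  -- The word has to be free for the induction on `Elementary`, so its equality with `ones k` is a
  -- hypothesis.
  have key : ∀ (a : Word) (f : WebHom a a), Elementary a f → ∀ k (e : a = ones k),
      (∃ i < k, comp (idc e) (comp f (idc e.symm)) = dotAt k i) ∨
        ∃ j, j + 1 < k ∧ comp (idc e) (comp f (idc e.symm)) = crossAt k j := by
    intro a f h
    induction h with
    | dot v =>
      intro k e
      rcases k with _ | k
      · simp at e
      obtain rfl : v = ones k := (List.cons.inj e).2
      exact Or.inl ⟨0, k.succ_pos, (one_comp _).trans (comp_one _)⟩
    | cross v =>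
      intro k e
      rcases k with _ | _ | k
      · simp at e
      · simp at e
      obtain rfl : v = ones k := (List.cons.inj (List.cons.inj e).2).2
      exact Or.inr ⟨0, by omega, (one_comp _).trans (comp_one _)⟩
    | @cons m a f h ih =>
      intro k e
      rcases k with _ | k
      · simp at e
      obtain rfl : a = ones k := (List.cons.inj e).2
      obtain rfl : m = 1 := (List.cons.inj e).1
      rcases ih k rfl with ⟨i, hi, h⟩ | ⟨j, hj, h⟩
      · rw [idc_rfl, one_comp, comp_one] at h
        subst h
        exact Or.inl ⟨i + 1, by omega, (one_comp _).trans (comp_one _)⟩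
      · rw [idc_rfl, one_comp, comp_one] at h
        subst h
        refine Or.inr ⟨j + 1, by omega, ((one_comp _).trans (comp_one _)).trans ?_⟩
        rw [crossAt_succ]
        rfl
  rcases key _ f hf k rfl with ⟨i, hi, h⟩ | ⟨j, hj, h⟩
  · rw [idc_rfl, one_comp, comp_one] at h
    exact ⟨Ser.c ⟨i, hi⟩, (serWeb_c k _).trans h.symm⟩
  · rw [idc_rfl, one_comp, comp_one] at h
    exact ⟨Ser.s ⟨j, by omega⟩, (serWeb_s k _).trans h.symm⟩

theorem ones_zero : ones 0 = strand 0 := rfl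

theorem strand_append_ones (k : ℕ) : strand 1 ++ ones k = ones (k + 1) := rfl

/-- The merge of `k` strands labelled `1`. -/
def fullMerge : (k : ℕ) → WebHom (ones k) (strand k)
  | 0 => idc ones_zero
  | k + 1 => comp (mrg 1 k (k + 1) (Nat.add_comm 1 k))
      (tn (strand_append_ones k) rfl (one (strand 1)) (fullMerge k))

/-- The split into `k` strands labelled `1`. -/
def fullSplit : (k : ℕ) → WebHom (strand k) (ones k)
  | 0 => idc ones_zero.symm
  | k + 1 => comp (tn rfl (strand_append_ones k) (one (strand 1)) (fullSplit k))
      (spl 1 k (k + 1) (Nat.add_comm 1 k))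

theorem mrg_mem_gr : ∀ k l m h, mrg k l m h ∈ gr (strand k ++ strand l) (strand m) 0
  | 0, _, _, _ => idc_mem_gr _
  | _ + 1, 0, _, _ => idc_mem_gr _
  | _ + 1, _ + 1, _, _ => comp_mem_gr_zero (idc_mem_gr _) (merge_mem_gr _ _)

theorem spl_mem_gr : ∀ k l m h, spl k l m h ∈ gr (strand m) (strand k ++ strand l) 0
  | 0, _, _, _ => idc_mem_gr _
  | _ + 1, 0, _, _ => idc_mem_gr _
  | _ + 1, _ + 1, _, _ => comp_mem_gr_zero (split_mem_gr _ _) (idc_mem_gr _)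

theorem fullMerge_mem_gr : ∀ k, fullMerge k ∈ gr (ones k) (strand k) 0
  | 0 => idc_mem_gr _
  | k + 1 => comp_mem_gr_zero (mrg_mem_gr _ _ _ _)
      (tn_mem_gr_zero (one_mem_gr _) (fullMerge_mem_gr k))

theorem fullSplit_mem_gr : ∀ k, fullSplit k ∈ gr (strand k) (ones k) 0
  | 0 => idc_mem_gr _
  | k + 1 => comp_mem_gr_zero (tn_mem_gr_zero (one_mem_gr _) (fullSplit_mem_gr k))
      (spl_mem_gr _ _ _ _)

/-- Removing digons one after another gives the factors `k + 1, k, …, 1`. Since the result is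
invertible, a complete merge after a complete split can be inserted wherever it helps. -/
theorem fullMerge_comp_fullSplit : ∀ k,
    comp (fullMerge k) (fullSplit k) = (k.factorial : ℂ) • one (strand k)
  | 0 => by
    rw [Nat.factorial_zero, Nat.cast_one, one_smul]
    exact idc_comp_idc ones_zero.symm ones_zero
  | k + 1 => by
    rw [fullMerge, fullSplit, comp_assoc, ← comp_assoc (tn (strand_append_ones k) _ _ _), tn_one_comp,
      fullMerge_comp_fullSplit k, tn_smul, tn_one_one, idc_rfl, smul_comp, one_comp, comp_smul,
      mrg_comp_spl, smul_smul, Nat.choose_succ_self_right, Nat.factorial_succ, ← Nat.cast_mul,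
      mul_comm]

theorem factorial_ne (k : ℕ) : (k.factorial : ℂ) ≠ 0 := Nat.cast_ne_zero.2 k.factorial_ne_zero

/-- Inserting a complete merge after a complete split on the thick strand, at the price of `l!`,
completes the merge to start from thin strands. The web then contains the endomorphism of `ones (l +
1)` to which the induction hypothesis applies. -/
theorem fullSplit_comp_mrg (l : ℕ) :
    comp (fullSplit (l + 1)) (mrg 1 l (l + 1) (Nat.add_comm 1 l)) = (l.factorial : ℂ)⁻¹ •
      comp (comp (fullSplit (l + 1)) (fullMerge (l + 1)))
        (tn rfl (strand_append_ones l) (one (strand 1)) (fullSplit l)) := by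
  rw [fullMerge, comp_assoc, comp_assoc, tn_one_comp, fullMerge_comp_fullSplit,
    tn_smul, tn_one_one, idc_rfl, comp_smul, comp_one, comp_smul,
    inv_smul_smul₀ (factorial_ne l)]

theorem spl_comp_fullMerge (l : ℕ) :
    comp (spl 1 l (l + 1) (Nat.add_comm 1 l)) (fullMerge (l + 1)) = (l.factorial : ℂ)⁻¹ •
      comp (tn (strand_append_ones l) rfl (one (strand 1)) (fullMerge l))
        (comp (fullSplit (l + 1)) (fullMerge (l + 1))) := by
  rw [fullSplit, ← comp_assoc, ← comp_assoc, tn_one_comp, fullMerge_comp_fullSplit,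
    tn_smul, tn_one_one, idc_rfl, smul_comp, one_comp, smul_comp,
    inv_smul_smul₀ (factorial_ne l)]

/-- Write $E_k$ for this composite. Peeling off one strand puts a split after a merge with labels
`1` and `l + 1` in the middle, which the square switch resolves. Completing the remaining thick
strands gives $E_{l+2}=(l!)^{-2}(1\otimes E_{l+1})(D\otimes E_l)(1\otimes E_{l+1})-l\,(1\otimes
E_{l+1})$, and strong induction applies. -/
theorem fullSplit_comp_fullMerge_mem (k : ℕ) :
    comp (fullSplit k) (fullMerge k) ∈ dotCross (ones k) := by
  induction k using Nat.strong_induction_on with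
  | _ k ih =>
  match k, ih with
  | 0, _ =>
    rw [fullSplit, fullMerge, idc_comp_idc]
    exact idc_mem_dotCross _
  | 1, _ =>
    rw [fullSplit, fullMerge, mrg_zero_right, spl_zero_right, fullSplit, fullMerge,
      ← idc_rfl (rfl : strand 1 = strand 1), tn_idc, tn_idc, idc_comp_idc, idc_comp_idc,
      idc_comp_idc]
    exact idc_mem_dotCross _
  | l + 2, ih =>
    have h₁ := ih (l + 1) (by omega)
    have h₀ := ih l (by omega)
    set E := comp (fullSplit (l + 1)) (fullMerge (l + 1)) with hE
    have w₁ : strand 1 ++ ones (l + 1) = ones (l + 2) := strand_append_ones (l + 1)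
    have w₂ : (strand 1 ++ strand 1) ++ ones l = ones (l + 2) := rfl
    have hA : comp (tn rfl w₁ (one (strand 1)) (fullSplit (l + 1)))
        (tn rfl rfl (one (strand 1)) (mrg 1 l (l + 1) (Nat.add_comm 1 l))) =
        (l.factorial : ℂ)⁻¹ • comp (tn w₁ w₁ (one (strand 1)) E) (tn rfl w₁ (one (strand 1))
          (tn rfl (strand_append_ones l) (one (strand 1)) (fullSplit l))) := by
      rw [tn_one_comp, fullSplit_comp_mrg, tn_smul, ← tn_one_comp (hy := w₁) (hy' := w₁)]
    have hB : comp (tn rfl rfl (one (strand 1)) (spl 1 l (l + 1) (Nat.add_comm 1 l)))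
        (tn w₁ rfl (one (strand 1)) (fullMerge (l + 1))) =
        (l.factorial : ℂ)⁻¹ • comp (tn w₁ rfl (one (strand 1)) (tn (strand_append_ones l) rfl
          (one (strand 1)) (fullMerge l))) (tn w₁ w₁ (one (strand 1)) E) := by
      rw [tn_one_comp, spl_comp_fullMerge, tn_smul, ← tn_one_comp (hy := w₁) (hy' := w₁)]
    -- The dumbbell acts on the first two strands and slides past the split and the merge on the
    -- other `l` strands, which close up to $E_l$.
    have hC : comp (tn rfl w₁ (one (strand 1))
          (tn rfl (strand_append_ones l) (one (strand 1)) (fullSplit l)))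
        (comp (tn (List.append_assoc _ _ _) (List.append_assoc _ _ _) bellN (one (strand l)))
          (tn w₁ rfl (one (strand 1)) (tn (strand_append_ones l) rfl
          (one (strand 1)) (fullMerge l)))) =
        tn w₂ w₂ bellN (comp (fullSplit l) (fullMerge l)) := by
      rw [← tn_assoc (h₁ := rfl) (h₂ := rfl) (h₃ := List.append_assoc _ _ _) (h₄ := w₂),
        ← tn_assoc (h₁ := rfl) (h₂ := rfl) (h₃ := w₂) (h₄ := List.append_assoc _ _ _),
        tn_one_one, idc_rfl, tn_comp_even (Or.inl (one_mem_gr _)), one_comp, comp_one,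
        tn_comp_even (Or.inl (fullSplit_mem_gr l)), one_comp]
    have e : comp (fullSplit (l + 2)) (fullMerge (l + 2)) =
        ((l.factorial : ℂ)⁻¹ * (l.factorial : ℂ)⁻¹) • comp (tn w₁ w₁ (one (strand 1)) E)
          (comp (tn w₂ w₂ bellN (comp (fullSplit l) (fullMerge l)))
            (tn w₁ w₁ (one (strand 1)) E)) - (l : ℂ) • tn w₁ w₁ (one (strand 1)) E := by
      have e₁ : comp (fullSplit (l + 2)) (fullMerge (l + 2)) =
          comp (tn rfl w₁ (one (strand 1)) (fullSplit (l + 1)))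
            (comp (comp (spl 1 (l + 1) (l + 2) (Nat.add_comm 1 (l + 1)))
              (mrg 1 (l + 1) (l + 2) (Nat.add_comm 1 (l + 1))))
            (tn w₁ rfl (one (strand 1)) (fullMerge (l + 1)))) := by
        rw [fullSplit, fullMerge, comp_assoc, comp_assoc]
      rw [e₁, spl_mrg_one, sub_comp, comp_sub, smul_comp, one_comp, comp_smul, tn_one_comp, ← hE]
      refine congrArg (· - (l : ℂ) • tn w₁ w₁ (one (strand 1)) E) ?_
      rw [comp_assoc, comp_assoc, hB, ← comp_assoc, hA, ← hC]
      simp only [comp_smul, smul_comp, smul_smul, comp_assoc]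
    rw [e]
    exact sub_mem (Subalgebra.smul_mem _ (mul_mem (tn_mem_dotCross (one_mem _) h₁)
      (mul_mem (tn_mem_dotCross bellN_mem_dotCross h₀) (tn_mem_dotCross (one_mem _) h₁))) _)
      (Subalgebra.smul_mem _ (tn_mem_dotCross (one_mem _) h₁) _)

end WebHom
end TypeQ
end

/-! ### Complete merges against merges, splits and dots. -/

noncomputable section
namespace TypeQ
namespace WebHom
variable {a b c d a' b' c' d' a'' b'' w x y z : Word}

theorem tn_idc_nil_left {u : Word} (h : u = []) {hx : u ++ a = x} {hy : [] ++ b = y}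
    {f : WebHom a b} : tn hx hy (idc h) f =
      comp (idc (by rw [← hy]; rfl)) (comp f (idc (by rw [← hx, h]; rfl))) := by
  subst h; exact tn_nil_left rfl

theorem tn_idc_nil_right {u : Word} (h : u = []) {hx : a ++ u = x} {hy : b ++ [] = y}
    {f : WebHom a b} : tn hx hy f (idc h) = comp (idc (by rw [← hy, List.append_nil]))
      (comp f (idc (by rw [← hx, h, List.append_nil]))) := by
  subst h; exact tn_nil_right rfl

theorem ones_append (k l m : ℕ) (h : k + l = m) : ones k ++ ones l = ones m := by
  rw [List.replicate_append_replicate, h]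

/-- Merging in groups, then merging two thick strands. -/
theorem mrg_comp_fullMerge : ∀ (k l m : ℕ) (h : k + l = m),
    comp (mrg k l m h) (tn (ones_append k l m h) rfl (fullMerge k) (fullMerge l)) = fullMerge m
  | 0, l, m, h => by
    obtain rfl : l = m := by omega
    have e : tn (ones_append 0 l l h) rfl (fullMerge 0) (fullMerge l) =
        comp (idc (strand_zero_add l l h).symm) (fullMerge l) := by
      have : fullMerge l = comp (fullMerge l) (one _) := (comp_one _).symm
      rw [fullMerge, this]
      have e := tn_comp_even (f := one (strand 0)) (g := fullMerge l) (h := idc ones_zero)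
        (k := one (ones l)) (hx := ones_append 0 l l h) (hy := rfl) (hy' := rfl) (hz := rfl)
        (Or.inr (idc_mem_gr _))
      rw [one_comp] at e
      rw [← e, ← idc_rfl (rfl : ones l = ones l), tn_idc, tn_nil_left (u := strand 0) rfl]
      simp only [comp_assoc, idc_comp_idc, idc_rfl, comp_one]
    rw [e, mrg_zero_left]
    exact idc_comp_cancel _ _ _
  | k + 1, l, n, h => by
    obtain ⟨m, rfl⟩ : ∃ m, n = m + 1 := ⟨k + l, by omega⟩
    have h' : k + l = m := by omega
    have e : tn (ones_append (k + 1) l (m + 1) h) rfl (fullMerge (k + 1)) (fullMerge l) =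
        comp (tn (List.append_assoc _ _ _) rfl (mrg 1 k (k + 1) (Nat.add_comm 1 k))
          (one (strand l))) (tn (strand_append_ones m) rfl (one (strand 1))
            (tn (ones_append k l m h') rfl (fullMerge k) (fullMerge l))) := by
      rw [← tn_assoc (h₁ := strand_append_ones k) (h₂ := rfl)
        (h₃ := ones_append (k + 1) l (m + 1) h) (h₄ := List.append_assoc _ _ _), fullMerge,
        tn_comp_even (Or.inl (one_mem_gr _)), one_comp]
    rw [e, ← comp_assoc, mrg_assoc 1 k l (k + 1) m (m + 1) (Nat.add_comm 1 k) h' h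
      (Nat.add_comm 1 m) _ rfl, comp_assoc, tn_one_comp, mrg_comp_fullMerge k l m h', fullMerge]

/-- Splitting into two thick strands, then splitting both. -/
theorem fullSplit_comp_spl : ∀ (k l m : ℕ) (h : k + l = m),
    comp (tn rfl (ones_append k l m h) (fullSplit k) (fullSplit l)) (spl k l m h) = fullSplit m
  | 0, l, m, h => by
    obtain rfl : l = m := by omega
    have e : tn rfl (ones_append 0 l l h) (fullSplit 0) (fullSplit l) =
        comp (fullSplit l) (idc (strand_zero_add l l h)) := by
      have : fullSplit l = comp (one _) (fullSplit l) := (one_comp _).symm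
      rw [fullSplit, this]
      have e := tn_comp_even (f := idc ones_zero.symm) (g := one (ones l)) (h := one (strand 0))
        (k := fullSplit l) (hx := rfl) (hy := rfl) (hy' := rfl) (hz := ones_append 0 l l h)
        (Or.inr (one_mem_gr _))
      rw [comp_one] at e
      rw [← e, ← idc_rfl (rfl : ones l = ones l), tn_idc, tn_nil_left (u := strand 0) rfl]
      simp only [← comp_assoc, idc_comp_idc, idc_rfl, one_comp]
    rw [e, spl_zero_left]
    exact comp_idc_cancel _ _ _
  | k + 1, l, n, h => by
    obtain ⟨m, rfl⟩ : ∃ m, n = m + 1 := ⟨k + l, by omega⟩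
    have h' : k + l = m := by omega
    have e : tn rfl (ones_append (k + 1) l (m + 1) h) (fullSplit (k + 1)) (fullSplit l) =
        comp (tn rfl (strand_append_ones m) (one (strand 1))
            (tn rfl (ones_append k l m h') (fullSplit k) (fullSplit l)))
          (tn rfl (List.append_assoc _ _ _) (spl 1 k (k + 1) (Nat.add_comm 1 k))
          (one (strand l))) := by
      rw [← tn_assoc (h₁ := rfl) (h₂ := strand_append_ones k)
        (h₃ := List.append_assoc _ _ _) (h₄ := ones_append (k + 1) l (m + 1) h), fullSplit,
        tn_comp_even (Or.inl (fullSplit_mem_gr l)), comp_one]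
    rw [e, comp_assoc, spl_assoc 1 k l (k + 1) m (m + 1) (Nat.add_comm 1 k) h' h
      (Nat.add_comm 1 m) _ rfl, ← comp_assoc, tn_one_comp, fullSplit_comp_spl k l m h', fullSplit]

/-- A dot is a derivation for merges, so it moves down to a sum of dots on the thin strands. -/
theorem dt_comp_fullMerge : ∀ k, ∃ r ∈ dotCross (ones k),
    comp (dt k) (fullMerge k) = comp (fullMerge k) r
  | 0 => ⟨0, zero_mem _, (zero_comp _).trans (comp_zero _).symm⟩
  | k + 1 => by
    obtain ⟨r, hr, e⟩ := dt_comp_fullMerge k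
    refine ⟨tn (strand_append_ones k) (strand_append_ones k) (dt 1) (one (ones k)) +
      tn (strand_append_ones k) (strand_append_ones k) (one (strand 1)) r,
      add_mem (tn_mem_dotCross dot_mem_dotCross (one_mem _)) (tn_mem_dotCross (one_mem _) hr), ?_⟩
    rw [fullMerge, ← comp_assoc, dt_comp_mrg, add_comp, comp_assoc, comp_assoc, tn_one_comp, e,
      comp_add, comp_assoc, comp_assoc, tn_one_comp, tn_comp_even (Or.inl (one_mem_gr _)),
      tn_comp_even (Or.inl (fullMerge_mem_gr k)), one_comp, one_comp, comp_one, comp_one]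

theorem strand_coe (m : ℕ+) : strand m = [m] := by
  obtain ⟨k, rfl⟩ : ∃ k : ℕ, m = k.succPNat := ⟨m.natPred, (PNat.succPNat_natPred m).symm⟩
  rfl

theorem strand_coe_append (m : ℕ+) (a : Word) : strand m ++ a = m :: a := by
  rw [strand_coe]; rfl

theorem ones_wsum_nil : ones (wsum []) = [] := rfl

/-- Merging strands labelled `1` into all letters of a word. -/
def mergeAll : (a : Word) → WebHom (ones (wsum a)) a
  | [] => idc ones_wsum_nil
  | m :: a => tn (ones_append m (wsum a) _ rfl) (strand_coe_append m a) (fullMerge m) (mergeAll a)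

theorem mergeAll_mem_gr : ∀ a, mergeAll a ∈ gr (ones (wsum a)) a 0
  | [] => idc_mem_gr _
  | m :: a => tn_mem_gr_zero (fullMerge_mem_gr m) (mergeAll_mem_gr a)

theorem ones_wsum_append (a b : Word) :
    ones (wsum a) ++ ones (wsum b) = ones (wsum (a ++ b)) :=
  ones_append _ _ _ (wsum_append a b).symm

theorem mergeAll_append : ∀ a b : Word,
    mergeAll (a ++ b) = tn (ones_wsum_append a b) rfl (mergeAll a) (mergeAll b)
  | [], b => by
    rw [mergeAll, tn_idc_nil_left ones_wsum_nil]
    exact ((one_comp _).trans (comp_one _)).symm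
  | m :: a, b => by
    change mergeAll (m :: (a ++ b)) = _
    rw [mergeAll, mergeAll]
    refine Eq.trans ?_ (tn_assoc (k₁ := ones_wsum_append a b) (k₂ := rfl)
      (k₃ := ones_append m (wsum (a ++ b)) _ rfl) (k₄ := strand_coe_append m (a ++ b))).symm
    rw [← mergeAll_append a b]
    rfl

theorem ones_coe_one : ones ((1 : ℕ+) : ℕ) = strand ((1 : ℕ+) : ℕ) := rfl

theorem fullMerge_one : fullMerge ((1 : ℕ+) : ℕ) = idc ones_coe_one := by
  change fullMerge (0 + 1) = _
  rw [fullMerge, mrg_zero_right, fullMerge, ← idc_rfl (rfl : strand 1 = strand 1), tn_idc,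
    idc_comp_idc]
  rfl

/-- A complete merge of one strand is an identity. An `idc` is left over because `wsum (ones k)`
equals `k` only by a proof. -/
theorem mergeAll_ones : ∀ k, ∃ h, mergeAll (ones k) = idc h
  | 0 => ⟨rfl, rfl⟩
  | k + 1 => by
    obtain ⟨h, e⟩ := mergeAll_ones k
    have e' : mergeAll (ones (k + 1)) = tn (ones_append _ _ _ rfl) (strand_coe_append 1 (ones k))
      (fullMerge ((1 : ℕ+) : ℕ)) (mergeAll (ones k)) := rfl
    rw [e, fullMerge_one, tn_idc] at e'
    exact ⟨_, e'⟩

theorem ones_wsum_single (m : ℕ+) : ones (wsum [m]) = ones m := congrArg ones (Nat.add_zero m)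

theorem mergeAll_single (m : ℕ+) :
    mergeAll [m] = comp (idc (strand_coe m)) (comp (fullMerge m)
      (idc (ones_wsum_single m))) := by
  rw [mergeAll, mergeAll, tn_idc_nil_right ones_wsum_nil]

end WebHom
end TypeQ
end

/-! ### Every web comes from dots and crossings. -/

noncomputable section
namespace TypeQ
namespace WebHom
variable {a b c d a' b' c' d' a'' b'' w x y z : Word}

/-- `f` is zero, or it comes from dots and crossings on strands labelled `1`. -/
def FromDotCross (f : WebHom a b) : Prop :=
  f = 0 ∨ ∃ h : ones (wsum a) = ones (wsum b), ∃ r ∈ dotCross (ones (wsum a)),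
    comp f (mergeAll a) = comp (mergeAll b) (comp (idc h) r)

/-- Zero is a separate alternative in `FromDotCross` because it also exists between words of
different total label, where the words of thin strands cannot be identified. -/
theorem FromDotCross.idc (h : a = b) : FromDotCross (WebHom.idc h) := by
  subst h
  refine Or.inr ⟨rfl, 1, one_mem _, ?_⟩
  rw [idc_rfl, idc_rfl, one_comp, one_comp]
  exact (comp_one _).symm

theorem FromDotCross.comp {g : WebHom b c} {f : WebHom a b} (hg : FromDotCross g)
    (hf : FromDotCross f) : FromDotCross (comp g f) := by
  rcases hg with rfl | ⟨h, r, hr, e⟩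
  · exact Or.inl (zero_comp f)
  rcases hf with rfl | ⟨h', s, hs, e'⟩
  · exact Or.inl (comp_zero g)
  refine Or.inr ⟨h'.trans h, _, mul_mem (idc_conj_mem_dotCross hr h' h'.symm) hs, ?_⟩
  rw [comp_assoc, e', ← comp_assoc, e, mul_eq_comp]
  simp only [comp_assoc, ← idc_comp_idc_comp h' h]
  rw [idc_comp_cancel]

theorem FromDotCross.tensor {f : WebHom a b} {g : WebHom c d} (hf : FromDotCross f)
    (hg : FromDotCross g) : FromDotCross (tensor f g) := by
  rcases hf with rfl | ⟨h, r, hr, e⟩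
  · exact Or.inl (zero_tensor g)
  rcases hg with rfl | ⟨h', s, hs, e'⟩
  · exact Or.inl (tensor_zero f)
  have H : ones (wsum a) ++ ones (wsum c) = ones (wsum (b ++ d)) := by
    rw [h, h', ones_wsum_append]
  refine Or.inr ⟨(ones_wsum_append a c).symm.trans H,
    tn (ones_wsum_append a c) (ones_wsum_append a c) r s, tn_mem_dotCross hr hs, ?_⟩
  -- The complete merges are even, so they interchange with the other factors without signs.
  rw [mergeAll_append, ← tn_rfl, tn_comp_even (Or.inr (mergeAll_mem_gr a)), e, e',
    ← tn_comp_even (hy := ones_wsum_append b d) (hy' := ones_wsum_append b d)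
      (Or.inl (mergeAll_mem_gr d)),
    ← tn_comp_even (hy := ones_wsum_append a c) (hy' := ones_wsum_append a c)
      (Or.inl (idc_mem_gr h')), tn_idc, mergeAll_append]

theorem FromDotCross.add {f g : WebHom a b} (hf : FromDotCross f) (hg : FromDotCross g) :
    FromDotCross (f + g) := by
  rcases hf with rfl | ⟨h, r, hr, e⟩
  · rwa [zero_add]
  rcases hg with rfl | ⟨h', s, hs, e'⟩
  · rw [add_zero]; exact Or.inr ⟨h, r, hr, e⟩
  refine Or.inr ⟨h, r + s, add_mem hr hs, ?_⟩
  rw [add_comp, e, e', comp_add, comp_add]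

theorem FromDotCross.smul (z : ℂ) {f : WebHom a b} (hf : FromDotCross f) :
    FromDotCross (z • f) := by
  rcases hf with rfl | ⟨h, r, hr, e⟩
  · exact Or.inl (smul_zero z)
  refine Or.inr ⟨h, z • r, Subalgebra.smul_mem _ hr z, ?_⟩
  rw [smul_comp, e, comp_smul, comp_smul]

theorem FromDotCross.dot (k : ℕ+) : FromDotCross (WebHom.dot k) := by
  obtain ⟨r, hr, e⟩ := dt_comp_fullMerge k
  refine Or.inr ⟨rfl, _, idc_conj_mem_dotCross hr (ones_wsum_single k)
    (ones_wsum_single k).symm, ?_⟩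
  have e₁ : WebHom.comp (WebHom.dot k) (WebHom.idc (strand_coe k)) =
      WebHom.comp (WebHom.idc (strand_coe k)) (dt k) := by
    obtain ⟨j, rfl⟩ : ∃ j : ℕ, k = j.succPNat := ⟨k.natPred, (PNat.succPNat_natPred k).symm⟩
    exact (comp_one _).trans (one_comp _).symm
  rw [mergeAll_single, ← comp_assoc, e₁, comp_assoc, ← comp_assoc (dt k), e, idc_rfl]
  simp only [comp_assoc, one_comp]
  rw [idc_comp_cancel]

theorem pair_append (k l : ℕ+) : strand k ++ strand l = [k, l] := by
  rw [strand_coe, strand_coe]; rfl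

theorem tn_idc_conj_right {h : d = d'} {h' : c' = c} {hx : a ++ c' = x} {hy : b ++ d' = y}
    (f : WebHom a b) (g : WebHom c d) : tn hx hy f (comp (idc h) (comp g (idc h'))) =
      comp (idc (by rw [← hy, h])) (comp (tn rfl rfl f g) (idc (by rw [← hx, h']))) := by
  subst h h' hx hy
  rw [idc_rfl, idc_rfl, one_comp, comp_one, idc_rfl, idc_rfl, one_comp, comp_one]

theorem tn_source {hx : a ++ c = x} {hy : b ++ d = y} (f : WebHom a b) (g : WebHom c d) :
    tn hx hy f g = comp (tn rfl hy f g) (idc hx.symm) := by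
  subst hx
  exact (comp_one _).symm

theorem mergeAll_pair (k l : ℕ+) : ∃ h, mergeAll [k, l] =
    comp (idc (pair_append k l)) (comp (tn rfl rfl (fullMerge k) (fullMerge l)) (idc h)) := by
  have h : ones (wsum [k, l]) = ones k ++ ones l := (ones_append k l _ rfl).symm
  refine ⟨h, ?_⟩
  rw [mergeAll, mergeAll_single, tn_idc_conj_right]

theorem merge_comp_idc (k l : ℕ+) : comp (merge k l) (idc (pair_append k l)) =
    comp (idc (strand_coe (k + l))) (mrg k l (k + l : ℕ+) (PNat.add_coe k l).symm) := by
  obtain ⟨i, rfl⟩ : ∃ i : ℕ, k = i.succPNat := ⟨k.natPred, (PNat.succPNat_natPred k).symm⟩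
  obtain ⟨j, rfl⟩ : ∃ j : ℕ, l = j.succPNat := ⟨l.natPred, (PNat.succPNat_natPred l).symm⟩
  exact (comp_one _).trans (idc_comp_cancel _ (strand_coe _) _).symm

theorem split_comp_idc (k l : ℕ+) : comp (split k l) (idc (strand_coe (k + l))) =
    comp (idc (pair_append k l)) (spl k l (k + l : ℕ+) (PNat.add_coe k l).symm) := by
  obtain ⟨i, rfl⟩ : ∃ i : ℕ, k = i.succPNat := ⟨k.natPred, (PNat.succPNat_natPred k).symm⟩
  obtain ⟨j, rfl⟩ : ∃ j : ℕ, l = j.succPNat := ⟨l.natPred, (PNat.succPNat_natPred l).symm⟩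
  exact (one_comp _).symm

/-- Complete merges followed by a merge are again a complete merge, so the polynomial is `1`. -/
theorem FromDotCross.merge (k l : ℕ+) : FromDotCross (WebHom.merge k l) := by
  obtain ⟨h, e⟩ := mergeAll_pair k l
  have H : ones (k + l : ℕ+) = ones (wsum [k + l]) := (ones_wsum_single _).symm
  have h' : ones k ++ ones l = ones (k + l : ℕ+) := ones_append k l _ (PNat.add_coe k l).symm
  refine Or.inr ⟨h.trans (h'.trans H), 1, one_mem _, ?_⟩
  have e₁ := mrg_comp_fullMerge k l (k + l : ℕ+) (PNat.add_coe k l).symm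
  rw [tn_source, ← comp_assoc] at e₁
  have e₂ := congrArg (fun f => WebHom.comp f (WebHom.idc h')) e₁
  simp only [comp_assoc, idc_comp_idc, idc_rfl, comp_one] at e₂
  rw [e, ← comp_assoc, merge_comp_idc, comp_assoc, ← comp_assoc (mrg _ _ _ _), e₂, one_eq,
    comp_one, mergeAll_single]
  simp only [comp_assoc, idc_comp_idc]

/-- The right-hand side contains a complete merge after a complete split on each of the two thick
strands. These give `k!` and `l!`, which the scalar cancels. -/
theorem spl_comp_fullMerge_add (k l m : ℕ) (h : k + l = m) :
    WebHom.comp (spl k l m h) (fullMerge m) =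
      ((k.factorial : ℂ)⁻¹ * (l.factorial : ℂ)⁻¹) •
        WebHom.comp (tn (ones_append k l m h) rfl (fullMerge k) (fullMerge l))
          (WebHom.comp (fullSplit m) (fullMerge m)) := by
  rw [← fullSplit_comp_spl k l m h, comp_assoc, ← comp_assoc,
    tn_comp_even (Or.inl (fullMerge_mem_gr l)), fullMerge_comp_fullSplit,
    fullMerge_comp_fullSplit, tn_smul, smul_tn, tn_one_one, idc_rfl, smul_smul, smul_comp,
    one_comp, smul_smul]
  refine (one_smul ℂ _).symm.trans (congrArg (· • _) ?_)
  have hk := factorial_ne k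
  have hl := factorial_ne l
  field_simp

/-- The polynomial is a multiple of the complete merge followed by the complete split on `k + l`
strands, which lies in `dotCross` by `fullSplit_comp_fullMerge_mem`. -/
theorem FromDotCross.split (k l : ℕ+) : FromDotCross (WebHom.split k l) := by
  obtain ⟨h, e⟩ := mergeAll_pair k l
  have H : ones (wsum [k + l]) = ones (k + l : ℕ+) := ones_wsum_single _
  refine Or.inr ⟨H.trans ((ones_append k l _ (PNat.add_coe k l).symm).symm.trans h.symm), _,
    Subalgebra.smul_mem _ (idc_conj_mem_dotCross
      (fullSplit_comp_fullMerge_mem (k + l : ℕ+)) H H.symm)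
      (((k : ℕ).factorial : ℂ)⁻¹ * ((l : ℕ).factorial : ℂ)⁻¹), ?_⟩
  rw [mergeAll_single, ← comp_assoc, split_comp_idc, comp_assoc, ← comp_assoc (spl _ _ _ _),
    spl_comp_fullMerge_add, e, tn_source]
  simp only [comp_assoc, comp_smul, smul_comp, idc_comp_idc_comp]

theorem fromDotCross (f : WebHom a b) : FromDotCross f := by
  induction f using ind with | h f =>
  induction f with
  | id h => exact .idc h
  | comp g f ihg ihf => exact ihg.comp ihf
  | tensor f g ihf ihg => exact ihf.tensor ihg
  | dot k => exact .dot k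
  | merge k l => exact .merge k l
  | split k l => exact .split k l
  | zero => exact Or.inl rfl
  | add f g ihf ihg => exact ihf.add ihg
  | smul z f ihf => exact ihf.smul z

/-- On `ones k` the complete merges are identities up to equality of words, so `fromDotCross`
exhibits the web itself as a polynomial in dots and crossings. -/
theorem mem_dotCross_ones (k : ℕ) (f : WebHom (ones k) (ones k)) : f ∈ dotCross (ones k) := by
  rcases fromDotCross f with rfl | ⟨_, r, hr, e⟩
  · exact zero_mem _
  obtain ⟨h, e'⟩ := mergeAll_ones k
  rw [e', idc_rfl, one_comp] at e
  have e₁ := congrArg (fun g => WebHom.comp g (WebHom.idc h.symm)) e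
  simp only [comp_assoc, idc_comp_idc, idc_rfl, comp_one] at e₁
  rw [e₁]
  exact idc_conj_mem_dotCross hr h.symm h

end WebHom

theorem serWeb_surjective (k : ℕ) : Function.Surjective (serWeb k) :=
  fun f => WebHom.dotCross_ones_le k (WebHom.mem_dotCross_ones k f)

end TypeQ
end

noncomputable section
namespace TypeQ

/-! ### An upper bound for the dimension of the Sergeev superalgebra -/

section
open scoped Classical Pointwise
variable {A : Type*} [Ring A]

/-- The product `s_j s_{j+1} ⋯ s_{j+l-1}`. -/
def descent (s : ℕ → A) : (j l : ℕ) → A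
  | _, 0 => 1
  | j, l + 1 => s j * descent s (j + 1) l

theorem comm_descent {s : ℕ → A} {i K : ℕ}
    (hcomm : ∀ i j, i + 1 < j → j < K → s i * s j = s j * s i) :
    ∀ {l j : ℕ}, i + 1 < j → j + l ≤ K → s i * descent s j l = descent s j l * s i
  | 0, j, _, _ => (mul_one _).trans (one_mul _).symm
  | l + 1, j, h, h' => by
    rw [descent, ← mul_assoc, hcomm i j h (by omega), mul_assoc,
      comm_descent hcomm (by omega) (by omega), mul_assoc]

/-- The letter commutes with the start of the descending product until it meets its neighbour; there
one braid relation lowers its index, and the result commutes with the rest. -/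
theorem shift_descent {s : ℕ → A} {K : ℕ}
    (hcomm : ∀ i j, i + 1 < j → j < K → s i * s j = s j * s i)
    (hbraid : ∀ i, i + 1 < K → s i * s (i + 1) * s i = s (i + 1) * s i * s (i + 1)) :
    ∀ {l j i : ℕ}, j < i + 1 → i + 1 < j + l → j + l ≤ K →
      s (i + 1) * descent s j l = descent s j l * s i
  | 0, j, i, h, h', _ => by omega
  | l + 1, j, i, h, h', h'' => by
    rw [descent]
    rcases eq_or_lt_of_le (Nat.lt_succ_iff.1 h) with rfl | h
    · obtain ⟨m, rfl⟩ : ∃ m, l = m + 1 := ⟨l - 1, by omega⟩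
      rw [descent, mul_assoc, mul_assoc, ← comm_descent hcomm (i := j) (by omega) (by omega),
        ← mul_assoc, ← mul_assoc, ← mul_assoc, ← mul_assoc, ← hbraid j (by omega)]
    · rw [← mul_assoc, ← hcomm j (i + 1) (by omega) (by omega), mul_assoc,
        shift_descent hcomm hbraid (by omega) (by omega) (by omega), mul_assoc]

/-- Normal forms of the products of `s_0, …, s_{m-2}`. -/
def permWords (s : ℕ → A) : ℕ → Finset A
  | 0 => {1}
  | m + 1 => (Finset.range (m + 1)).biUnion fun j =>
      (permWords s m).image fun x => descent s j (m - j) * x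

theorem card_permWords (s : ℕ → A) : ∀ m, (permWords s m).card ≤ m.factorial
  | 0 => le_rfl
  | m + 1 => by
    rw [permWords, Nat.factorial_succ]
    refine (Finset.card_biUnion_le_card_mul _ _ m.factorial fun j _ =>
      Finset.card_image_le.trans (card_permWords s m)).trans (by rw [Finset.card_range])

theorem one_mem_permWords (s : ℕ → A) : ∀ m, (1 : A) ∈ permWords s m
  | 0 => Finset.mem_singleton_self 1
  | m + 1 => Finset.mem_biUnion.2 ⟨m, Finset.self_mem_range_succ m, Finset.mem_image.2
      ⟨1, one_mem_permWords s m, by rw [Nat.sub_self, descent, one_mul]⟩⟩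

theorem descent_mul_mem [Algebra ℂ A] {s : ℕ → A} {m j : ℕ} (hj : j ≤ m) {x : A}
    (hx : x ∈ Submodule.span ℂ (permWords s m : Set A)) :
    descent s j (m - j) * x ∈ Submodule.span ℂ (permWords s (m + 1) : Set A) := by
  refine (Submodule.span_le (p := (Submodule.span ℂ (permWords s (m + 1) : Set A)).comap
    (LinearMap.mulLeft ℂ (descent s j (m - j))))).2 (fun y hy => ?_) hx
  exact Submodule.subset_span (Finset.mem_biUnion.2 ⟨j, by simpa [Nat.lt_succ_iff] using hj,
    Finset.mem_image_of_mem _ hy⟩)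

/-- For a normal form that begins with `s_j ⋯ s_{m-1}`, a letter `s_i` passes it if `i + 1 < j`,
lengthens it if `i + 1 = j`, shortens it if `i = j`, and passes it as `s_{i-1}` if `i > j`. In the
first and last case the induction on `m` takes over. -/
theorem mul_mem_span_permWords [Algebra ℂ A] {s : ℕ → A} {K : ℕ}
    (hcomm : ∀ i j, i + 1 < j → j < K → s i * s j = s j * s i)
    (hbraid : ∀ i, i + 1 < K → s i * s (i + 1) * s i = s (i + 1) * s i * s (i + 1))
    (hsq : ∀ i < K, s i * s i = 1) : ∀ {m i : ℕ}, m ≤ K + 1 → i + 1 < m → ∀ {x : A},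
      x ∈ Submodule.span ℂ (permWords s m : Set A) →
        s i * x ∈ Submodule.span ℂ (permWords s m : Set A)
  | 0, i, _, h, _, _ => by omega
  | m + 1, i, hm, h, x, hx => by
    refine (Submodule.span_le (p := (Submodule.span ℂ (permWords s (m + 1) : Set A)).comap
      (LinearMap.mulLeft ℂ (s i)))).2 (fun y hy => ?_) hx
    obtain ⟨j, hj, hy⟩ := Finset.mem_biUnion.1 hy
    obtain ⟨x, hx, rfl⟩ := Finset.mem_image.1 hy
    replace hx : x ∈ Submodule.span ℂ (permWords s m : Set A) := Submodule.subset_span hx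
    replace hj : j ≤ m := by simpa [Nat.lt_succ_iff] using hj
    change s i * (descent s j (m - j) * x) ∈ Submodule.span ℂ (permWords s (m + 1) : Set A)
    rw [← mul_assoc]
    rcases lt_trichotomy (i + 1) j with hij | hij | hij
    · rw [comm_descent hcomm hij (by omega), mul_assoc]
      exact descent_mul_mem hj (mul_mem_span_permWords hcomm hbraid hsq (by omega) (by omega) hx)
    · have e : s i * descent s j (m - j) = descent s i (m - i) := by
        rw [show m - i = (m - j) + 1 by omega, descent, hij]
      rw [e]
      exact descent_mul_mem (by omega) hx
    rcases eq_or_lt_of_le (Nat.lt_succ_iff.1 hij) with rfl | hij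
    · have e : s j * descent s j (m - j) = descent s (j + 1) (m - (j + 1)) := by
        rw [show m - j = (m - (j + 1)) + 1 by omega, descent, ← mul_assoc, hsq j (by omega),
          one_mul]
      rw [e]
      exact descent_mul_mem (by omega) hx
    · obtain ⟨i, rfl⟩ : ∃ i', i = i' + 1 := ⟨i - 1, by omega⟩
      rw [shift_descent hcomm hbraid hij (by omega) (by omega), mul_assoc]
      exact descent_mul_mem hj (mul_mem_span_permWords hcomm hbraid hsq (by omega) (by omega) hx)

/-- Normal forms of the products of `c_0, …, c_{m-1}`. -/
def clifWords (c : ℕ → A) : ℕ → Finset A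
  | 0 => {1}
  | m + 1 => clifWords c m ∪ (clifWords c m).image fun x => c m * x

theorem card_clifWords (c : ℕ → A) : ∀ m, (clifWords c m).card ≤ 2 ^ m
  | 0 => le_rfl
  | m + 1 => by
    rw [clifWords, pow_succ, mul_two]
    exact (Finset.card_union_le _ _).trans (Nat.add_le_add (card_clifWords c m)
      (Finset.card_image_le.trans (card_clifWords c m)))

theorem one_mem_clifWords (c : ℕ → A) : ∀ m, (1 : A) ∈ clifWords c m
  | 0 => Finset.mem_singleton_self 1
  | m + 1 => Finset.mem_union_left _ (one_mem_clifWords c m)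

/-- The letter `c_i` either anticommutes past the leading `c_m`, or cancels it, or becomes the
leading letter. -/
theorem mul_mem_span_clifWords [Algebra ℂ A] {c : ℕ → A} {K : ℕ}
    (hanti : ∀ i j, i < j → j < K → c i * c j = -(c j * c i))
    (hsq : ∀ i < K, c i * c i = 1) : ∀ {m i : ℕ}, m ≤ K → i < m → ∀ {x : A},
      x ∈ Submodule.span ℂ (clifWords c m : Set A) →
        c i * x ∈ Submodule.span ℂ (clifWords c m : Set A)
  | 0, i, _, h, _, _ => by omega
  | m + 1, i, hm, h, x, hx => by
    have h₁ : Submodule.span ℂ (clifWords c m : Set A) ≤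
        Submodule.span ℂ (clifWords c (m + 1) : Set A) :=
      Submodule.span_mono fun y hy => Finset.mem_union_left _ hy
    have h₂ : ∀ y ∈ Submodule.span ℂ (clifWords c m : Set A),
        c m * y ∈ Submodule.span ℂ (clifWords c (m + 1) : Set A) := fun y hy =>
      (Submodule.span_le (p := (Submodule.span ℂ (clifWords c (m + 1) : Set A)).comap
        (LinearMap.mulLeft ℂ (c m)))).2 (fun z hz => Submodule.subset_span
          (Finset.mem_union_right _ (Finset.mem_image_of_mem _ hz))) hy
    refine (Submodule.span_le (p := (Submodule.span ℂ (clifWords c (m + 1) : Set A)).comap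
      (LinearMap.mulLeft ℂ (c i)))).2 (fun y hy => ?_) hx
    change c i * y ∈ Submodule.span ℂ (clifWords c (m + 1) : Set A)
    rcases Finset.mem_union.1 hy with hy | hy
    · replace hy : y ∈ Submodule.span ℂ (clifWords c m : Set A) := Submodule.subset_span hy
      rcases eq_or_lt_of_le (Nat.lt_succ_iff.1 h) with rfl | h
      · exact h₂ y hy
      · exact h₁ (mul_mem_span_clifWords hanti hsq (by omega) h hy)
    · obtain ⟨y, hy', rfl⟩ := Finset.mem_image.1 hy
      replace hy : y ∈ Submodule.span ℂ (clifWords c m : Set A) := Submodule.subset_span hy'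
      rcases eq_or_lt_of_le (Nat.lt_succ_iff.1 h) with rfl | h
      · rw [← mul_assoc, hsq i (by omega), one_mul]
        exact h₁ hy
      · rw [← mul_assoc, hanti i m h (by omega), neg_mul, mul_assoc]
        exact Submodule.neg_mem _ (h₂ _ (mul_mem_span_clifWords hanti hsq (by omega) h hy))

/-- This moves a transposition to the right of a Clifford word. The result lies in the span for `K`
rather than `m`, because `σ` may raise indices. -/
theorem mul_clifWords_mem [Algebra ℂ A] {c : ℕ → A} {K : ℕ} {t : A} {σ : ℕ → ℕ} (hσ : ∀ i < K, σ i < K)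
    (hanti : ∀ i j, i < j → j < K → c i * c j = -(c j * c i)) (hsq : ∀ i < K, c i * c i = 1)
    (ht : ∀ i < K, t * c i = c (σ i) * t) : ∀ {m : ℕ}, m ≤ K → ∀ x ∈ clifWords c m,
      ∃ y ∈ Submodule.span ℂ (clifWords c K : Set A), t * x = y * t
  | 0, _, x, hx => by
    rw [Finset.mem_singleton.1 hx]
    exact ⟨1, Submodule.subset_span (one_mem_clifWords c K), (mul_one t).trans (one_mul t).symm⟩
  | m + 1, hm, x, hx => by
    rcases Finset.mem_union.1 hx with hx | hx
    · exact mul_clifWords_mem hσ hanti hsq ht (by omega) x hx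
    · obtain ⟨x', hx', rfl⟩ := Finset.mem_image.1 hx
      obtain ⟨y, hy, e⟩ := mul_clifWords_mem hσ hanti hsq ht (by omega) x' hx'
      refine ⟨c (σ m) * y, mul_mem_span_clifWords hanti hsq le_rfl (hσ m (by omega)) hy, ?_⟩
      rw [← mul_assoc, ht m (by omega), mul_assoc, e, mul_assoc]

end

namespace Ser
variable {k : ℕ}

theorem mk_eq {x y : FreeAlgebra ℂ (SerGen k)} (h : SerRel k x y) :
    RingQuot.mkAlgHom ℂ (SerRel k) x = RingQuot.mkAlgHom ℂ (SerRel k) y :=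
  RingQuot.mkAlgHom_rel ℂ h

/-- The generators `c_i`, extended by zero. -/
def cSeq (k i : ℕ) : Ser k := if h : i < k then c ⟨i, h⟩ else 0

/-- The generators `s_j`, extended by zero. -/
def sSeq (k j : ℕ) : Ser k := if h : j < k - 1 then s ⟨j, h⟩ else 0

theorem cSeq_of_lt {i : ℕ} (h : i < k) : cSeq k i = c ⟨i, h⟩ := dif_pos h

theorem sSeq_of_lt {j : ℕ} (h : j < k - 1) : sSeq k j = s ⟨j, h⟩ := dif_pos h

theorem cSeq_sq (i : ℕ) (h : i < k) : cSeq k i * cSeq k i = 1 := by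
  rw [cSeq_of_lt h]
  simpa [c] using mk_eq (.c_sq ⟨i, h⟩)

theorem cSeq_anti (i j : ℕ) (hij : i < j) (h : j < k) :
    cSeq k i * cSeq k j = -(cSeq k j * cSeq k i) := by
  rw [cSeq_of_lt h, cSeq_of_lt (hij.trans h)]
  simpa [c] using mk_eq (.c_anti ⟨i, hij.trans h⟩ ⟨j, h⟩ (by simp; omega))

theorem sSeq_sq (i : ℕ) (h : i < k - 1) : sSeq k i * sSeq k i = 1 := by
  rw [sSeq_of_lt h]
  simpa [s] using mk_eq (.s_sq ⟨i, h⟩)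

theorem sSeq_comm (i j : ℕ) (hij : i + 1 < j) (h : j < k - 1) :
    sSeq k i * sSeq k j = sSeq k j * sSeq k i := by
  rw [sSeq_of_lt h, sSeq_of_lt (by omega : i < k - 1)]
  simpa [s] using mk_eq (.s_comm ⟨i, by omega⟩ ⟨j, h⟩ (by simp; omega) (by simp; omega))

theorem sSeq_braid (i : ℕ) (h : i + 1 < k - 1) :
    sSeq k i * sSeq k (i + 1) * sSeq k i = sSeq k (i + 1) * sSeq k i * sSeq k (i + 1) := by
  rw [sSeq_of_lt h, sSeq_of_lt (by omega : i < k - 1)]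
  simpa [s] using mk_eq (.s_braid ⟨i, by omega⟩ ⟨i + 1, h⟩ rfl)

theorem sSeq_cSeq (j : ℕ) (h : j < k - 1) (i : ℕ) (hi : i < k) :
    sSeq k j * cSeq k i = cSeq k (Equiv.swap j (j + 1) i) * sSeq k j := by
  rcases eq_or_ne i j with rfl | h₁
  · rw [Equiv.swap_apply_left, sSeq_of_lt h, cSeq_of_lt hi, cSeq_of_lt (by omega : i + 1 < k)]
    simpa [s, c] using mk_eq (.sc_left ⟨i, h⟩ ⟨i, hi⟩ ⟨i + 1, by omega⟩ rfl rfl)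
  rcases eq_or_ne i (j + 1) with rfl | h₂
  · rw [Equiv.swap_apply_right, sSeq_of_lt h, cSeq_of_lt hi, cSeq_of_lt (by omega : j < k)]
    simpa [s, c] using mk_eq (.sc_right ⟨j, h⟩ ⟨j, by omega⟩ ⟨j + 1, hi⟩ rfl rfl)
  · rw [Equiv.swap_apply_of_ne_of_ne h₁ h₂, sSeq_of_lt h, cSeq_of_lt hi]
    simpa [s, c] using (mk_eq (.cs_comm ⟨i, hi⟩ ⟨j, h⟩ h₁ h₂)).symm

theorem hom_ext {A : Type*} [Semiring A] [Algebra ℂ A] {f g : Ser k →ₐ[ℂ] A}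
    (hc : ∀ i, f (c i) = g (c i)) (hs : ∀ j, f (s j) = g (s j)) : f = g := by
  refine RingQuot.ringQuot_ext' ℂ f g (FreeAlgebra.hom_ext (funext fun x => ?_))
  rcases x with i | j
  · exact hc i
  · exact hs j

/-- A left ideal that contains `1` is everything; it suffices to test generators. -/
theorem eq_top_of_mul_mem {W : Submodule ℂ (Ser k)} (h₁ : 1 ∈ W) (hc : ∀ i, ∀ w ∈ W, c i * w ∈ W)
    (hs : ∀ j, ∀ w ∈ W, s j * w ∈ W) : W = ⊤ := by
  have key : ∀ a : FreeAlgebra ℂ (SerGen k), ∀ w ∈ W,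
      RingQuot.mkAlgHom ℂ (SerRel k) a * w ∈ W := by
    intro a
    induction a using FreeAlgebra.induction with
    | grade0 z =>
      intro w hw
      rw [AlgHom.commutes, ← Algebra.smul_def]
      exact W.smul_mem z hw
    | grade1 x =>
      rcases x with i | j
      · exact hc i
      · exact hs j
    | mul a b ha hb =>
      intro w hw
      rw [map_mul, mul_assoc]
      exact ha _ (hb w hw)
    | add a b ha hb =>
      intro w hw
      rw [map_add, add_mul]
      exact W.add_mem (ha w hw) (hb w hw)
  refine eq_top_iff.2 fun x _ => ?_
  obtain ⟨a, rfl⟩ := RingQuot.mkAlgHom_surjective ℂ (SerRel k) x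
  simpa using key a 1 h₁

-- The products of Clifford normal forms and permutation normal forms span a left ideal containing
-- `1`: a `c_i` acts on the first factor, and an `s_j` first moves through it to the second.
open scoped Classical Pointwise in
theorem span_words (k : ℕ) : Submodule.span ℂ
    ((clifWords (cSeq k) k * permWords (sSeq k) k : Finset (Ser k)) : Set (Ser k)) = ⊤ := by
  rw [Finset.coe_mul, ← Submodule.span_mul_span]
  refine eq_top_of_mul_mem ?_ (fun i w hw => ?_) fun j w hw => ?_
  · rw [← one_mul (1 : Ser k)]
    exact Submodule.mul_mem_mul (Submodule.subset_span (one_mem_clifWords _ k))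
      (Submodule.subset_span (one_mem_permWords _ k))
  · induction hw using Submodule.mul_induction_on' with
    | mem_mul_mem x hx y hy =>
      rw [← mul_assoc, ← cSeq_of_lt i.2]
      exact Submodule.mul_mem_mul
        (mul_mem_span_clifWords cSeq_anti cSeq_sq le_rfl i.2 hx) hy
    | add x _ y _ hx hy => rw [mul_add]; exact Submodule.add_mem _ hx hy
  · have hW : ∀ y ∈ Submodule.span ℂ (permWords (sSeq k) k : Set (Ser k)),
        s j * y ∈ Submodule.span ℂ (permWords (sSeq k) k : Set (Ser k)) := fun y hy => by
      rw [← sSeq_of_lt j.2]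
      exact mul_mem_span_permWords sSeq_comm sSeq_braid sSeq_sq (by omega) (by omega) hy
    have hj : ∀ i < k, Equiv.swap (j : ℕ) (j + 1) i < k := fun i hi => by
      rw [Equiv.swap_apply_def]; split_ifs <;> omega
    induction hw using Submodule.mul_induction_on' with
    | mem_mul_mem x hx y hy =>
      induction hx using Submodule.span_induction with
      | mem x hx =>
        obtain ⟨z, hz, e⟩ := mul_clifWords_mem (t := sSeq k j) hj cSeq_anti cSeq_sq
          (sSeq_cSeq j j.2) le_rfl x hx
        rw [← mul_assoc, ← sSeq_of_lt j.2, e, mul_assoc, sSeq_of_lt j.2]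
        exact Submodule.mul_mem_mul hz (hW y hy)
      | zero => rw [zero_mul, mul_zero]; exact Submodule.zero_mem _
      | add u v _ _ hu hv => rw [add_mul, mul_add]; exact Submodule.add_mem _ hu hv
      | smul z u _ hu => rw [smul_mul_assoc, mul_smul_comm]; exact Submodule.smul_mem _ z hu
    | add x _ y _ hx hy => rw [mul_add]; exact Submodule.add_mem _ hx hy

instance finite (k : ℕ) : Module.Finite ℂ (Ser k) := by
  classical
  exact ⟨⟨_, span_words k⟩⟩

theorem finrank_le (k : ℕ) : Module.finrank ℂ (Ser k) ≤ 2 ^ k * k.factorial := by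
  classical
  rw [← finrank_top, ← span_words k]
  exact (finrank_span_finset_le_card _).trans (Finset.card_mul_le.trans
    (Nat.mul_le_mul (card_clifWords _ k) (card_permWords _ k)))

end Ser
end TypeQ
end

noncomputable section
namespace TypeQ

/-! ### Faithfulness of the action on tensor powers -/

/-- The prescribed formulas fix the generators on basis tensors, which are homogeneous, so there is
only one such action. -/
theorem SergeevAction.map_eq {n k : ℕ} (ψ : SergeevAction n k) : ψ.map = sergeevHom n k := by
  refine Ser.hom_ext (fun i => (basisT n k).ext fun x => ?_) fun j => (basisT n k).ext fun x => ?_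
  · rw [basisT_apply, ψ.map_c i _ _ fun i => isHomog_letterVec (x i)]
    exact ((sergeevAction n k).map_c i _ _ fun i => isHomog_letterVec (x i)).symm
  · have ha : (j : ℕ) < k := by omega
    have hb : (j : ℕ) + 1 < k := by omega
    rw [basisT_apply, ψ.map_s j ⟨j, ha⟩ ⟨j + 1, hb⟩ rfl rfl _ _ fun i => isHomog_letterVec (x i)]
    exact ((sergeevAction n k).map_s j ⟨j, ha⟩ ⟨j + 1, hb⟩ rfl rfl _ _
      fun i => isHomog_letterVec (x i)).symm

/-- The letter of the opposite parity. -/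
def flipLetter {n : ℕ} : Letter n → Letter n := Sum.swap

theorem cV_letterVec {n : ℕ} (x : Letter n) :
    ∃ z : ℂ, z ≠ 0 ∧ cV n (letterVec x) = z • letterVec (flipLetter x) := by
  rcases x with i | i
  · refine ⟨Complex.I, Complex.I_ne_zero, ?_⟩
    ext (j | j) <;> simp [cV, letterVec, flipLetter, Pi.single_apply]
  · refine ⟨-Complex.I, neg_ne_zero.2 Complex.I_ne_zero, ?_⟩
    ext (j | j) <;> simp [cV, letterVec, flipLetter, Pi.single_apply]
    split_ifs <;> simp

section
variable {n k : ℕ}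

theorem mem_of_smul_eq {M : Type*} [AddCommGroup M] [Module ℂ M] {W : Submodule ℂ M} {z : ℂ}
    (hz : z ≠ 0) {x y : M} (hx : x ∈ W) (h : x = z • y) : y ∈ W := by
  rw [h] at hx
  exact (W.smul_mem_iff hz).1 hx

/-- The orbit of a vector under the Sergeev superalgebra. -/
def orbitMap (n k : ℕ) (t : T n k) : Ser k →ₗ[ℂ] T n k :=
  (LinearMap.applyₗ t) ∘ₗ (sergeevHom n k).toLinearMap

theorem sergeevHom_mem_range (t : T n k) (x : Ser k) {u : T n k}
    (hu : u ∈ LinearMap.range (orbitMap n k t)) :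
    sergeevHom n k x u ∈ LinearMap.range (orbitMap n k t) := by
  obtain ⟨y, rfl⟩ := hu
  exact ⟨x * y, by simp [orbitMap]⟩

/-- Up to a nonzero scalar, `c_i` sends a basis tensor to the one with the parity of letter `i`
changed. -/
theorem flip_mem_range (t : T n k) (x : Fin k → Letter n) (i : Fin k)
    (h : basisT n k x ∈ LinearMap.range (orbitMap n k t)) :
    basisT n k (Function.update x i (flipLetter (x i))) ∈ LinearMap.range (orbitMap n k t) := by
  obtain ⟨z, hz, e⟩ := cV_letterVec (x i)
  have h' := sergeevHom_mem_range t (Ser.c i) h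
  rw [basisT_apply] at h'
  have e₁ := (sergeevAction n k).map_c i _ _ fun i => isHomog_letterVec (x i)
  have hm : ∀ (v : Fin k → VN n) (w : VN n), pureT n k (Function.update v i (z • w)) =
      z • pureT n k (Function.update v i w) := fun v w => (pureTM n k).map_update_smul v i z w
  rw [e, hm, smul_smul] at e₁
  have e₂ : Function.update (fun i => letterVec (x i)) i (letterVec (flipLetter (x i))) =
      fun j => letterVec (Function.update x i (flipLetter (x i)) j) := by
    funext j
    rcases eq_or_ne j i with rfl | hj
    · simp
    · simp [hj]
  rw [e₂] at e₁
  rw [basisT_apply]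
  exact mem_of_smul_eq (mul_ne_zero (sgn_ne_zero _) hz) h' e₁

theorem flips_mem_range (t : T n k) (x : Fin k → Letter n) (s : Finset (Fin k))
    (h : basisT n k x ∈ LinearMap.range (orbitMap n k t)) :
    basisT n k (fun i => if i ∈ s then flipLetter (x i) else x i) ∈
      LinearMap.range (orbitMap n k t) := by
  induction s using Finset.induction_on with
  | empty => simpa using h
  | insert i s hi ih =>
    have := flip_mem_range t _ i ih
    convert this using 2
    funext j
    rcases eq_or_ne j i with rfl | hj
    · simp [hi]
    · simp [hj]

theorem swap_mem_range (t : T n k) (x : Fin k → Letter n) (a b : Fin k) (hab : b.val = a.val + 1)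
    (h : basisT n k x ∈ LinearMap.range (orbitMap n k t)) :
    basisT n k (x ∘ Equiv.swap a b) ∈ LinearMap.range (orbitMap n k t) := by
  have h' := sergeevHom_mem_range t (Ser.s ⟨a, by omega⟩) h
  rw [basisT_apply] at h' ⊢
  exact mem_of_smul_eq (sgn_ne_zero _) h' ((sergeevAction n k).map_s ⟨a, by omega⟩ a b rfl hab _ _
    fun i => isHomog_letterVec (x i))

theorem perm_mem_range (t : T n k) (σ : Equiv.Perm (Fin k)) (x : Fin k → Letter n)
    (h : basisT n k x ∈ LinearMap.range (orbitMap n k t)) :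
    basisT n k (x ∘ σ) ∈ LinearMap.range (orbitMap n k t) := by
  rcases k with _ | k
  · rwa [Subsingleton.elim (x ∘ σ) x]
  have hσ : σ ∈ Submonoid.closure (Set.range fun i : Fin k => Equiv.swap i.castSucc i.succ) := by
    rw [Equiv.Perm.mclosure_swap_castSucc_succ]
    trivial
  induction hσ using Submonoid.closure_induction generalizing x with
  | mem σ hσ =>
    obtain ⟨i, rfl⟩ := hσ
    exact swap_mem_range t x _ _ (by simp) h
  | one => exact h
  | mul σ τ _ _ hσ hτ => exact hτ (x ∘ σ) (hσ x h)

end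

/-- The words in which each of the letters `0, …, k - 1` occurs once, with any parity. -/
def permLetters (k : ℕ) (p : Finset (Fin k) × Equiv.Perm (Fin k)) (i : Fin k) : Letter k :=
  if i ∈ p.1 then Sum.inr (p.2 i) else Sum.inl (p.2 i)

theorem permLetters_injective (k : ℕ) : Function.Injective (permLetters k) := by
  rintro ⟨s, σ⟩ ⟨t, τ⟩ h
  have h' : ∀ i, permLetters k (s, σ) i = permLetters k (t, τ) i := congrFun h
  have hs : s = t := by
    ext i
    have := h' i
    by_cases h₁ : i ∈ s <;> by_cases h₂ : i ∈ t <;> simp [permLetters, h₁, h₂] at this ⊢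
  subst hs
  refine Prod.ext rfl (Equiv.ext fun i => ?_)
  have := h' i
  by_cases h₁ : i ∈ s <;> simpa [permLetters, h₁] using this

/-- With `n = k` there are enough letters for a tensor `t` with distinct letters. Its orbit contains
$2^kk!$ different basis tensors, while the algebra has at most this dimension, so the orbit map of
`t` has no kernel. -/
theorem sergeevHom_injective (k : ℕ) : Function.Injective (sergeevHom k k) := by
  set t : T k k := basisT k k Sum.inl with ht
  have h₀ : t ∈ LinearMap.range (orbitMap k k t) := ⟨1, by simp [orbitMap]⟩
  have hmem : ∀ p, basisT k k (permLetters k p) ∈ LinearMap.range (orbitMap k k t) := by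
    rintro ⟨s, σ⟩
    exact flips_mem_range t (Sum.inl ∘ σ) s (perm_mem_range t σ _ h₀)
  have hli : LinearIndependent ℂ fun p => (⟨basisT k k (permLetters k p), hmem p⟩ :
      LinearMap.range (orbitMap k k t)) :=
    LinearIndependent.of_comp (LinearMap.range (orbitMap k k t)).subtype
      ((basisT k k).linearIndependent.comp _ (permLetters_injective k))
  have hcard := hli.fintype_card_le_finrank
  rw [Fintype.card_prod, Fintype.card_finset, Fintype.card_perm, Fintype.card_fin] at hcard
  have hle := Ser.finrank_le k
  have hsum := LinearMap.finrank_range_add_finrank_ker (orbitMap k k t)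
  have hker : LinearMap.ker (orbitMap k k t) = ⊥ := Submodule.finrank_eq_zero.1 (by omega)
  intro x y hxy
  refine LinearMap.ker_eq_bot.1 hker ?_
  simp [orbitMap, hxy]

end TypeQ
end

noncomputable section
namespace TypeQ

/-! ### Compatibility of `Ψ` and `ψ` -/

variable {n M L N : ℕ} {a b c d : Word}

/-- The map of a morphism of webs is induced by the operator `A` on the tensor power. -/
def WebLift (n N : ℕ) {a b : Word} (f : WebHom a b) (A : T n N →ₗ[ℂ] T n N) : Prop :=
  ∃ p : Pre a b, WebHom.mk p = f ∧ Lift n N p A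

theorem WebLift.tensor_one {f : WebHom a b} {e : Bool} {q : ℕ} {s : Finset ℕ}
    (hf : WebLift n M f (ladOp n M e q s)) (hq : q < M) (hs : s ⊆ Finset.range M)
    (hc : wsum c = L) (hN : M + L = N) :
    WebLift n N (f.tensor (WebHom.one c)) (ladOp n N e q s) := by
  obtain ⟨p, rfl, hp⟩ := hf
  exact ⟨_, rfl, hp.tensor_one hq hs hc hN⟩

theorem WebLift.one_tensor {f : WebHom a b} {e : Bool} {q u v : ℕ}
    (hf : WebLift n L f (ladOp n L e q (Finset.Ico u v))) (hq : q < L) (hv : v ≤ L)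
    (hc : wsum c = M) (hN : M + L = N) : WebLift n N ((WebHom.one c).tensor f)
      (ladOp n N e (M + q) (Finset.Ico (M + u) (M + v))) := by
  obtain ⟨p, rfl, hp⟩ := hf
  exact ⟨_, rfl, hp.one_tensor hq hv hc hN⟩

theorem wsum_ones : ∀ k, wsum (ones k) = k
  | 0 => rfl
  | k + 1 => (congrArg (1 + ·) (wsum_ones k)).trans (Nat.add_comm 1 k)

theorem webLift_dotAt : ∀ {k i : ℕ}, i < k →
    WebLift n k (WebHom.dotAt k i) (ladOp n k true i (Finset.Ico i (i + 1)))
  | k + 1, 0, _ => WebLift.tensor_one (M := 1) (L := k) ⟨_, rfl, lift_rung true⟩ one_pos (by simp)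
      (wsum_ones k) (Nat.add_comm 1 k)
  | k + 1, i + 1, h => by
    have := (webLift_dotAt (Nat.lt_of_succ_lt_succ h)).one_tensor (c := [1]) (M := 1)
      (N := k + 1) (by omega) (by omega) rfl (Nat.add_comm 1 k)
    rwa [Nat.add_comm 1 i, Nat.add_comm 1 (i + 1)] at this

theorem webLift_cross : WebLift n 2 WebHom.cross (ladOp n 2 false 0 (Finset.Ico 1 2)) := by
  refine ⟨(Pre.splitN 1 1 2 rfl ⊚ Pre.mergeN 1 1 2 rfl) ⊹ (-1 : ℂ) ⊡ Pre.one [1, 1], ?_, ?_⟩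
  · rw [WebHom.mk_add, WebHom.mk_smul, neg_one_smul, ← sub_eq_add_neg, WebHom.cross_eq,
      ← WebHom.bellN_eq]
    rfl
  · have h := ((lift_splitN_one (n := n) 1 2 rfl).comp (lift_mergeN 1 1 2 rfl)).add
      ((lift_id (n := n) (N := 2) (a := [1, 1]) (b := [1, 1]) rfl rfl).smul (-1))
    -- The summand `j = 0` is the identity and cancels against the subtracted one.
    have e : (∑ j ∈ Finset.range 2, permT n 2 (Equiv.swap 0 j)) ∘ₗ LinearMap.id +
        (-1 : ℂ) • LinearMap.id = ladOp n 2 false 0 (Finset.Ico 1 2) := by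
      rw [ladOp_false, LinearMap.comp_id, Finset.sum_range_succ, Finset.sum_range_one,
        Equiv.swap_self]
      have := permT_one n 2
      rw [show (Equiv.refl ℕ : Equiv.Perm ℕ) = 1 from rfl, this, neg_one_smul]
      simp
    rw [← e]
    exact h

theorem webLift_crossAt : ∀ {k j : ℕ}, j + 1 < k →
    WebLift n k (WebHom.crossAt k j) (ladOp n k false j (Finset.Ico (j + 1) (j + 2)))
  | k + 2, 0, _ => WebLift.tensor_one (M := 2) (L := k) webLift_cross two_pos
      (fun x hx => by simp at hx ⊢; omega) (wsum_ones k) (Nat.add_comm 2 k)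
  | k + 1, j + 1, h => by
    have := (webLift_crossAt (Nat.lt_of_succ_lt_succ h)).one_tensor (c := [1]) (M := 1)
      (N := k + 1) (by omega) (by omega) rfl (Nat.add_comm 1 k)
    rw [Nat.add_comm 1 j, Nat.add_comm 1 (j + 1), Nat.add_comm 1 (j + 2)] at this
    rw [WebHom.crossAt_succ]
    exact this

theorem symOne_apply (v : ℕ → VN n) : symOne n (v 0) = symProj n 1 (pureSeq n 1 v) := rfl

/-- With all labels equal to `1` there is nothing to symmetrize, so here a lift is the induced map
itself. -/
theorem wordProj_ones : ∀ (k : ℕ), wordProj n (ones k) k (wsum_ones k) =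
    (tensorPower n k).toLinearMap
  | 0 => rfl
  | k + 1 => by
    refine T_pure_ext fun v => ?_
    refine (wordProj_cons_pureSeq (1 : ℕ+) (ones k) (wsum_ones (k + 1)) (wsum_ones k) v).trans ?_
    rw [wordProj_ones k]
    refine (congrArg (fun u => _ ⊗ₜ[ℂ] tensorPower n k (pureSeq n k u)) ?_).trans
      (congrArg (fun u => u ⊗ₜ[ℂ] tensorPower n k (pureSeq n k fun i => v (i + 1)))
        (symOne_apply v).symm)
    exact funext fun i => congrArg v (Nat.add_comm 1 i)

theorem WebLift.comm {k : ℕ} {f : WebHom (ones k) (ones k)} {A : T n k →ₗ[ℂ] T n k}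
    (hf : WebLift n k f A) (t : T n k) :
    (webFunctor n).map f (tensorPower n k t) = tensorPower n k (A t) := by
  obtain ⟨p, rfl, hp⟩ := hf
  have := LinearMap.congr_fun hp.comm t
  rw [LinearMap.comp_apply, LinearMap.comp_apply, wordProj_ones] at this
  exact this

/-- The action of the endomorphisms of `↑_1^k` on `V^{⊗k}`. -/
def webAction (n k : ℕ) : WebHom (ones k) (ones k) →ₐ[ℂ] Module.End ℂ (T n k) :=
  AlgHom.ofLinearMap
    ((tensorPower n k).symm.conj.toLinearMap ∘ₗ (webFunctor n).map)
    (by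
      refine LinearMap.ext fun t => ?_
      simp [WebHom.one_eq, (webFunctor n).map_one, LinearEquiv.conj_apply])
    (fun f g => by
      refine LinearMap.ext fun t => ?_
      simp [WebHom.mul_eq_comp, (webFunctor n).map_comp, LinearEquiv.conj_apply])

theorem webAction_apply {k : ℕ} (f : WebHom (ones k) (ones k)) (t : T n k) :
    tensorPower n k (webAction n k f t) = (webFunctor n).map f (tensorPower n k t) := by
  simp [webAction, LinearEquiv.conj_apply]

theorem WebLift.webAction_eq {k : ℕ} {f : WebHom (ones k) (ones k)} {A : T n k →ₗ[ℂ] T n k}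
    (hf : WebLift n k f A) : webAction n k f = A := by
  refine LinearMap.ext fun t => (tensorPower n k).injective ?_
  rw [webAction_apply, hf.comm]

theorem webAction_comp_serWeb (n k : ℕ) : (webAction n k).comp (serWeb k) = sergeevHom n k := by
  refine Ser.hom_ext (fun i => ?_) fun j => ?_
  · rw [AlgHom.comp_apply, serWeb_c, (webLift_dotAt i.2).webAction_eq, sergeevHom_c,
      Nat.Ico_succ_singleton, ladOp_single]
  · rw [AlgHom.comp_apply, serWeb_s, (webLift_crossAt (by omega)).webAction_eq, sergeevHom_s,
      Nat.Ico_succ_singleton, ladOp_false, Finset.sum_singleton]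

/-- The action on the tensor power of `V_k` is faithful and factors through webs. -/
theorem serWeb_injective (k : ℕ) : Function.Injective (serWeb k) := by
  have h := sergeevHom_injective k
  rw [← webAction_comp_serWeb, AlgHom.coe_comp] at h
  exact h.of_comp

theorem homogeneous_sprod_span {M : Type} [AddCommGroup M] [Module ℂ M] {k : ℕ}
    {F G : Sym n k →ₗ[ℂ] M} (h : ∀ (p : Fin k → ZMod 2) (v : Fin k → VN n),
      (∀ i, IsHomog (p i) (v i)) → F (sprod v) = G (sprod v)) : F = G := by
  rw [← LinearMap.cancel_right (symProj_surjective n k)]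
  refine (basisT n k).ext fun x => ?_
  rw [LinearMap.comp_apply, LinearMap.comp_apply, basisT_apply]
  exact h _ _ fun i => isHomog_letterVec (x i)

theorem single_ext {M : Type} [AddCommGroup M] [Module ℂ M] {k : ℕ+}
    {F G : sword n [k] →ₗ[ℂ] M} (h : ∀ (p : Fin k → ZMod 2) (v : Fin k → VN n),
      (∀ i, IsHomog (p i) (v i)) → F (sprod v ⊗ₜ[ℂ] (1 : ℂ)) = G (sprod v ⊗ₜ[ℂ] (1 : ℂ))) :
    F = G := by
  refine TensorProduct.ext' fun u z => ?_
  have e := LinearMap.congr_fun (homogeneous_sprod_span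
    (F := F ∘ₗ (TensorProduct.mk ℂ (Sym n k) ℂ).flip 1)
    (G := G ∘ₗ (TensorProduct.mk ℂ (Sym n k) ℂ).flip 1) h) u
  have hz : u ⊗ₜ[ℂ] z = z • (u ⊗ₜ[ℂ] (1 : ℂ)) := by
    rw [← TensorProduct.tmul_smul, smul_eq_mul, mul_one]
  rw [hz, map_smul, map_smul]
  exact congrArg (z • ·) e

theorem pair_ext {M : Type} [AddCommGroup M] [Module ℂ M] {k l : ℕ+}
    {F G : sword n [k, l] →ₗ[ℂ] M} (h : ∀ (v : Fin k → VN n) (w : Fin l → VN n),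
      F (sprod v ⊗ₜ[ℂ] (sprod w ⊗ₜ[ℂ] (1 : ℂ))) = G (sprod v ⊗ₜ[ℂ] (sprod w ⊗ₜ[ℂ] (1 : ℂ)))) :
    F = G := by
  refine TensorProduct.ext (homogeneous_sprod_span fun _ v _ => single_ext fun _ w _ => h v w)

/-- Induction over diagrams. The generators are fixed on products of homogeneous vectors, which
span, and tensor products are fixed because `mu` is surjective. -/
theorem WebFunctor.map_eq (Ψ : WebFunctor n) (f : WebHom a b) :
    Ψ.map f = (webFunctor n).map f := by
  induction f using WebHom.ind with | h f =>
  induction f with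
  | id h => subst h; exact (Ψ.map_one _).trans ((webFunctor n).map_one _).symm
  | comp g f hg hf =>
    rw [WebHom.mk_comp, Ψ.map_comp, (webFunctor n).map_comp, hg, hf]
  | @tensor a b c d f g hf hg =>
    rw [WebHom.mk_tensor, ← LinearMap.cancel_right (mu n a c).surjective]
    refine (Ψ.map_tensor _ _).trans (Eq.trans ?_ ((webFunctor n).map_tensor _ _).symm)
    rw [hf, hg]
  | dot k =>
    exact single_ext fun p v hv => (Ψ.map_dot k p v hv).trans ((webFunctor n).map_dot k p v hv).symm
  | merge k l =>
    exact pair_ext fun v w => (Ψ.map_merge k l v w).trans ((webFunctor n).map_merge k l v w).symm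
  | split k l =>
    exact single_ext (k := k + l) fun p v hv =>
      (Ψ.map_split k l p v hv).trans ((webFunctor n).map_split k l p v hv).symm
  | zero => exact (map_zero Ψ.map).trans (map_zero (webFunctor n).map).symm
  | add f g hf hg => rw [WebHom.mk_add, map_add, map_add, hf, hg]
  | smul z f hf => rw [WebHom.mk_smul, map_smul, map_smul, hf]

/-- The sum of the two components contains `1` and is stable under left multiplication by
generators. -/
theorem Ser.gr_sup_gr (k : ℕ) : Ser.gr k 0 ⊔ Ser.gr k 1 = ⊤ := by
  have key : ∀ (g : SerGen k) (ε : ZMod 2), ∀ x ∈ Ser.gr k ε,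
      Sum.elim Ser.c Ser.s g * x ∈ Ser.gr k 0 ⊔ Ser.gr k 1 := by
    intro g ε x hx
    have : Sum.elim Ser.c Ser.s g * x ∈ Ser.gr k ((if g.isLeft then 1 else 0) + ε) := by
      induction hx using Submodule.span_induction with
      | mem x hx =>
        obtain ⟨w, rfl, rfl⟩ := hx
        refine Submodule.subset_span ⟨g :: w, ?_, by simp [Ser.word]⟩
        rcases g with g | g <;> simp [List.countP_cons, add_comm]
      | zero => simp
      | add x y _ _ hx hy => rw [mul_add]; exact add_mem hx hy
      | smul z x _ hx => rw [mul_smul_comm]; exact Submodule.smul_mem _ _ hx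
    rcases eq_zero_or_one ((if g.isLeft then 1 else 0) + ε) with h | h <;> rw [h] at this
    · exact Submodule.mem_sup_left this
    · exact Submodule.mem_sup_right this
  have key' : ∀ g : SerGen k, ∀ x ∈ Ser.gr k 0 ⊔ Ser.gr k 1,
      Sum.elim Ser.c Ser.s g * x ∈ Ser.gr k 0 ⊔ Ser.gr k 1 := by
    intro g x hx
    obtain ⟨y, hy, z, hz, rfl⟩ := Submodule.mem_sup.1 hx
    rw [mul_add]
    exact add_mem (key g 0 y hy) (key g 1 z hz)
  exact Ser.eq_top_of_mul_mem (Submodule.mem_sup_left (Submodule.subset_span ⟨[], rfl, rfl⟩))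
    (fun i => key' (Sum.inl i)) fun j => key' (Sum.inr j)

theorem eq_zero_of_hasPar {V W : Type} [AddCommGroup V] [Module ℂ V] [SuperSpace V]
    [AddCommGroup W] [Module ℂ W] [SuperSpace W] {f : V →ₗ[ℂ] W} (h₀ : HasPar 0 f)
    (h₁ : HasPar 1 f) : f = 0 := by
  refine LinearMap.ext fun v => ?_
  obtain ⟨u, rfl⟩ : ∃ u, par u = v := ⟨par v, par_par v⟩
  have e := (h₀ u).symm.trans (h₁ u)
  rw [sgn_zero, sgn_one, one_smul, neg_one_smul] at e
  rw [eq_neg_iff_add_eq_zero, ← two_smul ℂ, smul_eq_zero] at e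
  rw [e.resolve_left two_ne_zero, LinearMap.zero_apply]

/-- The definition of parity for webs does not exclude a nonzero web that is both even and odd. The
functor for `n = k` decides this, since a linear map of both parities is zero and the action of `Ser
k` is faithful. -/
theorem eq_zero_of_serWeb_mem {k : ℕ} {x : Ser k} (h₀ : serWeb k x ∈ WebHom.gr (ones k) (ones k) 0)
    (h₁ : serWeb k x ∈ WebHom.gr (ones k) (ones k) 1) : x = 0 := by
  have h := eq_zero_of_hasPar ((webFunctor k).map_gr 0 _ h₀).1 ((webFunctor k).map_gr 1 _ h₁).1
  refine sergeevHom_injective k ?_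
  rw [map_zero, ← webAction_comp_serWeb]
  refine LinearMap.ext fun t => (tensorPower k k).injective ?_
  rw [AlgHom.comp_apply, webAction_apply, h]
  simp

/-- The component of `x` of the wrong parity has an image that is both even and odd, so it vanishes.
-/
theorem serWeb_mem_gr {k : ℕ} {ε : ZMod 2} {x : Ser k} :
    serWeb k x ∈ WebHom.gr (ones k) (ones k) ε ↔ x ∈ Ser.gr k ε := by
  refine ⟨fun h => ?_, serWeb_gr k ε x⟩
  obtain ⟨y, hy, z, hz, rfl⟩ : ∃ y ∈ Ser.gr k 0, ∃ z ∈ Ser.gr k 1, y + z = x :=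
    Submodule.mem_sup.1 (Ser.gr_sup_gr k ▸ Submodule.mem_top)
  have hy' := serWeb_gr k 0 y hy
  have hz' := serWeb_gr k 1 z hz
  rw [map_add] at h
  rcases eq_zero_or_one ε with rfl | rfl
  · rw [eq_zero_of_serWeb_mem ((Submodule.add_mem_iff_right _ hy').1 h) hz', add_zero]
    exact hy
  · rw [eq_zero_of_serWeb_mem hy' ((Submodule.add_mem_iff_left _ hz').1 h), zero_add]
    exact hz

end TypeQ
end

/-! ### The isomorphism and its compatibility with the two actions. -/

theorem propositionP (k : ℕ) (hk : 1 ≤ k) :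
    ∃ ξ : TypeQ.Ser k ≃ₐ[ℂ] TypeQ.WebHom (TypeQ.ones k) (TypeQ.ones k),
      (∀ i, ξ (TypeQ.Ser.c i) = TypeQ.WebHom.dotAt k i) ∧
      (∀ j, ξ (TypeQ.Ser.s j) = TypeQ.WebHom.crossAt k j) ∧
      (∀ ε x, ξ x ∈ TypeQ.WebHom.gr (TypeQ.ones k) (TypeQ.ones k) ε ↔ x ∈ TypeQ.Ser.gr k ε) ∧
      ∀ n : ℕ, 1 ≤ n →
        Nonempty (TypeQ.WebFunctor n) ∧ Nonempty (TypeQ.SergeevAction n k) ∧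
        ∀ (Ψ : TypeQ.WebFunctor n) (ψ : TypeQ.SergeevAction n k) (x : TypeQ.Ser k)
          (t : TypeQ.T n k),
          Ψ.map (ξ x) (TypeQ.tensorPower n k t) = TypeQ.tensorPower n k (ψ.map x t) := by
  refine ⟨AlgEquiv.ofBijective (TypeQ.serWeb k)
    ⟨TypeQ.serWeb_injective k, TypeQ.serWeb_surjective k⟩, TypeQ.serWeb_c k, TypeQ.serWeb_s k,
    fun ε x => TypeQ.serWeb_mem_gr, fun n _ =>
    ⟨⟨TypeQ.webFunctor n⟩, ⟨TypeQ.sergeevAction n k⟩, fun Ψ ψ x t => ?_⟩⟩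
  -- By uniqueness, arbitrary `Ψ` and `ψ` are the constructed ones.
  rw [Ψ.map_eq, ψ.map_eq, ← TypeQ.webAction_comp_serWeb]
  exact (TypeQ.webAction_apply _ t).symm
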